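/- Let $F$ be a global field (a number field, or a finite extension of $\mathbb F_p(t)$ for a prime $p$), and let $S$ be a non-empty finite set of places of $F$ containing all Archimedean places. For a non-Archimedean place $v$ let $F_v$ be the completion of $F$ at $v$ and $\mathcal O_v\subset F_v$ its valuation ring. Let $\mathcal O_S$ be the ring of $S$-integers of $F$, and let $\mathbb A_F^S$ be the ring of $S$-adeles, i.e. the restricted product of the fields $F_v$ ($v\notin S$) with respect to the subrings $\mathcal O_v$. Let $X$ be an algebraic variety over $F$, i.e. a separated scheme of finite type over $F$. For a finite set of places $T\supseteq S$, an integral model of $X$ over $\mathcal O_T$ is a faithfully flat, separated scheme $\mathcal X$ of finite type over $\mathcal O_T$ together with an isomorphism $\mathcal X\times_{\mathcal O_T}F\cong X$ over $F$; for $v\notin T$ one regards $\mathcal X(\mathcal O_v)$ as a subset of $X(F_v)$. The set $X(\mathbb A_F^S)=\mathrm{Mor}_F(\mathrm{Spec}\,\mathbb A_F^S,X)\subset\prod_{v\notin S}X(F_v)$ carries the adelic topology: the direct limit topology of the products $\prod_{v\in T\setminus S}X(F_v)\times\prod_{v\notin T}\mathcal Y(\mathcal O_v)$, where $T\supseteq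 S$ is a finite set of places, $\mathcal Y$ is an integral model of $X$ over $\mathcal O_T$, and $X(F_v)$ has the topology induced by that of $F_v$. 1. For every open subset $U\subseteq X(\mathbb A_F^S)$ and every $z\in U$ there is an integral model $\mathcal X$ of $X$ over $\mathcal O_S$ such that $$z\in\prod_{v\notin S}\mathcal X(\mathcal O_v)\subseteq U.$$ Moreover, the subsets $\prod_{v\notin S}\mathcal X(\mathcal O_v)\subseteq X(\mathbb A_F^S)$, where $\mathcal X$ runs through the integral models of $X$ over $\mathcal O_S$, form a basis of the topology of $X(\mathbb A_F^S)$. 2. Suppose that $X$ is an algebraic group over $F$ (a group scheme). Then the subsets $\prod_{v\notin S}\mathcal X(\mathcal O_v)$, where $\mathcal X$ runs through the group scheme models of $X$ over $\mathcal O_S$ (integral models that are group schemes over $\mathcal O_S$, the isomorphism $\mathcal X\times_{\mathcal O_S}F\cong X$ being one of group schemes), form a fundamental system of neighbourhoods of $1$ in $X(\mathbb A_F^S)$. If moreover $X$ is smooth over $F$, then the same holds for the subsets $\prod_{v\notin S}\mathcal X(\mathcal O_v)$, where $\mathcal X$ runs through the group scheme models of $X$ that are smooth over $\mathcal O_S$.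 -/

import Mathlib

open CategoryTheory AlgebraicGeometry IsDedekindDomain

universe u

namespace IntegralModels

/-- A global field: a number field, or a finite extension of `𝔽_p(t)` for some prime `p`. -/
class IsGlobalField (F : Type*) [Field F] : Prop where
  out : NumberField F ∨
    ∃ (p : ℕ) (_ : Fact p.Prime) (_ : Algebra (RatFunc (ZMod p)) F),
      FiniteDimensional (RatFunc (ZMod p)) F

/-! ### An element of a global field is integral at all but finitely many places -/

theorem poles_dedekind {R F : Type*} [CommRing R] [IsDedekindDomain R] [Field F] [Algebra R F] [IsFractionRing R F]
  (x : F) : {A : ValuationSubring F | (∀ r : R, algebraMap R F r ∈ A) ∧ x ∉ A}.Finite := by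
  refine ((HeightOneSpectrum.Support.finite R x).image fun v => v.valuationSubringAtPrime F).subset ?_
  rintro A ⟨hA, hx⟩
  let f : R →+* A := (algebraMap R F).codRestrict A.toSubring hA
  have hf : ∀ r, ((f r : A) : F) = algebraMap R F r := fun r => rfl
  let p : Ideal R := (IsLocalRing.maximalIdeal A).comap f
  have hp : p.IsPrime := Ideal.comap_isPrime f _
  have unit_of : ∀ s : R, s ∉ p → (algebraMap R F s)⁻¹ ∈ A := by
    intro s hs
    have : IsUnit (f s) := by
      simpa [p, IsLocalRing.mem_maximalIdeal] using! hs
    obtain ⟨u, hu⟩ := this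
    have h1 : ((u⁻¹ : Aˣ) : A).1 * algebraMap R F s = 1 := by
      rw [← hf, ← hu, ← A.coe_mul]; simp
    rw [← eq_inv_of_mul_eq_one_left h1]
    exact Subtype.mem _
  have hp0 : p ≠ ⊥ := by
    intro h0
    apply hx
    obtain ⟨a, b, hb, rfl⟩ := IsFractionRing.div_surjective (A := R) x
    rw [div_eq_mul_inv]
    refine A.mul_mem _ _ (hA a) (unit_of b ?_)
    rw [h0]; simpa using nonZeroDivisors.ne_zero hb
  let v : HeightOneSpectrum R := ⟨p, hp, hp0⟩
  have hle : v.valuationSubringAtPrime F ≤ A := by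
    rintro _ ⟨a, s, hs, rfl⟩
    exact A.mul_mem _ _ (hA a) (unit_of s hs)
  have heq : v.valuationSubringAtPrime F = A := 
    ValuationSubring.eq_of_le_of_ne_top _ hle (by rintro rfl; exact hx (ValuationSubring.mem_top _))
  refine ⟨v, ?_, heq⟩
  have : x ∉ (v.valuation F).valuationSubring := by
    rwa [← v.valuationSubringAtPrime_eq_valuationSubring, heq]
  simpa [HeightOneSpectrum.Support, Valuation.mem_valuationSubring_iff] using this

theorem poles_finite_extension {R K F : Type*} [CommRing R] [IsDedekindDomain R] [Field K]
    [Algebra R K] [IsFractionRing R K] [Field F] (φ : K →+* F) (hφ : φ.Finite) (x : F) :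
    {A : ValuationSubring F | (∀ r : R, φ (algebraMap R K r) ∈ A) ∧ x ∉ A}.Finite := by
  let _ : Algebra K F := φ.toAlgebra
  have : FiniteDimensional K F := hφ
  let E := separableClosure K F
  let _ : Algebra R E := ((algebraMap K E).comp (algebraMap R K)).toAlgebra
  have : IsScalarTower R K E := IsScalarTower.of_algebraMap_eq' rfl
  let C := integralClosure R E
  have : IsDedekindDomain C := integralClosure.isDedekindDomain R K E
  have : IsFractionRing C E := integralClosure.isFractionRing_of_finite_extension K E
  have mem_of_pow : ∀ (A : ValuationSubring F) (z : F) (m : ℕ), m ≠ 0 → z ^ m ∈ A → z ∈ A := by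
    intro A z m hm hz
    rw [← A.valuation_le_one_iff] at hz ⊢
    rw [map_pow] at hz
    exact (pow_le_one_iff hm).mp hz
  obtain ⟨q, hq⟩ := ExpChar.exists E
  have hq0 : ∀ n, q ^ n ≠ 0 := fun n => pow_ne_zero _ (expChar_pos E q).ne'
  have key : ∀ z : F, ∃ n : ℕ, ∃ y : E, algebraMap E F y = z ^ q ^ n := fun z =>
    IsPurelyInseparable.pow_mem E q z
  obtain ⟨n, y, hy⟩ := key x
  refine Set.Finite.of_finite_image (f := fun A => A.comap (algebraMap E F))
    ((poles_dedekind (R := C) y).subset ?_) ?_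
  · rintro _ ⟨A, ⟨hA, hx⟩, rfl⟩
    refine ⟨fun r => ?_, fun h => hx ?_⟩
    · obtain ⟨P, hP, hPr⟩ := r.2
      rw [ValuationSubring.mem_comap]
      let g : R →+* A := (φ.comp (algebraMap R K)).codRestrict A.toSubring hA
      have hint : IsIntegral A (algebraMap E F (algebraMap C E r)) := by
        refine ⟨P.map g, hP.map g, ?_⟩
        rw [Polynomial.eval₂_map]
        have := congrArg (algebraMap E F) hPr
        rw [Polynomial.hom_eval₂, map_zero] at this
        exact this
      obtain ⟨a, ha⟩ := IsIntegrallyClosed.isIntegral_iff.mp hint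
      rw [← ha]
      exact a.2
    · rw [ValuationSubring.mem_comap, hy] at h
      exact mem_of_pow A x _ (hq0 n) h
  · rintro A - B - hAB
    ext z
    obtain ⟨m, w, hw⟩ := key z
    have h1 : ∀ D : ValuationSubring F, z ∈ D ↔ w ∈ D.comap (algebraMap E F) := fun D => by
      rw [ValuationSubring.mem_comap, hw]
      exact ⟨fun h => pow_mem h _, mem_of_pow D z _ (hq0 m)⟩
    rw [h1, h1]
    exact iff_of_eq (congrArg (w ∈ ·) hAB)

open Polynomial in
theorem exists_ratFunc_inv (k : Type*) [Field k] :
    ∃ σ : RatFunc k →+* RatFunc k, Function.Surjective σ ∧ σ RatFunc.X = RatFunc.X⁻¹ := by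
  have ht : Transcendental k (RatFunc.X⁻¹ : RatFunc k) := fun h =>
    RatFunc.transcendental_X (by simpa using h.inv)
  have hinj : Function.Injective (aeval (RatFunc.X⁻¹ : RatFunc k)) :=
    transcendental_iff_injective.mp ht
  let σ : RatFunc k →+* RatFunc k := IsFractionRing.lift (A := k[X]) (K := RatFunc k)
    (g := (aeval (RatFunc.X⁻¹ : RatFunc k)).toRingHom) hinj
  have hσ : ∀ f : k[X], σ (algebraMap k[X] (RatFunc k) f) = aeval (RatFunc.X⁻¹ : RatFunc k) f :=
    fun f => IsFractionRing.lift_algebraMap hinj f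
  have hX : σ RatFunc.X = RatFunc.X⁻¹ := by
    have h := hσ X
    rwa [RatFunc.algebraMap_X, aeval_X] at h
  refine ⟨σ, fun y => ⟨σ y, ?_⟩, hX⟩
  have : σ.comp σ = RingHom.id _ := by
    refine IsLocalization.ringHom_ext (nonZeroDivisors k[X]) (Polynomial.ringHom_ext ?_ ?_)
    · intro a
      have hC : σ (algebraMap k[X] (RatFunc k) (C a)) = algebraMap k[X] (RatFunc k) (C a) := by
        rw [hσ, aeval_C]; rfl
      simp only [RingHom.comp_apply, hC, RingHom.id_apply]
    · simp only [RingHom.comp_apply, RatFunc.algebraMap_X, hX, map_inv₀, inv_inv, RingHom.id_apply]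
  exact congrArg (fun f : RatFunc k →+* RatFunc k => f y) this

open Polynomial in
theorem finite_poles {F : Type*} [Field F] [h : IsGlobalField F] (x : F) :
    {A : ValuationSubring F | x ∉ A}.Finite := by
  rcases h.out with h | ⟨p, hp, alg, hfin⟩
  · refine (poles_finite_extension (R := ℤ) (algebraMap ℚ F) (RingHom.finite_algebraMap.mpr h.to_finiteDimensional) x).subset
      fun A hA => ⟨fun r => ?_, hA⟩
    simp
  · obtain ⟨σ, hσ, hX⟩ := exists_ratFunc_inv (ZMod p)
    let φ := algebraMap (RatFunc (ZMod p)) F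
    have hφ : φ.Finite := RingHom.finite_algebraMap.mpr hfin
    have hC : ∀ (ψ : RatFunc (ZMod p) →+* F) (A : ValuationSubring F), ψ RatFunc.X ∈ A →
        ∀ r : (ZMod p)[X], ψ (algebraMap _ _ r) ∈ A := by
      intro ψ A hA r
      induction r using Polynomial.induction_on' with
      | add f g hf hg => rw [map_add, map_add]; exact A.add_mem _ _ hf hg
      | monomial n a =>
        rw [← C_mul_X_pow_eq_monomial, map_mul, map_mul, map_pow, map_pow, RatFunc.algebraMap_X]
        refine A.mul_mem _ _ ?_ (pow_mem hA n)
        obtain ⟨m, rfl⟩ := ZMod.natCast_zmod_surjective a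
        simp
    refine ((poles_finite_extension (R := (ZMod p)[X]) φ hφ x).union
      (poles_finite_extension (R := (ZMod p)[X]) (φ.comp σ)
        (hφ.comp (RingHom.Finite.of_surjective σ hσ)) x)).subset fun A hA => ?_
    rcases A.mem_or_inv_mem (φ RatFunc.X) with h | h
    · exact Or.inl ⟨hC φ A h, hA⟩
    · refine Or.inr ⟨hC (φ.comp σ) A ?_, hA⟩
      rwa [RingHom.comp_apply, hX, map_inv₀]

/-! ### Places, completions, `S`-integers and `S`-adeles -/

/-- A non-Archimedean place of a global field `F`, given by its discrete valuation ring `𝒪_{F,v}`,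
a subring of `F` with fraction field `F`. -/
structure FinPlace (F : Type u) [Field F] : Type u where
  /-- the discrete valuation ring `𝒪_{F,v}` -/
  ring : ValuationSubring F
  isDVR : IsDiscreteValuationRing ring

/-- The places of `F`: the Archimedean ones (there are none in positive characteristic) and the
non-Archimedean ones. -/
abbrev Place (F : Type u) [Field F] : Type u := NumberField.InfinitePlace F ⊕ FinPlace F

section Field

variable {F : Type u} [Field F]

namespace FinPlace

variable (v : FinPlace F)

/-- The maximal ideal of `𝒪_{F,v}`. -/
noncomputable def prime : HeightOneSpectrum v.ring :=
  haveI := v.isDVR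
  IsDiscreteValuationRing.maximalIdeal v.ring

/-- The completion `F_v`. -/
noncomputable abbrev completion : Type u :=
  haveI := v.isDVR
  v.prime.adicCompletion F

/-- The completed discrete valuation ring `𝒪_v ⊆ F_v`. -/
noncomputable abbrev integers : ValuationSubring v.completion :=
  haveI := v.isDVR
  v.prime.adicCompletionIntegers F

theorem algebraMap_mem_integers {x : F} (hx : x ∈ v.ring) :
    algebraMap F v.completion x ∈ v.integers := by
  have := v.isDVR
  exact v.prime.coe_algebraMap_mem v.ring F ⟨x, hx⟩

end FinPlace

/-- The non-Archimedean places outside `S`. When `S` contains all the Archimedean places, these are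
exactly the places outside `S`. -/
def Outside (S : Set (Place F)) : Type u := {v : FinPlace F // Sum.inr v ∉ S}

/-- If `S ⊆ T`, a place outside `T` is outside `S`. -/
def Outside.incl {S T : Set (Place F)} (h : S ⊆ T) (v : Outside T) : Outside S :=
  ⟨v.1, fun hv => v.2 (h hv)⟩

/-- The ring `𝒪_S` of `S`-integers. -/
def sIntegers (S : Set (Place F)) : Subring F := ⨅ v : Outside S, v.1.ring.toSubring

theorem mem_ring_of_mem_sIntegers {S : Set (Place F)} {x : F} (hx : x ∈ sIntegers S)
    (v : Outside S) : x ∈ v.1.ring :=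
  (Subring.mem_iInf.mp hx) v

/-- The inclusion `𝒪_S → 𝒪_v` for `v ∉ S`. -/
noncomputable def sIntegersMap (S : Set (Place F)) (v : Outside S) :
    sIntegers S →+* v.1.integers :=
  ((algebraMap F v.1.completion).comp (sIntegers S).subtype).codRestrict v.1.integers.toSubring
    fun x => v.1.algebraMap_mem_integers (mem_ring_of_mem_sIntegers x.2 v)

/-- The ring `𝔸_F^S` of `S`-adeles: families `(x_v)_{v ∉ S}` with `x_v ∈ F_v` for all `v` and
`x_v ∈ 𝒪_v` for all but finitely many `v`. -/
abbrev SAdeles (S : Set (Place F)) : Type u :=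
  RestrictedProduct (fun v : Outside S => v.1.completion)
    (fun v : Outside S => (v.1.integers : Set v.1.completion)) Filter.cofinite

/-- The projection `𝔸_F^S → F_v` for `v ∉ S`. -/
noncomputable def adeleProj (S : Set (Place F)) (v : Outside S) : SAdeles S →+* v.1.completion :=
  RestrictedProduct.evalRingHom (fun v : Outside S => v.1.completion) v

/-- The diagonal embedding `F → 𝔸_F^S`. -/
noncomputable def diagonal [IsGlobalField F] (S : Set (Place F)) : F →+* SAdeles S where
  toFun x := ⟨fun v => algebraMap F v.1.completion x, by
    have hinj : Function.Injective fun v : Outside S => v.1.ring := by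
      rintro ⟨⟨A, hA⟩, hv⟩ ⟨⟨B, hB⟩, hw⟩ (rfl : A = B)
      rfl
    refine ((finite_poles x).preimage hinj.injOn).subset fun v hv hx => hv ?_
    exact v.1.algebraMap_mem_integers hx⟩
  map_one' := Subtype.ext <| funext fun _ => map_one _
  map_mul' x y := Subtype.ext <| funext fun _ => map_mul _ x y
  map_zero' := Subtype.ext <| funext fun _ => map_zero _
  map_add' x y := Subtype.ext <| funext fun _ => map_add _ x y

end Field

/-! ### Points of schemes, and their topologies -/

/-- `Spec A` as a scheme over `Spec R`, for a ring homomorphism `R → A`. -/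
noncomputable def specOver {R A : Type u} [CommRing R] [CommRing A] (f : R →+* A) :
    Over (Spec (.of R)) :=
  Over.mk (Spec.map (CommRingCat.ofHom f))

/-- The value in `A` at an `A`-point `z` of `X` of a section `s` on an open set through which
`z` factors. -/
noncomputable def valueAt {X : Scheme.{u}} {A : Type u} [CommRing A] (z : Spec (.of A) ⟶ X)
    {U : X.Opens} (h : ⊤ ≤ z ⁻¹ᵁ U) (s : Γ(X, U)) : A :=
  (Scheme.ΓSpecIso (.of A)).hom (z.appLE U ⊤ h s)

section Points

variable {F : Type u} [Field F]

/-- The set `X(F_v)` of morphisms `Spec F_v → X` over `F`. -/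
def LocalPoints (X : Over (Spec (.of F))) (v : FinPlace F) : Type u :=
  specOver (algebraMap F v.completion) ⟶ X

/-- The topology of `X(F_v)` induced by the topology of `F_v`: the coarsest one for which, for each
affine open `U` of `X`, the set `U(F_v)` is open, and each regular function on `U`
is continuous as a function `U(F_v) → F_v`. -/
instance LocalPoints.instTopologicalSpace (X : Over (Spec (.of F))) (v : FinPlace F) :
    TopologicalSpace (LocalPoints X v) :=
  TopologicalSpace.generateFrom
    {W | ∃ (U : X.left.Opens) (_ : IsAffineOpen U) (s : Γ(X.left, U)) (V : Set v.completion),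
      IsOpen V ∧
      W = {z : LocalPoints X v | ∃ h : ⊤ ≤ (CommaMorphism.left z) ⁻¹ᵁ U,
        valueAt (CommaMorphism.left z) h s ∈ V}}

/-- An integral model over `𝒪_S` of a scheme `X` over `F`: a faithfully flat (that is, flat and
surjective), separated scheme of finite type over `𝒪_S` together with an isomorphism of its generic
fibre with `X` over `F`. -/
structure IntegralModel (X : Over (Spec (.of F))) (S : Set (Place F)) where
  /-- the scheme over `𝒪_S` -/
  scheme : Over (Spec (.of (sIntegers S)))
  flat : Flat scheme.hom
  surjective : Surjective scheme.hom
  separated : IsSeparated scheme.hom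
  locallyOfFiniteType : LocallyOfFiniteType scheme.hom
  quasiCompact : QuasiCompact scheme.hom
  /-- the isomorphism `𝒳 ×_{𝒪_S} F ≅ X` -/
  iso : (Over.pullback (Spec.map (CommRingCat.ofHom (sIntegers S).subtype))).obj scheme ≅ X

/-- The canonical morphism `X ≅ 𝒳 ×_{𝒪_S} F → 𝒳`. -/
noncomputable def IntegralModel.genericMap {X : Over (Spec (.of F))} {S : Set (Place F)}
    (Y : IntegralModel X S) : X.left ⟶ Y.scheme.left :=
  Y.iso.inv.left ≫ Limits.pullback.fst _ _

/-- The subset `𝒳(𝒪_v) ⊆ X(F_v)` for a model `𝒳` of `X` over `𝒪_S` and `v ∉ S`: the points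
`Spec F_v → X → 𝒳` which extend to a morphism `Spec 𝒪_v → 𝒳` over `𝒪_S`. -/
def IntegralModel.localIntegralPoints {X : Over (Spec (.of F))} {S : Set (Place F)}
    (Y : IntegralModel X S) (v : Outside S) : Set (LocalPoints X v.1) :=
  {z | ∃ w : specOver (sIntegersMap S v) ⟶ Y.scheme,
    Spec.map (CommRingCat.ofHom v.1.integers.subtype) ≫ w.left =
      CommaMorphism.left z ≫ Y.genericMap}

variable [IsGlobalField F]

/-- The set `X(𝔸_F^S)` of morphisms `Spec 𝔸_F^S → X` over `F`. -/
def AdelicPoints (X : Over (Spec (.of F))) (S : Set (Place F)) : Type u :=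
  specOver (diagonal S) ⟶ X

/-- The component `z_v ∈ X(F_v)` of a point `z ∈ X(𝔸_F^S)` at a place `v ∉ S`. -/
noncomputable def AdelicPoints.component {X : Over (Spec (.of F))} {S : Set (Place F)}
    (z : AdelicPoints X S) (v : Outside S) : LocalPoints X v.1 :=
  CategoryStruct.comp (Y := specOver (diagonal S))
    (Over.homMk (Spec.map (CommRingCat.ofHom (adeleProj S v))) (by
      simp only [specOver, Over.mk_hom, ← Spec.map_comp, ← CommRingCat.ofHom_comp]
      rfl)) z

/-- The points of `X(𝔸_F^S)` whose components at all the places `v ∉ T` lie in `𝒴(𝒪_v)`, for a model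
`𝒴` of `X` over `𝒪_T`, where `S ⊆ T`. For finite `T` this is
`∏_{v ∈ T ∖ S} X(F_v) × ∏_{v ∉ T} 𝒴(𝒪_v)`. -/
def adelicBox {X : Over (Spec (.of F))} {S T : Set (Place F)} (h : S ⊆ T)
    (Y : IntegralModel X T) : Set (AdelicPoints X S) :=
  {z | ∀ v : Outside T, z.component (v.incl h) ∈ Y.localIntegralPoints v}

/-- The adelic topology on `X(𝔸_F^S)`: the direct limit topology of the products
`∏_{v ∈ T ∖ S} X(F_v) × ∏_{v ∉ T} 𝒴(𝒪_v)`, each with its product topology, where `T ⊇ S` runs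
through the finite sets of places and `𝒴` through the models of `X` over `𝒪_T`. In other
words, a set is open if its trace on each such product is open in that product. -/
noncomputable instance AdelicPoints.instTopologicalSpace (X : Over (Spec (.of F)))
    (S : Set (Place F)) : TopologicalSpace (AdelicPoints X S) :=
  ⨆ (T : Set (Place F)) (_ : T.Finite) (h : S ⊆ T) (Y : IntegralModel X T),
    TopologicalSpace.coinduced (Subtype.val : adelicBox h Y → AdelicPoints X S)
      (TopologicalSpace.induced (fun z v => z.1.component v)
        (Pi.topologicalSpace (ι := Outside S) (Y := fun v => LocalPoints X v.1)))

/-- The subset `∏_{v ∉ S} 𝒳(𝒪_v)` of `X(𝔸_F^S)`, for a model `𝒳` of `X` over `𝒪_S`. -/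
def IntegralModel.integralPoints {X : Over (Spec (.of F))} {S : Set (Place F)}
    (Y : IntegralModel X S) : Set (AdelicPoints X S) :=
  {z | ∀ v : Outside S, z.component v ∈ Y.localIntegralPoints v}

end Points

/-! ### Group schemes -/

section Group

open scoped Obj MonObj

variable {F : Type u} [Field F]

/-- A group scheme model over `𝒪_S` of a group scheme `X` over `F`: a model which is a group
scheme, such that the isomorphism of its generic fibre with `X` is one of group schemes. -/
structure GroupModel (X : Over (Spec (.of F))) [GrpObj X] (S : Set (Place F))
    extends IntegralModel X S where
  grpObj : GrpObj scheme
  isMonHom_iso : IsMonHom iso.hom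

/-- The unit `1 ∈ X(𝔸_F^S)` for a group scheme `X` over `F`. -/
noncomputable def AdelicPoints.unit [IsGlobalField F] (X : Over (Spec (.of F))) [GrpObj X]
    (S : Set (Place F)) : AdelicPoints X S :=
  SemiCartesianMonoidalCategory.toUnit (specOver (diagonal S)) ≫ η[X]

end Group

end IntegralModels

/-! The theorem rests on changing a model at one closed point of the base without touching the
others.

The base. The ring `𝒪_S` is a Dedekind domain with fraction field `F`, and its non-zero primes are
exactly the places outside `S` (`sIntegers_isDedekindDomain`, `sIntegers_isFractionRing`,
`exists_placePt_eq`). The last fact needs, for every finite place in `S`, an `S`-integer with a pole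
there. Over number fields this is finiteness of the class group. Over function fields it is a
dimension count in the style of Riemann's inequality (`exists_notMem_forall_mem`), and it is here
that `S` must be non-empty.

Modification. Since models are flat, morphisms are determined on the generic fibre. A morphism of
generic fibres extends to a neighbourhood of the generic fibre (`exists_isExt_generic`), and such a
neighbourhood contains all but finitely many closed fibres (`exists_ne_zero_of_range_subset`). Hence
two separated models agree at almost all primes and can be glued. Given a model `Y` of `X` and a
model `Z` of an open subscheme of `X`, the fibre of `Y` over a prime can be replaced by that of `Z`
(`FlatModel.exists_modification`). Lattices in coordinate rings of affine charts, glued in the same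
manner, provide a first separated model (`exists_separated_model`).

The basis. Whether a point is integral at `v` depends only on the model near the fibre at `v`
(`isIntegralPt_iff_of_agreesAt`), and an adelic point is integral for a fixed model at almost all
places (`AdelicPoints.finite_not_isIntegralPt`). At the finitely many remaining places, and at those
where `U` imposes a condition, one inserts an affine model whose integral points form a small
polydisc containing the given point (`exists_chart`). Surjectivity onto the base then holds because
there are integral points at all places. Conversely, sets of integral points are open: this is true
at each place, and two models have the same integral points almost everywhere.

Groups. It suffices to extend the division morphism and the unit, because the group axioms can be
checked on the generic fibre (`exists_grpObj_of_div`). Both extend at almost all places. At the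
others the inserted model is a polydisc around `1` in coordinates vanishing at `1`. The identities
`x / 1 = x` and `x / x = 1` show that division has linear part `x - y`, which is integral. Rescaling
the coordinates by `π ^ N` keeps the linear part and makes the higher terms integral for large `N`
(`exists_scaledOrder_extension`, `exists_extendsAt_div`).

Smoothness. If `X` is smooth, the coordinates at `1` can be chosen so that the relations between
them have an integral linear part containing an identity matrix. After rescaling, the relations are
linear modulo `π` and a Jacobian determinant is congruent to `1` modulo `π`, so that the polydisc is
smooth near the fibre (`exists_smooth_away_scaledOrder`). -/

namespace IntegralModels

open Limits

/-! ### The generic point of the base -/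

section GenericFibre

variable (R F : Type u) [CommRing R] [Field F] [Algebra R F]

/-- The inclusion of the generic point in the spectrum of a domain. -/
noncomputable abbrev genMap : Spec (.of F) ⟶ Spec (.of R) :=
  Spec.map (CommRingCat.ofHom (algebraMap R F))

/-- The generic point of the spectrum of a domain. -/
def genPt [IsDomain R] : Spec (.of R) := (⟨⊥, Ideal.isPrime_bot⟩ : PrimeSpectrum R)

variable [IsFractionRing R F]

instance flat_genMap : Flat (genMap R F) := by
  rw [Flat.SpecMap_iff]
  exact (RingHom.flat_algebraMap_iff).mpr (IsLocalization.flat F (nonZeroDivisors R))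

instance isPreimmersion_genMap : IsPreimmersion (genMap R F) :=
  IsPreimmersion.of_isLocalization (nonZeroDivisors R)

theorem range_genMap [IsDomain R] : Set.range (genMap R F) = {genPt R} := by
  ext x
  constructor
  · rintro ⟨y, rfl⟩
    have hy : y = (⟨⊥, Ideal.isPrime_bot⟩ : PrimeSpectrum F) := Subsingleton.elim (α := PrimeSpectrum F) _ _
    rw [hy]
    apply PrimeSpectrum.ext
    exact Ideal.comap_bot_of_injective _ (IsFractionRing.injective R F)
  · rintro rfl
    refine ⟨(⟨⊥, Ideal.isPrime_bot⟩ : PrimeSpectrum F), PrimeSpectrum.ext ?_⟩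
    exact Ideal.comap_bot_of_injective _ (IsFractionRing.injective R F)

instance isSchemeTheoreticallyDominant_genMap [IsDomain R] :
    IsSchemeTheoreticallyDominant (genMap R F) := by
  have : IsDominant (genMap R F) := by
    rw [isDominant_iff, DenseRange, range_genMap, dense_iff_closure_eq, Set.eq_univ_iff_forall]
    intro x
    rw [← specializes_iff_mem_closure]
    exact (PrimeSpectrum.le_iff_specializes _ _).mp (bot_le (a := x.asIdeal))
  exact .of_isDominant _

end GenericFibre

/-! ### Density of the generic fibre and extension of morphisms -/

section Density

variable {R F : Type u} [CommRing R] [IsDomain R] [Field F] [Algebra R F] [IsFractionRing R F]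
  {X Y Z V : Scheme.{u}} {sX : X ⟶ Spec (.of F)} {sY : Y ⟶ Spec (.of R)} {g : X ⟶ Y}

/-- By flatness the generic fibre is schematically dense in `Y`. The equalizer of `a` and `b` is a
closed subscheme, as `Z` is separated, and it contains the generic fibre, so its ideal vanishes. -/
theorem hom_ext_of_generic (H : IsPullback g sX sY (genMap R F)) [Flat sY] [Z.IsSeparated]
    {a b : Y ⟶ Z} (h : g ≫ a = g ≫ b) : a = b := by
  have : IsSchemeTheoreticallyDominant g := .of_isPullback H.flip
  have hk : (equalizer.ι a b).ker = ⊥ := by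
    rw [eq_bot_iff, ← g.ker_eq_bot, ← equalizer.lift_ι g h]
    exact Scheme.Hom.le_ker_comp _ _
  have := IsClosedImmersion.isIso_iff_ker_eq_bot.mpr hk
  rw [← cancel_epi (equalizer.ι a b), equalizer.condition]

theorem range_of_isPullback (H : IsPullback g sX sY (genMap R F)) :
    Set.range g = {y | sY y = genPt R} := by
  have := H.isoPullback_hom_fst
  have h : Set.range (H.isoPullback.hom ≫ pullback.fst sY (genMap R F)) =
      Set.range (pullback.fst sY (genMap R F)) := by
    refine Set.ext fun y => ⟨fun ⟨x, hx⟩ => ⟨H.isoPullback.hom x, by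
      rw [← Scheme.Hom.comp_apply, hx]⟩, fun ⟨z, hz⟩ => ?_⟩
    obtain ⟨x, rfl⟩ := H.isoPullback.hom.surjective z
    exact ⟨x, by rw [Scheme.Hom.comp_apply, hz]⟩
  rw [← this, h, Scheme.Pullback.range_fst, range_genMap]
  rfl

omit [IsDomain R] in
theorem isPreimmersion_of_isPullback (H : IsPullback g sX sY (genMap R F)) : IsPreimmersion g :=
  MorphismProperty.of_isPullback H.flip (isPreimmersion_genMap R F)

theorem denseRange_of_isPullback (H : IsPullback g sX sY (genMap R F)) [Flat sY] : DenseRange g := by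
  have : IsSchemeTheoreticallyDominant g := .of_isPullback H.flip
  have : QuasiCompact g := MorphismProperty.of_isPullback H.flip inferInstance
  exact g.denseRange

omit [IsDomain R] [IsFractionRing R F] in
/-- Shrinking a scheme to `V` cuts its generic fibre down to the part over `V`. -/
theorem isPullback_shrink (H : IsPullback g sX sY (genMap R F)) (j : V ⟶ Y) :
    IsPullback (pullback.fst j g) (pullback.snd j g ≫ sX) (j ≫ sY) (genMap R F) :=
  ((IsPullback.of_hasPullback j g).flip.paste_horiz H.flip).flip

/-- `ψ : V ⟶ Z` extends the morphism `φ : X ⟶ Z` defined on the generic fibre `g : X ⟶ Y`. -/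
def IsExt (g : X ⟶ Y) (φ : X ⟶ Z) (j : V ⟶ Y) (ψ : V ⟶ Z) : Prop :=
  ∀ ⦃T : Scheme.{u}⦄ (t : T ⟶ V) (x : T ⟶ X), t ≫ j = x ≫ g → t ≫ ψ = x ≫ φ

theorem IsExt.of_pullback {φ : X ⟶ Z} {j : V ⟶ Y} {ψ : V ⟶ Z}
    (h : pullback.fst j g ≫ ψ = pullback.snd j g ≫ φ) : IsExt g φ j ψ := fun T t x e => by
  rw [← pullback.lift_fst t x e, Category.assoc, h, pullback.lift_snd_assoc]

theorem IsExt.comp {φ : X ⟶ Z} {j : V ⟶ Y} {ψ : V ⟶ Z} (h : IsExt g φ j ψ) {W : Scheme.{u}}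
    (i : W ⟶ V) : IsExt g φ (i ≫ j) (i ≫ ψ) := fun T t x e => by
  rw [← Category.assoc]
  exact h (t ≫ i) x (by simpa using e)

/-- The generic fibre of `V` is the part of `X` over `V`, and it is dense because `V` is flat over
the base. -/
theorem IsExt.unique (H : IsPullback g sX sY (genMap R F)) [Flat sY] [Z.IsSeparated] {φ : X ⟶ Z}
    {j : V ⟶ Y} [Flat j] {ψ ψ' : V ⟶ Z} (h : IsExt g φ j ψ) (h' : IsExt g φ j ψ') : ψ = ψ' :=
  hom_ext_of_generic (isPullback_shrink H j)
    ((h _ _ pullback.condition).trans (h' _ _ pullback.condition).symm)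

/-- By uniqueness the local extensions agree on overlaps. -/
theorem IsExt.glue (H : IsPullback g sX sY (genMap R F)) [Flat sY] [Z.IsSeparated] {φ : X ⟶ Z}
    {j : V ⟶ Y} [IsOpenImmersion j]
    (h : ∀ v : V, ∃ U : V.Opens, v ∈ U ∧ ∃ ψ : U.toScheme ⟶ Z, IsExt g φ (U.ι ≫ j) ψ) :
    ∃ ψ : V ⟶ Z, IsExt g φ j ψ := by
  choose U hU ψ hψ using h
  let 𝒰 : V.OpenCover := {
    I₀ := V, X i := (U i), f i := (U i).ι,
    mem₀ := by
      rw [Scheme.presieve₀_mem_precoverage_iff]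
      refine ⟨fun x ↦ ⟨x, by simpa using hU x⟩, inferInstance⟩ }
  have key : ∀ a b : V, pullback.fst (U a).ι (U b).ι ≫ ψ a = pullback.snd (U a).ι (U b).ι ≫ ψ b := by
    intro a b
    have h1 := (hψ a).comp (pullback.fst (U a).ι (U b).ι)
    have h2 := (hψ b).comp (pullback.snd (U a).ι (U b).ι)
    rw [← pullback.condition_assoc] at h2
    exact h1.unique H h2
  refine ⟨𝒰.glueMorphisms ψ key, IsExt.of_pullback ?_⟩
  refine Scheme.Cover.hom_ext (𝒰.pullback₁ (pullback.fst j g)) _ _ fun (i : V) => ?_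
  have h4 : (U i).ι ≫ 𝒰.glueMorphisms ψ key = ψ i := Scheme.Cover.ι_glueMorphisms 𝒰 ψ key i
  have h3 := hψ i (pullback.snd (pullback.fst j g) (U i).ι)
    (pullback.fst (pullback.fst j g) (U i).ι ≫ pullback.snd j g) (by
      rw [← pullback.condition_assoc, pullback.condition, Category.assoc])
  calc pullback.fst (pullback.fst j g) (U i).ι ≫ pullback.fst j g ≫ 𝒰.glueMorphisms ψ key
      = pullback.snd (pullback.fst j g) (U i).ι ≫ (U i).ι ≫ 𝒰.glueMorphisms ψ key := by
        rw [pullback.condition_assoc]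
    _ = pullback.snd (pullback.fst j g) (U i).ι ≫ ψ i := by rw [h4]
    _ = _ := by rw [h3, Category.assoc]; rfl

/-- Preimmersions are surjective on stalks, and a flat local homomorphism is faithfully flat, hence
injective. -/
instance isIso_stalkMap_of_flat_of_isPreimmersion (g : X ⟶ Y) [Flat g] [IsPreimmersion g] (x : X) :
    IsIso (g.stalkMap x) := by
  have hs : Function.Surjective (g.stalkMap x) := g.stalkMap_surjective x
  have hf := Flat.stalkMap g x
  have hi : Function.Injective (g.stalkMap x) := by
    algebraize [(g.stalkMap x).hom]
    have : IsLocalHom (algebraMap (Y.presheaf.stalk (g x)) (X.presheaf.stalk x)) :=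
      inferInstanceAs (IsLocalHom (g.stalkMap x).hom)
    have := Module.FaithfullyFlat.of_flat_of_isLocalHom (A := Y.presheaf.stalk (g x))
      (B := X.presheaf.stalk x)
    exact FaithfulSMul.algebraMap_injective (Y.presheaf.stalk (g x)) (X.presheaf.stalk x)
  exact (ConcreteCategory.isIso_iff_bijective _).mpr ⟨hi, hs⟩

omit [IsDomain R] in
/-- A morphism from the generic fibre extends near every point of the generic fibre. -/
theorem exists_isExt_of_mem_range (H : IsPullback g sX sY (genMap R F)) [Flat sY]
    [IsLocallyNoetherian X] [IsLocallyNoetherian Y]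
    {S : Scheme.{u}} {s : Y ⟶ S} {sZ : Z ⟶ S} [LocallyOfFiniteType sZ]
    {φ : X ⟶ Z} (hφ : φ ≫ sZ = g ≫ s) (x : X) :
    ∃ U : Y.Opens, g x ∈ U ∧ ∃ ψ : U.toScheme ⟶ Z, IsExt g φ U.ι ψ := by
  have : IsPreimmersion g := isPreimmersion_of_isPullback H
  have : Flat g := MorphismProperty.of_isPullback H.flip (flat_genMap R F)
  -- `X` and `Y` have the same local ring at `x`, so `φ` defines a morphism on the spectrum of the
  -- local ring of `Y` at `g x`. It spreads out to an open set because `sZ` is locally of finite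
  -- type.
  obtain ⟨U, hU, f, hf, -⟩ := spread_out_of_isGermInjective' s sZ (x := g x)
    (Spec.map (inv (g.stalkMap x)) ≫ X.fromSpecStalk x ≫ φ) (by
      rw [Category.assoc, Category.assoc, hφ, ← Scheme.SpecMap_stalkMap_fromSpecStalk_assoc,
        ← Spec.map_comp_assoc, IsIso.hom_inv_id, Spec.map_id, Category.id_comp])
  have hx : x ∈ g ⁻¹ᵁ U := hU
  have e1 : (g ⁻¹ᵁ U).fromSpecStalkOfMem x hx ≫ (g ∣_ U) =
      Spec.map (g.stalkMap x) ≫ U.fromSpecStalkOfMem (g x) hU := by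
    rw [← cancel_mono U.ι, Category.assoc, morphismRestrict_ι, Category.assoc,
      Scheme.Opens.fromSpecStalkOfMem_ι, Scheme.Opens.fromSpecStalkOfMem_ι_assoc,
      Scheme.SpecMap_stalkMap_fromSpecStalk]
  obtain ⟨x', rfl⟩ : ∃ x' : (g ⁻¹ᵁ U).toScheme, (g ⁻¹ᵁ U).ι x' = x := ⟨⟨x, hx⟩, rfl⟩
  have e2 : (g ⁻¹ᵁ U).toScheme.fromSpecStalk x' =
      Spec.map ((g ⁻¹ᵁ U).ι.stalkMap x') ≫ (g ⁻¹ᵁ U).fromSpecStalkOfMem ((g ⁻¹ᵁ U).ι x') hx := by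
    rw [← cancel_mono (g ⁻¹ᵁ U).ι, Category.assoc, Scheme.Opens.fromSpecStalkOfMem_ι]
    exact (Scheme.SpecMap_stalkMap_fromSpecStalk (g ⁻¹ᵁ U).ι (x := x')).symm
  -- So far `f` and `φ` agree only as germs at `x'`. They agree on some open `N` in the generic
  -- fibre, and `N` is the trace of an open set `W` of `Y`, since `g` is a topological embedding.
  obtain ⟨N, hN, hNe⟩ := spread_out_unique_of_isGermInjective' (x := x')
    ((g ∣_ U) ≫ f) ((g ⁻¹ᵁ U).ι ≫ φ) (by
      rw [e2, Category.assoc, Category.assoc, reassoc_of% e1, ← hf,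
        ← Spec.map_comp_assoc (inv _), IsIso.inv_hom_id, Spec.map_id, Category.id_comp,
        Scheme.Opens.fromSpecStalkOfMem_ι_assoc])
  obtain ⟨M, hM, hMe⟩ := (g.isEmbedding.isInducing.isOpen_iff).mp ((g ⁻¹ᵁ U).ι ''ᵁ N).2
  let W : Y.Opens := ⟨M, hM⟩
  have hW : g ⁻¹ᵁ W = (g ⁻¹ᵁ U).ι ''ᵁ N := TopologicalSpace.Opens.ext hMe
  refine ⟨U ⊓ W, ⟨hU, ?_⟩, Y.homOfLE inf_le_left ≫ f, fun T t y e => ?_⟩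
  · have : (g ⁻¹ᵁ U).ι x' ∈ g ⁻¹ᵁ W := by rw [hW]; exact ⟨x', hN, rfl⟩
    exact this
  · have hr : Set.range y ⊆ Set.range (N.ι ≫ (g ⁻¹ᵁ U).ι) := by
      rintro _ ⟨z, rfl⟩
      have h1 : g (y z) ∈ W := by
        rw [← Scheme.Hom.comp_apply, ← e, Scheme.Hom.comp_apply]
        exact (t z).2.2
      have h2 : y z ∈ (g ⁻¹ᵁ U).ι ''ᵁ N := by rw [← hW]; exact h1
      obtain ⟨w, hw, hw'⟩ := h2
      exact ⟨⟨w, hw⟩, hw'⟩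
    let y' := IsOpenImmersion.lift (N.ι ≫ (g ⁻¹ᵁ U).ι) y hr
    have hy' : y' ≫ N.ι ≫ (g ⁻¹ᵁ U).ι = y := IsOpenImmersion.lift_fac _ _ _
    have e3 : t ≫ Y.homOfLE inf_le_left = y' ≫ N.ι ≫ (g ∣_ U) := by
      rw [← cancel_mono U.ι, Category.assoc, Scheme.homOfLE_ι, e, Category.assoc, Category.assoc,
        morphismRestrict_ι, ← hy']
      simp only [Category.assoc]
    rw [reassoc_of% e3, hNe, ← hy']
    simp only [Category.assoc]

/-- A morphism from the generic fibre extends to an open neighbourhood of the generic fibre. -/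
theorem exists_isExt_generic (H : IsPullback g sX sY (genMap R F)) [Flat sY]
    [IsLocallyNoetherian X] [IsLocallyNoetherian Y] [Z.IsSeparated]
    {S : Scheme.{u}} {s : Y ⟶ S} {sZ : Z ⟶ S} [LocallyOfFiniteType sZ]
    {φ : X ⟶ Z} (hφ : φ ≫ sZ = g ≫ s) :
    ∃ U : Y.Opens, (∀ x, g x ∈ U) ∧ ∃ ψ : U.toScheme ⟶ Z, IsExt g φ U.ι ψ := by
  choose U hU ψ hψ using exists_isExt_of_mem_range H hφ
  refine ⟨⨆ x, U x, fun x => TopologicalSpace.Opens.mem_iSup.mpr ⟨x, hU x⟩, IsExt.glue H ?_⟩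
  rintro ⟨v, hv⟩
  obtain ⟨x, hx⟩ := TopologicalSpace.Opens.mem_iSup.mp hv
  have hle : U x ≤ ⨆ x, U x := le_iSup U x
  refine ⟨(⨆ x, U x).ι ⁻¹ᵁ U x, hx, (⨆ x, U x).ι ∣_ U x ≫ ψ x, ?_⟩
  rw [← morphismRestrict_ι]
  exact (hψ x).comp _

/-- An open neighbourhood of the generic fibre contains all fibres over a dense open set. -/
theorem exists_ne_zero_of_range_subset (H : IsPullback g sX sY (genMap R F)) [QuasiCompact sY]
    (V : Y.Opens) (hV : ∀ x, g x ∈ V) :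
    ∃ r : R, r ≠ 0 ∧ ∀ y : Y, r ∉ (sY y).asIdeal → y ∈ V := by
  have : CompactSpace Y := by
    rw [← isCompact_univ_iff]
    exact sY.isCompact_preimage (U := ⊤) isCompact_univ
  have aff : ∀ U : Y.affineOpens, ∃ r : R, r ≠ 0 ∧ ∀ y ∈ U.1, r ∉ (sY y).asIdeal → y ∈ V := by
    rintro ⟨U, hU⟩
    let C := Γ(Y, U)
    let h : Spec C ⟶ Spec (.of R) := hU.fromSpec ≫ sY
    let a : R →+* C := (Spec.preimage h).hom
    have ha : Spec.map (CommRingCat.ofHom a) = h := Spec.map_preimage h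
    obtain ⟨I, hI⟩ := (PrimeSpectrum.isClosed_iff_zeroLocus_ideal _).mp
      ((hU.fromSpec ⁻¹ᵁ V).isOpen.isClosed_compl)
    by_contra hcon
    have hdis : Disjoint (I : Set C) ((nonZeroDivisors R).map a : Set C) := by
      rw [Set.disjoint_left]
      rintro _ hc ⟨r, hr, rfl⟩
      refine hcon ⟨r, nonZeroDivisors.ne_zero hr, fun y hy hry => ?_⟩
      by_contra hyV
      obtain ⟨p, rfl⟩ : ∃ p, hU.fromSpec p = y := by
        have : y ∈ Set.range hU.fromSpec := by rw [hU.range_fromSpec]; exact hy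
        exact this
      have hp : p ∈ PrimeSpectrum.zeroLocus (I : Set C) := by
        rw [← hI]; exact hyV
      apply hry
      have : sY (hU.fromSpec p) = Spec.map (CommRingCat.ofHom a) p := by rw [ha]; rfl
      rw [this]
      exact hp hc
    obtain ⟨P, hP, hIP, hPd⟩ := Ideal.exists_le_prime_disjoint I _ hdis
    let p : Spec C := (⟨P, hP⟩ : PrimeSpectrum C)
    have hgen : sY (hU.fromSpec p) = genPt R := by
      have : sY (hU.fromSpec p) = Spec.map (CommRingCat.ofHom a) p := by rw [ha]; rfl
      rw [this]
      refine PrimeSpectrum.ext (eq_bot_iff.mpr ?_)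
      intro r hr
      by_contra hr0
      exact Set.disjoint_left.mp hPd hr ⟨r, mem_nonZeroDivisors_of_ne_zero hr0, rfl⟩
    have : hU.fromSpec p ∈ Set.range g := by rw [range_of_isPullback H]; exact hgen
    obtain ⟨x, hx⟩ := this
    have h1 : p ∈ (hU.fromSpec ⁻¹ᵁ V : Set (Spec C))ᶜ := by rw [hI]; exact hIP
    exact h1 (by change hU.fromSpec p ∈ V; rw [← hx]; exact hV x)
  choose r hr0 hr using aff
  obtain ⟨t, ht⟩ := isCompact_univ.elim_finite_subcover (fun U : Y.affineOpens => (U.1 : Set Y))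
    (fun U => U.1.isOpen) (fun y _ => by
      obtain ⟨_, ⟨U, hU, rfl⟩, hyU, -⟩ :=
        Y.isBasis_affineOpens.exists_subset_of_mem_open (Set.mem_univ y) isOpen_univ
      exact Set.mem_iUnion.mpr ⟨⟨U, hU⟩, hyU⟩)
  refine ⟨∏ U ∈ t, r U, Finset.prod_ne_zero_iff.mpr fun U _ => hr0 U, fun y hy => ?_⟩
  obtain ⟨U, hUt, hyU⟩ := Set.mem_iUnion₂.mp (ht (Set.mem_univ y))
  exact hr U y hyU fun h => hy (Ideal.mem_of_dvd _ (Finset.dvd_prod_of_mem r hUt) h)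

end Density
end IntegralModels

/-! ### Gluing two schemes along a common open subscheme -/

namespace IntegralModels

open Limits

section GlueSchemes

variable {X X₁ X₂ Z : Scheme.{u}}

/-- The open cover by two jointly surjective open immersions. -/
noncomputable def twoCover (j₁ : X₁ ⟶ X) (j₂ : X₂ ⟶ X) [IsOpenImmersion j₁] [IsOpenImmersion j₂]
    (h : ∀ x, x ∈ Set.range j₁ ∨ x ∈ Set.range j₂) : Scheme.OpenCover.{0} X where
  I₀ := Bool
  X b := match b with
    | true => X₁
    | false => X₂
  f b := match b with
    | true => j₁
    | false => j₂
  mem₀ := by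
    rw [Scheme.presieve₀_mem_precoverage_iff]
    refine ⟨fun x => (h x).elim (fun h => ⟨true, h⟩) (fun h => ⟨false, h⟩), ?_⟩
    rintro (_ | _) <;> infer_instance

theorem exists_glue_hom (j₁ : X₁ ⟶ X) (j₂ : X₂ ⟶ X) [IsOpenImmersion j₁] [IsOpenImmersion j₂]
    (h : ∀ x, x ∈ Set.range j₁ ∨ x ∈ Set.range j₂) (a : X₁ ⟶ Z) (b : X₂ ⟶ Z)
    (hab : pullback.fst j₁ j₂ ≫ a = pullback.snd j₁ j₂ ≫ b) :
    ∃ c : X ⟶ Z, j₁ ≫ c = a ∧ j₂ ≫ c = b := by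
  let 𝒰 := twoCover j₁ j₂ h
  let f : ∀ i, 𝒰.X i ⟶ Z := fun i => match i with
    | true => a
    | false => b
  have hf : ∀ x y, pullback.fst (𝒰.f x) (𝒰.f y) ≫ f x = pullback.snd _ _ ≫ f y := by
    rintro (_ | _) (_ | _)
    · change pullback.fst j₂ j₂ ≫ b = pullback.snd j₂ j₂ ≫ b
      rw [fst_eq_snd_of_mono_eq]
    · change pullback.fst j₂ j₁ ≫ b = pullback.snd j₂ j₁ ≫ a
      rw [← pullbackSymmetry_hom_comp_snd, Category.assoc, ← hab, pullbackSymmetry_hom_comp_fst_assoc]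
    · exact hab
    · change pullback.fst j₁ j₁ ≫ a = pullback.snd j₁ j₁ ≫ a
      rw [fst_eq_snd_of_mono_eq]
  exact ⟨𝒰.glueMorphisms f hf, Scheme.Cover.ι_glueMorphisms 𝒰 f hf true,
    Scheme.Cover.ι_glueMorphisms 𝒰 f hf false⟩

theorem hom_ext_two (j₁ : X₁ ⟶ X) (j₂ : X₂ ⟶ X) [IsOpenImmersion j₁] [IsOpenImmersion j₂]
    (h : ∀ x, x ∈ Set.range j₁ ∨ x ∈ Set.range j₂) {a b : X ⟶ Z} (h₁ : j₁ ≫ a = j₁ ≫ b)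
    (h₂ : j₂ ≫ a = j₂ ≫ b) : a = b := by
  refine Scheme.Cover.hom_ext (twoCover j₁ j₂ h) _ _ ?_
  rintro (_ | _)
  · exact h₂
  · exact h₁

theorem of_two_source (P : MorphismProperty Scheme.{u}) [IsZariskiLocalAtSource P]
    (j₁ : X₁ ⟶ X) (j₂ : X₂ ⟶ X) [IsOpenImmersion j₁] [IsOpenImmersion j₂]
    (h : ∀ x, x ∈ Set.range j₁ ∨ x ∈ Set.range j₂) {f : X ⟶ Z} (h₁ : P (j₁ ≫ f))
    (h₂ : P (j₂ ≫ f)) : P f := by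
  refine IsZariskiLocalAtSource.of_openCover (twoCover j₁ j₂ h) ?_
  rintro (_ | _)
  · exact h₂
  · exact h₁

theorem compactSpace_of_two [CompactSpace X₁] [CompactSpace X₂] (j₁ : X₁ ⟶ X) (j₂ : X₂ ⟶ X)
    (h : ∀ x, x ∈ Set.range j₁ ∨ x ∈ Set.range j₂) : CompactSpace X := by
  rw [← isCompact_univ_iff]
  convert (isCompact_range j₁.continuous).union (isCompact_range j₂.continuous)
  exact (Set.eq_univ_of_forall h).symm

/-- Two schemes can be glued along a common open subscheme. -/
theorem exists_glue {V Y₁ Y₂ : Scheme.{u}} (a₁ : V ⟶ Y₁) (a₂ : V ⟶ Y₂) [IsOpenImmersion a₁]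
    [IsOpenImmersion a₂] :
    ∃ (Y : Scheme.{u}) (i₁ : Y₁ ⟶ Y) (i₂ : Y₂ ⟶ Y), IsOpenImmersion i₁ ∧ IsOpenImmersion i₂ ∧
      IsPushout a₁ a₂ i₁ i₂ ∧ (∀ y, y ∈ Set.range i₁ ∨ y ∈ Set.range i₂) ∧
      ∀ y₁ y₂, i₁ y₁ = i₂ y₂ → ∃ v, a₁ v = y₁ ∧ a₂ v = y₂ := by
  have : ∀ {i j : WidePushoutShape WalkingPair} (f : i ⟶ j), IsOpenImmersion ((span a₁ a₂).map f) := by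
    intro i j f
    match i, j, f with
    | _, _, WidePushoutShape.Hom.id x =>
      exact inferInstanceAs (IsOpenImmersion ((span a₁ a₂).map (𝟙 x)))
    | _, _, WidePushoutShape.Hom.init WalkingPair.left => exact ‹IsOpenImmersion a₁›
    | _, _, WidePushoutShape.Hom.init WalkingPair.right => exact ‹IsOpenImmersion a₂›
  have h1 : IsOpenImmersion (pushout.inl a₁ a₂) :=
    inferInstanceAs (IsOpenImmersion (colimit.ι (span a₁ a₂) WalkingSpan.left))
  have h2 : IsOpenImmersion (pushout.inr a₁ a₂) :=
    inferInstanceAs (IsOpenImmersion (colimit.ι (span a₁ a₂) WalkingSpan.right))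
  refine ⟨pushout a₁ a₂, pushout.inl a₁ a₂, pushout.inr a₁ a₂, h1, h2, .of_hasPushout _ _, ?_, ?_⟩
  · intro y
    obtain ⟨i, x, hx⟩ := Scheme.IsLocallyDirected.ι_jointly_surjective (span a₁ a₂) y
    rcases i with _ | _ | _
    · have hw : a₁ ≫ pushout.inl a₁ a₂ = colimit.ι (span a₁ a₂) none :=
        colimit.w (span a₁ a₂) WalkingSpan.Hom.fst
      exact Or.inl ⟨a₁ x, hx ▸ congrArg (fun f : V ⟶ pushout a₁ a₂ => f x) hw⟩
    · exact Or.inl ⟨x, hx⟩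
    · exact Or.inr ⟨x, hx⟩
  · intro y₁ y₂ e
    obtain ⟨k, fi, fj, x, hx, hy⟩ := (Scheme.IsLocallyDirected.ι_eq_ι_iff (span a₁ a₂)
      (i := WalkingSpan.left) (j := WalkingSpan.right)).mp e
    match k, fi, fj with
    | _, WidePushoutShape.Hom.init WalkingPair.left, WidePushoutShape.Hom.init WalkingPair.right =>
      exact ⟨x, hx, hy⟩

end GlueSchemes

/-! ### Flat models and their gluing -/

section FlatModel

/-- A flat scheme of finite type over `R` with a given generic fibre. -/
structure FlatModel (R : Type u) {F : Type u} [CommRing R] [Field F] [Algebra R F]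
    {X : Scheme.{u}} (sX : X ⟶ Spec (.of F)) where
  scheme : Scheme.{u}
  str : scheme ⟶ Spec (.of R)
  gen : X ⟶ scheme
  isPullback : IsPullback gen sX str (genMap R F)
  flat : Flat str
  locallyOfFiniteType : LocallyOfFiniteType str
  quasiCompact : QuasiCompact str

attribute [instance] FlatModel.flat FlatModel.locallyOfFiniteType FlatModel.quasiCompact

variable {R F : Type u} [CommRing R] [IsDomain R] [IsNoetherianRing R] [Field F] [Algebra R F]
  [IsFractionRing R F] {X X₁ X₂ : Scheme.{u}} {sX : X ⟶ Spec (.of F)}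

instance FlatModel.isLocallyNoetherian (M : FlatModel R sX) : IsLocallyNoetherian M.scheme :=
  LocallyOfFiniteType.isLocallyNoetherian M.str

instance FlatModel.compactSpace (M : FlatModel R sX) : CompactSpace M.scheme := by
  rw [← isCompact_univ_iff]
  exact M.str.isCompact_preimage (U := ⊤) isCompact_univ

instance FlatModel.isPreimmersion_gen (M : FlatModel R sX) : IsPreimmersion M.gen :=
  isPreimmersion_of_isPullback M.isPullback

omit [IsNoetherianRing R] in
theorem FlatModel.mem_range_gen (M : FlatModel R sX) {y : M.scheme} :
    y ∈ Set.range M.gen ↔ M.str y = genPt R := by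
  rw [range_of_isPullback M.isPullback]; rfl

omit [IsDomain R] [IsNoetherianRing R] [IsFractionRing R F] in
/-- Gluing two models along open subschemes whose generic fibre is the intersection of the
generic fibres. -/
theorem FlatModel.exists_glue {j₁ : X₁ ⟶ X} {j₂ : X₂ ⟶ X} [IsOpenImmersion j₁] [IsOpenImmersion j₂]
    (hj : ∀ x, x ∈ Set.range j₁ ∨ x ∈ Set.range j₂) (M₁ : FlatModel R (j₁ ≫ sX))
    (M₂ : FlatModel R (j₂ ≫ sX)) {V : Scheme.{u}} (a₁ : V ⟶ M₁.scheme) (a₂ : V ⟶ M₂.scheme)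
    [IsOpenImmersion a₁] [IsOpenImmersion a₂] (ha : a₁ ≫ M₁.str = a₂ ≫ M₂.str)
    (h : ∃ t : pullback j₁ j₂ ⟶ V, t ≫ a₁ = pullback.fst j₁ j₂ ≫ M₁.gen ∧
      t ≫ a₂ = pullback.snd j₁ j₂ ≫ M₂.gen)
    (hV : ∀ v x₁ x₂, a₁ v = M₁.gen x₁ → a₂ v = M₂.gen x₂ → j₁ x₁ = j₂ x₂) :
    ∃ (M : FlatModel R sX) (i₁ : M₁.scheme ⟶ M.scheme) (i₂ : M₂.scheme ⟶ M.scheme),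
      IsOpenImmersion i₁ ∧ IsOpenImmersion i₂ ∧ i₁ ≫ M.str = M₁.str ∧ i₂ ≫ M.str = M₂.str ∧
      j₁ ≫ M.gen = M₁.gen ≫ i₁ ∧ j₂ ≫ M.gen = M₂.gen ≫ i₂ ∧ a₁ ≫ i₁ = a₂ ≫ i₂ ∧
      (∀ y, y ∈ Set.range i₁ ∨ y ∈ Set.range i₂) ∧
      ∀ y₁ y₂, i₁ y₁ = i₂ y₂ → ∃ v, a₁ v = y₁ ∧ a₂ v = y₂ := by
  obtain ⟨Y, i₁, i₂, _, _, hp, hi, hi'⟩ := IntegralModels.exists_glue a₁ a₂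
  obtain ⟨t, ht₁, ht₂⟩ := h
  let s : Y ⟶ Spec (.of R) := hp.desc M₁.str M₂.str ha
  have hs₁ : i₁ ≫ s = M₁.str := hp.inl_desc _ _ _
  have hs₂ : i₂ ≫ s = M₂.str := hp.inr_desc _ _ _
  obtain ⟨g, hg₁, hg₂⟩ := exists_glue_hom j₁ j₂ hj (M₁.gen ≫ i₁) (M₂.gen ≫ i₂) (by
    rw [← reassoc_of% ht₁, hp.w, reassoc_of% ht₂])
  have hw : g ≫ s = sX ≫ genMap R F := by
    refine hom_ext_two j₁ j₂ hj ?_ ?_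
    · rw [reassoc_of% hg₁, hs₁, M₁.isPullback.w, Category.assoc]
    · rw [reassoc_of% hg₂, hs₂, M₂.isPullback.w, Category.assoc]
  -- The glued scheme has generic fibre `X` precisely if the comparison morphism `L` is an
  -- isomorphism. It is an open immersion on both charts, surjective because the charts cover, and
  -- injective because of `hV`: points identified in the overlap already coincide in `X`.
  let L : X ⟶ pullback s (genMap R F) := pullback.lift g sX hw
  have hR : IsPullback (pullback.snd s (genMap R F)) (pullback.fst s (genMap R F)) (genMap R F) s :=
    (IsPullback.of_hasPullback _ _).flip
  have hL₁ : IsPullback (j₁ ≫ L) M₁.gen (pullback.fst s (genMap R F)) i₁ := by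
    refine IsPullback.of_right (h₁₂ := pullback.snd s (genMap R F)) ?_ ?_ hR
    · rw [hs₁, Category.assoc, pullback.lift_snd]
      exact M₁.isPullback.flip
    · rw [Category.assoc, pullback.lift_fst, hg₁]
  have hL₂ : IsPullback (j₂ ≫ L) M₂.gen (pullback.fst s (genMap R F)) i₂ := by
    refine IsPullback.of_right (h₁₂ := pullback.snd s (genMap R F)) ?_ ?_ hR
    · rw [hs₂, Category.assoc, pullback.lift_snd]
      exact M₂.isPullback.flip
    · rw [Category.assoc, pullback.lift_fst, hg₂]
  have o₁ : IsOpenImmersion (j₁ ≫ L) := MorphismProperty.of_isPullback hL₁.flip inferInstance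
  have o₂ : IsOpenImmersion (j₂ ≫ L) := MorphismProperty.of_isPullback hL₂.flip inferInstance
  have cross : ∀ x₁ x₂, (j₁ ≫ L) x₁ = (j₂ ≫ L) x₂ → j₁ x₁ = j₂ x₂ := by
    intro x₁ x₂ e
    have e' : (M₁.gen ≫ i₁) x₁ = (M₂.gen ≫ i₂) x₂ := by
      rw [← hL₁.w, ← hL₂.w, Scheme.Hom.comp_apply, e, Scheme.Hom.comp_apply (j₂ ≫ L)]
    rw [Scheme.Hom.comp_apply, Scheme.Hom.comp_apply] at e'
    obtain ⟨v, hv₁, hv₂⟩ := hi' _ _ e'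
    exact hV v _ _ hv₁ hv₂
  have hinj : Function.Injective L := by
    intro x x' e
    rcases hj x with ⟨y, rfl⟩ | ⟨y, rfl⟩ <;> rcases hj x' with ⟨y', rfl⟩ | ⟨y', rfl⟩
    · rw [← Scheme.Hom.comp_apply, ← Scheme.Hom.comp_apply] at e
      rw [(j₁ ≫ L).injective e]
    · rw [← Scheme.Hom.comp_apply, ← Scheme.Hom.comp_apply] at e
      exact cross _ _ e
    · rw [← Scheme.Hom.comp_apply, ← Scheme.Hom.comp_apply] at e
      exact (cross _ _ e.symm).symm
    · rw [← Scheme.Hom.comp_apply, ← Scheme.Hom.comp_apply] at e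
      rw [(j₂ ≫ L).injective e]
  have hsurj : Function.Surjective L := by
    have fib : ∀ {X' Y' : Scheme.{u}} {a : X' ⟶ pullback s (genMap R F)} {b : X' ⟶ Y'}
        {i : Y' ⟶ Y} (H : IsPullback a b (pullback.fst s (genMap R F)) i)
        (p : ↑(pullback s (genMap R F))), pullback.fst s (genMap R F) p ∈ Set.range i →
        p ∈ Set.range a := by
      intro X' Y' a b i H p hp
      rw [← H.isoPullback_hom_fst]
      have : p ∈ Set.range (pullback.fst (pullback.fst s (genMap R F)) i) := by
        rw [Scheme.Pullback.range_fst]; exact hp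
      obtain ⟨q, rfl⟩ := this
      obtain ⟨x, rfl⟩ := H.isoPullback.hom.surjective q
      exact ⟨x, by rw [Scheme.Hom.comp_apply]⟩
    intro p
    rcases hi (pullback.fst s (genMap R F) p) with h | h
    · obtain ⟨x, rfl⟩ := fib hL₁ p h
      exact ⟨j₁ x, by rw [Scheme.Hom.comp_apply]⟩
    · obtain ⟨x, rfl⟩ := fib hL₂ p h
      exact ⟨j₂ x, by rw [Scheme.Hom.comp_apply]⟩
  have hopen : IsOpenImmersion L := by
    refine IsOpenImmersion.of_openCover_source L (twoCover j₁ j₂ hj) hinj ?_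
    rintro (_ | _)
    · exact o₂
    · exact o₁
  have hiso : IsIso L := (isIso_iff_isOpenImmersion_and_surjective L).mpr ⟨hopen, ⟨hsurj⟩⟩
  have hpb : IsPullback g sX s (genMap R F) :=
    IsPullback.of_iso_pullback ⟨hw⟩ (asIso L) (pullback.lift_fst _ _ _) (pullback.lift_snd _ _ _)
  refine ⟨⟨Y, s, g, hpb, ?_, ?_, ?_⟩, i₁, i₂, inferInstance, inferInstance, hs₁, hs₂, hg₁, hg₂,
    hp.w, hi, hi'⟩
  · have := HasRingHomProperty.instIsZariskiLocalAtSource (P := @Flat.{u})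
    exact of_two_source @Flat i₁ i₂ hi (hs₁ ▸ M₁.flat) (hs₂ ▸ M₂.flat)
  · have := HasRingHomProperty.instIsZariskiLocalAtSource (P := @LocallyOfFiniteType.{u})
    exact of_two_source @LocallyOfFiniteType i₁ i₂ hi (hs₁ ▸ M₁.locallyOfFiniteType)
      (hs₂ ▸ M₂.locallyOfFiniteType)
  · have := compactSpace_of_two i₁ i₂ hi
    exact (quasiCompact_iff_compactSpace s).mpr this

/-- The restriction of a model to an open subscheme. -/
noncomputable def FlatModel.restrict (M : FlatModel R sX) {V W : Scheme.{u}} (j : V ⟶ M.scheme)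
    [IsOpenImmersion j] {i : W ⟶ X} {g : W ⟶ V} (H : IsPullback g i j M.gen) :
    FlatModel R (i ≫ sX) where
  scheme := V
  str := j ≫ M.str
  gen := g
  isPullback := (H.flip.paste_horiz M.isPullback.flip).flip
  flat := inferInstance
  locallyOfFiniteType := inferInstance
  quasiCompact := by
    have : IsNoetherian M.scheme := {}
    have : TopologicalSpace.NoetherianSpace V := j.isEmbedding.isInducing.noetherianSpace
    infer_instance

end FlatModel
end IntegralModels

/-! ### Models near the generic fibre: uniqueness and separatedness -/

namespace IntegralModels

open Limits

section SpreadOut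

variable {R F : Type u} [CommRing R] [IsDomain R] [IsNoetherianRing R] [Field F] [Algebra R F]
  [IsFractionRing R F]

theorem isSeparated_of_str {Y S : Scheme.{u}} [S.IsSeparated] (s : Y ⟶ S) [IsSeparated s] :
    Y.IsSeparated :=
  ⟨by rw [← terminal.comp_from s]; infer_instance⟩

theorem IsExt.refl {X Y : Scheme.{u}} (g : X ⟶ Y) {V : Scheme.{u}} (j : V ⟶ Y) : IsExt g g j j :=
  fun _ _ _ e => e

theorem isLocallyNoetherian_over_field {X : Scheme.{u}} (sX : X ⟶ Spec (.of F))
    [LocallyOfFiniteType sX] : IsLocallyNoetherian X :=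
  LocallyOfFiniteType.isLocallyNoetherian sX

omit [IsDomain R] [IsNoetherianRing R] [IsFractionRing R F] in
theorem FlatModel.locallyOfFiniteType_generic {X : Scheme.{u}} {sX : X ⟶ Spec (.of F)}
    (M : FlatModel R sX) : LocallyOfFiniteType sX :=
  MorphismProperty.of_isPullback M.isPullback inferInstance

/-- Two separated models of the same scheme are isomorphic near the generic fibre. -/
theorem FlatModel.exists_iso {O : Scheme.{u}} {sO : O ⟶ Spec (.of F)}
    (M₁ M₂ : FlatModel R sO) [M₁.scheme.IsSeparated] [M₂.scheme.IsSeparated] :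
    ∃ (V : Scheme.{u}) (a₁ : V ⟶ M₁.scheme) (a₂ : V ⟶ M₂.scheme) (t : O ⟶ V),
      IsOpenImmersion a₁ ∧ IsOpenImmersion a₂ ∧ t ≫ a₁ = M₁.gen ∧ t ≫ a₂ = M₂.gen ∧
      a₁ ≫ M₁.str = a₂ ≫ M₂.str := by
  have := M₁.locallyOfFiniteType_generic
  have := isLocallyNoetherian_over_field sO
  obtain ⟨U₁, hU₁, b₁, hb₁⟩ := exists_isExt_generic M₁.isPullback (Z := M₂.scheme) (s := M₁.str)
    (sZ := M₂.str) (φ := M₂.gen) (by rw [M₁.isPullback.w, M₂.isPullback.w])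
  obtain ⟨U₂, hU₂, b₂, hb₂⟩ := exists_isExt_generic M₂.isPullback (Z := M₁.scheme) (s := M₂.str)
    (sZ := M₁.str) (φ := M₁.gen) (by rw [M₁.isPullback.w, M₂.isPullback.w])
  -- `b₁` and `b₂` extend the identity of the generic fibre in the two directions. On `V` and on its
  -- counterpart `V'` both composites are defined; they are the inclusions, by uniqueness of
  -- extensions.
  let V := b₁ ⁻¹ᵁ U₂
  let a₁ : V.toScheme ⟶ M₁.scheme := V.ι ≫ U₁.ι
  let c₁ : V.toScheme ⟶ U₂.toScheme := b₁ ∣_ U₂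
  have hc₁ : c₁ ≫ U₂.ι = V.ι ≫ b₁ := morphismRestrict_ι _ _
  have hcb : c₁ ≫ b₂ = a₁ := by
    refine IsExt.unique M₁.isPullback (φ := M₁.gen) (j := a₁) ?_ (IsExt.refl _ _)
    intro T v x e
    rw [← Category.assoc]
    refine hb₂ _ x ?_
    rw [Category.assoc, hc₁, ← Category.assoc]
    exact hb₁ _ x (by rw [Category.assoc]; exact e)
  let V' := b₂ ⁻¹ᵁ a₁.opensRange
  have hr : Set.range c₁ ⊆ Set.range V'.ι := by
    rintro _ ⟨v, rfl⟩
    rw [Scheme.Opens.range_ι]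
    change b₂ (c₁ v) ∈ a₁.opensRange
    rw [← Scheme.Hom.comp_apply, hcb]
    exact ⟨v, rfl⟩
  let e : V.toScheme ⟶ V'.toScheme := IsOpenImmersion.lift V'.ι c₁ hr
  have he : e ≫ V'.ι = c₁ := IsOpenImmersion.lift_fac _ _ _
  have hr' : Set.range (V'.ι ≫ b₂) ⊆ Set.range a₁ := by
    rintro _ ⟨v, rfl⟩
    rw [Scheme.Hom.comp_apply]
    exact v.2
  let e' : V'.toScheme ⟶ V.toScheme := IsOpenImmersion.lift a₁ (V'.ι ≫ b₂) hr'
  have he' : e' ≫ a₁ = V'.ι ≫ b₂ := IsOpenImmersion.lift_fac _ _ _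
  have h1 : e ≫ e' = 𝟙 _ := by
    rw [← cancel_mono a₁, Category.assoc, he', reassoc_of% he, hcb, Category.id_comp]
  have h2 : e' ≫ e = 𝟙 _ := by
    rw [← cancel_mono (V'.ι ≫ U₂.ι), Category.id_comp]
    refine IsExt.unique M₂.isPullback (φ := M₂.gen) (j := V'.ι ≫ U₂.ι) ?_ (IsExt.refl _ _)
    intro T v x ex
    rw [Category.assoc, reassoc_of% he, hc₁, ← Category.assoc, ← Category.assoc]
    refine hb₁ _ x ?_
    have : (v ≫ V'.ι) ≫ b₂ = x ≫ M₁.gen := hb₂ _ x (by rw [Category.assoc]; exact ex)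
    have he'' : e' ≫ V.ι ≫ U₁.ι = V'.ι ≫ b₂ := he'
    rw [← this]
    simp only [Category.assoc, ← he'']
  have hei : IsIso e := ⟨e', h1, h2⟩
  have hlift : ∀ x, M₁.gen x ∈ Set.range a₁ := by
    intro x
    let y : U₁.toScheme := ⟨M₁.gen x, hU₁ x⟩
    have hl : Set.range M₁.gen ⊆ Set.range U₁.ι := by
      rintro _ ⟨z, rfl⟩; rw [Scheme.Opens.range_ι]; exact hU₁ z
    have := hb₁ (IsOpenImmersion.lift U₁.ι M₁.gen hl) (𝟙 _) (by
      rw [IsOpenImmersion.lift_fac, Category.id_comp])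
    have hy : IsOpenImmersion.lift U₁.ι M₁.gen hl x ∈ b₁ ⁻¹ᵁ U₂ := by
      change b₁ _ ∈ U₂
      rw [← Scheme.Hom.comp_apply, this, Category.id_comp]
      exact hU₂ x
    refine ⟨⟨_, hy⟩, ?_⟩
    change U₁.ι (IsOpenImmersion.lift U₁.ι M₁.gen hl x) = _
    rw [← Scheme.Hom.comp_apply, IsOpenImmersion.lift_fac]
  let t : O ⟶ V.toScheme := IsOpenImmersion.lift a₁ M₁.gen (by rintro _ ⟨x, rfl⟩; exact hlift x)
  have ht : t ≫ a₁ = M₁.gen := IsOpenImmersion.lift_fac _ _ _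
  have ha₂ : e ≫ V'.ι ≫ U₂.ι = V.ι ≫ b₁ := by rw [reassoc_of% he, hc₁]
  have ext₂ : IsExt M₁.gen M₂.gen a₁ (V.ι ≫ b₁) := hb₁.comp V.ι
  refine ⟨V, a₁, e ≫ V'.ι ≫ U₂.ι, t, inferInstance, inferInstance, ht, ?_, ?_⟩
  · rw [ha₂, ext₂ t (𝟙 _) (by rw [ht, Category.id_comp]), Category.id_comp]
  · refine hom_ext_of_generic (isPullback_shrink M₁.isPullback a₁) ?_
    rw [ha₂, pullback.condition_assoc, M₁.isPullback.w, ← Category.assoc _ (V.ι ≫ b₁),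
      ext₂ _ _ pullback.condition, Category.assoc, M₂.isPullback.w]

/-- A model of a separated scheme is separated over a dense open subset of the base. -/
theorem FlatModel.exists_separated {X : Scheme.{u}} {sX : X ⟶ Spec (.of F)} [X.IsSeparated]
    (M : FlatModel R sX) :
    ∃ (N : FlatModel R sX) (j : N.scheme ⟶ M.scheme), IsSeparated N.str ∧ IsOpenImmersion j ∧
      j ≫ M.str = N.str ∧ N.gen ≫ j = M.gen := by
  let P := pullback M.str M.str
  let p : P ⟶ Spec (.of R) := pullback.fst M.str M.str ≫ M.str
  let Δ : M.scheme ⟶ P := pullback.diagonal M.str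
  let G := pullback.fst p (genMap R F)
  have HG : IsPullback G (pullback.snd p (genMap R F)) p (genMap R F) := .of_hasPullback _ _
  have hGm : IsPreimmersion G := isPreimmersion_of_isPullback HG
  have hp : pullback.snd M.str M.str ≫ M.str = p := pullback.condition.symm
  let u₁ : pullback p (genMap R F) ⟶ X := M.isPullback.lift (G ≫ pullback.fst _ _)
    (pullback.snd p (genMap R F)) (by rw [Category.assoc]; exact HG.w)
  let u₂ : pullback p (genMap R F) ⟶ X := M.isPullback.lift (G ≫ pullback.snd _ _)
    (pullback.snd p (genMap R F)) (by rw [Category.assoc, hp]; exact HG.w)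
  have hu₁ : u₁ ≫ M.gen = G ≫ pullback.fst _ _ := M.isPullback.lift_fst _ _ _
  have hu₂ : u₂ ≫ M.gen = G ≫ pullback.snd _ _ := M.isPullback.lift_fst _ _ _
  let E := equalizer.ι u₁ u₂
  have hE : IsClosed (Set.range E) := E.isClosedEmbedding.isClosed_range
  obtain ⟨K, hK, hKE⟩ := G.isEmbedding.isInducing.isClosed_iff.mp hE
  let d : X ⟶ pullback p (genMap R F) := pullback.lift (M.gen ≫ Δ) sX (by
    simp only [p, Δ, Category.assoc, pullback.diagonal_fst_assoc]
    exact M.isPullback.w)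
  have hd : d ≫ G = M.gen ≫ Δ := pullback.lift_fst _ _ _
  have hde : d ≫ u₁ = d ≫ u₂ := by
    rw [← cancel_mono M.gen, Category.assoc, Category.assoc, hu₁, hu₂, reassoc_of% hd,
      reassoc_of% hd, pullback.diagonal_fst, pullback.diagonal_snd]
  -- `K` is a closed set whose trace on the generic fibre is the locus `E` where the two projections
  -- to `X` agree, that is, the diagonal of `X`; it is closed as `X` is separated. So the diagonal
  -- acquires no new points in the generic fibre when its closure is taken.
  have hsub : closure (Set.range Δ) ⊆ K := by
    refine closure_minimal ?_ hK
    have hdense : DenseRange M.gen := denseRange_of_isPullback M.isPullback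
    have : Set.range M.gen ⊆ Δ ⁻¹' K := by
      rintro _ ⟨x, rfl⟩
      change Δ (M.gen x) ∈ K
      rw [← Scheme.Hom.comp_apply, ← hd, Scheme.Hom.comp_apply]
      change d x ∈ G ⁻¹' K
      rw [hKE]
      refine ⟨equalizer.lift d hde x, ?_⟩
      rw [← Scheme.Hom.comp_apply, equalizer.lift_ι]
    have h2 : closure (Set.range M.gen) ⊆ Δ ⁻¹' K :=
      closure_minimal this (hK.preimage Δ.continuous)
    rintro _ ⟨y, rfl⟩
    exact h2 (hdense y)
  have hEΔ : ∀ w, w ∈ Set.range E → G w ∈ Set.range Δ := by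
    rintro _ ⟨z, rfl⟩
    have e : (E ≫ G ≫ pullback.fst _ _) ≫ Δ = E ≫ G := by
      refine pullback.hom_ext ?_ ?_
      · simp only [Δ, Category.assoc, pullback.diagonal_fst, Category.comp_id]
      · simp only [Δ, Category.assoc, pullback.diagonal_snd, Category.comp_id]
        rw [← hu₁, ← hu₂, equalizer.condition_assoc]
    refine ⟨(E ≫ G ≫ pullback.fst _ _) z, ?_⟩
    rw [← Scheme.Hom.comp_apply, ← Scheme.Hom.comp_apply, e]
  have hlc : IsLocallyClosed (Set.range Δ) := Δ.isLocallyClosed_range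
  -- `V` is the complement of the points which the closure adds to the diagonal. It is open because
  -- the diagonal is locally closed, and it contains the generic fibre. Hence it contains all fibres
  -- over some basic open set, and over that set the diagonal is closed.
  let V : P.Opens := ⟨coborder (Set.range Δ), hlc.isOpen_coborder⟩
  have : QuasiCompact p := inferInstance
  obtain ⟨r, hr, hrV⟩ := exists_ne_zero_of_range_subset HG V (by
    intro w hw
    have h1 : w ∈ Set.range E := by
      rw [← hKE]
      exact hsub hw.1
    exact hw.2 (hEΔ w h1))
  let U : M.scheme.Opens := M.str ⁻¹ᵁ (PrimeSpectrum.basicOpen r : (Spec (.of R)).Opens)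
  have hUr : ∀ y : U.toScheme, r ∉ (M.str (U.ι y)).asIdeal := fun y => y.2
  have hgU : ∀ x, M.gen x ∈ U := by
    intro x
    change r ∉ (M.str (M.gen x)).asIdeal
    rw [M.mem_range_gen.mp ⟨x, rfl⟩]
    exact hr
  let gU : X ⟶ U.toScheme := IsOpenImmersion.lift U.ι M.gen (by
    rintro _ ⟨x, rfl⟩; rw [Scheme.Opens.range_ι]; exact hgU x)
  have hg : gU ≫ U.ι = M.gen := IsOpenImmersion.lift_fac _ _ _
  have H : IsPullback gU (𝟙 X) U.ι M.gen := IsOpenImmersion.isPullback _ _ _ _ (by simp [hg]) (by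
    ext x
    simpa using hgU x)
  let N' := M.restrict U.ι H
  let N : FlatModel R sX := ⟨N'.scheme, N'.str, N'.gen, by simpa using N'.isPullback, N'.flat,
    N'.locallyOfFiniteType, N'.quasiCompact⟩
  refine ⟨N, U.ι, ⟨?_⟩, (inferInstance : IsOpenImmersion (Scheme.Opens.ι U)), rfl, hg⟩
  let s : U.toScheme ⟶ Spec (.of R) := U.ι ≫ M.str
  let m : pullback s s ⟶ P := pullback.map s s M.str M.str U.ι U.ι (𝟙 _) (by simp [s]) (by simp [s])
  have hm₁ : m ≫ pullback.fst _ _ = pullback.fst _ _ ≫ U.ι := pullback.lift_fst _ _ _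
  have hm₂ : m ≫ pullback.snd _ _ = pullback.snd _ _ ≫ U.ι := pullback.lift_snd _ _ _
  have hrange : Set.range (pullback.diagonal s) = m ⁻¹' closure (Set.range Δ) := by
    apply le_antisymm
    · rintro _ ⟨y, rfl⟩
      have e : U.ι ≫ Δ = pullback.diagonal s ≫ m := by
        refine pullback.hom_ext ?_ ?_
        · simp [Δ, hm₁]
        · simp [Δ, hm₂]
      refine subset_closure ⟨U.ι y, ?_⟩
      rw [← Scheme.Hom.comp_apply, ← Scheme.Hom.comp_apply, e]
    · intro w hw
      have hwV : m w ∈ V := by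
        refine hrV _ ?_
        have : p (m w) = M.str (U.ι (pullback.fst s s w)) := by
          simp only [p, ← Scheme.Hom.comp_apply]
          rw [reassoc_of% hm₁, Category.assoc]
        rw [this]
        exact hUr _
      have hwΔ : m w ∈ Set.range Δ := by
        rw [← closure_inter_coborder (s := Set.range Δ)]
        exact ⟨hw, hwV⟩
      have hq : w ∈ Set.range (pullback.fst m Δ) := by
        rw [Scheme.Pullback.range_fst]; exact hwΔ
      obtain ⟨q, rfl⟩ := hq
      have e : (pullback.fst m Δ ≫ pullback.fst s s) ≫ pullback.diagonal s = pullback.fst m Δ := by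
        refine pullback.hom_ext ?_ ?_
        · simp
        · rw [← cancel_mono U.ι]
          simp only [Category.assoc, pullback.diagonal_snd, Category.comp_id]
          rw [← hm₁, ← hm₂, pullback.condition_assoc, pullback.condition_assoc]
          simp [Δ]
      refine ⟨(pullback.fst m Δ ≫ pullback.fst s s) q, ?_⟩
      rw [← Scheme.Hom.comp_apply, e]
  exact .of_isPreimmersion _ (hrange ▸ isClosed_closure.preimage m.continuous)

end SpreadOut
end IntegralModels

/-! ### Affine models given by orders -/

namespace IntegralModels

open Limits

section Affine

variable {R F : Type u} [CommRing R] [IsDomain R] [Field F] [Algebra R F]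
  [IsFractionRing R F] {A : Type u} [CommRing A] [Algebra F A] [Algebra R A] [IsScalarTower R F A]

/-- A subalgebra `B` over `R` of an `F`-algebra `A` is an `R`-lattice if it is finitely generated
and spans `A`. -/
structure IsOrder (B : Subalgebra R A) : Prop where
  fg : B.FG
  exists_mul_mem : ∀ a : A, ∃ r : R, r ≠ 0 ∧ algebraMap R A r * a ∈ B

omit [IsDomain R] in
theorem isUnit_algebraMap_of_ne_zero (F : Type u) [Field F] [Algebra R F] [IsFractionRing R F]
    {A : Type u} [CommRing A] [Algebra F A] [Algebra R A] [IsScalarTower R F A] {r : R} (hr : r ≠ 0) : IsUnit (algebraMap R A r) := by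
  rw [IsScalarTower.algebraMap_apply R F A]
  refine (IsUnit.mk0 _ ?_).map _
  rwa [Ne, FaithfulSMul.algebraMap_eq_zero_iff]

variable (F) in
theorem isOrder_adjoin {s : Set A} (hs : s.Finite) (hA : Algebra.adjoin F s = ⊤) :
    IsOrder (Algebra.adjoin R s) where
  fg := ⟨hs.toFinset, by simp⟩
  exists_mul_mem a := by
    have ha : a ∈ Algebra.adjoin F s := hA ▸ Algebra.mem_top
    induction ha using Algebra.adjoin_induction with
    | mem x hx => exact ⟨1, one_ne_zero, by simpa using Algebra.subset_adjoin hx⟩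
    | algebraMap x =>
      obtain ⟨a, b, hb, rfl⟩ := IsFractionRing.div_surjective (A := R) x
      refine ⟨b, nonZeroDivisors.ne_zero hb, ?_⟩
      have : algebraMap R A b * algebraMap F A (algebraMap R F a / algebraMap R F b) =
          algebraMap R A a := by
        rw [IsScalarTower.algebraMap_apply R F A, IsScalarTower.algebraMap_apply R F A, ← map_mul,
          mul_div_cancel₀]
        rw [Ne, FaithfulSMul.algebraMap_eq_zero_iff]
        exact nonZeroDivisors.ne_zero hb
      rw [this]
      exact Subalgebra.algebraMap_mem _ _
    | add x y _ _ hx hy =>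
      obtain ⟨r, hr, hx⟩ := hx
      obtain ⟨t, ht, hy⟩ := hy
      refine ⟨r * t, mul_ne_zero hr ht, ?_⟩
      have := add_mem (Subalgebra.smul_mem _ hx t) (Subalgebra.smul_mem _ hy r)
      convert this using 1
      simp only [Algebra.smul_def, map_mul]
      ring
    | mul x y _ _ hx hy =>
      obtain ⟨r, hr, hx⟩ := hx
      obtain ⟨t, ht, hy⟩ := hy
      refine ⟨r * t, mul_ne_zero hr ht, ?_⟩
      convert mul_mem hx hy using 1
      simp only [map_mul]
      ring

theorem IsOrder.isLocalization (F : Type u) [Field F] [Algebra R F] [IsFractionRing R F]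
    {A : Type u} [CommRing A] [Algebra F A] [Algebra R A] [IsScalarTower R F A]
    {B : Subalgebra R A} (hB : IsOrder B) :
    IsLocalization (Algebra.algebraMapSubmonoid B (nonZeroDivisors R)) A where
  map_units := by
    rintro ⟨_, r, hr, rfl⟩
    exact isUnit_algebraMap_of_ne_zero F (r := r) (nonZeroDivisors.ne_zero (M₀ := R) hr)
  surj a := by
    obtain ⟨r, hr, h⟩ := hB.exists_mul_mem a
    exact ⟨(⟨_, h⟩, ⟨algebraMap R B r, r, mem_nonZeroDivisors_of_ne_zero hr, rfl⟩), mul_comm _ _⟩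
  exists_of_eq h := ⟨1, by rw [Subtype.ext h]⟩

/-- The affine model defined by an order. -/
noncomputable def affineModel (R F : Type u) [CommRing R] [IsDedekindDomain R] [Field F] [Algebra R F]
    [IsFractionRing R F] {A : Type u} [CommRing A] [Algebra F A] [Algebra R A] [IsScalarTower R F A]
    (B : Subalgebra R A) (hB : IsOrder B) :
    FlatModel R (Spec.map (CommRingCat.ofHom (algebraMap F A))) where
  scheme := Spec (.of B)
  str := Spec.map (CommRingCat.ofHom (algebraMap R B))
  gen := Spec.map (CommRingCat.ofHom (algebraMap B A))
  isPullback := by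
    have := hB.isLocalization F
    have : Algebra.IsPushout R B F A :=
      Algebra.isPushout_of_isLocalization (nonZeroDivisors R) F B A
    exact isPullback_SpecMap_of_isPushout _ _ _ _ (CommRingCat.isPushout_of_isPushout R B F A)
  flat := by
    rw [Flat.SpecMap_iff]
    -- Over a Dedekind domain flatness means torsion-freeness, and `B` lies in an algebra over the
    -- fraction field.
    have h2 : Module.IsTorsionFree R A := by
      refine Module.isTorsionFree_iff_smul_eq_zero.mpr fun r a h => ?_
      by_cases hr : r = 0
      · exact Or.inl hr
      · rw [Algebra.smul_def] at h
        exact Or.inr ((isUnit_algebraMap_of_ne_zero F hr).mul_right_eq_zero.mp h)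
    have : Module.IsTorsionFree R B := inferInstance
    exact RingHom.flat_algebraMap_iff.mpr inferInstance
  locallyOfFiniteType := by
    rw [HasRingHomProperty.Spec_iff (P := @LocallyOfFiniteType)]
    exact (RingHom.finiteType_algebraMap).mpr ((Subalgebra.fg_iff_finiteType B).mp hB.fg)
  quasiCompact := inferInstance

end Affine

/-! ### Existence of separated models -/

section Existence

variable {R F : Type u} [CommRing R] [IsDedekindDomain R] [Field F] [Algebra R F]
  [IsFractionRing R F] {X : Scheme.{u}} {sX : X ⟶ Spec (.of F)}

/-- Transport of a model along an equality of structure morphisms. -/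
def FlatModel.congr (M : FlatModel R sX) {sX' : X ⟶ Spec (.of F)} (h : sX = sX') :
    FlatModel R sX' where
  __ := M
  isPullback := h ▸ M.isPullback

/-- The generic fibre carries the induced topology, so each of its open subsets is the trace of an
open subset of the model. -/
theorem FlatModel.exists_restrict (M : FlatModel R sX) {O : Scheme.{u}} (i : O ⟶ X)
    [IsOpenImmersion i] {sO : O ⟶ Spec (.of F)} (h : i ≫ sX = sO) :
    ∃ (N : FlatModel R sO) (j : N.scheme ⟶ M.scheme), IsOpenImmersion j ∧
      j ≫ M.str = N.str ∧ N.gen ≫ j = i ≫ M.gen := by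
  subst h
  obtain ⟨K, hK, hKE⟩ := M.gen.isEmbedding.isInducing.isOpen_iff.mp i.opensRange.2
  let V : M.scheme.Opens := ⟨K, hK⟩
  let g : O ⟶ V.toScheme := IsOpenImmersion.lift V.ι (i ≫ M.gen) (by
    rintro _ ⟨x, rfl⟩
    rw [Scheme.Opens.range_ι, Scheme.Hom.comp_apply]
    change i x ∈ M.gen ⁻¹' K
    rw [hKE]
    exact ⟨x, rfl⟩)
  have H : IsPullback g i V.ι M.gen :=
    IsOpenImmersion.isPullback _ _ _ _ (IsOpenImmersion.lift_fac _ _ _).symm (by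
      ext x
      rw [Scheme.Opens.opensRange_ι]
      change x ∈ M.gen ⁻¹' K ↔ x ∈ i.opensRange.1
      rw [hKE])
  exact ⟨M.restrict V.ι H, V.ι, (inferInstance : IsOpenImmersion (Scheme.Opens.ι V)), rfl, H.w⟩

/-- Over `X₁ ∩ X₂` the two models restrict to separated models of the same scheme. These are
isomorphic near the generic fibre, and one glues along this isomorphism. The result need not be
separated, but it becomes so once finitely many closed fibres are discarded. -/
theorem FlatModel.exists_glue_of_separated [X.IsSeparated] {X₁ X₂ : Scheme.{u}} {j₁ : X₁ ⟶ X}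
    {j₂ : X₂ ⟶ X} [IsOpenImmersion j₁] [IsOpenImmersion j₂]
    (hj : ∀ x, x ∈ Set.range j₁ ∨ x ∈ Set.range j₂) (M₁ : FlatModel R (j₁ ≫ sX))
    (M₂ : FlatModel R (j₂ ≫ sX)) [M₁.scheme.IsSeparated] [M₂.scheme.IsSeparated] :
    ∃ M : FlatModel R sX, IsSeparated M.str := by
  obtain ⟨N₁, k₁, hk₁, hs₁, hg₁⟩ := M₁.exists_restrict (pullback.fst j₁ j₂) rfl
  obtain ⟨N₂, k₂, hk₂, hs₂, hg₂⟩ := M₂.exists_restrict (pullback.snd j₁ j₂)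
    (sO := pullback.fst j₁ j₂ ≫ j₁ ≫ sX)
    (by rw [← Category.assoc, ← Category.assoc, pullback.condition])
  have : N₁.scheme.IsSeparated := isSeparated_of_str k₁
  have : N₂.scheme.IsSeparated := isSeparated_of_str k₂
  obtain ⟨V, a₁, a₂, t, ha₁, ha₂, ht₁, ht₂, hs⟩ := N₁.exists_iso N₂
  obtain ⟨M, -⟩ := FlatModel.exists_glue hj M₁ M₂ (a₁ ≫ k₁) (a₂ ≫ k₂)
    (by rw [Category.assoc, Category.assoc, hs₁, hs₂, hs])
    ⟨t, by rw [reassoc_of% ht₁, hg₁], by rw [reassoc_of% ht₂, hg₂]⟩ (by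
      intro v x₁ x₂ h₁ h₂
      have hv : a₁ v ∈ Set.range N₁.gen := by
        rw [N₁.mem_range_gen]
        have : M₁.str (M₁.gen x₁) = genPt R := M₁.mem_range_gen.mp ⟨_, rfl⟩
        rw [← this, ← h₁, ← hs₁]
        rfl
      obtain ⟨o, ho⟩ := hv
      have hv : v = t o := by
        apply a₁.isOpenEmbedding.injective
        rw [← ho, ← ht₁, Scheme.Hom.comp_apply]
      subst hv
      have e₁ : pullback.fst j₁ j₂ o = x₁ := by
        apply M₁.gen.isEmbedding.injective
        rw [← h₁, ← Scheme.Hom.comp_apply, ← hg₁, ← ht₁]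
        simp only [Scheme.Hom.comp_apply]
      have e₂ : pullback.snd j₁ j₂ o = x₂ := by
        apply M₂.gen.isEmbedding.injective
        rw [← h₂, ← Scheme.Hom.comp_apply, ← hg₂, ← ht₂]
        simp only [Scheme.Hom.comp_apply]
      rw [← e₁, ← e₂, ← Scheme.Hom.comp_apply, ← Scheme.Hom.comp_apply, pullback.condition])
  obtain ⟨N, -, hN, -⟩ := M.exists_separated
  exact ⟨N, hN⟩

theorem exists_model_of_spec {A : Type u} [CommRing A] {X : Scheme.{u}} (sX : X ⟶ Spec (.of F))
    (e : X ≅ Spec (.of A)) [LocallyOfFiniteType sX] :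
    ∃ M : FlatModel R sX, M.scheme.IsSeparated := by
  obtain ⟨φ, hφ⟩ := Spec.map_surjective (e.inv ≫ sX)
  algebraize [φ.hom, φ.hom.comp (algebraMap R F)]
  have hft : Algebra.FiniteType F A := by
    have : LocallyOfFiniteType (Spec.map φ) := hφ ▸ inferInstance
    exact HasRingHomProperty.Spec_iff.mp this
  obtain ⟨s, hs⟩ := hft.out
  let M := affineModel R F _ (isOrder_adjoin (R := R) F s.finite_toSet hs)
  have hφ' : e.hom ≫ Spec.map (CommRingCat.ofHom (algebraMap F A)) = sX := by
    change e.hom ≫ Spec.map φ = sX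
    rw [hφ, e.hom_inv_id_assoc]
  exact ⟨(M.restrict (𝟙 _) (i := e.hom) (g := e.hom ≫ M.gen)
    (.of_vert_isIso ⟨by simp⟩)).congr hφ',
    (inferInstance : (Spec (.of _)).IsSeparated)⟩

variable (R sX) in
-- Induction over a finite affine cover: each affine open has a model given by an order, and these
-- are glued on one at a time.
theorem exists_separated_model [IsSeparated sX] [LocallyOfFiniteType sX] [QuasiCompact sX] :
    ∃ M : FlatModel R sX, IsSeparated M.str := by
  have : X.IsSeparated := isSeparated_of_str sX
  have hc : CompactSpace X := (quasiCompact_iff_compactSpace sX).mp inferInstance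
  have key : ∃ M : FlatModel R ((⊤ : X.Opens).ι ≫ sX), IsSeparated M.str := by
    refine compact_open_induction_on
      (P := fun U : X.Opens => ∃ M : FlatModel R (U.ι ≫ sX), IsSeparated M.str)
      (⊤ : X.Opens) isCompact_univ ?_ ?_
    · obtain ⟨M, hM⟩ := exists_model_of_spec (R := R) ((⊥ : X.Opens).ι ≫ sX)
        (isAffineOpen_bot X).isoSpec
      have : (⊥ : X.Opens).toScheme.IsSeparated := isSeparated_of_str (⊥ : X.Opens).ι
      obtain ⟨N, -, hN, -⟩ := M.exists_separated
      exact ⟨N, hN⟩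
    · intro U _ W ⟨M, hM⟩
      obtain ⟨M', hM'⟩ := exists_model_of_spec (R := R) (W.1.ι ≫ sX) W.2.isoSpec
      have : M.scheme.IsSeparated := isSeparated_of_str M.str
      have h₁ := X.homOfLE_ι (le_sup_left : U ≤ U ⊔ W.1)
      have h₂ := X.homOfLE_ι (le_sup_right : W.1 ≤ U ⊔ W.1)
      have : (U ⊔ W.1).toScheme.IsSeparated := isSeparated_of_str (U ⊔ W.1).ι
      let N := M.congr (sX' := X.homOfLE (le_sup_left : U ≤ U ⊔ W.1) ≫ (U ⊔ W.1).ι ≫ sX)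
        (by rw [← h₁, Category.assoc])
      let N' := M'.congr (sX' := X.homOfLE (le_sup_right : W.1 ≤ U ⊔ W.1) ≫ (U ⊔ W.1).ι ≫ sX)
        (by rw [← h₂, Category.assoc])
      have : N.scheme.IsSeparated := ‹M.scheme.IsSeparated›
      have : N'.scheme.IsSeparated := hM'
      refine FlatModel.exists_glue_of_separated ?_ N N'
      intro x
      obtain hx | hx : (U ⊔ W.1).ι x ∈ U ∨ (U ⊔ W.1).ι x ∈ W.1 := x.2
      · left
        obtain ⟨y, hy⟩ : ∃ y : U.toScheme, U.ι y = (U ⊔ W.1).ι x := ⟨⟨_, hx⟩, rfl⟩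
        refine ⟨y, (U ⊔ W.1).ι.isOpenEmbedding.injective ?_⟩
        rw [← hy, ← h₁, Scheme.Hom.comp_apply]
      · right
        obtain ⟨y, hy⟩ : ∃ y : W.1.toScheme, W.1.ι y = (U ⊔ W.1).ι x := ⟨⟨_, hx⟩, rfl⟩
        refine ⟨y, (U ⊔ W.1).ι.isOpenEmbedding.injective ?_⟩
        rw [← hy, ← h₂, Scheme.Hom.comp_apply]
  obtain ⟨M, hM⟩ := key
  refine ⟨(M.restrict (𝟙 _) (i := X.topIso.inv) (g := X.topIso.inv ≫ M.gen)
    (.of_vert_isIso ⟨by simp⟩)).congr (by simp), ?_⟩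
  change IsSeparated (𝟙 _ ≫ M.str)
  infer_instance

end Existence
end IntegralModels

/-! ### Modifying a model at finitely many closed points of the base -/

namespace IntegralModels

open Limits

section Step

variable {R F : Type u} [CommRing R] [IsDedekindDomain R] [Field F] [Algebra R F]
  [IsFractionRing R F] {X W W' : Scheme.{u}} {sX : X ⟶ Spec (.of F)} {sW : W ⟶ Spec (.of F)}
  {sW' : W' ⟶ Spec (.of F)}

/-- The models `Z` and `Y` become isomorphic, compatibly with the morphism `j` of generic fibres,
over a neighbourhood of the point `q` of the base, up to the generic fibre. -/
def AgreesAt (q : Spec (.of R)) (j : W ⟶ X) (Z : FlatModel R sW) (Y : FlatModel R sX) : Prop :=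
  ∃ (Ω : Scheme.{u}) (b : Ω ⟶ Z.scheme) (a : Ω ⟶ Y.scheme) (t : W ⟶ Ω), IsOpenImmersion b ∧
    IsOpenImmersion a ∧ b ≫ Z.str = a ≫ Y.str ∧ t ≫ b = Z.gen ∧ t ≫ a = j ≫ Y.gen ∧
    (∀ z, Z.str z = q → z ∈ Set.range b) ∧ ∀ y, Y.str y = q → y ∈ Set.range a

omit [IsDedekindDomain R] [IsFractionRing R F] in
theorem AgreesAt.refl (q : Spec (.of R)) (Y : FlatModel R sX) : AgreesAt q (𝟙 X) Y Y :=
  ⟨Y.scheme, 𝟙 _, 𝟙 _, Y.gen, inferInstance, inferInstance, rfl, by simp, by simp,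
    fun z _ => ⟨z, rfl⟩, fun z _ => ⟨z, rfl⟩⟩

omit [IsDedekindDomain R] [IsFractionRing R F] in
theorem AgreesAt.trans {q : Spec (.of R)} {j : W' ⟶ W} {k : W ⟶ X} {Z' : FlatModel R sW'}
    {Z : FlatModel R sW} {Y : FlatModel R sX} (h : AgreesAt q j Z' Z) (h' : AgreesAt q k Z Y) :
    AgreesAt q (j ≫ k) Z' Y := by
  obtain ⟨Ω, b, a, t, _, _, hs, htb, hta, hb, ha⟩ := h
  obtain ⟨Ω', b', a', t', _, _, hs', htb', hta', hb', ha'⟩ := h'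
  refine ⟨pullback a b', pullback.fst _ _ ≫ b, pullback.snd _ _ ≫ a',
    pullback.lift t (j ≫ t') (by rw [hta, Category.assoc, htb']), inferInstance, inferInstance,
    ?_, ?_, ?_, ?_, ?_⟩
  · rw [Category.assoc, Category.assoc, hs, ← hs', pullback.condition_assoc]
  · rw [pullback.lift_fst_assoc, htb]
  · rw [pullback.lift_snd_assoc, Category.assoc, hta', Category.assoc]
  · intro z hz
    obtain ⟨w, rfl⟩ := hb z hz
    have hw : Z.str (a w) = q := by
      rw [← hz, ← Scheme.Hom.comp_apply, ← hs, Scheme.Hom.comp_apply]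
    obtain ⟨w', hw'⟩ := hb' _ hw
    have : w ∈ Set.range (pullback.fst a b') := by
      rw [Scheme.Pullback.range_fst]; exact ⟨w', hw'⟩
    obtain ⟨o, rfl⟩ := this
    exact ⟨o, rfl⟩
  · intro y hy
    obtain ⟨w, rfl⟩ := ha' y hy
    have hw : Z.str (b' w) = q := by
      rw [← hy, ← Scheme.Hom.comp_apply, hs', Scheme.Hom.comp_apply]
    obtain ⟨w', hw'⟩ := ha _ hw
    have : w ∈ Set.range (pullback.snd a b') := by
      rw [Scheme.Pullback.range_snd]; exact ⟨w', hw'⟩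
    obtain ⟨o, rfl⟩ := this
    exact ⟨o, rfl⟩

theorem isClosed_singleton_of_ne_genPt {p : Spec (.of R)} (hp : p ≠ genPt R) :
    IsClosed ({p} : Set (Spec (.of R))) := by
  refine (PrimeSpectrum.isClosed_singleton_iff_isMaximal (R := R) p).mpr ?_
  exact Ring.DimensionLEOne.maximalOfPrime (fun h => hp (PrimeSpectrum.ext h)) p.isPrime

theorem finite_setOf_mem_asIdeal {r : R} (hr : r ≠ 0) :
    {p : Spec (.of R) | r ∈ p.asIdeal}.Finite := by
  have h := Ideal.finite_factors (R := R) (I := Ideal.span {r}) (by simpa using hr)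
  refine (h.image fun v => (⟨v.asIdeal, v.isPrime⟩ : PrimeSpectrum R)).subset ?_
  intro p hp
  refine ⟨⟨p.asIdeal, p.isPrime, fun h0 => hr ?_⟩, ?_, rfl⟩
  · have : r ∈ p.asIdeal := hp
    rwa [h0] at this
  · rw [Set.mem_ofPred_eq, Ideal.dvd_span_singleton]
    exact hp

theorem isClosed_of_finite {K : Set (Spec (.of R))} (hK : K.Finite) (hgen : genPt R ∉ K) :
    IsClosed K := by
  rw [← Set.biUnion_of_singleton K]
  exact hK.isClosed_biUnion fun p hp => isClosed_singleton_of_ne_genPt (by rintro rfl; exact hgen hp)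

/-- Removing finitely many closed fibres from a model. -/
theorem FlatModel.exists_compl (M : FlatModel R sX) {K : Set (Spec (.of R))} (hK : K.Finite)
    (hgen : genPt R ∉ K) :
    ∃ (N : FlatModel R sX) (j : N.scheme ⟶ M.scheme), IsOpenImmersion j ∧ j ≫ M.str = N.str ∧
      N.gen ≫ j = M.gen ∧ ∀ y, y ∈ Set.range j ↔ M.str y ∉ K := by
  let U : M.scheme.Opens := M.str ⁻¹ᵁ ⟨Kᶜ, (isClosed_of_finite hK hgen).isOpen_compl⟩
  have hgU : ∀ x, M.gen x ∈ U := by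
    intro x
    change M.str (M.gen x) ∉ K
    rwa [M.mem_range_gen.mp ⟨x, rfl⟩]
  let gU : X ⟶ U.toScheme := IsOpenImmersion.lift U.ι M.gen (by
    rintro _ ⟨x, rfl⟩; rw [Scheme.Opens.range_ι]; exact hgU x)
  have hg : gU ≫ U.ι = M.gen := IsOpenImmersion.lift_fac _ _ _
  have H : IsPullback gU (𝟙 X) U.ι M.gen := IsOpenImmersion.isPullback _ _ _ _ (by simp [hg]) (by
    ext x
    simpa using hgU x)
  refine ⟨(M.restrict U.ι H).congr (Category.id_comp _), U.ι,
    (inferInstance : IsOpenImmersion (Scheme.Opens.ι U)), rfl, hg, fun y => ?_⟩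
  change y ∈ Set.range U.ι ↔ _
  rw [Scheme.Opens.range_ι]
  rfl

/-- A morphism from the spectrum of a local ring factors through an open subscheme containing the
image of the closed point. -/
theorem exists_fac_of_closedPoint {A : Type u} [CommRing A] [IsLocalRing A] {X U : Scheme.{u}}
    (l : Spec (.of A) ⟶ X) (i : U ⟶ X) [IsOpenImmersion i]
    (h : l (IsLocalRing.closedPoint A) ∈ Set.range i) : ∃ l' : Spec (.of A) ⟶ U, l' ≫ i = l := by
  refine ⟨IsOpenImmersion.lift i l ?_, IsOpenImmersion.lift_fac _ _ _⟩
  rintro _ ⟨x, rfl⟩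
  have hs : x ⤳ IsLocalRing.closedPoint A := IsLocalRing.specializes_closedPoint (R := A) x
  exact (hs.map l.continuous).mem_open i.opensRange.2 h

/-- Separatedness is checked near the closed points of the base. -/
theorem isSeparated_of_forall_fibre {Y S : Scheme.{u}} (s : Y ⟶ S) [QuasiSeparated s]
    (h : ∀ q : S, ∃ (U : Scheme.{u}) (i : U ⟶ Y), IsOpenImmersion i ∧ IsSeparated (i ≫ s) ∧
      ∀ y, s y = q → y ∈ Set.range i) : IsSeparated s := by
  refine IsSeparated.of_valuativeCriterion s ?_
  have key (A : Type u) [CommRing A] [IsDomain A] [ValuationRing A] (K : Type u) [Field K]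
      [Algebra A K] [IsFractionRing A K] (i₂ : Spec (.of A) ⟶ S) (l₁ l₂ : Spec (.of A) ⟶ Y)
      (h₁ : l₁ ≫ s = i₂) (h₂ : l₂ ≫ s = i₂)
      (e : Spec.map (CommRingCat.ofHom (algebraMap A K)) ≫ l₁ =
        Spec.map (CommRingCat.ofHom (algebraMap A K)) ≫ l₂) : l₁ = l₂ := by
    -- Both lifts send the closed point into the fibre over `i₂ o`, so both factor through the same
    -- open `U`, which is separated over the base.
    let o : Spec (.of A) := IsLocalRing.closedPoint A
    obtain ⟨U, i, _, _, hi⟩ := h (i₂ o)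
    obtain ⟨m₁, rfl⟩ := exists_fac_of_closedPoint l₁ i (hi (l₁ o) (by rw [← h₁]; rfl))
    obtain ⟨m₂, rfl⟩ := exists_fac_of_closedPoint l₂ i (hi (l₂ o) (by rw [← h₂]; rfl))
    rw [Category.assoc] at h₁ h₂
    have sep := IsSeparated.valuativeCriterion (i ≫ s)
      ⟨A, K, Spec.map (CommRingCat.ofHom (algebraMap A K)) ≫ m₁, i₂, ⟨by rw [Category.assoc, h₁]⟩⟩
    have : Spec.map (CommRingCat.ofHom (algebraMap A K)) ≫ m₂ =
        Spec.map (CommRingCat.ofHom (algebraMap A K)) ≫ m₁ := by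
      rw [← cancel_mono i, Category.assoc, Category.assoc, e]
    have e' : m₁ = m₂ := congrArg CommSq.LiftStruct.l
      (sep.elim ⟨m₁, rfl, h₁⟩ ⟨m₂, this, h₂⟩)
    rw [e']
  rintro ⟨A, K, i₁, i₂, sq⟩
  refine ⟨?_⟩
  rintro ⟨l₁, h₁, h₁'⟩ ⟨l₂, h₂, h₂'⟩
  have := key A K i₂ l₁ l₂ h₁' h₂' (h₁.trans h₂.symm)
  subst this
  rfl

/-- A separated model can be modified at one place. -/
theorem FlatModel.exists_modification [X.IsSeparated] {p : Spec (.of R)} (hp : p ≠ genPt R)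
    (Y : FlatModel R sX) [IsSeparated Y.str] (j : W ⟶ X) [IsOpenImmersion j]
    (hj : j ≫ sX = sW) (Z : FlatModel R sW) [IsSeparated Z.str] :
    ∃ Y' : FlatModel R sX, IsSeparated Y'.str ∧ AgreesAt p j Z Y' ∧
      ∀ q, q ≠ p → AgreesAt q (𝟙 X) Y Y' := by
  subst hj
  have : Y.scheme.IsSeparated := isSeparated_of_str Y.str
  have : Z.scheme.IsSeparated := isSeparated_of_str Z.str
  obtain ⟨Yw, k, hk, hks, hkg⟩ := Y.exists_restrict j rfl
  have : Yw.scheme.IsSeparated := isSeparated_of_str k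
  obtain ⟨V, a₁, a₂, t, ha₁, ha₂, ht₁, ht₂, hs⟩ := Yw.exists_iso Z
  obtain ⟨r, hr, hrV⟩ := exists_ne_zero_of_range_subset Z.isPullback a₂.opensRange (by
    intro x
    rw [← ht₂]
    exact ⟨t x, rfl⟩)
  -- Where `r` is invertible, `Z` lies entirely in the overlap with `Y`. The fibres of `Z` over the
  -- other primes containing `r`, except `p`, are removed, and so is the fibre of `Y` over `p`.
  -- Gluing the remainders leaves `Z` over `p` and `Y` over all other primes.
  let K : Set (Spec (.of R)) := {q | r ∈ q.asIdeal} \ {p}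
  have hK : K.Finite := (finite_setOf_mem_asIdeal hr).subset Set.sdiff_subset
  have hgr : r ∉ (genPt R).asIdeal := hr
  have hKg : genPt R ∉ K := fun h => hgr h.1
  obtain ⟨Y₁, c, hc, hcs, hcg, hcr⟩ : ∃ (N : FlatModel R (𝟙 X ≫ sX)) (j : N.scheme ⟶ Y.scheme),
      IsOpenImmersion j ∧ j ≫ Y.str = N.str ∧ N.gen ≫ j = Y.gen ∧
        ∀ y, y ∈ Set.range j ↔ Y.str y ∉ ({p} : Set (Spec (.of R))) := by
    rw [Category.id_comp]
    exact Y.exists_compl (Set.finite_singleton p) (by simpa using hp.symm)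
  obtain ⟨Z', d, hd, hds, hdg, hdr⟩ := Z.exists_compl hK hKg
  let B : Set (Spec (.of R)) := insert p K
  have hB : B.Finite := hK.insert p
  have hBg : genPt R ∉ B := by
    rintro (h | h)
    · exact hp h.symm
    · exact hKg h
  let V' : V.Opens := (a₂ ≫ Z.str) ⁻¹ᵁ ⟨Bᶜ, (isClosed_of_finite hB hBg).isOpen_compl⟩
  have hV' : ∀ v : V'.toScheme, Z.str (a₂ (V'.ι v)) ∉ B := fun v => v.2
  have hV'' : ∀ v, Z.str (a₂ v) ∉ B → v ∈ Set.range V'.ι := by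
    intro v hv
    rw [Scheme.Opens.range_ι]
    exact hv
  have hsv : ∀ v, Yw.str (a₁ v) = Z.str (a₂ v) := by
    intro v
    rw [← Scheme.Hom.comp_apply, hs, Scheme.Hom.comp_apply]
  have hkv : ∀ v, Y.str (k v) = Yw.str v := by
    intro v
    rw [← hks, Scheme.Hom.comp_apply]
  let b₁ : V'.toScheme ⟶ Y₁.scheme := IsOpenImmersion.lift c (V'.ι ≫ a₁ ≫ k) (by
    rintro _ ⟨v, rfl⟩
    rw [hcr]
    simp only [Scheme.Hom.comp_apply]
    rw [hkv, hsv]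
    exact fun h => hV' v (Or.inl h))
  have hb₁ : b₁ ≫ c = V'.ι ≫ a₁ ≫ k := IsOpenImmersion.lift_fac _ _ _
  let b₂ : V'.toScheme ⟶ Z'.scheme := IsOpenImmersion.lift d (V'.ι ≫ a₂) (by
    rintro _ ⟨v, rfl⟩
    rw [hdr]
    simp only [Scheme.Hom.comp_apply]
    exact fun h => hV' v (Or.inr h))
  have hb₂ : b₂ ≫ d = V'.ι ≫ a₂ := IsOpenImmersion.lift_fac _ _ _
  have : IsOpenImmersion b₁ := by
    have : IsOpenImmersion (b₁ ≫ c) := by rw [hb₁]; infer_instance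
    exact IsOpenImmersion.of_comp b₁ c
  have : IsOpenImmersion b₂ := by
    have : IsOpenImmersion (b₂ ≫ d) := by rw [hb₂]; infer_instance
    exact IsOpenImmersion.of_comp b₂ d
  let t' : W ⟶ V'.toScheme := IsOpenImmersion.lift V'.ι t (by
    rintro _ ⟨w, rfl⟩
    refine hV'' _ ?_
    rw [← Scheme.Hom.comp_apply t, ht₂, Z.mem_range_gen.mp ⟨w, rfl⟩]
    exact hBg)
  have ht' : t' ≫ V'.ι = t := IsOpenImmersion.lift_fac _ _ _
  have ht₁' : t' ≫ b₁ = j ≫ Y₁.gen := by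
    rw [← cancel_mono c, Category.assoc, Category.assoc, hb₁, reassoc_of% ht', reassoc_of% ht₁,
      hkg, hcg]
  have ht₂' : t' ≫ b₂ = Z'.gen := by
    rw [← cancel_mono d, Category.assoc, hb₂, reassoc_of% ht', ht₂, hdg]
  obtain ⟨M, i₁, i₂, hi₁, hi₂, his₁, his₂, hig₁, hig₂, hbi, hcov, hint⟩ :=
    FlatModel.exists_glue (sX := sX) (j₁ := 𝟙 X) (j₂ := j) (fun x => Or.inl ⟨x, rfl⟩)
    Y₁ Z' b₁ b₂
    (by
      rw [← hcs, ← hds, reassoc_of% hb₁, reassoc_of% hb₂, hks, hs])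
    ⟨pullback.snd (𝟙 X) j ≫ t', by
      rw [Category.assoc, ht₁', ← pullback.condition_assoc, Category.id_comp Y₁.gen], by rw [Category.assoc, ht₂']⟩
    (by
      intro v x₁ x₂ h₁ h₂
      have hv : b₂ v = (t' ≫ b₂) x₂ := by rw [h₂, ht₂']
      have hv : v = t' x₂ := b₂.isOpenEmbedding.injective hv
      subst hv
      apply Y₁.gen.isEmbedding.injective
      change Y₁.gen x₁ = _
      rw [← h₁, ← Scheme.Hom.comp_apply, ht₁', Scheme.Hom.comp_apply])
  have hig₁ : M.gen = Y₁.gen ≫ i₁ := (Category.id_comp _).symm.trans hig₁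
  -- A point of `Z'` which is not over `p` lies over the complement of `B`, where all of `Z` belongs
  -- to the overlap. Thus `Z'` contributes nothing new away from `p`, and separatedness can be
  -- tested on `Y₁` and on `Z'` alone.
  have hY : ∀ y, M.str y ≠ p → y ∈ Set.range i₁ := by
    intro y hy
    rcases hcov y with h | ⟨z, rfl⟩
    · exact h
    · have hz : Z.str (d z) = M.str (i₂ z) := by
        rw [← Scheme.Hom.comp_apply, ← Scheme.Hom.comp_apply, hds, his₂]
      have hdz : Z.str (d z) ∉ K := (hdr _).mp ⟨z, rfl⟩
      have hB : Z.str (d z) ∉ B := by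
        rintro (h | h)
        · exact hy (hz ▸ h)
        · exact hdz h
      obtain ⟨v, hv⟩ := hrV (d z) (fun h => hdz ⟨h, fun h' => hB (Or.inl h')⟩)
      obtain ⟨v', rfl⟩ := hV'' v (by rw [hv]; exact hB)
      have : b₂ v' = z := by
        apply d.isOpenEmbedding.injective
        rw [← hv, ← Scheme.Hom.comp_apply, hb₂, Scheme.Hom.comp_apply]
      refine ⟨b₁ v', ?_⟩
      rw [← this]
      change (b₁ ≫ i₁) v' = (b₂ ≫ i₂) v'
      rw [hbi]
  have hZ : ∀ y, M.str y = p → y ∈ Set.range i₂ := by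
    intro y hy
    rcases hcov y with ⟨z, rfl⟩ | h
    · exfalso
      have h1 : Y.str (c z) ∉ ({p} : Set _) := (hcr _).mp ⟨z, rfl⟩
      apply h1
      rw [← Scheme.Hom.comp_apply, hcs, ← his₁]
      exact hy
    · exact h
  have : IsSeparated Y₁.str := by rw [← hcs]; infer_instance
  have : IsSeparated Z'.str := by rw [← hds]; infer_instance
  refine ⟨M, ?_, ?_, ?_⟩
  · refine isSeparated_of_forall_fibre M.str fun q => ?_
    by_cases hq : q = p
    · exact ⟨_, i₂, hi₂, by rw [his₂]; infer_instance, fun y hy => hZ y (hy.trans hq)⟩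
    · exact ⟨Y₁.scheme, i₁, hi₁, by rw [his₁]; infer_instance, fun y hy => hY y (hy ▸ hq)⟩
  · exact ⟨_, d, i₂, Z'.gen, hd, hi₂, by rw [hds, his₂], hdg, hig₂.symm,
      fun z hz => (hdr z).mpr fun h => h.2 hz, hZ⟩
  · intro q hq
    exact ⟨_, c, i₁, Y₁.gen, hc, hi₁, by rw [hcs, his₁], hcg, hig₁.symm.trans (Category.id_comp _).symm,
      fun z hz => (hcr z).mpr fun h => hq (hz ▸ h), fun y hy => hY y (hy ▸ hq)⟩

/-- A separated model can be modified at finitely many places. -/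
theorem FlatModel.exists_modifications [X.IsSeparated] (Y : FlatModel R sX) [IsSeparated Y.str]
    {Q : Set (Spec (.of R))} (hQ : Q.Finite) (hgen : genPt R ∉ Q)
    {W : Spec (.of R) → Scheme.{u}} (j : ∀ q, W q ⟶ X) [∀ q, IsOpenImmersion (j q)]
    (Z : ∀ q, FlatModel R (j q ≫ sX)) (hZ : ∀ q, IsSeparated (Z q).str) :
    ∃ Y' : FlatModel R sX, IsSeparated Y'.str ∧ (∀ q ∈ Q, AgreesAt q (j q) (Z q) Y') ∧
      ∀ q ∉ Q, AgreesAt q (𝟙 X) Y Y' := by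
  induction Q, hQ using Set.Finite.induction_on with
  | empty => exact ⟨Y, inferInstance, by simp, fun q _ => .refl q Y⟩
  | @insert p Q hpQ hQ ih =>
    obtain ⟨Y', hY', h₁, h₂⟩ := ih fun h => hgen (Or.inr h)
    obtain ⟨Y'', hY'', h₃, h₄⟩ := Y'.exists_modification (p := p)
      (by rintro rfl; exact hgen (Or.inl rfl)) (j p) rfl (Z p)
    refine ⟨Y'', hY'', ?_, ?_⟩
    · rintro q (rfl | hq)
      · exact h₃
      · have := (h₁ q hq).trans (h₄ q (by rintro rfl; exact hpQ hq))
        rwa [Category.comp_id] at this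
    · intro q hq
      have := (h₂ q fun h => hq (Or.inr h)).trans (h₄ q (by rintro rfl; exact hq (Or.inl rfl)))
      rwa [Category.comp_id] at this

end Step
end IntegralModels

/-! ### Integral points of models -/

namespace IntegralModels

open Limits

/-- The closed point of the spectrum of a local ring. -/
def closedPt (A : Type u) [CommRing A] [IsLocalRing A] : Spec (.of A) :=
  IsLocalRing.closedPoint A

theorem specMap_comp_specMap {A B C : Type u} [CommRing A] [CommRing B] [CommRing C] (f : A →+* B)
    (g : B →+* C) : Spec.map (CommRingCat.ofHom g) ≫ Spec.map (CommRingCat.ofHom f) =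
      Spec.map (CommRingCat.ofHom (g.comp f)) :=
  (Spec.map_comp _ _).symm

section IntegralPt

variable {R F : Type u} [CommRing R] [Field F] [Algebra R F] {X W : Scheme.{u}}
  {sX : X ⟶ Spec (.of F)} {sW : W ⟶ Spec (.of F)}

/-- A `K`-point of `X` extends to an `A`-point of the model `M`. -/
def IsIntegralPt (M : FlatModel R sX) {A K : Type u} [CommRing A] [CommRing K] (ρ : R →+* A)
    (ι : A →+* K) (z : Spec (.of K) ⟶ X) : Prop :=
  ∃ w : Spec (.of A) ⟶ M.scheme, w ≫ M.str = Spec.map (CommRingCat.ofHom ρ) ∧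
    Spec.map (CommRingCat.ofHom ι) ≫ w = z ≫ M.gen

/-- A morphism from the spectrum of a local ring factors through any open set containing the image
of the closed point. So an `A`-point with closed point over `q` sees only the neighbourhood on which
the two models are identified. -/
theorem isIntegralPt_iff_of_agreesAt {q : Spec (.of R)} {j : W ⟶ X} {Z : FlatModel R sW}
    {Y : FlatModel R sX} (h : AgreesAt q j Z Y) (hj : j ≫ sX = sW) {A K : Type u} [CommRing A]
    [IsLocalRing A] [CommRing K] {ρ : R →+* A} {ι : A →+* K}
    (hq : Spec.map (CommRingCat.ofHom ρ) (closedPt A) = q)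
    {z : Spec (.of K) ⟶ X} :
    IsIntegralPt Y ρ ι z ↔ ∃ z' : Spec (.of K) ⟶ W, z' ≫ j = z ∧ IsIntegralPt Z ρ ι z' := by
  obtain ⟨Ω, b, a, t, _, _, hs, htb, hta, hb, ha⟩ := h
  constructor
  · rintro ⟨w, hw, hwz⟩
    obtain ⟨w', rfl⟩ := exists_fac_of_closedPoint w a (ha (w (closedPt A)) (by
      rw [← hq, ← hw, Scheme.Hom.comp_apply]))
    let z' : Spec (.of K) ⟶ W := Z.isPullback.lift (Spec.map (CommRingCat.ofHom ι) ≫ w' ≫ b)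
      (z ≫ sX) (by
        rw [Category.assoc, Category.assoc, hs, ← Category.assoc w', ← Category.assoc, hwz,
          Category.assoc, Category.assoc, Y.isPullback.w])
    have h1 : z' ≫ Z.gen = Spec.map (CommRingCat.ofHom ι) ≫ w' ≫ b := Z.isPullback.lift_fst _ _ _
    have h2 : z' ≫ sW = z ≫ sX := Z.isPullback.lift_snd _ _ _
    have h3 : z' ≫ t = Spec.map (CommRingCat.ofHom ι) ≫ w' := by
      rw [← cancel_mono b, Category.assoc, htb, h1, Category.assoc]
    refine ⟨z', Y.isPullback.hom_ext ?_ ?_, w' ≫ b, ?_, h1.symm⟩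
    · rw [Category.assoc, ← hta, reassoc_of% h3, hwz]
    · rw [Category.assoc, hj, h2]
    · rw [← hw, Category.assoc, Category.assoc, hs]
  · rintro ⟨z', rfl, w, hw, hwz⟩
    obtain ⟨w', rfl⟩ := exists_fac_of_closedPoint w b (hb (w (closedPt A)) (by
      rw [← hq, ← hw, Scheme.Hom.comp_apply]))
    refine ⟨w' ≫ a, ?_, ?_⟩
    · rw [← hw, Category.assoc, Category.assoc, hs]
    · have h3 : Spec.map (CommRingCat.ofHom ι) ≫ w' = z' ≫ t := by
        rw [← cancel_mono b, Category.assoc, hwz, Category.assoc, htb]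
      rw [reassoc_of% h3, hta, Category.assoc]

theorem exists_lift_of_forall_mem {B A K : Type u} [CommRing A] [CommRing B] [CommRing K] {ι : A →+* K}
    (hι : Function.Injective ι) (f : B →+* K) (h : ∀ b, f b ∈ ι.range) :
    ∃ g : B →+* A, ι.comp g = f := by
  let e : A ≃+* ι.range := RingEquiv.ofBijective ι.rangeRestrict
    ⟨fun x y h => hι (congrArg Subtype.val h), ι.rangeRestrict_surjective⟩
  refine ⟨e.symm.toRingHom.comp (f.codRestrict ι.range h), RingHom.ext fun b => ?_⟩
  exact congrArg Subtype.val (e.apply_symm_apply (f.codRestrict ι.range h b))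

/-- Integrality may be tested on generators of the order. For `A = 𝒪_v` the integral points
therefore form a polydisc in the coordinates `s`. -/
theorem isIntegralPt_affineModel [IsDedekindDomain R] [IsFractionRing R F] {C : Type u} [CommRing C]
    [Algebra F C] [Algebra R C] [IsScalarTower R F C] {s : Set C}
    (hB : IsOrder (Algebra.adjoin R s)) {A K : Type u} [CommRing A] [CommRing K] {ρ : R →+* A}
    {ι : A →+* K} (hι : Function.Injective ι) {φ : C →+* K}
    (hφ : φ.comp (algebraMap R C) = ι.comp ρ) :
    IsIntegralPt (affineModel R F _ hB) ρ ι (Spec.map (CommRingCat.ofHom φ)) ↔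
      ∀ x ∈ s, φ x ∈ ι.range := by
  constructor
  · rintro ⟨w, -, hw⟩ x hx
    obtain ⟨ψ, rfl⟩ := Spec.map_surjective w
    change Spec.map _ ≫ Spec.map _ = Spec.map _ ≫ Spec.map (CommRingCat.ofHom (algebraMap _ C)) at hw
    rw [← Spec.map_comp, ← Spec.map_comp] at hw
    have h := congrArg (fun f => f.hom ⟨x, Algebra.subset_adjoin hx⟩) (Spec.map_injective hw)
    exact ⟨_, h⟩
  · intro h
    obtain ⟨g, hg⟩ := exists_lift_of_forall_mem hι (φ.comp (algebraMap (Algebra.adjoin R s) C)) (by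
      rintro ⟨b, hb⟩
      change φ b ∈ _
      induction hb using Algebra.adjoin_induction with
      | mem x hx => exact h x hx
      | algebraMap r => exact ⟨ρ r, (congrArg (fun f => f r) hφ).symm⟩
      | add x y _ _ hx hy => rw [map_add]; exact add_mem hx hy
      | mul x y _ _ hx hy => rw [map_mul]; exact mul_mem hx hy)
    refine ⟨Spec.map (CommRingCat.ofHom g), ?_, ?_⟩
    · refine (specMap_comp_specMap (algebraMap R (Algebra.adjoin R s)) g).trans ?_
      have : g.comp (algebraMap R (Algebra.adjoin R s)) = ρ := by
        ext r
        apply hι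
        have h1 := congrArg (fun f => f (algebraMap R (Algebra.adjoin R s) r)) hg
        exact h1.trans (congrArg (fun f => f r) hφ)
      rw [this]
    · refine (specMap_comp_specMap g ι).trans (Eq.trans ?_ (specMap_comp_specMap
        (algebraMap (Algebra.adjoin R s) C) φ).symm)
      rw [hg]

end IntegralPt

section Value

theorem valueAt_specMap_comp {X : Scheme.{u}} {A K : Type u} [CommRing A] [CommRing K]
    (φ : A →+* K) (j : Spec (.of A) ⟶ X) {U : X.Opens}
    (h : ⊤ ≤ (Spec.map (CommRingCat.ofHom φ) ≫ j) ⁻¹ᵁ U) (h' : ⊤ ≤ j ⁻¹ᵁ U) (s : Γ(X, U)) :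
    valueAt (Spec.map (CommRingCat.ofHom φ) ≫ j) h s =
      φ ((Scheme.ΓSpecIso (.of A)).hom (j.appLE U ⊤ h' s)) := by
  have h1 := Scheme.Hom.appLE_comp_appLE (Spec.map (CommRingCat.ofHom φ)) j U ⊤ ⊤ h' le_top
  have h2 := Scheme.ΓSpecIso_naturality (CommRingCat.ofHom φ)
  have h4 : (Spec.map (CommRingCat.ofHom φ)).appLE ⊤ ⊤ le_top =
      (Spec.map (CommRingCat.ofHom φ)).appTop := Scheme.Hom.appLE_eq_app _
  rw [valueAt, ← h1, h4]
  exact congrArg (fun f => f.hom (j.appLE U ⊤ h' s)) h2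

variable {F : Type u} [Field F]

/-- The open sets of local points defined by a chart. -/
theorem isOpen_chart {X : Over (Spec (.of F))} {v : FinPlace F} {A : Type u} [CommRing A]
    (j : Spec (.of A) ⟶ X.left) [IsOpenImmersion j] (a : A) {V : Set v.completion} (hV : IsOpen V) :
    IsOpen {z : LocalPoints X v | ∃ φ : A →+* v.completion,
      Spec.map (CommRingCat.ofHom φ) ≫ j = CommaMorphism.left z ∧ φ a ∈ V} := by
  have hle : (⊤ : (Spec (.of A)).Opens) ≤ j ⁻¹ᵁ j.opensRange := fun x _ => ⟨x, rfl⟩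
  have hbij : Function.Surjective (j.appLE j.opensRange ⊤ hle) := by
    have : IsIso (j.appLE j.opensRange ⊤ hle) := by
      have e : (⊤ : (Spec (.of A)).Opens) = j ⁻¹ᵁ j.opensRange := by ext x; simp
      have : IsIso (j.app j.opensRange) := j.isIso_app _ le_rfl
      rw [Scheme.Hom.appLE]
      have : IsIso ((Spec (.of A)).presheaf.map (homOfLE hle).op) := by
        have : IsIso (homOfLE hle) := ⟨homOfLE e.ge, rfl, rfl⟩
        infer_instance
      infer_instance
    exact (ConcreteCategory.bijective_of_isIso (j.appLE j.opensRange ⊤ hle)).2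
  obtain ⟨s, hs⟩ := hbij ((Scheme.ΓSpecIso (.of A)).inv a)
  have hs' : (Scheme.ΓSpecIso (.of A)).hom (j.appLE j.opensRange ⊤ hle s) = a := by
    rw [hs]
    exact congrArg (fun f => f.hom a) (Scheme.ΓSpecIso (.of A)).inv_hom_id
  refine TopologicalSpace.isOpen_generateFrom_of_mem
    ⟨j.opensRange, isAffineOpen_opensRange j, s, V, hV, ?_⟩
  ext z
  constructor
  · rintro ⟨φ, hφ, ha⟩
    have h : ⊤ ≤ (CommaMorphism.left z) ⁻¹ᵁ j.opensRange := by
      rw [← hφ]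
      rintro x -
      exact ⟨Spec.map (CommRingCat.ofHom φ) x, rfl⟩
    refine ⟨h, ?_⟩
    have h2 : ∀ (y : Spec (.of v.completion) ⟶ X.left) (hy : y = Spec.map (CommRingCat.ofHom φ) ≫ j)
        (h : ⊤ ≤ y ⁻¹ᵁ j.opensRange), valueAt y h s = φ a := by
      rintro y rfl h
      rw [valueAt_specMap_comp φ j h hle s, hs']
    rw [h2 _ hφ.symm h]
    exact ha
  · rintro ⟨h, hv⟩
    let z' : Spec (.of v.completion) ⟶ Spec (.of A) := IsOpenImmersion.lift j (CommaMorphism.left z)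
      (by rintro _ ⟨x, rfl⟩; exact h (Set.mem_univ x))
    have hz' : z' ≫ j = CommaMorphism.left z := IsOpenImmersion.lift_fac _ _ _
    obtain ⟨φ, hφ⟩ := Spec.map_surjective z'
    have hφ' : Spec.map (CommRingCat.ofHom φ.hom) ≫ j = CommaMorphism.left z := by
      rw [← hz', ← hφ]; rfl
    refine ⟨φ.hom, hφ', ?_⟩
    have h2 : ∀ (y : Spec (.of v.completion) ⟶ X.left)
        (hy : y = Spec.map (CommRingCat.ofHom φ.hom) ≫ j)
        (h : ⊤ ≤ y ⁻¹ᵁ j.opensRange), valueAt y h s = φ.hom a := by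
      rintro y rfl h
      rw [valueAt_specMap_comp φ.hom j h hle s, hs']
    rw [← h2 _ hφ'.symm h]
    exact hv

end Value
end IntegralModels

/-! ### Local fields, comparison of integral points, openness -/

namespace IntegralModels

open Limits Topology

section Valuation

variable {F : Type u} [Field F] (v : FinPlace F)

namespace FinPlace

theorem isOpen_integers : IsOpen (v.integers : Set v.completion) := by
  have := v.isDVR
  exact Valued.isOpen_valuationSubring v.completion

theorem denseRange_algebraMap : DenseRange (algebraMap F v.completion) := by
  have := v.isDVR
  exact HeightOneSpectrum.denseRange_algebraMap F v.prime

theorem exists_uniformizer : ∃ π : F, π ≠ 0 ∧ π ∈ v.ring ∧ π⁻¹ ∉ v.ring := by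
  have := v.isDVR
  obtain ⟨π, hπ⟩ := IsDiscreteValuationRing.exists_irreducible v.ring
  have h0 : (π : F) ≠ 0 := fun h => hπ.ne_zero (Subtype.ext h)
  refine ⟨π, h0, π.2, fun h => hπ.not_isUnit ?_⟩
  exact IsUnit.of_mul_eq_one ⟨_, h⟩ (Subtype.ext (mul_inv_cancel₀ h0))

theorem valued_lt_one {π : F} (h : π ∈ v.ring) (h' : π⁻¹ ∉ v.ring) :
    letI := v.isDVR
    Valued.v (algebraMap F v.completion π) < 1 := by
  let _ := v.isDVR
  have h1 : (⟨π, h⟩ : v.ring) ∈ v.prime.asIdeal := by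
    change _ ∈ IsLocalRing.maximalIdeal v.ring
    rw [IsLocalRing.mem_maximalIdeal, mem_nonunits_iff]
    rintro ⟨y, hy⟩
    apply h'
    have hy' : ((y : v.ring) : F) = π := congrArg Subtype.val hy
    have h2 : (((y⁻¹ : v.ringˣ) : v.ring) : F) * π = 1 := by
      rw [← hy', ← v.ring.coe_mul]; simp
    rw [← eq_inv_of_mul_eq_one_left h2]
    exact Subtype.mem _
  have h2 := (v.prime.valuation_lt_one_iff_mem (K := F) ⟨π, h⟩).mpr h1
  have h3 := v.prime.valuedAdicCompletion_eq_valuation' (K := F) π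
  exact (le_of_eq h3).trans_lt h2

theorem mem_ring_iff {x : F} : x ∈ v.ring ↔ algebraMap F v.completion x ∈ v.integers := by
  refine ⟨v.algebraMap_mem_integers, fun h => ?_⟩
  by_contra hx
  let _ := v.isDVR
  have h1 := v.valued_lt_one (π := x⁻¹) ((v.ring.mem_or_inv_mem x).resolve_left hx)
    (by rwa [inv_inv])
  rw [map_inv₀, map_inv₀] at h1
  have h0 : Valued.v (algebraMap F v.completion x) ≠ 0 := by
    rw [Ne, map_eq_zero, map_eq_zero]
    rintro rfl
    exact hx (zero_mem _)
  have h2 : Valued.v (algebraMap F v.completion x) ≤ 1 := h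
  have h3 := mul_lt_mul'' h1 (lt_of_le_of_ne h2 ?_) zero_le zero_le
  · rw [inv_mul_cancel₀ h0, one_mul] at h3
    exact lt_irrefl _ h3
  · intro h4
    rw [h4, inv_one] at h1
    exact lt_irrefl _ h1

/-- A neighbourhood of `x` contains `x + π ^ N 𝒪_v` for all large `N`. -/
theorem exists_pow_of_mem_nhds {π : F} (h : π ∈ v.ring) (h' : π⁻¹ ∉ v.ring) {x : v.completion}
    {Ω : Set v.completion} (hΩ : Ω ∈ 𝓝 x) :
    ∃ N₀ : ℕ, ∀ N ≥ N₀, ∀ o ∈ v.integers, x + algebraMap F v.completion π ^ N * o ∈ Ω := by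
  let _ := v.isDVR
  obtain ⟨γ, hγ⟩ := Valued.mem_nhds.mp hΩ
  have hlt := v.valued_lt_one h h'
  obtain ⟨N₀, hN₀⟩ := exists_pow_lt₀ hlt
    (Units.mk0 (MonoidWithZeroHom.ValueGroup₀.embedding (γ : MonoidWithZeroHom.ValueGroup₀ _)) (by
      rw [Ne, map_eq_zero]; exact γ.ne_zero))
  refine ⟨N₀, fun N hN o ho => hγ ?_⟩
  rw [Set.mem_ofPred_eq, Valuation.restrict_lt_iff_lt_embedding, add_sub_cancel_left, map_mul,
    map_pow]
  refine lt_of_le_of_lt ?_ hN₀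
  have ho' : Valued.v o ≤ 1 := ho
  calc _ ≤ Valued.v (algebraMap F v.completion π) ^ N * 1 := mul_le_mul_right ho' _
    _ ≤ _ := by rw [mul_one]; exact pow_le_pow_right_of_le_one' hlt.le hN

/-- The condition on `b` is open and non-empty, and `F` is dense in `F_v`. -/
theorem exists_approx (x : v.completion) {c : F} (hc : c ≠ 0) :
    ∃ b : F, (x - algebraMap F v.completion b) / algebraMap F v.completion c ∈ v.integers := by
  have hc' : algebraMap F v.completion c ≠ 0 := by simpa using hc
  have hopen : IsOpen {y : v.completion |
      (x - y) / algebraMap F v.completion c ∈ (v.integers : Set v.completion)} := by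
    refine v.isOpen_integers.preimage (f := fun y => (x - y) / algebraMap F v.completion c) ?_
    let _ := v.isDVR
    fun_prop
  obtain ⟨y, hy, b, rfl⟩ := v.denseRange_algebraMap.inter_open_nonempty _ hopen
    ⟨x, by simp⟩
  exact ⟨b, hy⟩

end FinPlace
end Valuation

section Compare

variable {R R' F : Type u} [CommRing R] [IsDomain R] [IsNoetherianRing R] [CommRing R'] [Field F]
  [Algebra R F] [IsFractionRing R F] [Algebra R' F] [Algebra R' R] [IsScalarTower R' R F]
  {X W : Scheme.{u}} {sX : X ⟶ Spec (.of F)} {sW : W ⟶ Spec (.of F)}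

/-- Outside finitely many places, integral points of `Z` are integral for `Y`. -/
theorem exists_isIntegralPt_of_isIntegralPt (Z : FlatModel R sW) (Y : FlatModel R' sX)
    [Y.scheme.IsSeparated] {j : W ⟶ X} (hj : j ≫ sX = sW) :
    ∃ r : R, r ≠ 0 ∧ ∀ {A K : Type u} [CommRing A] [IsLocalRing A] [CommRing K] {ρ : R →+* A}
      {ρ' : R' →+* A} {ι : A →+* K} {z : Spec (.of K) ⟶ W}, ρ.comp (algebraMap R' R) = ρ' →
      IsUnit (ρ r) → IsIntegralPt Z ρ ι z → IsIntegralPt Y ρ' ι (z ≫ j) := by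
  have := Z.locallyOfFiniteType_generic
  have := isLocallyNoetherian_over_field sW
  -- `Z` is viewed over the smaller base `R'`, over which `Y` lives, so that `j` extends to a
  -- morphism into `Y` near the generic fibre of `Z`.
  let s : Z.scheme ⟶ Spec (.of R') := Z.str ≫ Spec.map (CommRingCat.ofHom (algebraMap R' R))
  have hφ : (j ≫ Y.gen) ≫ Y.str = Z.gen ≫ s := by
    rw [Category.assoc, Y.isPullback.w, reassoc_of% hj, ← Category.assoc Z.gen, Z.isPullback.w,
      Category.assoc]
    congr 1
    refine Eq.trans ?_ (specMap_comp_specMap _ _).symm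
    rw [← IsScalarTower.algebraMap_eq]
  obtain ⟨U, hU, ψ, hψ⟩ := exists_isExt_generic Z.isPullback hφ
  obtain ⟨r, hr, hrU⟩ := exists_ne_zero_of_range_subset Z.isPullback U hU
  refine ⟨r, hr, ?_⟩
  rintro A K _ _ _ ρ ρ' ι z rfl hu ⟨w, hw, hwz⟩
  have hψs : ψ ≫ Y.str = U.ι ≫ s := by
    refine hom_ext_of_generic (isPullback_shrink Z.isPullback U.ι) ?_
    rw [← Category.assoc, hψ _ _ pullback.condition, Category.assoc, hφ, pullback.condition_assoc]
  -- If `r` becomes a unit in `A`, the closed point lies over the locus where `r` does not vanish,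
  -- and there the fibres of `Z` are contained in `U`.
  obtain ⟨w', rfl⟩ := exists_fac_of_closedPoint w U.ι (by
    rw [Scheme.Opens.range_ι]
    refine hrU (w (closedPt A)) ?_
    have : Z.str (w (closedPt A)) = Spec.map (CommRingCat.ofHom ρ) (closedPt A) := by
      rw [← hw, Scheme.Hom.comp_apply]
    rw [this]
    intro h
    exact (IsLocalRing.mem_maximalIdeal _).mp h hu)
  refine ⟨w' ≫ ψ, ?_, ?_⟩
  · rw [Category.assoc, hψs]
    rw [Category.assoc] at hw
    simp only [s]
    rw [reassoc_of% hw]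
    exact specMap_comp_specMap _ _
  · rw [← Category.assoc, hψ _ z (by rw [Category.assoc]; exact hwz), Category.assoc]

end Compare

section Local

variable {F : Type u} [Field F] {v : FinPlace F} {X : Over (Spec (.of F))}

/-- The morphism underlying a local point. -/
def LocalPoints.pt (z : LocalPoints X v) : Spec (.of v.completion) ⟶ X.left :=
  CommaMorphism.left z

theorem LocalPoints.pt_comp_hom (z : LocalPoints X v) :
    z.pt ≫ X.hom = Spec.map (CommRingCat.ofHom (algebraMap F v.completion)) :=
  Over.w z

variable {R : Type u} [CommRing R] [Algebra R F]

/-- The set of integral points of a model is open. -/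
theorem isOpen_setOf_isIntegralPt (M : FlatModel R X.hom) {ρ : R →+* v.integers}
    (hρ : v.integers.subtype.comp ρ = (algebraMap F v.completion).comp (algebraMap R F)) :
    IsOpen {z : LocalPoints X v |
      IsIntegralPt M ρ v.integers.subtype z.pt} := by
  have hι : Function.Injective v.integers.subtype := Subtype.val_injective
  rw [isOpen_iff_forall_mem_open]
  rintro z ⟨w, hw, hwz⟩
  -- An affine neighbourhood `N` of the image of the closed point contains the whole integral point.
  -- On the generic part of `N` it suffices for integrality that finitely many generators of the
  -- functions on `N` take values in `𝒪_v`. This is an open condition, as `𝒪_v` is open.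
  obtain ⟨_, ⟨N, hN, rfl⟩, hNw, -⟩ := M.scheme.isBasis_affineOpens.exists_subset_of_mem_open
    (Set.mem_univ (w (closedPt v.integers))) isOpen_univ
  have hN : IsAffineOpen N := hN
  have : IsAffineHom M.gen := MorphismProperty.of_isPullback (P := @IsAffineHom) M.isPullback.flip
    (by unfold genMap; infer_instance)
  have hW : IsAffineOpen (M.gen ⁻¹ᵁ N) := hN.preimage M.gen
  obtain ⟨w', rfl⟩ := exists_fac_of_closedPoint w hN.fromSpec (by
    rw [hN.range_fromSpec]; exact hNw)
  let θ := M.gen.appLE N (M.gen ⁻¹ᵁ N) le_rfl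
  have hθ : Spec.map θ ≫ hN.fromSpec = hW.fromSpec ≫ M.gen :=
    IsAffineOpen.SpecMap_appLE_fromSpec _ _ _ _
  obtain ⟨τ, hτ⟩ := Spec.map_surjective (hN.fromSpec ≫ M.str)
  have hfin : τ.hom.FiniteType := by
    have : LocallyOfFiniteType (Spec.map τ) := hτ ▸ inferInstance
    exact HasRingHomProperty.Spec_iff.mp this
  let _ : Algebra R Γ(M.scheme, N) := τ.hom.toAlgebra
  obtain ⟨s, hs⟩ : ∃ s : Finset Γ(M.scheme, N), Algebra.adjoin R (s : Set Γ(M.scheme, N)) = ⊤ :=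
    (RingHom.finiteType_algebraMap.mp hfin).out
  classical
  obtain ⟨g, rfl⟩ := Spec.map_surjective w'
  have key : ∀ (z : LocalPoints X v) (φ : Γ(X.left, M.gen ⁻¹ᵁ N) →+* v.completion),
      Spec.map (CommRingCat.ofHom φ) ≫ hW.fromSpec = z.pt →
      Spec.map (θ ≫ CommRingCat.ofHom φ) ≫ hN.fromSpec = z.pt ≫ M.gen := by
    intro z φ hφ
    rw [Spec.map_comp, Category.assoc, hθ, reassoc_of% hφ]
  -- The function `1` is inserted so that membership forces the point into the chart even if `s` is
  -- empty.
  refine ⟨⋂ b ∈ insert (1 : Γ(M.scheme, N)) s, {z : LocalPoints X v | ∃ φ : Γ(X.left, M.gen ⁻¹ᵁ N) →+* v.completion,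
      Spec.map (CommRingCat.ofHom φ) ≫ hW.fromSpec = z.pt ∧
        φ (θ b) ∈ (v.integers : Set v.completion)}, ?_, ?_, ?_⟩
  · intro z' hz'
    simp only [Set.mem_iInter] at hz'
    obtain ⟨φ, hφ, -⟩ := hz' 1 (Finset.mem_insert_self _ _)
    have hb : ∀ b ∈ s, φ (θ b) ∈ v.integers := by
      intro b hb
      obtain ⟨φ', hφ', h⟩ := hz' b (Finset.mem_insert_of_mem hb)
      rw [← hφ, cancel_mono] at hφ'
      have h3 : φ' = φ := congrArg CommRingCat.Hom.hom (Spec.map_injective hφ')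
      rwa [h3] at h
    have hφτ : (φ.comp θ.hom).comp τ.hom = v.integers.subtype.comp ρ := by
      have h1 : Spec.map (τ ≫ θ ≫ CommRingCat.ofHom φ) =
          Spec.map (CommRingCat.ofHom (v.integers.subtype.comp ρ)) := by
        rw [Spec.map_comp, hτ, reassoc_of% key z' φ hφ, M.isPullback.w, hρ]
        rw [← Category.assoc, z'.pt_comp_hom]
        exact specMap_comp_specMap _ _
      exact congrArg CommRingCat.Hom.hom (Spec.map_injective h1)
    obtain ⟨g', hg'⟩ := exists_lift_of_forall_mem hι (φ.comp θ.hom) (by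
      intro b
      have hb' : b ∈ Algebra.adjoin R (s : Set Γ(M.scheme, N)) := hs ▸ Algebra.mem_top
      induction hb' using Algebra.adjoin_induction with
      | mem x hx => exact ⟨⟨_, hb x hx⟩, rfl⟩
      | algebraMap r => exact ⟨ρ r, (congrArg (fun f => f r) hφτ).symm⟩
      | add x y _ _ hx hy => rw [map_add]; exact add_mem hx hy
      | mul x y _ _ hx hy => rw [map_mul]; exact mul_mem hx hy)
    refine ⟨Spec.map (CommRingCat.ofHom g') ≫ hN.fromSpec, ?_, ?_⟩
    · rw [Category.assoc, ← hτ]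
      refine (specMap_comp_specMap τ.hom g').trans ?_
      congr 2
      refine RingHom.ext fun r => hι ?_
      have h1 := congrArg (fun f => f (τ.hom r)) hg'
      exact h1.trans (congrArg (fun f => f r) hφτ)
    · rw [← key z' φ hφ, ← Category.assoc]
      congr 1
      refine (specMap_comp_specMap g' _).trans ?_
      rw [hg']
      rfl
  · exact isOpen_biInter_finset fun b _ => isOpen_chart hW.fromSpec (θ b) v.isOpen_integers
  · simp only [Set.mem_iInter]
    intro b _
    let z' : Spec (.of v.completion) ⟶ Spec Γ(X.left, M.gen ⁻¹ᵁ N) :=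
      IsOpenImmersion.lift hW.fromSpec z.pt (by
        rintro _ ⟨x, rfl⟩
        rw [hW.range_fromSpec]
        change M.gen (z.pt x) ∈ N
        rw [← Scheme.Hom.comp_apply, ← hwz, ← Category.assoc, Scheme.Hom.comp_apply]
        have : hN.fromSpec ((Spec.map (CommRingCat.ofHom v.integers.subtype) ≫ Spec.map g) x) ∈
          Set.range hN.fromSpec := ⟨_, rfl⟩
        rwa [hN.range_fromSpec] at this)
    have hz' : z' ≫ hW.fromSpec = z.pt := IsOpenImmersion.lift_fac _ _ _
    obtain ⟨φ, hφ⟩ := Spec.map_surjective z'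
    have hφ' : Spec.map (CommRingCat.ofHom φ.hom) ≫ hW.fromSpec = z.pt := by
      rw [← hz', ← hφ]; rfl
    refine ⟨φ.hom, hφ', ?_⟩
    have h1 := key z φ.hom hφ'
    rw [← hwz, ← Category.assoc, cancel_mono] at h1
    have h2 : θ ≫ φ = g ≫ CommRingCat.ofHom v.integers.subtype := by
      apply Spec.map_injective
      rw [Spec.map_comp, Spec.map_comp] at *
      exact h1
    have h3 := congrArg (fun f => f.hom b) h2
    exact h3 ▸ Subtype.mem _

end Local
end IntegralModels

/-! ### Small polydiscs as neighbourhoods of local points -/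

namespace IntegralModels

open Limits Topology

section Chart

variable {F : Type u} [Field F] {v : FinPlace F} {X : Over (Spec (.of F))}

/-- In charts, the topology on local points is coarser than the one given by coordinates. -/
theorem exists_nhds_chart (z : LocalPoints X v) {U : Set (LocalPoints X v)} (hU : IsOpen U)
    (hz : z ∈ U) :
    ∃ G : X.left.Opens, (∀ x, z.pt x ∈ G) ∧ ∀ {A : Type u} [CommRing A] [Algebra F A]
      (j : Spec (.of A) ⟶ X.left) [IsOpenImmersion j],
      j ≫ X.hom = Spec.map (CommRingCat.ofHom (algebraMap F A)) → (∀ x, j x ∈ G) →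
      ∀ {κ : Type u} [Finite κ] (x : κ → A), Algebra.adjoin F (Set.range x) = ⊤ →
      ∀ φ : A →+* v.completion, Spec.map (CommRingCat.ofHom φ) ≫ j = z.pt →
      ∃ Ω ∈ 𝓝 fun k => φ (x k), ∀ (z' : LocalPoints X v) (φ' : A →+* v.completion),
        Spec.map (CommRingCat.ofHom φ') ≫ j = z'.pt → (fun k => φ' (x k)) ∈ Ω → z' ∈ U := by
  have hU' : TopologicalSpace.GenerateOpen
    {W | ∃ (U : X.left.Opens) (_ : IsAffineOpen U) (s : Γ(X.left, U)) (V : Set v.completion),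
      IsOpen V ∧ W = {z : LocalPoints X v | ∃ h : ⊤ ≤ (CommaMorphism.left z) ⁻¹ᵁ U,
        valueAt (CommaMorphism.left z) h s ∈ V}} U := hU
  induction hU' generalizing z with
  | basic W hW =>
    obtain ⟨U, -, s, V, hV, rfl⟩ := hW
    obtain ⟨h, hv⟩ := hz
    refine ⟨U, fun x => h (Set.mem_univ x), ?_⟩
    intro A _ _ j _ hj hjU κ _ x hx φ hφ
    have h' : ⊤ ≤ j ⁻¹ᵁ U := fun y _ => hjU y
    -- On the chart the regular function `s` is a polynomial in the coordinates `x`, so its value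
    -- depends continuously on theirs.
    let a : A := (Scheme.ΓSpecIso (.of A)).hom (j.appLE U ⊤ h' s)
    have ha : a ∈ Algebra.adjoin F (Set.range x) := hx ▸ Algebra.mem_top
    rw [Algebra.adjoin_range_eq_range_aeval] at ha
    obtain ⟨P, hP⟩ := ha
    have hval : ∀ (z' : LocalPoints X v) (φ' : A →+* v.completion),
        Spec.map (CommRingCat.ofHom φ') ≫ j = z'.pt →
        (∃ h : ⊤ ≤ z'.pt ⁻¹ᵁ U, valueAt z'.pt h s = φ' a) ∧
        φ' a = MvPolynomial.aeval (fun k => φ' (x k)) P := by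
      intro z' φ' hφ'
      constructor
      · rw [← hφ']
        have h1 : ⊤ ≤ (Spec.map (CommRingCat.ofHom φ') ≫ j) ⁻¹ᵁ U := fun y _ => hjU _
        exact ⟨h1, valueAt_specMap_comp φ' j h1 h' s⟩
      · have halg : φ'.comp (algebraMap F A) = algebraMap F v.completion := by
          have h2 := z'.pt_comp_hom
          rw [← hφ', Category.assoc, hj] at h2
          have h3 := (specMap_comp_specMap (algebraMap F A) φ').symm.trans h2
          exact congrArg CommRingCat.Hom.hom (Spec.map_injective h3)
        let ψ : A →ₐ[F] v.completion := ⟨φ', fun r => congrArg (fun f => f r) halg⟩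
        change ψ a = MvPolynomial.aeval (fun k => ψ (x k)) P
        rw [show a = MvPolynomial.aeval x P from hP.symm]
        exact MvPolynomial.comp_aeval_apply x ψ P
    have hcont : Continuous fun t : κ → v.completion => MvPolynomial.aeval t P := by
      let _ := v.isDVR
      simp only [MvPolynomial.aeval_def, MvPolynomial.eval₂_eq_eval_map]
      exact MvPolynomial.continuous_eval _
    refine ⟨_, (hV.preimage hcont).mem_nhds ?_, ?_⟩
    · rw [Set.mem_preimage]
      obtain ⟨⟨h1, h2⟩, h3⟩ := hval z φ hφ
      rw [← h3, ← h2]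
      exact hv
    · intro z' φ' hφ' hmem
      obtain ⟨⟨h1, h2⟩, h3⟩ := hval z' φ' hφ'
      refine ⟨h1, ?_⟩
      have h4 : valueAt z'.pt h1 s ∈ V := by
        rw [h2, h3]; exact hmem
      exact h4
  | univ => exact ⟨⊤, fun _ => trivial, fun _ _ _ _ _ _ _ _ _ _ => ⟨_, Filter.univ_mem, fun _ _ _ _ => trivial⟩⟩
  | inter U₁ U₂ h₁ h₂ ih₁ ih₂ =>
    obtain ⟨G₁, hG₁, H₁⟩ := ih₁ z h₁ hz.1
    obtain ⟨G₂, hG₂, H₂⟩ := ih₂ z h₂ hz.2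
    refine ⟨G₁ ⊓ G₂, fun x => ⟨hG₁ x, hG₂ x⟩, ?_⟩
    intro A _ _ j _ hj hjG κ _ x hx φ hφ
    obtain ⟨Ω₁, hΩ₁, K₁⟩ := H₁ j hj (fun x => (hjG x).1) x hx φ hφ
    obtain ⟨Ω₂, hΩ₂, K₂⟩ := H₂ j hj (fun x => (hjG x).2) x hx φ hφ
    exact ⟨_, Filter.inter_mem hΩ₁ hΩ₂, fun z' φ' h h' => ⟨K₁ z' φ' h h'.1, K₂ z' φ' h h'.2⟩⟩
  | sUnion T hT ih =>
    obtain ⟨U, hU, hz⟩ := hz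
    obtain ⟨G, hG, H⟩ := ih U hU z (hT U hU) hz
    refine ⟨G, hG, ?_⟩
    intro A _ _ j _ hj hjG κ _ x hx φ hφ
    obtain ⟨Ω, hΩ, K⟩ := H j hj hjG x hx φ hφ
    exact ⟨Ω, hΩ, fun z' φ' h h' => ⟨U, hU, K z' φ' h h'⟩⟩

/-- The polydiscs of small radius in a chart are contained in a given neighbourhood. -/
theorem exists_polydisc {U : Set (LocalPoints X v)} {A : Type u} [CommRing A]
    (j : Spec (.of A) ⟶ X.left) {κ : Type u} [Finite κ] (x : κ → A) (φ : A →+* v.completion)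
    (h : ∃ Ω ∈ 𝓝 fun k => φ (x k), ∀ (z' : LocalPoints X v) (φ' : A →+* v.completion),
        Spec.map (CommRingCat.ofHom φ') ≫ j = z'.pt → (fun k => φ' (x k)) ∈ Ω → z' ∈ U)
    {π : F} (hπ : π ∈ v.ring) (hπ' : π⁻¹ ∉ v.ring) :
    ∃ N₀ : ℕ, ∀ N ≥ N₀, ∀ (z' : LocalPoints X v) (φ' : A →+* v.completion),
        Spec.map (CommRingCat.ofHom φ') ≫ j = z'.pt →
        (∀ k, (φ' (x k) - φ (x k)) / algebraMap F v.completion (π ^ N) ∈ v.integers) → z' ∈ U := by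
  obtain ⟨Ω, hΩ, H⟩ := h
  have hπ0 : π ≠ 0 := by rintro rfl; simp at hπ'
  rw [nhds_pi, Filter.mem_pi'] at hΩ
  obtain ⟨I, t, ht, hI⟩ := hΩ
  choose N hN using fun k => v.exists_pow_of_mem_nhds hπ hπ' (ht k)
  refine ⟨I.sup N, fun n hn z' φ' hφ' hk => H z' φ' hφ' (hI ?_)⟩
  intro k hkI
  have h1 := hN k n ((Finset.le_sup hkI).trans hn) _ (hk k)
  rwa [← map_pow, mul_div_cancel₀, add_sub_cancel] at h1
  rw [Ne, map_eq_zero]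
  exact pow_ne_zero _ hπ0

variable {R : Type u} [CommRing R] [IsDedekindDomain R] [Algebra R F] [IsFractionRing R F]

/-- A chart at `z` whose integral points lie in a given neighbourhood of `z`. -/
theorem exists_chart [LocallyOfFiniteType X.hom] {ρ : R →+* v.integers}
    (hρ : v.integers.subtype.comp ρ = (algebraMap F v.completion).comp (algebraMap R F))
    (z : LocalPoints X v) {U : Set (LocalPoints X v)} (hU : IsOpen U) (hz : z ∈ U) :
    ∃ (W : Scheme.{u}) (j : W ⟶ X.left) (Z : FlatModel R (j ≫ X.hom)), IsOpenImmersion j ∧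
      IsSeparated Z.str ∧
      (∃ z₀, z₀ ≫ j = z.pt ∧ IsIntegralPt Z ρ v.integers.subtype z₀) ∧
      ∀ (z' : LocalPoints X v) (z₁ : Spec (.of v.completion) ⟶ W), z₁ ≫ j = z'.pt →
        IsIntegralPt Z ρ v.integers.subtype z₁ → z' ∈ U := by
  obtain ⟨G, hG, H⟩ := exists_nhds_chart z hU hz
  obtain ⟨π, hπ0, hπ, hπ'⟩ := v.exists_uniformizer
  let o : Spec (.of v.completion) := closedPt v.completion
  have ho : ∀ x : Spec (.of v.completion), x = o := fun x =>
    Subsingleton.elim (α := PrimeSpectrum v.completion) _ _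
  obtain ⟨_, ⟨W, hW, rfl⟩, hzW, hWG⟩ := X.left.isBasis_affineOpens.exists_subset_of_mem_open
    (hG o) G.2
  have hW : IsAffineOpen W := hW
  let j := hW.fromSpec
  obtain ⟨τ, hτ⟩ := Spec.map_surjective (j ≫ X.hom)
  let _ : Algebra F Γ(X.left, W) := τ.hom.toAlgebra
  let _ : Algebra R Γ(X.left, W) := (τ.hom.comp (algebraMap R F)).toAlgebra
  have : IsScalarTower R F Γ(X.left, W) := .of_algebraMap_eq' rfl
  have hj : Spec.map (CommRingCat.ofHom (algebraMap F Γ(X.left, W))) = j ≫ X.hom := hτ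
  obtain ⟨s, hs⟩ : ∃ s : Finset Γ(X.left, W), Algebra.adjoin F (s : Set Γ(X.left, W)) = ⊤ := by
    have : LocallyOfFiniteType (Spec.map τ) := hτ ▸ inferInstance
    exact (RingHom.finiteType_algebraMap.mp (HasRingHomProperty.Spec_iff.mp this)).out
  let x : s → Γ(X.left, W) := fun k => k.1
  have hx : Algebra.adjoin F (Set.range x) = ⊤ := by simpa [x] using hs
  obtain ⟨φ₀, hφ₀⟩ : ∃ φ₀ : Spec (.of v.completion) ⟶ Spec Γ(X.left, W), φ₀ ≫ j = z.pt :=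
    ⟨IsOpenImmersion.lift j z.pt (by
      rintro _ ⟨x, rfl⟩
      rw [hW.range_fromSpec, ho x]
      exact hzW), IsOpenImmersion.lift_fac _ _ _⟩
  obtain ⟨φ, rfl⟩ := Spec.map_surjective φ₀
  have hφ₀' : Spec.map (CommRingCat.ofHom φ.hom) ≫ j = z.pt := hφ₀
  have halg : ∀ (z' : LocalPoints X v) (φ' : Γ(X.left, W) →+* v.completion),
      Spec.map (CommRingCat.ofHom φ') ≫ j = z'.pt →
      φ'.comp (algebraMap F _) = algebraMap F v.completion := by
    intro z' φ' hφ'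
    have h2 := z'.pt_comp_hom
    rw [← hφ', Category.assoc, ← hj] at h2
    have h3 := (specMap_comp_specMap (algebraMap F _) φ').symm.trans h2
    exact congrArg CommRingCat.Hom.hom (Spec.map_injective h3)
  obtain ⟨N, hN⟩ := exists_polydisc (U := U) j x φ.hom
    (H j hj.symm (fun y => hWG (by
      have : j y ∈ Set.range j := ⟨y, rfl⟩
      rwa [hW.range_fromSpec] at this)) x hx φ.hom hφ₀') hπ hπ'
  have hN := hN N le_rfl
  have hc : π ^ N ≠ 0 := pow_ne_zero _ hπ0
  -- The coordinates of `z` lie in `F_v` only. They are replaced by elements of `F` that are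
  -- congruent to them modulo `π ^ N`, so that the rescaled coordinates `y` are defined over `F` and
  -- still integral at `z`.
  choose b hb using fun k => v.exists_approx (φ.hom (x k)) hc
  let y : s → Γ(X.left, W) := fun k => algebraMap F _ (π ^ N)⁻¹ * (x k - algebraMap F _ (b k))
  have hy : ∀ φ' : Γ(X.left, W) →+* v.completion,
      φ'.comp (algebraMap F _) = algebraMap F v.completion → ∀ k,
      φ' (y k) = (φ' (x k) - algebraMap F v.completion (b k)) /
        algebraMap F v.completion (π ^ N) := by
    intro φ' hφ' k
    have h1 : ∀ a, φ' (algebraMap F _ a) = algebraMap F v.completion a :=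
      fun a => congrArg (fun f => f a) hφ'
    simp only [y, map_mul, map_sub, h1, map_inv₀]
    rw [div_eq_inv_mul]
  have hgen : Algebra.adjoin F (Set.range y) = ⊤ := by
    rw [eq_top_iff, ← hx, Algebra.adjoin_le_iff]
    rintro _ ⟨k, rfl⟩
    have : x k = algebraMap F _ (π ^ N) * y k + algebraMap F _ (b k) := by
      simp only [y]
      rw [← mul_assoc, ← map_mul, mul_inv_cancel₀ hc, map_one, one_mul, sub_add_cancel]
    rw [this]
    exact add_mem (mul_mem (Subalgebra.algebraMap_mem _ _) (Algebra.subset_adjoin ⟨k, rfl⟩))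
      (Subalgebra.algebraMap_mem _ _)
  have hord := isOrder_adjoin (R := R) F (Set.finite_range y) hgen
  have hcrit : ∀ (z' : LocalPoints X v) (φ' : Γ(X.left, W) →+* v.completion),
      Spec.map (CommRingCat.ofHom φ') ≫ j = z'.pt →
      (IsIntegralPt (affineModel R F _ hord) ρ v.integers.subtype
        (Spec.map (CommRingCat.ofHom φ')) ↔ ∀ k, (φ' (x k) - algebraMap F v.completion (b k)) /
        algebraMap F v.completion (π ^ N) ∈ v.integers) := by
    intro z' φ' hφ'
    rw [isIntegralPt_affineModel hord Subtype.val_injective, Set.forall_mem_range]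
    · refine forall_congr' fun k => ?_
      rw [hy φ' (halg z' φ' hφ') k]
      simp
    · rw [hρ, ← halg z' φ' hφ', RingHom.comp_assoc]
      rfl
  refine ⟨Spec Γ(X.left, W), j, (affineModel R F _ hord).congr hj, inferInstance, ?_,
    ⟨Spec.map (CommRingCat.ofHom φ.hom), hφ₀, (hcrit z φ.hom hφ₀).mpr hb⟩, ?_⟩
  · change IsSeparated (Spec.map _)
    infer_instance
  · intro z' z₁ hz₁ hint
    obtain ⟨φ', rfl⟩ := Spec.map_surjective z₁
    refine hN z' φ'.hom hz₁ fun k => ?_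
    have h1 := (hcrit z' φ'.hom hz₁).mp hint k
    -- By the ultrametric inequality two points that are close to `b` are equally close to each
    -- other.
    have h2 := sub_mem h1 (hb k)
    rwa [← sub_div, sub_sub_sub_cancel_right] at h2

end Chart
end IntegralModels

/-! ### Adelic points are integral almost everywhere -/

namespace IntegralModels

open Limits Topology

section Adelic

variable {F : Type u} [Field F] {X : Over (Spec (.of F))} {S : Set (Place F)}

/-- The point of `Spec 𝒪_S` corresponding to a place outside `S`. -/
noncomputable def placePt (S : Set (Place F)) (v : Outside S) : Spec (.of (sIntegers S)) :=
  Spec.map (CommRingCat.ofHom (sIntegersMap S v)) (closedPt v.1.integers)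

theorem subtype_comp_sIntegersMap (v : Outside S) :
    v.1.integers.subtype.comp (sIntegersMap S v) =
      (algebraMap F v.1.completion).comp (algebraMap (sIntegers S) F) := rfl

/-- The model underlying an integral model. -/
noncomputable def IntegralModel.flatModel (Y : IntegralModel X S) :
    FlatModel (sIntegers S) X.hom where
  scheme := Y.scheme.left
  str := Y.scheme.hom
  gen := Y.genericMap
  isPullback := by
    have hw : Y.iso.inv.left ≫ pullback.snd Y.scheme.hom
      (Spec.map (CommRingCat.ofHom (sIntegers S).subtype)) = X.hom := Over.w Y.iso.inv
    refine IsPullback.of_iso_pullback ⟨?_⟩ ((Over.forget _).mapIso Y.iso.symm) rfl hw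
    change (Y.iso.inv.left ≫ pullback.fst Y.scheme.hom
      (Spec.map (CommRingCat.ofHom (sIntegers S).subtype))) ≫ _ = _
    rw [Category.assoc, pullback.condition, ← Category.assoc, hw]
    rfl
  flat := Y.flat
  locallyOfFiniteType := Y.locallyOfFiniteType
  quasiCompact := Y.quasiCompact

theorem IntegralModel.mem_localIntegralPoints_iff (Y : IntegralModel X S) (v : Outside S)
    (z : LocalPoints X v.1) :
    z ∈ Y.localIntegralPoints v ↔
      IsIntegralPt Y.flatModel (sIntegersMap S v) v.1.integers.subtype z.pt := by
  constructor
  · rintro ⟨w, hw⟩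
    exact ⟨w.left, Over.w w, hw⟩
  · rintro ⟨w, hw, hwz⟩
    exact ⟨Over.homMk w hw, hwz⟩

/-- A surjective separated flat model is an integral model. -/
noncomputable def FlatModel.integralModel (M : FlatModel (sIntegers S) X.hom)
    (hsep : IsSeparated M.str) (hsurj : Surjective M.str) : IntegralModel X S where
  scheme := Over.mk M.str
  flat := M.flat
  surjective := hsurj
  separated := hsep
  locallyOfFiniteType := M.locallyOfFiniteType
  quasiCompact := M.quasiCompact
  iso := Over.isoMk M.isPullback.isoPullback.symm M.isPullback.isoPullback_inv_snd

theorem FlatModel.mem_localIntegralPoints_integralModel (M : FlatModel (sIntegers S) X.hom)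
    (hsep : IsSeparated M.str) (hsurj : Surjective M.str) (v : Outside S)
    (z : LocalPoints X v.1) :
    z ∈ (M.integralModel hsep hsurj).localIntegralPoints v ↔
      IsIntegralPt M (sIntegersMap S v) v.1.integers.subtype z.pt := by
  have h : (M.integralModel hsep hsurj).genericMap = M.gen :=
    M.isPullback.isoPullback_hom_fst
  constructor
  · rintro ⟨w, hw⟩
    exact ⟨w.left, Over.w w, hw.trans (congrArg (z.pt ≫ ·) h)⟩
  · rintro ⟨w, hw, hwz⟩
    exact ⟨Over.homMk w hw, hwz.trans (congrArg (z.pt ≫ ·) h).symm⟩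

theorem Outside.ring_injective : Function.Injective fun v : Outside S => v.1.ring := by
  rintro ⟨⟨A, hA⟩, hv⟩ ⟨⟨B, hB⟩, hw⟩ (rfl : A = B)
  rfl

variable [IsGlobalField F]

theorem Outside.finite_setOf_notMem (x : F) : {v : Outside S | x ∉ v.1.ring}.Finite :=
  (finite_poles x).preimage Outside.ring_injective.injOn

omit [IsGlobalField F] in
theorem isUnit_sIntegersMap {r : sIntegers S} (hr : r ≠ 0) {v : Outside S}
    (h : (r : F)⁻¹ ∈ v.1.ring) : IsUnit (sIntegersMap S v r) := by
  refine IsUnit.of_mul_eq_one ⟨_, v.1.algebraMap_mem_integers h⟩ (Subtype.ext ?_)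
  change algebraMap F v.1.completion r * algebraMap F v.1.completion (r : F)⁻¹ = 1
  rw [← map_mul, mul_inv_cancel₀, map_one]
  exact fun h => hr (Subtype.ext h)

/-- The morphism underlying an adelic point. -/
def AdelicPoints.pt (z : AdelicPoints X S) : Spec (.of (SAdeles S)) ⟶ X.left :=
  CommaMorphism.left z

theorem AdelicPoints.component_pt (z : AdelicPoints X S) (v : Outside S) :
    (z.component v).pt = Spec.map (CommRingCat.ofHom (adeleProj S v)) ≫ z.pt := rfl

omit [IsGlobalField F] in
theorem isIntegralPt_congr {R : Type u} [CommRing R] [Algebra R F] {X : Scheme.{u}}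
    {sX sX' : X ⟶ Spec (.of F)} (M : FlatModel R sX) (h : sX = sX') {A K : Type u} [CommRing A]
    [CommRing K] (ρ : R →+* A) (ι : A →+* K) (z : Spec (.of K) ⟶ X) :
    IsIntegralPt (M.congr h) ρ ι z ↔ IsIntegralPt M ρ ι z := Iff.rfl

omit [IsGlobalField F] in
theorem SAdeles.finite_setOf_notMem (a : SAdeles S) :
    {v : Outside S | adeleProj S v a ∉ v.1.integers}.Finite := a.2

variable [IsDedekindDomain (sIntegers S)] [IsFractionRing (sIntegers S) F]

/-- Over the locus where `a` is invertible, `z` is given by a homomorphism from the functions on `W`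
to the localization of the adeles at `a`. The images of finitely many generators are fractions `α /
a ^ m`. They are integral at `v` as soon as `a⁻¹` and the adeles `α` are, so the component is
integral for an order on `W`; this order is then compared with `Y`. -/
theorem AdelicPoints.finite_not_isIntegralPt_of_chart [LocallyOfFiniteType X.hom]
    (z : AdelicPoints X S) (Y : FlatModel (sIntegers S) X.hom) [Y.scheme.IsSeparated]
    {a : SAdeles S} {W : X.left.Opens} (hW : IsAffineOpen W)
    (ha : ∀ p : Spec (.of (SAdeles S)), a ∉ p.asIdeal →
      z.pt p ∈ W) :
    {v : Outside S | (∃ u ∈ v.1.integers, adeleProj S v a * u = 1) ∧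
      ¬ IsIntegralPt Y (sIntegersMap S v) v.1.integers.subtype (z.component v).pt}.Finite := by
  let j := hW.fromSpec
  obtain ⟨τ, hτ⟩ := Spec.map_surjective (j ≫ X.hom)
  let _ : Algebra F Γ(X.left, W) := τ.hom.toAlgebra
  let _ : Algebra (sIntegers S) Γ(X.left, W) := (τ.hom.comp (algebraMap (sIntegers S) F)).toAlgebra
  have : IsScalarTower (sIntegers S) F Γ(X.left, W) := .of_algebraMap_eq' rfl
  have hj : Spec.map (CommRingCat.ofHom (algebraMap F Γ(X.left, W))) = j ≫ X.hom := hτ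
  obtain ⟨s, hs⟩ : ∃ s : Finset Γ(X.left, W), Algebra.adjoin F (s : Set Γ(X.left, W)) = ⊤ := by
    have : LocallyOfFiniteType (Spec.map τ) := hτ ▸ inferInstance
    exact (RingHom.finiteType_algebraMap.mp (HasRingHomProperty.Spec_iff.mp this)).out
  have hord := isOrder_adjoin (R := sIntegers S) F s.finite_toSet hs
  let L := Localization.Away a
  let c : Spec (.of L) ⟶ Spec (.of (SAdeles S)) := Spec.map (CommRingCat.ofHom (algebraMap _ L))
  have hc : ∀ x, a ∉ (c x).asIdeal := by
    intro x
    have h1 := (PrimeSpectrum.localization_away_comap_range L a).le ⟨x, rfl⟩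
    exact h1
  obtain ⟨θ₀, hθ₀⟩ : ∃ θ₀ : Spec (.of L) ⟶ Spec Γ(X.left, W), θ₀ ≫ j = c ≫ z.pt :=
    ⟨IsOpenImmersion.lift j (c ≫ z.pt) (by
      rintro _ ⟨x, rfl⟩
      rw [hW.range_fromSpec, Scheme.Hom.comp_apply]
      exact ha _ (hc x)), IsOpenImmersion.lift_fac _ _ _⟩
  obtain ⟨θ, rfl⟩ := Spec.map_surjective θ₀
  have hα : ∀ b, ∃ (α : SAdeles S) (m : ℕ), θ.hom b * algebraMap _ L a ^ m = algebraMap _ L α := by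
    intro b
    obtain ⟨m, α, h⟩ := IsLocalization.Away.surj a (θ.hom b)
    exact ⟨α, m, h⟩
  choose α m hαm using hα
  have hdiag : ∀ (v : Outside S) (φ : L →+* v.1.completion), φ.comp (algebraMap _ L) = adeleProj S v →
      Spec.map (CommRingCat.ofHom (φ.comp θ.hom)) ≫ j = (z.component v).pt := by
    intro v φ hφ
    rw [AdelicPoints.component_pt, ← hφ]
    have h1 := specMap_comp_specMap θ.hom φ
    rw [← h1, Category.assoc]
    have h2 := specMap_comp_specMap (algebraMap (SAdeles S) L) φ
    rw [← h2, Category.assoc]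
    exact congrArg _ hθ₀
  obtain ⟨r, hr, hrY⟩ := exists_isIntegralPt_of_isIntegralPt
    ((affineModel (sIntegers S) F _ hord).congr hj) Y rfl
  refine ((s.finite_toSet.biUnion fun b _ => SAdeles.finite_setOf_notMem (α b)).union
    (Outside.finite_setOf_notMem (S := S) (r : F)⁻¹)).subset ?_
  rintro v ⟨⟨u, hu, hau⟩, hv⟩
  by_contra hcon
  rw [Set.mem_union, not_or] at hcon
  simp only [Set.mem_iUnion, Set.mem_ofPred_eq, not_exists, not_not] at hcon
  obtain ⟨h1, h2⟩ := hcon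
  apply hv
  let φ : L →+* v.1.completion := IsLocalization.Away.lift (g := adeleProj S v) a
    (IsUnit.of_mul_eq_one _ hau)
  have hφ : φ.comp (algebraMap (SAdeles S) L) = adeleProj S v := IsLocalization.Away.lift_comp (x := a) _
  have h3 := hdiag v φ hφ
  have halg : (φ.comp θ.hom).comp (algebraMap F _) = algebraMap F v.1.completion := by
    have h2 := (z.component v).pt_comp_hom
    rw [← h3, Category.assoc, ← hj] at h2
    have h3 := (specMap_comp_specMap (algebraMap F _) (φ.comp θ.hom)).symm.trans h2
    exact congrArg CommRingCat.Hom.hom (Spec.map_injective h3)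
  rw [← h3]
  refine hrY rfl (isUnit_sIntegersMap hr h2) ?_
  rw [isIntegralPt_congr]
  refine (isIntegralPt_affineModel (φ := φ.comp θ.hom) hord Subtype.val_injective ?_).mpr ?_
  · rw [subtype_comp_sIntegersMap, ← halg, RingHom.comp_assoc]
    rfl
  · intro b hb
    have h4 : φ (θ.hom b) * adeleProj S v a ^ m b = adeleProj S v (α b) := by
      rw [← hφ]
      have := congrArg φ (hαm b)
      rwa [map_mul, map_pow] at this
    have h5 : φ (θ.hom b) = adeleProj S v (α b) * u ^ m b := by
      rw [← h4, mul_assoc, ← mul_pow, hau, one_pow, mul_one]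
    have h6 : φ (θ.hom b) ∈ v.1.integers := by
      rw [h5]
      exact mul_mem (h1 b hb) (pow_mem hu _)
    exact ⟨⟨_, h6⟩, rfl⟩

/-- The components of an adelic point are integral outside finitely many places. -/
theorem AdelicPoints.finite_not_isIntegralPt [LocallyOfFiniteType X.hom]
    (z : AdelicPoints X S) (Y : FlatModel (sIntegers S) X.hom) [Y.scheme.IsSeparated] :
    {v : Outside S |
      ¬ IsIntegralPt Y (sIntegersMap S v) v.1.integers.subtype (z.component v).pt}.Finite := by
  -- The point `z` need not factor through a single affine chart. Each prime of the adele ring has a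
  -- basic open neighbourhood that does, and finitely many of these suffice.
  have key : ∀ p : PrimeSpectrum (SAdeles S), ∃ a : SAdeles S, a ∉ p.asIdeal ∧
      {v : Outside S | (∃ u ∈ v.1.integers, adeleProj S v a * u = 1) ∧
      ¬ IsIntegralPt Y (sIntegersMap S v) v.1.integers.subtype (z.component v).pt}.Finite := by
    intro p
    obtain ⟨_, ⟨W, hW, rfl⟩, hzW, -⟩ := X.left.isBasis_affineOpens.exists_subset_of_mem_open
      (Set.mem_univ (z.pt p)) isOpen_univ
    have hW : IsAffineOpen W := hW
    obtain ⟨_, ⟨_, ⟨a, rfl⟩, rfl⟩, hpa, haW⟩ := PrimeSpectrum.isBasis_basic_opens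
      |>.exists_subset_of_mem_open (a := p) (u := z.pt ⁻¹' W) hzW (W.2.preimage z.pt.continuous)
    exact ⟨a, hpa, z.finite_not_isIntegralPt_of_chart Y hW fun q hq => haW hq⟩
  choose a ha hfin using key
  have hspan : Ideal.span (Set.range a) = ⊤ := by
    by_contra hne
    obtain ⟨M, hM, hle⟩ := Ideal.exists_le_maximal _ hne
    exact ha ⟨M, hM.isPrime⟩ (hle (Ideal.subset_span ⟨_, rfl⟩))
  rw [Ideal.eq_top_iff_one, Finsupp.mem_ideal_span_range_iff_exists_finsupp] at hspan
  obtain ⟨c, hc⟩ := hspan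
  refine (((c.support.finite_toSet.biUnion fun p _ => hfin p).union
    (c.support.finite_toSet.biUnion fun p _ => SAdeles.finite_setOf_notMem (c p))).union
    (c.support.finite_toSet.biUnion fun p _ => SAdeles.finite_setOf_notMem (a p))).subset ?_
  intro v hv
  by_contra hcon
  simp only [Set.mem_union, Set.mem_iUnion, Set.mem_ofPred_eq, not_or, not_exists, not_and,
    not_not] at hcon
  obtain ⟨⟨h1, h2⟩, h3⟩ := hcon
  have hsum : ∑ p ∈ c.support, adeleProj S v (c p) * adeleProj S v (a p) = 1 := by
    have := congrArg (adeleProj S v) hc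
    rw [Finsupp.sum, map_sum, map_one] at this
    simpa only [map_mul] using this
  have hsum' : ∑ p ∈ c.support.attach, (⟨_, h2 p.1 p.2⟩ : v.1.integers) * ⟨_, h3 p.1 p.2⟩ = 1 := by
    apply Subtype.ext
    have h4 := map_sum v.1.integers.subtype (fun p : c.support =>
      (⟨_, h2 p.1 p.2⟩ : v.1.integers) * ⟨_, h3 p.1 p.2⟩) c.support.attach
    refine h4.trans (Eq.trans ?_ hsum)
    rw [← Finset.sum_attach c.support]
    rfl
  -- Where all the coefficients are integral, the relation `∑ c p * a p = 1` holds in the local ring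
  -- `𝒪_v`, so one of the `a p` is a unit there and its chart applies.
  obtain ⟨p, hp⟩ : ∃ p : c.support, IsUnit (⟨_, h3 p.1 p.2⟩ : v.1.integers) := by
    by_contra hcon
    rw [not_exists] at hcon
    have h4 : (1 : v.1.integers) ∈ IsLocalRing.maximalIdeal v.1.integers := by
      rw [← hsum']
      exact Ideal.sum_mem _ fun p _ => Ideal.mul_mem_left _ _
        ((IsLocalRing.mem_maximalIdeal _).mpr (hcon p))
    exact (Ideal.ne_top_iff_one _).mp (IsLocalRing.maximalIdeal.isMaximal _).ne_top h4
  obtain ⟨u, hu⟩ := hp.exists_right_inv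
  exact hv (h1 p.1 p.2 ⟨u, u.2, congrArg Subtype.val hu⟩)

end Adelic
end IntegralModels

/-! ### Valuation rings of finite extensions -/

namespace IntegralModels

section ValuationSubrings

/-- A finite extension of the fraction field of a Dedekind domain is, up to powers, the fraction
field of an integral extension which is a Dedekind domain. -/
theorem exists_dedekind_pow {R K : Type*} {F : Type u} [CommRing R] [IsDedekindDomain R] [Field K]
    [Algebra R K] [IsFractionRing R K] [Field F] {φ : K →+* F} (hφ : φ.Finite) :
    ∃ (E C : Type u) (_ : Field E) (_ : CommRing C) (_ : IsDedekindDomain C) (_ : Algebra C E)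
      (_ : IsFractionRing C E) (ι : E →+* F) (Q : ℕ), Q ≠ 0 ∧ (∀ z : F, ∃ y, ι y = z ^ Q) ∧
      ∀ c : C, (φ.comp (algebraMap R K)).IsIntegralElem (ι (algebraMap C E c)) := by
  let _ : Algebra K F := φ.toAlgebra
  have : FiniteDimensional K F := hφ
  -- The integral closure of `R` in the separable part `E` is a Dedekind domain. The extension `F /
  -- E` is purely inseparable of bounded exponent, which gives a uniform power mapping `F` into `E`.
  let E := separableClosure K F
  let _ : Algebra R E := ((algebraMap K E).comp (algebraMap R K)).toAlgebra
  have : IsScalarTower R K E := IsScalarTower.of_algebraMap_eq' rfl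
  have : IsDedekindDomain (integralClosure R E) := integralClosure.isDedekindDomain R K E
  have : IsFractionRing (integralClosure R E) E :=
    integralClosure.isFractionRing_of_finite_extension K E
  obtain ⟨q, hq⟩ := ExpChar.exists E
  refine ⟨E, integralClosure R E, inferInstance, inferInstance, inferInstance, inferInstance,
    inferInstance, algebraMap E F, q ^ IsPurelyInseparable.exponent E F,
    pow_ne_zero _ (expChar_pos E q).ne', fun z => IsPurelyInseparable.exponent_def' E q z, ?_⟩
  rintro ⟨c, P, hP, hc⟩
  refine ⟨P, hP, ?_⟩
  have := congrArg (algebraMap E F) hc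
  rwa [Polynomial.hom_eval₂, map_zero] at this

variable {F : Type*} [Field F]

theorem mem_of_isIntegralElem {R : Type*} [CommRing R] {ψ : R →+* F} {A : ValuationSubring F}
    (hA : ∀ r, ψ r ∈ A) {z : F} (hz : ψ.IsIntegralElem z) : z ∈ A := by
  obtain ⟨P, hP, h⟩ := hz
  let g : R →+* A := ψ.codRestrict A.toSubring hA
  have hint : IsIntegral A z := by
    refine ⟨P.map g, hP.map g, ?_⟩
    rw [Polynomial.eval₂_map]
    exact h
  obtain ⟨a, rfl⟩ := IsIntegrallyClosed.isIntegral_iff.mp hint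
  exact a.2

theorem mem_of_pow_mem {A : ValuationSubring F} {z : F} {m : ℕ} (hm : m ≠ 0) (hz : z ^ m ∈ A) :
    z ∈ A := by
  rw [← A.valuation_le_one_iff] at hz ⊢
  rw [map_pow] at hz
  exact (pow_le_one_iff hm).mp hz

theorem valuation_lt_one_iff_inv {A : ValuationSubring F} {z : F} (hz : z ≠ 0) :
    A.valuation z < 1 ↔ z⁻¹ ∉ A := by
  rw [← A.valuation_le_one_iff, map_inv₀, not_le, one_lt_inv₀]
  exact zero_lt_iff.mpr ((map_ne_zero _).mpr hz)

theorem valuation_lt_one_iff_not_isUnit {A : ValuationSubring F} (a : A) :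
    A.valuation (a : F) < 1 ↔ ¬IsUnit a := by
  rw [A.valuation_eq_one_iff]
  exact ⟨ne_of_lt, (A.valuation_le_one a).lt_of_ne⟩

theorem exists_pow_valuation_le {A : ValuationSubring F} [IsDiscreteValuationRing A] {a b : F}
    (ha : A.valuation a < 1) (hb : b ≠ 0) :
    ∃ N : ℕ, ∀ n ≥ N, A.valuation (a ^ n) ≤ A.valuation b := by
  have haA : a ∈ A := (A.valuation_le_one_iff a).mp ha.le
  rcases A.mem_or_inv_mem b with hbA | hbA
  · have hb' : (⟨b, hbA⟩ : A) ≠ 0 := fun h => hb (congrArg Subtype.val h)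
    have h1 : IsDiscreteValuationRing.addVal A ⟨b, hbA⟩ ≠ ⊤ :=
      fun h => hb' (IsDiscreteValuationRing.addVal_eq_top_iff.mp h)
    obtain ⟨N, hN⟩ := ENat.ne_top_iff_exists.mp h1
    refine ⟨N, fun n hn => ?_⟩
    have h2 : (⟨b, hbA⟩ : A) ∣ ⟨a, haA⟩ ^ n := by
      rw [← IsDiscreteValuationRing.addVal_le_iff_dvd, IsDiscreteValuationRing.addVal_pow, ← hN]
      have h3 : 1 ≤ IsDiscreteValuationRing.addVal A ⟨a, haA⟩ := by
        rw [Order.one_le_iff_pos, pos_iff_ne_zero, Ne, IsDiscreteValuationRing.addVal_eq_zero_iff]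
        exact (valuation_lt_one_iff_not_isUnit ⟨a, haA⟩).mp ha
      calc (N : ℕ∞) ≤ n := by exact_mod_cast hn
        _ = n • 1 := by simp
        _ ≤ _ := nsmul_le_nsmul_right h3 n
    obtain ⟨c, hc⟩ := h2
    have h4 : a ^ n = b * c := congrArg Subtype.val hc
    rw [h4, map_mul]
    exact mul_le_of_le_one_right' (A.valuation_le_one c)
  · refine ⟨0, fun n _ => ?_⟩
    have h1 : 1 ≤ A.valuation b := by
      rw [← A.valuation_le_one_iff, map_inv₀] at hbA
      exact (inv_le_one₀ (zero_lt_iff.mpr ((map_ne_zero _).mpr hb))).mp hbA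
    refine le_trans ?_ h1
    rw [A.valuation_le_one_iff]
    exact pow_mem haA n

/-- The non-trivial valuation rings of the fraction field of a Dedekind domain which contain the
domain are its localizations at the non-zero primes. -/
theorem exists_eq_valuationSubringAtPrime {C : Type*} [CommRing C] [IsDedekindDomain C]
    [Algebra C F] [IsFractionRing C F] {A : ValuationSubring F}
    (hA : ∀ c : C, algebraMap C F c ∈ A) (hA' : A ≠ ⊤) :
    ∃ v : HeightOneSpectrum C, v.valuationSubringAtPrime F = A ∧
      ∀ c, c ∈ v.asIdeal ↔ A.valuation (algebraMap C F c) < 1 := by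
  let f : C →+* A := (algebraMap C F).codRestrict A.toSubring hA
  let p : Ideal C := (IsLocalRing.maximalIdeal A).comap f
  have hp : p.IsPrime := Ideal.comap_isPrime f _
  have hmem : ∀ c, c ∈ p ↔ A.valuation (algebraMap C F c) < 1 := fun c =>
    ((IsLocalRing.mem_maximalIdeal _).trans Iff.rfl).trans
      (valuation_lt_one_iff_not_isUnit (f c)).symm
  have hinv : ∀ s : C, s ∉ p → (algebraMap C F s)⁻¹ ∈ A := by
    intro s hs
    rw [hmem] at hs
    by_cases h0 : algebraMap C F s = 0
    · rw [h0, inv_zero]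
      exact A.zero_mem
    · rwa [valuation_lt_one_iff_inv h0, not_not] at hs
  have hp0 : p ≠ ⊥ := by
    intro h0
    refine hA' (eq_top_iff.mpr fun x _ => ?_)
    obtain ⟨a, b, hb, rfl⟩ := IsFractionRing.div_surjective (A := C) x
    rw [div_eq_mul_inv]
    refine A.mul_mem _ _ (hA a) (hinv b ?_)
    rw [h0]
    simpa using nonZeroDivisors.ne_zero hb
  refine ⟨⟨p, hp, hp0⟩, ValuationSubring.eq_of_le_of_ne_top _ ?_ hA', hmem⟩
  rintro _ ⟨a, s, hs, rfl⟩
  exact A.mul_mem _ _ (hA a) (hinv s hs)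

variable {R K : Type*} [CommRing R] [IsDedekindDomain R] [Field K] [Algebra R K]
  [IsFractionRing R K] {φ : K →+* F}

theorem comap_ne_top_of_pow {E : Type*} [Field E] {ι : E →+* F} {Q : ℕ} (hQ : Q ≠ 0)
    (hpow : ∀ z : F, ∃ y, ι y = z ^ Q) {A : ValuationSubring F} (hA : A ≠ ⊤) :
    A.comap ι ≠ ⊤ := by
  intro h
  refine hA (eq_top_iff.mpr fun z _ => mem_of_pow_mem hQ ?_)
  obtain ⟨y, hy⟩ := hpow z
  rw [← hy]
  exact ValuationSubring.mem_comap.mp (h ▸ ValuationSubring.mem_top y)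

/-- The non-trivial valuation rings of a finite extension of the fraction field of a Dedekind domain
which contain the domain are discrete. -/
theorem isDiscreteValuationRing_of_ne_top (hφ : φ.Finite) {A : ValuationSubring F}
    (hA : ∀ r : R, φ (algebraMap R K r) ∈ A) (hA' : A ≠ ⊤) : IsDiscreteValuationRing A := by
  obtain ⟨E, C, _, _, _, _, _, ι, Q, hQ, hpow, hint⟩ := exists_dedekind_pow (R := R) hφ
  obtain ⟨v, hv, -⟩ := exists_eq_valuationSubringAtPrime (C := C) (A := A.comap ι)
    (fun c => ValuationSubring.mem_comap.mpr (mem_of_isIntegralElem hA (hint c))) (comap_ne_top_of_pow hQ hpow hA')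
  have hdvr : IsDiscreteValuationRing (A.comap ι) := by
    rw [← hv]
    exact IsLocalization.AtPrime.isDiscreteValuationRing_of_dedekind_domain C v.ne_bot _
  -- `ρ` is the multiplicative map `z ↦ z ^ Q` into `E`. Composed with the valuation of the discrete
  -- ring below, it increases strictly along proper divisibility in `A`. So divisibility in `A` is
  -- well founded, and a Bézout ring with this property is principal.
  choose ρ hρ using hpow
  have hρA : ∀ z ∈ A, ρ z ∈ A.comap ι := fun z hz => by
    rw [ValuationSubring.mem_comap, hρ]
    exact pow_mem hz Q
  have hρmul : ∀ y z, ρ (y * z) = ρ y * ρ z := fun y z => ι.injective (by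
    rw [map_mul, hρ, hρ, hρ, mul_pow])
  let f : A → ℕ∞ := fun a => IsDiscreteValuationRing.addVal (A.comap ι) ⟨ρ a, hρA a a.2⟩
  have hf : ∀ a b, DvdNotUnit a b → f a < f b := by
    rintro a b ⟨ha, c, hc, rfl⟩
    have h1 : f (a * c) = f a + f c :=
      (congrArg (IsDiscreteValuationRing.addVal (A.comap ι)) (Subtype.ext (hρmul a c) :
        (⟨ρ (a * c : A), hρA _ (a * c).2⟩ : A.comap ι) =
          ⟨ρ a, hρA a a.2⟩ * ⟨ρ c, hρA c c.2⟩)).trans IsDiscreteValuationRing.addVal_mul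
    have h2 : f a ≠ ⊤ := by
      intro h
      have h3 : ρ a = 0 := congrArg Subtype.val (IsDiscreteValuationRing.addVal_eq_top_iff.mp h)
      have h4 := hρ a
      rw [h3, map_zero] at h4
      exact ha (Subtype.ext (eq_zero_of_pow_eq_zero h4.symm))
    have h3 : f c ≠ 0 := by
      intro h
      refine hc ?_
      have h4 := IsDiscreteValuationRing.addVal_eq_zero_iff.mp h
      obtain ⟨⟨d, hd⟩, hd'⟩ := h4.exists_right_inv
      have h5 : ρ c * d = 1 := congrArg Subtype.val hd'
      have h6 : (c : F) ^ Q * ι d = 1 := by rw [← hρ, ← map_mul, h5, map_one]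
      have h7 : c ^ Q * ⟨ι d, hd⟩ = 1 := Subtype.ext h6
      exact (isUnit_pow_iff hQ).mp (IsUnit.of_mul_eq_one _ h7)
    rw [h1]
    exact (ENat.lt_add_one_iff h2).mpr le_rfl |>.trans_le (by gcongr; exact Order.one_le_iff_pos.mpr (pos_iff_ne_zero.mpr h3))
  have hwf : WfDvdMonoid A := ⟨Subrelation.wf (fun {a b} h => hf a b h)
    (InvImage.wf f wellFounded_lt)⟩
  have hpir : IsPrincipalIdealRing A := (IsBezout.TFAE.out 3 1).mp hwf
  exact { not_a_field' := by
            intro h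
            refine hA' (eq_top_iff.mpr fun z _ => ?_)
            rcases A.mem_or_inv_mem z with hz | hz
            · exact hz
            · have hf : IsField A := IsLocalRing.isField_iff_maximalIdeal_eq.mpr h
              by_cases h0 : z = 0
              · rw [h0]; exact A.zero_mem
              · obtain ⟨⟨d, hd⟩, h1⟩ := hf.mul_inv_cancel (a := ⟨z⁻¹, hz⟩)
                  (fun h => inv_ne_zero h0 (congrArg Subtype.val h))
                have h2 : z⁻¹ * d = 1 := congrArg Subtype.val h1
                rw [← inv_inv z, ← eq_inv_of_mul_eq_one_right h2]
                exact hd }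

/-- Distinct non-trivial valuation rings containing a Dedekind domain can be separated by an
integral element. -/
theorem exists_isIntegralElem_of_ne (hφ : φ.Finite) {A B : ValuationSubring F}
    (hA : ∀ r : R, φ (algebraMap R K r) ∈ A) (hB : ∀ r : R, φ (algebraMap R K r) ∈ B)
    (hA' : A ≠ ⊤) (hB' : B ≠ ⊤) (hAB : A ≠ B) :
    ∃ s : F, (φ.comp (algebraMap R K)).IsIntegralElem s ∧ A.valuation s < 1 ∧
      B.valuation s = 1 := by
  obtain ⟨E, C, _, _, _, _, _, ι, Q, hQ, hpow, hint⟩ := exists_dedekind_pow (R := R) hφ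
  obtain ⟨v, hv, hv'⟩ := exists_eq_valuationSubringAtPrime (C := C) (A := A.comap ι)
    (fun c => ValuationSubring.mem_comap.mpr (mem_of_isIntegralElem hA (hint c))) (comap_ne_top_of_pow hQ hpow hA')
  obtain ⟨w, hw, hw'⟩ := exists_eq_valuationSubringAtPrime (C := C) (A := B.comap ι)
    (fun c => ValuationSubring.mem_comap.mpr (mem_of_isIntegralElem hB (hint c))) (comap_ne_top_of_pow hQ hpow hB')
  -- A valuation ring of `F` is determined by its trace on `E`, since it contains `z` if and only if
  -- it contains `z ^ Q`. So distinct rings induce distinct primes of `C`.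
  have hvw : v ≠ w := by
    rintro rfl
    refine hAB (SetLike.ext fun z => ?_)
    obtain ⟨y, hy⟩ := hpow z
    have h1 : ∀ D : ValuationSubring F, z ∈ D ↔ y ∈ D.comap ι := fun D => by
      rw [ValuationSubring.mem_comap, hy]
      exact ⟨fun h => pow_mem h Q, mem_of_pow_mem hQ⟩
    rw [h1, h1, ← hv, ← hw]
  have hlt : ∀ (D : ValuationSubring F) (e : E), e ∈ D.comap ι →
      ((D.comap ι).valuation e < 1 ↔ D.valuation (ι e) < 1) := by
    intro D e he
    by_cases h0 : e = 0
    · simp [h0]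
    · rw [valuation_lt_one_iff_inv h0, valuation_lt_one_iff_inv ((map_ne_zero ι).mpr h0),
        ValuationSubring.mem_comap, map_inv₀]
  obtain ⟨c, hcv, hcw⟩ := SetLike.not_le_iff_exists.mp fun h : v.asIdeal ≤ w.asIdeal =>
    hvw (HeightOneSpectrum.ext (v.isMaximal.eq_of_le w.isPrime.ne_top h))
  have hcA : algebraMap C E c ∈ A.comap ι :=
    ValuationSubring.mem_comap.mpr (mem_of_isIntegralElem hA (hint c))
  have hcB : algebraMap C E c ∈ B.comap ι :=
    ValuationSubring.mem_comap.mpr (mem_of_isIntegralElem hB (hint c))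
  refine ⟨ι (algebraMap C E c), hint c, ?_, ?_⟩
  · rwa [← hlt A _ hcA, ← hv']
  · rw [hw', hlt B _ hcB] at hcw
    exact le_antisymm ((B.valuation_le_one_iff _).mpr hcB) (not_lt.mp hcw)

end ValuationSubrings
end IntegralModels

/-! ### `S`-integers as a Dedekind domain -/

namespace IntegralModels

section Arithmetic

variable {F : Type u} [Field F] {S : Set (Place F)}

theorem FinPlace.ring_ne_top (v : FinPlace F) : v.ring ≠ ⊤ := by
  intro h
  obtain ⟨π, -, -, hπ⟩ := v.exists_uniformizer
  exact hπ (h ▸ ValuationSubring.mem_top _)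

theorem mem_sIntegers {x : F} : x ∈ sIntegers S ↔ ∀ v : Outside S, x ∈ v.1.ring :=
  Subring.mem_iInf

theorem mem_placePt {v : Outside S} {r : sIntegers S} :
    r ∈ (placePt S v).asIdeal ↔ v.1.ring.valuation (r : F) < 1 := by
  have h1 : r ∈ (placePt S v).asIdeal ↔ ¬IsUnit (sIntegersMap S v r) :=
    IsLocalRing.mem_maximalIdeal (R := v.1.integers) _
  by_cases h0 : r = 0
  · simp [h0]
  · have h0' : (r : F) ≠ 0 := fun h => h0 (Subtype.ext h)
    rw [h1, valuation_lt_one_iff_inv h0', not_iff_not]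
    refine ⟨fun h => ?_, fun h => isUnit_sIntegersMap h0 h⟩
    obtain ⟨⟨c, hc⟩, h2⟩ := h.exists_right_inv
    have h3 : algebraMap F v.1.completion r * c = 1 := congrArg Subtype.val h2
    rw [v.1.mem_ring_iff, map_inv₀, ← eq_inv_of_mul_eq_one_right h3]
    exact hc

theorem mem_sIntegers_of_isIntegralElem {R : Type*} [CommRing R] {ψ : R →+* F}
    (hψ : ∀ r, ψ r ∈ sIntegers S) {x : F} (hx : ψ.IsIntegralElem x) : x ∈ sIntegers S :=
  mem_sIntegers.mpr fun v => mem_of_isIntegralElem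
    (fun r => mem_ring_of_mem_sIntegers (hψ r) v) hx

variable {R K : Type*} [CommRing R] [IsDedekindDomain R] [Field K] [Algebra R K]
  [IsFractionRing R K] {φ : K →+* F}

theorem exists_mem_sIntegers_separating (hφ : φ.Finite)
    (hR : ∀ r, φ (algebraMap R K r) ∈ sIntegers S) {v w : Outside S} (h : v ≠ w) :
    ∃ s ∈ sIntegers S, v.1.ring.valuation s < 1 ∧ w.1.ring.valuation s = 1 := by
  obtain ⟨s, h1, h2⟩ := exists_isIntegralElem_of_ne hφ
    (fun r => mem_ring_of_mem_sIntegers (hR r) v) (fun r => mem_ring_of_mem_sIntegers (hR r) w)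
    v.1.ring_ne_top w.1.ring_ne_top fun h' => h (Outside.ring_injective h')
  exact ⟨s, mem_sIntegers_of_isIntegralElem hR h1, h2⟩

/-- An `S`-integer which is a unit at one place, with prescribed zeros at finitely many others. -/
theorem exists_mem_sIntegers_valuation_le (hφ : φ.Finite)
    (hR : ∀ r, φ (algebraMap R K r) ∈ sIntegers S) (v : Outside S) {T : Set (Outside S)}
    (hT : T.Finite) (hv : v ∉ T) {b : F} (hb : b ≠ 0) :
    ∃ s ∈ sIntegers S, v.1.ring.valuation s = 1 ∧
      ∀ w ∈ T, w.1.ring.valuation s ≤ w.1.ring.valuation b := by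
  induction T, hT using Set.Finite.induction_on with
  | empty => exact ⟨1, one_mem _, map_one _, fun w hw => hw.elim⟩
  | @insert w T _ _ ih =>
    obtain ⟨s, h1, h2, h3⟩ := ih fun h => hv (Or.inr h)
    obtain ⟨t, h4, h5, h6⟩ := exists_mem_sIntegers_separating hφ hR (v := w) (w := v)
      fun h => hv (Or.inl h.symm)
    have := w.1.isDVR
    obtain ⟨N, hN⟩ := exists_pow_valuation_le h5 hb
    refine ⟨s * t ^ N, mul_mem h1 (pow_mem h4 N), by rw [map_mul, map_pow, h2, h6]; simp, ?_⟩
    rintro w' (rfl | hw')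
    · rw [map_mul]
      exact (mul_le_of_le_one_left' ((ValuationSubring.valuation_le_one_iff _ _).mpr
        (mem_ring_of_mem_sIntegers h1 w'))).trans (hN N le_rfl)
    · rw [map_mul]
      exact (mul_le_of_le_one_right' ((ValuationSubring.valuation_le_one_iff _ _).mpr
        (pow_mem (mem_ring_of_mem_sIntegers h4 w') N))).trans (h3 w' hw')

variable [IsGlobalField F]

/-- `x` has finitely many poles, none of them at `v`. An `S`-integer which is a unit at `v` and
vanishes to sufficiently high order at these poles clears them. -/
theorem exists_mul_mem_sIntegers (hφ : φ.Finite) (hR : ∀ r, φ (algebraMap R K r) ∈ sIntegers S)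
    {v : Outside S} {x : F} (hx : x ∈ v.1.ring) :
    ∃ s ∈ sIntegers S, v.1.ring.valuation s = 1 ∧ s * x ∈ sIntegers S := by
  by_cases h0 : x = 0
  · exact ⟨1, one_mem _, map_one _, by simp [h0, zero_mem]⟩
  obtain ⟨s, h1, h2, h3⟩ := exists_mem_sIntegers_valuation_le hφ hR v
    (Outside.finite_setOf_notMem x) (fun h => h hx) (inv_ne_zero h0)
  refine ⟨s, h1, h2, mem_sIntegers.mpr fun w => ?_⟩
  by_cases hw : x ∈ w.1.ring
  · exact mul_mem (mem_ring_of_mem_sIntegers h1 w) hw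
  · rw [← ValuationSubring.valuation_le_one_iff, map_mul]
    calc _ ≤ w.1.ring.valuation x⁻¹ * w.1.ring.valuation x := by gcongr; exact h3 w hw
      _ = 1 := by rw [← map_mul, inv_mul_cancel₀ h0, map_one]
      _ ≤ 1 := le_rfl

theorem isFractionRing_sIntegers (hφ : φ.Finite) (hR : ∀ r, φ (algebraMap R K r) ∈ sIntegers S)
    (v : Outside S) : IsFractionRing (sIntegers S) F := by
  have key : ∀ x ∈ v.1.ring, ∃ a b : sIntegers S, (b : F) ≠ 0 ∧ x = a / b := by
    intro x hx
    obtain ⟨s, h1, h2, h3⟩ := exists_mul_mem_sIntegers hφ hR hx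
    have h0 : s ≠ 0 := by rintro rfl; simp at h2
    exact ⟨⟨_, h3⟩, ⟨s, h1⟩, h0, (mul_div_cancel_left₀ x h0).symm⟩
  refine IsFractionRing.of_field _ _ fun x => ?_
  rcases v.1.ring.mem_or_inv_mem x with h | h
  · obtain ⟨a, b, -, h⟩ := key x h
    exact ⟨a, b, h⟩
  · obtain ⟨a, b, -, h⟩ := key _ h
    exact ⟨b, a, by rw [← inv_inv x, h, inv_div]; rfl⟩

omit [IsGlobalField F] in
theorem placePt_injective_of_finite (hφ : φ.Finite)
    (hR : ∀ r, φ (algebraMap R K r) ∈ sIntegers S) {v w : Outside S}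
    (h : (placePt S v).asIdeal ≤ (placePt S w).asIdeal) : v = w := by
  by_contra hvw
  obtain ⟨s, h1, h2, h3⟩ := exists_mem_sIntegers_separating hφ hR hvw
  exact (mem_placePt.mp (h (mem_placePt.mpr h2 : (⟨s, h1⟩ : sIntegers S) ∈ _))).ne h3

/-- `π` is a uniformizer of the valuation ring at `v`, made `S`-integral by a factor that is a unit
at `v`. -/
theorem exists_mem_placePt_le (hφ : φ.Finite) (hR : ∀ r, φ (algebraMap R K r) ∈ sIntegers S)
    (v : Outside S) : ∃ π : sIntegers S, π ≠ 0 ∧ π ∈ (placePt S v).asIdeal ∧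
      ∀ x ∈ (placePt S v).asIdeal, (x / π : F) ∈ v.1.ring := by
  have := v.1.isDVR
  obtain ⟨⟨ϖ, hϖ⟩, h⟩ := IsDiscreteValuationRing.exists_irreducible v.1.ring
  obtain ⟨s, h1, h2, h3⟩ := exists_mul_mem_sIntegers hφ hR hϖ
  have h0 : ϖ ≠ 0 := fun h' => h.ne_zero (Subtype.ext h')
  have hs0 : s ≠ 0 := by rintro rfl; simp at h2
  have h4 : v.1.ring.valuation (s * ϖ) = v.1.ring.valuation ϖ := by rw [map_mul, h2, one_mul]
  refine ⟨⟨s * ϖ, h3⟩, fun h' => mul_ne_zero hs0 h0 (congrArg Subtype.val h'), ?_, fun x hx => ?_⟩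
  · rw [mem_placePt]
    change v.1.ring.valuation (s * ϖ) < 1
    rw [h4]
    exact (valuation_lt_one_iff_not_isUnit _).mpr h.not_isUnit
  · rw [mem_placePt] at hx
    have hxA : (x : F) ∈ v.1.ring := mem_ring_of_mem_sIntegers x.2 v
    have h5 : (⟨x, hxA⟩ : v.1.ring) ∈ IsLocalRing.maximalIdeal v.1.ring :=
      (valuation_lt_one_iff_not_isUnit _).mp hx
    rw [h.maximalIdeal_eq, Ideal.mem_span_singleton] at h5
    obtain ⟨c, hc⟩ := h5
    have h6 : (x : F) = ϖ * c := congrArg Subtype.val hc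
    rw [← ValuationSubring.valuation_le_one_iff, map_div₀]
    change _ / v.1.ring.valuation (s * ϖ) ≤ 1
    rw [h4, h6, map_mul, mul_div_cancel_left₀ _ ((map_ne_zero _).mpr h0)]
    exact v.1.ring.valuation_le_one c

/-- `P` is dominated by a valuation ring `B` of `F`, which is discrete because `F` is finite over
the fraction field of a Dedekind domain inside `𝒪_S`. By `hS` no place in `S` has a valuation ring
containing `𝒪_S`, so `B` is a place `v` outside `S`. If `x` vanishes at `v` and `0 ≠ a ∈ P`, then `x
^ N / a` is integral at `v` for some `N`. Hence `s * x ^ N ∈ P` for some `s` that is a unit at `v`,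
and `x ∈ P`. -/
theorem exists_placePt_eq_of_isPrime (hφ : φ.Finite)
    (hR : ∀ r, φ (algebraMap R K r) ∈ sIntegers S)
    (hS : ∀ v : FinPlace F, Sum.inr v ∈ S → ∃ x ∈ sIntegers S, x ∉ v.ring)
    {P : Ideal (sIntegers S)} [hP : P.IsPrime] (hP0 : P ≠ ⊥) :
    ∃ v : Outside S, (placePt S v).asIdeal = P := by
  obtain ⟨B, hB, hPB⟩ := Ideal.image_subset_nonunits_valuationSubring P hP.ne_top
  have hlt : ∀ a ∈ P, B.valuation (a : F) < 1 := fun a ha => hPB ⟨a, ha, rfl⟩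
  obtain ⟨a, ha, ha0⟩ := Submodule.exists_mem_ne_zero_of_ne_bot hP0
  have ha0' : (a : F) ≠ 0 := fun h => ha0 (Subtype.ext h)
  have hB' : B ≠ ⊤ := by
    rintro rfl
    exact (valuation_lt_one_iff_inv ha0').mp (hlt a ha) (ValuationSubring.mem_top _)
  let v₀ : FinPlace F := ⟨B, isDiscreteValuationRing_of_ne_top hφ (fun r => hB (hR r)) hB'⟩
  have hv₀ : Sum.inr v₀ ∉ S := fun h => by
    obtain ⟨x, hx, hx'⟩ := hS v₀ h
    exact hx' (hB hx)
  let v : Outside S := ⟨v₀, hv₀⟩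
  have hle : P ≤ (placePt S v).asIdeal := fun x hx => mem_placePt.mpr (hlt x hx)
  refine ⟨v, le_antisymm (fun x hx => ?_) hle⟩
  have := v.1.isDVR
  obtain ⟨N, hN⟩ := exists_pow_valuation_le (mem_placePt.mp hx) ha0'
  have h1 : (x : F) ^ N / a ∈ v.1.ring := by
    rw [← ValuationSubring.valuation_le_one_iff, map_div₀]
    exact div_le_one_of_le₀ (hN N le_rfl) (zero_le)
  obtain ⟨s, h2, h3, h4⟩ := exists_mul_mem_sIntegers hφ hR h1
  have h5 : (⟨s, h2⟩ : sIntegers S) * x ^ N ∈ P := by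
    have : (⟨s, h2⟩ : sIntegers S) * x ^ N = a * ⟨_, h4⟩ := Subtype.ext (by
      change s * (x : F) ^ N = a * (s * ((x : F) ^ N / a))
      field_simp)
    rw [this]
    exact Ideal.mul_mem_right _ _ ha
  refine hP.mem_of_pow_mem N ((hP.mem_or_mem h5).resolve_left fun h => ?_)
  exact (mem_placePt.mp (hle h)).ne h3

/-- It suffices to show that primes are finitely generated. The prime of `v` is generated by a local
uniformizer `π` together with, for each of the finitely many other zeros `w` of `π`, an `S`-integer
that vanishes at `v` and is a unit at `w`. Dimension one and integral closedness follow from the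
description of primes and of `𝒪_S` by places. -/
theorem isDedekindDomain_sIntegers (hφ : φ.Finite) (hR : ∀ r, φ (algebraMap R K r) ∈ sIntegers S)
    (hS : ∀ v : FinPlace F, Sum.inr v ∈ S → ∃ x ∈ sIntegers S, x ∉ v.ring) (v₀ : Outside S) :
    IsDedekindDomain (sIntegers S) := by
  have := isFractionRing_sIntegers hφ hR v₀
  have hnoeth : IsNoetherianRing (sIntegers S) := by
    refine IsNoetherianRing.of_prime fun P hP => ?_
    by_cases hP0 : P = ⊥
    · rw [hP0]
      exact Submodule.fg_bot
    obtain ⟨v, rfl⟩ := exists_placePt_eq_of_isPrime hφ hR hS hP0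
    obtain ⟨π, hπ0, hπ, hdiv⟩ := exists_mem_placePt_le hφ hR v
    have hπ0' : (π : F) ≠ 0 := fun h => hπ0 (Subtype.ext h)
    have hfin : {w : Outside S | w ≠ v ∧ (π : F)⁻¹ ∉ w.1.ring}.Finite :=
      (Outside.finite_setOf_notMem _).subset fun w hw => hw.2
    choose y hy hyv hyw using fun w : {w : Outside S | w ≠ v ∧ (π : F)⁻¹ ∉ w.1.ring} =>
      exists_mem_sIntegers_separating hφ hR w.2.1.symm
    let y' : {w : Outside S | w ≠ v ∧ (π : F)⁻¹ ∉ w.1.ring} → sIntegers S := fun w => ⟨y w, hy w⟩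
    have := hfin.to_subtype
    have hfg : (Ideal.span (insert π (Set.range y'))).FG :=
      Submodule.fg_span ((Set.finite_range _).insert _)
    convert hfg using 1
    refine le_antisymm (fun x hx => ?_) ?_
    -- `J` is the ideal of denominators of `x` with respect to the proposed generators. It is
    -- contained in no maximal ideal: only zeros of `π` matter, and at each of them some element of
    -- `J` is a unit.
    · let J := (Ideal.span (insert π (Set.range y'))).colon {x}
      have hJ : ∀ s, s ∈ J ↔ s * x ∈ Ideal.span (insert π (Set.range y')) := fun s =>
        Submodule.mem_colon_singleton
      have hπJ : π ∈ J := (hJ _).mpr (Ideal.mul_mem_right _ _ (Ideal.subset_span (Or.inl rfl)))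
      have htop : J = ⊤ := by
        by_contra htop
        obtain ⟨M, hM, hle⟩ := J.exists_le_maximal htop
        obtain ⟨w, rfl⟩ := exists_placePt_eq_of_isPrime (P := M) hφ hR hS fun h =>
          hπ0 (by simpa [h] using hle hπJ)
        by_cases hwv : w = v
        · subst hwv
          obtain ⟨s, h1, h2, h3⟩ := exists_mul_mem_sIntegers hφ hR (hdiv x hx)
          have h4 : (⟨s, h1⟩ : sIntegers S) ∈ J := by
            rw [hJ]
            have : (⟨s, h1⟩ : sIntegers S) * x = π * ⟨_, h3⟩ := Subtype.ext (by
              change s * (x : F) = π * (s * (x / π))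
              field_simp)
            rw [this]
            exact Ideal.mul_mem_right _ _ (Ideal.subset_span (Or.inl rfl))
          exact (mem_placePt.mp (hle h4)).ne h2
        · have hw : (π : F)⁻¹ ∉ w.1.ring :=
            (valuation_lt_one_iff_inv hπ0').mp (mem_placePt.mp (hle hπJ))
          have h4 : y' ⟨w, hwv, hw⟩ ∈ J :=
            (hJ _).mpr (Ideal.mul_mem_right _ _ (Ideal.subset_span (Or.inr ⟨_, rfl⟩)))
          exact (mem_placePt.mp (hle h4)).ne (hyw ⟨w, hwv, hw⟩)
      have := (hJ 1).mp (htop ▸ Submodule.mem_top)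
      rwa [one_mul] at this
    · rw [Ideal.span_le]
      rintro _ (rfl | ⟨w, rfl⟩)
      · exact hπ
      · exact mem_placePt.mpr (hyv w)
  have hdim : Ring.DimensionLEOne (sIntegers S) := ⟨fun {P} hP0 hP => by
    obtain ⟨v, rfl⟩ := exists_placePt_eq_of_isPrime hφ hR hS hP0
    obtain ⟨M, hM, hle⟩ := (placePt S v).asIdeal.exists_le_maximal (placePt S v).isPrime.ne_top
    obtain ⟨w, rfl⟩ := exists_placePt_eq_of_isPrime (P := M) hφ hR hS fun h =>
      hP0 (eq_bot_iff.mpr (h ▸ hle))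
    rwa [placePt_injective_of_finite hφ hR hle]⟩
  have hic : IsIntegrallyClosed (sIntegers S) := (isIntegrallyClosed_iff F).mpr fun {x} hx =>
    ⟨⟨x, mem_sIntegers_of_isIntegralElem (ψ := algebraMap (sIntegers S) F) (fun r => r.2) hx⟩, rfl⟩
  exact { }

omit [IsGlobalField F] in
-- Euclid's argument. A product `ρ` of non-zero elements of `R` vanishes at every place of `S` whose
-- ring contains `R`. A valuation ring containing `R` in which `1 + ρ * c` is not a unit is then a
-- place outside `S`. A place at which no non-zero element of `R` vanishes would contain the
-- fraction field of `R`, hence all of `F`.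
theorem nonempty_outside_of_finite (hfin : S.Finite) (hφ : φ.Finite)
    (hR' : ∀ r : R, r ≠ 0 → ∃ c, 1 + r * c ≠ 0 ∧ ¬IsUnit (1 + r * c)) : Nonempty (Outside S) := by
  have hinj : Function.Injective (φ.comp (algebraMap R K)) :=
    φ.injective.comp (IsFractionRing.injective R K)
  have key : ∀ v : FinPlace F, ∃ r : R, r ≠ 0 ∧ ((∀ r : R, φ (algebraMap R K r) ∈ v.ring) →
      v.ring.valuation (φ (algebraMap R K r)) < 1) := by
    intro v
    by_contra! h
    have hv := (h 1 one_ne_zero).1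
    refine v.ring_ne_top (eq_top_iff.mpr fun z _ => ?_)
    refine mem_of_isIntegralElem (ψ := φ) (fun k => ?_) (hφ.to_isIntegral z)
    obtain ⟨a, b, hb, rfl⟩ := IsFractionRing.div_surjective (A := R) k
    rw [map_div₀, div_eq_mul_inv]
    have hb0 := nonZeroDivisors.ne_zero hb
    refine mul_mem (hv a) ?_
    by_contra h'
    exact ((valuation_lt_one_iff_inv ((map_ne_zero_iff _ hinj).mpr hb0)).mpr h').not_ge (h b hb0).2
  choose r hr0 hr using key
  have hfin' : {v : FinPlace F | Sum.inr v ∈ S}.Finite :=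
    hfin.preimage Sum.inr_injective.injOn
  let ρ := ∏ v ∈ hfin'.toFinset, r v
  have hρ0 : ρ ≠ 0 := Finset.prod_ne_zero_iff.mpr fun v _ => hr0 v
  obtain ⟨c, hc0, hc⟩ := hR' ρ hρ0
  let ψ := (φ.comp (algebraMap R K)).rangeRestrict
  obtain ⟨B, hB, hIB⟩ := Ideal.image_subset_nonunits_valuationSubring
    (Ideal.span {ψ (1 + ρ * c)}) fun h => by
      rw [Ideal.span_singleton_eq_top] at h
      obtain ⟨⟨_, d, rfl⟩, hd⟩ := h.exists_right_inv
      refine hc (IsUnit.of_mul_eq_one d (hinj ?_))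
      rw [map_mul, map_one]
      exact congrArg Subtype.val hd
  have hlt : B.valuation (φ (algebraMap R K (1 + ρ * c))) < 1 :=
    hIB ⟨_, Ideal.mem_span_singleton_self _, rfl⟩
  have hRB : ∀ r : R, φ (algebraMap R K r) ∈ B := fun r => hB ⟨r, rfl⟩
  have hB' : B ≠ ⊤ := by
    rintro rfl
    exact (valuation_lt_one_iff_inv ((map_ne_zero_iff _ hinj).mpr hc0)).mp hlt
      (ValuationSubring.mem_top _)
  let v : FinPlace F := ⟨B, isDiscreteValuationRing_of_ne_top hφ hRB hB'⟩
  refine ⟨v, fun hv => ?_⟩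
  obtain ⟨d, hd⟩ : r v ∣ ρ * c :=
    (Finset.dvd_prod_of_mem r (hfin'.mem_toFinset.mpr hv)).mul_right c
  have h1 : B.valuation (φ (algebraMap R K (ρ * c))) < 1 := by
    rw [hd, map_mul, map_mul, map_mul]
    exact mul_lt_one_of_lt_of_le (hr v hRB) ((B.valuation_le_one_iff _).mpr (hRB d))
  have h2 : (1 : F) = φ (algebraMap R K (1 + ρ * c)) - φ (algebraMap R K (ρ * c)) := by
    rw [map_add, map_add, map_one, map_one, add_sub_cancel_right]
  have h3 : B.valuation 1 < 1 := by
    rw [h2]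
    exact Valuation.map_sub_lt _ hlt h1
  rw [map_one] at h3
  exact h3.false

end Arithmetic
end IntegralModels

/-! ### Function fields: relations over `k(s)` and dimension bounds -/

namespace IntegralModels

section FunctionField

open Polynomial IntermediateField
open scoped IntermediateField.algebraAdjoinAdjoin

variable {k F : Type*} [Field k] [Field F] [Algebra k F]

theorem aeval_mem_of_mem {N : Subalgebra k F} {s : F} (hs : s ∈ N) (p : k[X]) : aeval s p ∈ N :=
  (Algebra.adjoin_le (Set.singleton_subset_iff.mpr hs)) (aeval_mem_adjoin_singleton k s)

theorem aeval_eq_add_mul_divX (s : F) (p : k[X]) :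
    aeval s p = algebraMap k F (p.coeff 0) + s * aeval s p.divX := by
  conv_lhs => rw [← p.divX_mul_X_add]
  rw [map_add, map_mul, aeval_X, aeval_C, add_comm, mul_comm]

/-- A linear relation over `k(s)` can be chosen with polynomial coefficients, not all of them
divisible by `s`. -/
theorem exists_relation {s : F} (hs : s ≠ 0) [FiniteDimensional k⟮s⟯ F] {d : ℕ}
    (hd : Module.finrank k⟮s⟯ F = d) (y : Fin (d + 1) → F) :
    ∃ a : Fin (d + 1) → k[X], (∃ i, (a i).coeff 0 ≠ 0) ∧ ∑ i, aeval s (a i) * y i = 0 := by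
  have h1 : ¬LinearIndependent (Algebra.adjoin k {s}) y := by
    rw [LinearIndependent.iff_fractionRing (Algebra.adjoin k {s}) k⟮s⟯]
    intro h
    have := h.fintype_card_le_finrank
    simp [hd] at this
  obtain ⟨g, hg, i₀, hi₀⟩ := Fintype.not_linearIndependent_iff.mp h1
  have h2 : ∀ i, ∃ p : k[X], aeval s p = (g i : F) := fun i => by
    have := Algebra.adjoin_singleton_eq_range_aeval k s
    exact this.le (g i).2
  choose a ha using h2
  -- While all coefficients are divisible by `s`, the relation can be divided by `s`. The degree of
  -- the non-zero coefficient `a i₀` bounds the number of divisions.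
  have key : ∀ (n : ℕ) (a : Fin (d + 1) → k[X]), a i₀ ≠ 0 → (a i₀).natDegree ≤ n →
      ∑ i, aeval s (a i) * y i = 0 →
      ∃ a : Fin (d + 1) → k[X], (∃ i, (a i).coeff 0 ≠ 0) ∧ ∑ i, aeval s (a i) * y i = 0 := by
    intro n
    induction n with
    | zero =>
      intro a h0 hn h
      refine ⟨a, ⟨i₀, fun hc => h0 ?_⟩, h⟩
      rw [eq_C_of_natDegree_le_zero hn, hc, C_0]
    | succ n ih =>
      intro a h0 hn h
      by_cases hc : ∃ i, (a i).coeff 0 ≠ 0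
      · exact ⟨a, hc, h⟩
      push Not at hc
      have h3 : ∀ i, aeval s (a i) = s * aeval s (a i).divX := fun i => by
        rw [aeval_eq_add_mul_divX, hc i, map_zero, zero_add]
      refine ih (fun i => (a i).divX) (fun h4 => h0 ?_) ?_ ?_
      · rw [← (a i₀).divX_mul_X_add, h4, hc]
        simp
      · rw [natDegree_divX_eq_natDegree_tsub_one]
        omega
      · refine (mul_eq_zero.mp ?_).resolve_left hs
        rw [Finset.mul_sum, ← h]
        refine Finset.sum_congr rfl fun i _ => ?_
        rw [h3, mul_assoc]
  refine key _ a (fun h => hi₀ ?_) le_rfl ?_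
  · rw [← Subtype.coe_inj, ← ha, h, map_zero]
    rfl
  · rw [← hg]
    refine Finset.sum_congr rfl fun i _ => ?_
    rw [ha]
    rfl

theorem algebraMap_mem_valuation_eq_one {B : ValuationSubring F} (hB : ∀ c : k, algebraMap k F c ∈ B)
    {c : k} (hc : c ≠ 0) : B.valuation (algebraMap k F c) = 1 := by
  refine le_antisymm ((B.valuation_le_one_iff _).mpr (hB c)) (not_lt.mp fun h => ?_)
  rw [valuation_lt_one_iff_inv ((_root_.map_ne_zero _).mpr hc), ← map_inv₀] at h
  exact h (hB _)

/-- A ring which is not contained in a discrete valuation ring `B` has dimension less than the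
degree modulo a function vanishing at `B`. -/
theorem exists_sum_mem_of_not_mem {s : F} (hs : s ≠ 0) [FiniteDimensional k⟮s⟯ F] {d : ℕ}
    (hd : Module.finrank k⟮s⟯ F = d) {N : Subalgebra k F} (hsN : s ∈ N) {B : ValuationSubring F}
    [IsDiscreteValuationRing B] (hB : ∀ c : k, algebraMap k F c ∈ B) (hsB : B.valuation s < 1)
    {y₀ : F} (hy₀ : y₀ ∈ N) (hy₀B : y₀ ∉ B) (z : Fin d → F) (hz : ∀ i, z i ∈ N) :
    ∃ c : Fin d → k, c ≠ 0 ∧ ∃ w ∈ N, ∑ i, c i • z i = s * w := by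
  -- Suppose the `z i` are independent modulo `s`. For `y ∈ N`, a relation between `y` and the `z i`
  -- whose coefficients are not all divisible by `s` has a coefficient at `y` with non-zero constant
  -- term, that is, a unit of `B`. So the poles at `B` of all elements of `N` have order bounded by
  -- that of `s ^ e`, which the powers of `y₀` contradict.
  by_contra! H
  have hsB' : s ∈ B := (B.valuation_le_one_iff _).mp hsB.le
  have haev : ∀ p : k[X], aeval s p ∈ B := fun p => by
    have := aeval_mem_of_mem (N := { B.toSubring with algebraMap_mem' := hB }) hsB' p
    exact this
  obtain ⟨e, he⟩ : ∃ e : ℕ, ∀ i, s ^ e * z i ∈ B := by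
    have : ∀ i, ∀ᶠ e : ℕ in Filter.atTop, s ^ e * z i ∈ B := by
      intro i
      by_cases h0 : z i = 0
      · simp [h0, B.zero_mem]
      obtain ⟨N, hN⟩ := exists_pow_valuation_le hsB (inv_ne_zero h0)
      filter_upwards [Filter.eventually_ge_atTop N] with n hn
      rw [← B.valuation_le_one_iff, map_mul]
      calc _ ≤ B.valuation (z i)⁻¹ * B.valuation (z i) := by gcongr; exact hN n hn
        _ = 1 := by rw [← map_mul, inv_mul_cancel₀ h0, map_one]
        _ ≤ 1 := le_rfl
    exact (Filter.eventually_all.mpr this).exists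
  have key : ∀ y ∈ N, s ^ e * y ∈ B := by
    intro y hy
    obtain ⟨a, ⟨i₀, hi₀⟩, ha⟩ := exists_relation hs hd (Fin.cons y z)
    rw [Fin.sum_univ_succ] at ha
    simp only [Fin.cons_zero, Fin.cons_succ] at ha
    have h0 : (a 0).coeff 0 ≠ 0 := by
      intro h0
      have hsum : ∑ i : Fin d, (a i.succ).coeff 0 • z i = s * -((aeval s (a 0).divX) * y +
          ∑ i : Fin d, aeval s (a i.succ).divX * z i) := by
        have h1 : ∑ i : Fin d, aeval s (a i.succ) * z i = ∑ i : Fin d, (a i.succ).coeff 0 • z i +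
            s * ∑ i : Fin d, aeval s (a i.succ).divX * z i := by
          rw [Finset.mul_sum, ← Finset.sum_add_distrib]
          refine Finset.sum_congr rfl fun i _ => ?_
          rw [aeval_eq_add_mul_divX, Algebra.smul_def]
          ring
        rw [h1, aeval_eq_add_mul_divX, h0, map_zero] at ha
        linear_combination ha
      refine H _ ?_ _ (neg_mem (add_mem (mul_mem (aeval_mem_of_mem hsN _) hy)
        (sum_mem fun i _ => mul_mem (aeval_mem_of_mem hsN _) (hz i)))) hsum
      intro h1
      refine hi₀ ?_
      induction i₀ using Fin.cases with
      | zero => exact h0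
      | succ i => exact congrFun h1 i
    have h1 : B.valuation (aeval s (a 0)) = 1 := by
      rw [aeval_eq_add_mul_divX, Valuation.map_add_eq_of_lt_left,
        algebraMap_mem_valuation_eq_one hB h0]
      rw [algebraMap_mem_valuation_eq_one hB h0, map_mul]
      exact mul_lt_one_of_lt_of_le hsB ((B.valuation_le_one_iff _).mpr (haev _))
    have h2 : aeval s (a 0) * (s ^ e * y) = -∑ i : Fin d, aeval s (a i.succ) * (s ^ e * z i) := by
      have h3 : ∑ i : Fin d, aeval s (a i.succ) * (s ^ e * z i) =
          s ^ e * ∑ i : Fin d, aeval s (a i.succ) * z i := by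
        rw [Finset.mul_sum]
        exact Finset.sum_congr rfl fun i _ => by ring
      rw [h3]
      linear_combination s ^ e * ha
    have h3 : B.valuation (s ^ e * y) = B.valuation (aeval s (a 0) * (s ^ e * y)) := by
      rw [map_mul _ (aeval s (a 0)), h1, one_mul]
    rw [← B.valuation_le_one_iff, h3, h2, B.valuation_le_one_iff]
    exact neg_mem (sum_mem fun i _ => mul_mem (haev _) (he i))
  have hy0 : y₀ ≠ 0 := fun h => hy₀B (h ▸ B.zero_mem)
  have hlt : B.valuation y₀⁻¹ < 1 := by
    rw [valuation_lt_one_iff_inv (inv_ne_zero hy0), inv_inv]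
    exact hy₀B
  obtain ⟨n, hn⟩ := exists_pow_valuation_le hlt (pow_ne_zero (e + 1) hs)
  have h1 := key _ (pow_mem hy₀ n)
  rw [← B.valuation_le_one_iff] at h1
  have h2 : B.valuation (s ^ e * y₀ ^ n * y₀⁻¹ ^ n) ≤ B.valuation (s ^ e) * B.valuation s := by
    rw [map_mul, ← map_mul _ _ s, ← pow_succ]
    exact (mul_le_of_le_one_left' h1).trans (hn n le_rfl)
  rw [mul_assoc, ← mul_pow, mul_inv_cancel₀ hy0, one_pow, mul_one] at h2
  have h3 : 0 < B.valuation (s ^ e) := zero_lt_iff.mpr ((_root_.map_ne_zero _).mpr (pow_ne_zero _ hs))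
  exact (mul_lt_of_lt_one_right h3 hsB).not_ge h2

/-- The quotient of `A` by `A ⊓ B` embeds into `V ⧸ B`, and by hypothesis its image contains no `m +
1` independent vectors. -/
theorem finrank_le_add_of_forall_exists {V : Type*} [AddCommGroup V] [Module k V]
    (A B : Submodule k V) [FiniteDimensional k A] {m : ℕ}
    (h : ∀ z : Fin (m + 1) → V, (∀ i, z i ∈ A) → ∃ c : Fin (m + 1) → k, c ≠ 0 ∧
      ∑ i, c i • z i ∈ B) : Module.finrank k A ≤ Module.finrank k (A ⊓ B : Submodule k V) + m := by
  let f : A →ₗ[k] V ⧸ B := B.mkQ.comp A.subtype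
  have h1 := f.finrank_range_add_finrank_ker
  have h2 : Module.finrank k (LinearMap.ker f) = Module.finrank k (A ⊓ B : Submodule k V) := by
    have : LinearMap.ker f = B.comap A.subtype := by
      rw [LinearMap.ker_comp, Submodule.ker_mkQ]
    rw [this, ← Submodule.map_comap_subtype]
    exact (Submodule.equivMapOfInjective _ A.subtype_injective _).finrank_eq
  have h3 : Module.finrank k (LinearMap.range f) ≤ m := by
    by_contra! hlt
    obtain ⟨w, hw⟩ := exists_linearIndependent_of_le_finrank (R := k) (Nat.succ_le_of_lt hlt)
    choose z hz using fun i => (w i).2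
    obtain ⟨c, hc, hcB⟩ := h (fun i => z i) fun i => (z i).2
    refine hc (funext fun i => Fintype.linearIndependent_iff.mp hw c ?_ i)
    refine Subtype.ext ?_
    have h4 : f (∑ i, c i • z i) = 0 := by
      change B.mkQ _ = 0
      rw [← LinearMap.mem_ker, Submodule.ker_mkQ]
      simpa using hcB
    rw [map_sum] at h4
    simp only [map_smul, hz] at h4
    simpa using h4
  omega

end FunctionField
end IntegralModels

/-! ### Function fields: subrings `k[t]`, integral bases and constants -/

namespace IntegralModels

section FunctionField

open Polynomial IntermediateField
open scoped IntermediateField.algebraAdjoinAdjoin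

/-- As a quotient of `k[X]` this domain is a principal ideal ring, whether or not `t` is
transcendental. -/
theorem isDedekindDomain_adjoin_singleton {k F : Type*} [Field k] [Field F] [Algebra k F] (t : F) :
    IsDedekindDomain (Algebra.adjoin k {t}) := by
  let f : k[X] →ₐ[k] Algebra.adjoin k {t} :=
    aeval (⟨t, Algebra.self_mem_adjoin_singleton k t⟩ : Algebra.adjoin k {t})
  have hf : Function.Surjective f := by
    rintro ⟨x, hx⟩
    have hx' := (Algebra.adjoin_singleton_eq_range_aeval k t).le hx
    obtain ⟨p, rfl⟩ := hx'
    refine ⟨p, Subtype.ext ?_⟩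
    exact (Polynomial.aeval_algHom_apply (Algebra.adjoin k {t}).val _ p).symm
  have := IsPrincipalIdealRing.of_surjective f.toRingHom hf
  infer_instance

/-- In a function field of one variable, every transcendental element is separating up to a finite
extension. -/
theorem finiteDimensional_adjoin_simple {k F : Type*} [Field k] [Field F] [Algebra k F]
    [Algebra.EssFiniteType k F] (htr : Algebra.trdeg k F ≤ 1) {t : F} (ht : Transcendental k t) :
    FiniteDimensional k⟮t⟯ F := by
  have hb : IsTranscendenceBasis k (fun _ : Unit => t) :=
    AlgebraicIndependent.isTranscendenceBasis_of_lift_trdeg_le_of_finite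
      (algebraicIndependent_unique_type_iff.mpr ht) (by
        simpa using htr)
  have halg : Algebra.IsAlgebraic k⟮t⟯ F := by
    have := hb.isAlgebraic_field
    rwa [Set.range_const] at this
  have : Algebra.EssFiniteType k⟮t⟯ F := .of_comp k k⟮t⟯ F
  exact Algebra.finite_of_essFiniteType_of_isAlgebraic

theorem adjoin_simple_inv {k F : Type*} [Field k] [Field F] [Algebra k F] (t : F) :
    k⟮t⁻¹⟯ = k⟮t⟯ := by
  refine le_antisymm (adjoin_simple_le_iff.mpr (inv_mem (mem_adjoin_simple_self k t)))
    (adjoin_simple_le_iff.mpr ?_)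
  simpa using inv_mem (mem_adjoin_simple_self k t⁻¹)

variable {k : Type*} {F : Type u} [Field k] [Field F] [Algebra k F]

theorem adjoin_singleton_mem {A : ValuationSubring F} (hA : ∀ c : k, algebraMap k F c ∈ A) {t : F}
    (ht : t ∈ A) (r : Algebra.adjoin k {t}) : algebraMap k⟮t⟯ F (algebraMap _ _ r) ∈ A :=
  Algebra.adjoin_le (S := { A.toSubring with algebraMap_mem' := hA })
    (Set.singleton_subset_iff.mpr ht) r.2

theorem transcendental_of_notMem {A : ValuationSubring F} (hA : ∀ c : k, algebraMap k F c ∈ A)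
    {t : F} (ht : t ∉ A) : Transcendental k t := fun h =>
  ht (mem_of_isIntegralElem (ψ := algebraMap k F) hA (isAlgebraic_iff_isIntegral.mp h))

theorem isDiscreteValuationRing_of_mem {t : F} [FiniteDimensional k⟮t⟯ F] {A : ValuationSubring F}
    (hA : ∀ c : k, algebraMap k F c ∈ A) (ht : t ∈ A) (hA' : A ≠ ⊤) :
    IsDiscreteValuationRing A := by
  have := isDedekindDomain_adjoin_singleton (k := k) t
  exact isDiscreteValuationRing_of_ne_top (R := Algebra.adjoin k {t}) (K := k⟮t⟯)
    (RingHom.finite_algebraMap.mpr inferInstance) (adjoin_singleton_mem hA ht) hA'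

/-- A basis over `k(t)` consisting of elements integral over `k[t]`. -/
theorem exists_linearIndependent_isIntegral (t : F) [FiniteDimensional k⟮t⟯ F] :
    ∃ b : Fin (Module.finrank k⟮t⟯ F) → F, LinearIndependent k⟮t⟯ b ∧
      ∀ i, IsIntegral (Algebra.adjoin k {t}) (b i) := by
  let b := Module.finBasis k⟮t⟯ F
  have halg : Algebra.IsAlgebraic (Algebra.adjoin k {t}) F :=
    Algebra.IsAlgebraic.trans (Algebra.adjoin k {t}) k⟮t⟯ F
  choose c hc0 hc using fun i => (halg.isAlgebraic (b i)).exists_integral_multiple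
  have hc' : ∀ i, algebraMap (Algebra.adjoin k {t}) k⟮t⟯ (c i) ≠ 0 := fun i =>
    (map_ne_zero_iff _ (FaithfulSMul.algebraMap_injective _ _)).mpr (hc0 i)
  refine ⟨fun i => c i • b i, ?_, hc⟩
  have := b.linearIndependent.units_smul fun i => Units.mk0 _ (hc' i)
  convert this using 1
  funext i
  exact (algebraMap_smul k⟮t⟯ (c i) (b i)).symm

/-- A non-zero element without poles has no zeros. -/
theorem valuation_eq_one_of_forall_mem (hk : ∀ (A : ValuationSubring F) (c : k), algebraMap k F c ∈ A)
    {t : F} (ht : Transcendental k t) [Algebra.EssFiniteType k F] (htr : Algebra.trdeg k F ≤ 1)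
    {z : F} (hz0 : z ≠ 0) (hz : ∀ v : FinPlace F, z ∈ v.ring) (v : FinPlace F) :
    v.ring.valuation z = 1 := by
  have := finiteDimensional_adjoin_simple htr ht
  have hti : Transcendental k t⁻¹ := fun h => ht (by simpa using h.inv)
  have := finiteDimensional_adjoin_simple htr hti
  -- Each non-trivial valuation ring of `F` contains `t` or `t⁻¹` and is therefore discrete, that
  -- is, a place. So `z` lies in all valuation rings and is algebraic over `k`; then `z⁻¹` is
  -- algebraic too and has no poles either.
  have h1 : z ∈ (integralClosure k F).toSubring := by
    have : IsIntegrallyClosedIn (integralClosure k F).toSubring F :=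
      inferInstanceAs (IsIntegrallyClosedIn (integralClosure k F) F)
    rw [Subring.eq_iInf_of_isIntegrallyClosedIn (R := (integralClosure k F).toSubring),
      Subring.mem_iInf]
    rintro ⟨A, -⟩
    change z ∈ A
    by_cases hA : A = ⊤
    · rw [hA]
      exact ValuationSubring.mem_top _
    rcases A.mem_or_inv_mem t with h | h
    · exact hz ⟨A, isDiscreteValuationRing_of_mem (hk A) h hA⟩
    · exact hz ⟨A, isDiscreteValuationRing_of_mem (hk A) h hA⟩
  have h2 : IsIntegral k z⁻¹ := IsIntegral.inv h1
  refine le_antisymm ((ValuationSubring.valuation_le_one_iff _ _).mpr (hz v)) (not_lt.mp fun h => ?_)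
  rw [valuation_lt_one_iff_inv hz0] at h
  exact h (mem_of_isIntegralElem (ψ := algebraMap k F) (hk v.ring) h2)

end FunctionField
end IntegralModels

/-! ### Function fields: functions with a pole at a single place -/

namespace IntegralModels

section FunctionField

open Polynomial IntermediateField
open scoped IntermediateField.algebraAdjoinAdjoin

variable {k : Type*} {F : Type u} [Field k] [Field F] [Algebra k F]

/-- The functions without poles in a given set of places. -/
def regularOn (hk : ∀ (A : ValuationSubring F) (c : k), algebraMap k F c ∈ A)
    (T : Set (FinPlace F)) : Subalgebra k F where
  carrier := {z | ∀ v ∈ T, z ∈ v.ring}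
  mul_mem' ha hb v hv := mul_mem (ha v hv) (hb v hv)
  add_mem' ha hb v hv := add_mem (ha v hv) (hb v hv)
  algebraMap_mem' c v _ := hk v.ring c

theorem linearIndependent_pow_mul {t : F} (ht : Transcendental k t) {d : ℕ} {b : Fin d → F}
    (hb : LinearIndependent k⟮t⟯ b) (n : ℕ) :
    LinearIndependent k fun p : Fin n × Fin d => t ^ (p.1 : ℕ) * b p.2 := by
  have h1 : LinearIndependent k fun i : Fin n => AdjoinSimple.gen k t ^ (i : ℕ) := by
    have h2 : LinearIndependent k fun i : ℕ => t ^ i := by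
      have h3 := (Polynomial.basisMonomials k).linearIndependent.map'
        (aeval (R := k) t).toLinearMap
        (LinearMap.ker_eq_bot.mpr (transcendental_iff_injective.mp ht))
      have h4 : (fun i : ℕ => t ^ i) =
          (aeval (R := k) t).toLinearMap ∘ Polynomial.basisMonomials k := by
        funext i
        simp [← X_pow_eq_monomial]
      rw [h4]
      exact h3
    have h4 : LinearIndependent k fun i : ℕ => AdjoinSimple.gen k t ^ i :=
      LinearIndependent.of_comp k⟮t⟯.val.toLinearMap (by exact h2)
    exact h4.comp _ Fin.val_injective
  exact linearIndependent_smul h1 hb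

/-- In a function field of one variable, there are functions with a pole at one place only. -/
theorem exists_notMem_forall_mem [IsGlobalField F] [Algebra.EssFiniteType k F]
    (hk : ∀ (A : ValuationSubring F) (c : k), algebraMap k F c ∈ A)
    (htr : Algebra.trdeg k F ≤ 1) (v₀ : FinPlace F) :
    ∃ x : F, x ∉ v₀.ring ∧ ∀ v : FinPlace F, v ≠ v₀ → x ∈ v.ring := by
  obtain ⟨π, hπ0, hπ, hπ'⟩ := v₀.exists_uniformizer
  have hlt : v₀.ring.valuation π < 1 := (valuation_lt_one_iff_inv hπ0).mpr hπ'
  have ht : Transcendental k π⁻¹ := transcendental_of_notMem (hk v₀.ring) hπ'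
  have hs : Transcendental k π := fun h => ht h.inv
  have := finiteDimensional_adjoin_simple htr ht
  have := finiteDimensional_adjoin_simple htr hs
  have := isDedekindDomain_adjoin_singleton (k := k) π
  have := v₀.isDVR
  obtain ⟨m, hm⟩ : ∃ m, Module.finrank k⟮π⟯ F = m + 1 :=
    Nat.exists_eq_succ_of_ne_zero Module.finrank_pos.ne'
  have hfin : {v : FinPlace F | v ≠ v₀ ∧ π⁻¹ ∉ v.ring}.Finite := by
    refine Set.Finite.subset ((finite_poles π⁻¹).preimage (f := FinPlace.ring) ?_) fun v hv => hv.2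
    rintro ⟨A, _⟩ _ ⟨B, _⟩ _ (rfl : A = B)
    rfl
  -- `N` consists of the functions regular at the zeros of `π` other than `v₀`. Since `N` contains a
  -- function with a pole at `v₀`, the quotient of `N` by `π N` has dimension at most `m`, one less
  -- than the degree of `F` over `k(π)`.
  let N := regularOn hk {v : FinPlace F | v ≠ v₀ ∧ π⁻¹ ∉ v.ring}
  have hπN : π ∈ N := fun v hv => by
    simpa using (v.ring.mem_or_inv_mem π⁻¹).resolve_left hv.2
  obtain ⟨y₀, hy₀N, hy₀⟩ : ∃ y₀ ∈ N, y₀ ∉ v₀.ring := by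
    -- `S` collects the poles of `π`, so that `k[π]` consists of `S`-integers. The function `y₀` is
    -- `σ / π`, where `σ` is a unit at `v₀` and cancels the other zeros of `π`.
    let S : Set (Place F) := {p | ∃ v, p = Sum.inr v ∧ π ∉ v.ring}
    have hout : ∀ v : FinPlace F, π ∈ v.ring → Sum.inr v ∉ S := by
      rintro v hv ⟨w, h, hw⟩
      obtain rfl := Sum.inr_injective h
      exact hw hv
    have hmem : ∀ w : Outside S, π ∈ w.1.ring := fun w => by
      by_contra h
      exact w.2 ⟨_, rfl, h⟩
    obtain ⟨σ, -, h2, h3⟩ := exists_mem_sIntegers_valuation_le (S := S)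
      (R := Algebra.adjoin k {π}) (φ := algebraMap k⟮π⟯ F)
      (RingHom.finite_algebraMap.mpr inferInstance)
      (fun r => mem_sIntegers.mpr fun w => adjoin_singleton_mem (hk w.1.ring) (hmem w) r)
      ⟨v₀, hout v₀ hπ⟩ (T := {w | w.1 ≠ v₀ ∧ π⁻¹ ∉ w.1.ring})
      (hfin.preimage Subtype.val_injective.injOn) (fun h => h.1 rfl) hπ0
    refine ⟨σ / π, fun v hv => ?_, fun h => ?_⟩
    · have h4 := h3 ⟨v, hout v (hπN v hv)⟩ hv
      rw [← ValuationSubring.valuation_le_one_iff, map_div₀]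
      exact div_le_one_of_le₀ h4 zero_le
    · rw [← ValuationSubring.valuation_le_one_iff, map_div₀] at h
      have h5 : v₀.ring.valuation σ = 1 := h2
      rw [h5, one_div, inv_le_one₀ (zero_lt_iff.mpr ((_root_.map_ne_zero _).mpr hπ0))] at h
      exact h.not_gt hlt
  let Nj : ℕ → Submodule k F := fun j =>
    (Subalgebra.toSubmodule N).comap (LinearMap.mulLeft k (π ^ j))
  -- The space `Nj j` is `π⁻ʲ N`. Descending from it to `N` takes `j` steps, each of which loses at
  -- most `m` dimensions.
  have hstep : ∀ (j : ℕ) (A : Submodule k F) [FiniteDimensional k A], A ≤ Nj j →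
      Module.finrank k A ≤
        Module.finrank k (A ⊓ Subalgebra.toSubmodule N : Submodule k F) + j * m := by
    intro j
    induction j with
    | zero =>
      intro A _ hA
      rw [inf_of_le_left fun a ha => by simpa [Nj] using hA ha]
      simp
    | succ j ih =>
      intro A _ hA
      have h1 := finrank_le_add_of_forall_exists A (Nj j) (m := m) fun z hz => by
        obtain ⟨c, hc, w, hw, hcw⟩ := exists_sum_mem_of_not_mem hπ0 hm hπN (hk v₀.ring) hlt hy₀N hy₀
          (fun i => π ^ (j + 1) * z i) fun i => hA (hz i)
        refine ⟨c, hc, ?_⟩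
        have h2 : π ^ j * ∑ i, c i • z i = w := by
          refine mul_left_cancel₀ hπ0 ?_
          rw [← hcw, Finset.mul_sum, Finset.mul_sum]
          refine Finset.sum_congr rfl fun i _ => ?_
          rw [mul_smul_comm, mul_smul_comm, pow_succ', mul_assoc]
        change π ^ j * ∑ i, c i • z i ∈ N
        rwa [h2]
      have h2 := ih (A ⊓ Nj j) inf_le_right
      have h3 : Module.finrank k (A ⊓ Nj j ⊓ Subalgebra.toSubmodule N : Submodule k F) ≤
          Module.finrank k (A ⊓ Subalgebra.toSubmodule N : Submodule k F) :=
        Submodule.finrank_mono (inf_le_inf_right _ inf_le_left)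
      rw [add_mul, one_mul]
      omega
  obtain ⟨b, hb, hbint⟩ : ∃ b : Fin (m + 1) → F, LinearIndependent k⟮π⁻¹⟯ b ∧
      ∀ i, IsIntegral (Algebra.adjoin k {π⁻¹}) (b i) := by
    have h1 := exists_linearIndependent_isIntegral (k := k) π⁻¹
    have h2 : Module.finrank k⟮π⁻¹⟯ F = m + 1 := by rw [adjoin_simple_inv, hm]
    rwa [h2] at h1
  obtain ⟨c, hc⟩ : ∃ c : ℕ, ∀ i, π ^ c * b i ∈ N := by
    refine (Filter.eventually_all.mpr fun i => (?_ : ∀ᶠ c : ℕ in Filter.atTop, _)).exists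
    refine (Filter.eventually_all_finite hfin).mpr fun v hv => ?_
    have := v.isDVR
    obtain ⟨n, hn⟩ := exists_pow_valuation_le ((valuation_lt_one_iff_inv hπ0).mpr hv.2)
      (inv_ne_zero (hb.ne_zero i))
    filter_upwards [Filter.eventually_ge_atTop n] with e he
    rw [← ValuationSubring.valuation_le_one_iff, map_mul]
    calc _ ≤ v.ring.valuation (b i)⁻¹ * v.ring.valuation (b i) := by gcongr; exact hn e he
      _ = 1 := by rw [← map_mul, inv_mul_cancel₀ (hb.ne_zero i), map_one]
      _ ≤ 1 := le_rfl
  -- The space `Λ` below has dimension `(n + 1) * (m + 1)` and lies in `π⁻⁽ⁿ⁺ᶜ⁾ N`, so it meets `N`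
  -- in dimension at least `(n + 1) * (m + 1) - (n + c) * m = n + 1 + m - c * m`. With this `n` the
  -- bound is `m + 2`. Elements of `Λ` have poles only at zeros of `π`, hence elements of `Λ ∩ N`
  -- have poles at `v₀` at most.
  obtain ⟨n, hn⟩ : ∃ n, n = c * m + 1 := ⟨_, rfl⟩
  let g : Fin (n + 1) × Fin (m + 1) → F := fun p => π⁻¹ ^ (p.1 : ℕ) * b p.2
  let Λ := Submodule.span k (Set.range g)
  have : FiniteDimensional k Λ := FiniteDimensional.span_of_finite k (Set.finite_range g)
  have hΛ : Module.finrank k Λ = (n + 1) * (m + 1) := by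
    rw [finrank_span_eq_card (linearIndependent_pow_mul ht hb (n + 1))]
    simp
  have hΛN : Λ ≤ Nj (n + c) := by
    rw [Submodule.span_le]
    rintro _ ⟨⟨i, j⟩, rfl⟩
    change π ^ (n + c) * (π⁻¹ ^ (i : ℕ) * b j) ∈ N
    have h1 : π ^ (n + c) * (π⁻¹ ^ (i : ℕ) * b j) = π ^ (n - i) * (π ^ c * b j) := by
      rw [show n + c = n - i + c + i by omega, pow_add, pow_add, inv_pow]
      field_simp
    rw [h1]
    exact mul_mem (pow_mem hπN _) (hc j)
  have hΛreg : ∀ z ∈ Λ, ∀ v : FinPlace F, π⁻¹ ∈ v.ring → z ∈ v.ring := by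
    intro z hz v hv
    have h1 : Λ ≤ Subalgebra.toSubmodule (regularOn hk {v}) := by
      rw [Submodule.span_le]
      rintro _ ⟨⟨i, j⟩, rfl⟩ _ rfl
      refine mul_mem (pow_mem hv _) ?_
      exact mem_of_isIntegralElem (ψ := algebraMap (Algebra.adjoin k {π⁻¹}) F)
        (fun r => adjoin_singleton_mem (hk _) hv r) (hbint j)
    exact h1 hz v rfl
  by_contra! H
  have hreg : ∀ z ∈ Λ ⊓ Subalgebra.toSubmodule N, ∀ v : FinPlace F, z ∈ v.ring := by
    rintro z ⟨hz, hzN⟩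
    have h1 : ∀ v : FinPlace F, v ≠ v₀ → z ∈ v.ring := fun v hv => by
      by_cases h : π⁻¹ ∈ v.ring
      · exact hΛreg z hz v h
      · exact hzN v ⟨hv, h⟩
    intro v
    by_cases hv : v = v₀
    · rw [hv]
      by_contra h
      obtain ⟨v, h2, h3⟩ := H z h
      exact h3 (h1 v h2)
    · exact h1 v hv
  have hrank : m + 2 ≤ Module.finrank k (Λ ⊓ Subalgebra.toSubmodule N : Submodule k F) := by
    have := hstep (n + c) Λ hΛN
    rw [hΛ, hn] at this
    nlinarith
  -- If `Λ ∩ N` had no poles at all, then `m + 2` independent elements of it would satisfy a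
  -- relation over `k[π]` whose constant terms do not all vanish. These constant terms give a
  -- non-zero function without poles that is divisible by `π`, so it has a zero at `v₀`, which is
  -- impossible.
  obtain ⟨w, hw⟩ := exists_linearIndependent_of_le_finrank hrank
  obtain ⟨a, ⟨i₀, hi₀⟩, ha⟩ := exists_relation hπ0 hm fun i => (w i : F)
  have hne : ∑ i, (a i).coeff 0 • w i ≠ 0 := fun h =>
    hi₀ (Fintype.linearIndependent_iff.mp hw _ h i₀)
  have hval := valuation_eq_one_of_forall_mem hk hs htr (fun h => hne (Subtype.ext h))
    (hreg _ (∑ i, (a i).coeff 0 • w i).2) v₀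
  have hz : ((∑ i, (a i).coeff 0 • w i : (Λ ⊓ Subalgebra.toSubmodule N : Submodule k F)) : F) =
      π * -∑ i, aeval π (a i).divX * w i := by
    have h1 : ∑ i, aeval π (a i) * (w i : F) = ∑ i, (a i).coeff 0 • (w i : F) +
        π * ∑ i, aeval π (a i).divX * w i := by
      rw [Finset.mul_sum, ← Finset.sum_add_distrib]
      refine Finset.sum_congr rfl fun i _ => ?_
      rw [aeval_eq_add_mul_divX, Algebra.smul_def]
      ring
    rw [Submodule.coe_sum]
    simp only [Submodule.coe_smul]
    linear_combination ha - h1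
  rw [hz, map_mul] at hval
  refine (mul_lt_one_of_lt_of_le hlt ((ValuationSubring.valuation_le_one_iff _ _).mpr
    (neg_mem (sum_mem fun i _ => mul_mem ?_ (hreg _ (w i).2 v₀))))).ne hval
  have := aeval_mem_of_mem (N := regularOn hk {v₀}) (s := π) (fun v hv => by
    rw [Set.mem_singleton_iff.mp hv]; exact hπ) (a i).divX
  exact this v₀ rfl

end FunctionField
end IntegralModels

/-! ### The `S`-integers of a global field -/

namespace IntegralModels

section

variable {F : Type u} [Field F] {S : Set (Place F)}

/-- By finiteness of the class group some power of the prime of `v₀` is principal. The inverse of a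
generator has its only pole at `v₀`. -/
theorem exists_pole_mem_sIntegers_of_numberField [NumberField F]
    {v₀ : FinPlace F} (hv₀ : Sum.inr v₀ ∈ S) : ∃ x ∈ sIntegers S, x ∉ v₀.ring := by
  have hR : ∀ (A : ValuationSubring F) (r : NumberField.RingOfIntegers F),
      algebraMap (NumberField.RingOfIntegers F) F r ∈ A := fun A r =>
    mem_of_isIntegralElem (ψ := algebraMap ℤ F) (by simp) r.2
  obtain ⟨P, hP, hPm⟩ := exists_eq_valuationSubringAtPrime (hR v₀.ring) v₀.ring_ne_top
  have hPmem : P.asIdeal ∈ nonZeroDivisors (Ideal (NumberField.RingOfIntegers F)) :=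
    mem_nonZeroDivisors_of_ne_zero P.ne_bot
  obtain ⟨a, ha⟩ : (P.asIdeal ^ Fintype.card
      (ClassGroup (NumberField.RingOfIntegers F))).IsPrincipal := by
    rw [← ClassGroup.mk0_eq_one_iff (pow_mem hPmem _), ← SubmonoidClass.mk_pow _ hPmem, map_pow,
      pow_card_eq_one]
  have haP : a ∈ P.asIdeal := by
    refine Ideal.pow_le_self (n := Fintype.card (ClassGroup (NumberField.RingOfIntegers F)))
      Fintype.card_ne_zero ?_
    rw [ha]
    exact Ideal.mem_span_singleton_self a
  have ha0 : a ≠ 0 := by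
    rintro rfl
    refine pow_ne_zero _ P.ne_bot (ha.trans ?_)
    simp
  have ha0' : algebraMap (NumberField.RingOfIntegers F) F a ≠ 0 := by simpa using ha0
  refine ⟨(algebraMap _ F a)⁻¹, mem_sIntegers.mpr fun v => ?_,
    (valuation_lt_one_iff_inv ha0').mp ((hPm a).mp haP)⟩
  by_contra h
  obtain ⟨Q, hQ, hQm⟩ := exists_eq_valuationSubringAtPrime (hR v.1.ring) v.1.ring_ne_top
  have haQ := (hQm a).mpr ((valuation_lt_one_iff_inv ha0').mpr h)
  have hle : P.asIdeal ≤ Q.asIdeal := by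
    have := Q.isPrime
    refine Ideal.IsPrime.le_of_pow_le (n := Fintype.card (ClassGroup _)) (ha.le.trans ?_)
    exact (Ideal.span_singleton_le_iff_mem _).mpr haQ
  have heq : P = Q := HeightOneSpectrum.ext (P.isMaximal.eq_of_le Q.isPrime.ne_top hle)
  obtain ⟨⟨A, hA⟩, hv⟩ := v
  obtain ⟨B, hB⟩ := v₀
  refine hv ?_
  have : A = B := by
    rw [← show _ = A from hQ, ← show _ = B from hP, heq]
  subst this
  exact hv₀

theorem exists_finite_numberField [NumberField F] :
    ∃ (R K : Type u) (_ : CommRing R) (_ : IsDedekindDomain R) (_ : Field K) (_ : Algebra R K)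
      (_ : IsFractionRing R K) (φ : K →+* F), φ.Finite ∧
      (∀ r, φ (algebraMap R K r) ∈ sIntegers S) :=
  ⟨NumberField.RingOfIntegers F, F, inferInstance, inferInstance, inferInstance, inferInstance,
    inferInstance, RingHom.id F, RingHom.Finite.id F, fun r => mem_sIntegers.mpr fun v =>
      mem_of_isIntegralElem (ψ := algebraMap ℤ F) (by simp) r.2⟩

open Polynomial IntermediateField in
open scoped IntermediateField.algebraAdjoinAdjoin in
-- There are no Archimedean places in positive characteristic, so `S` contains a finite place `v₀`.
-- A function `x` with its only pole at `v₀` is a transcendental `S`-integer, and the required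
-- Dedekind domain is `𝔽_p[x]`.
theorem exists_finite_functionField [IsGlobalField F] (p : ℕ) [Fact p.Prime]
    [Algebra (RatFunc (ZMod p)) F] [FiniteDimensional (RatFunc (ZMod p)) F] (hne : S.Nonempty) :
    (∃ (R K : Type u) (_ : CommRing R) (_ : IsDedekindDomain R) (_ : Field K) (_ : Algebra R K)
      (_ : IsFractionRing R K) (φ : K →+* F), φ.Finite ∧
      (∀ r, φ (algebraMap R K r) ∈ sIntegers S)) ∧
    ∀ v : FinPlace F, Sum.inr v ∈ S → ∃ x ∈ sIntegers S, x ∉ v.ring := by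
  let _ : Algebra (ZMod p) F :=
    ((algebraMap (RatFunc (ZMod p)) F).comp (algebraMap (ZMod p) (RatFunc (ZMod p)))).toAlgebra
  have : IsScalarTower (ZMod p) (RatFunc (ZMod p)) F := .of_algebraMap_eq' rfl
  let _ : Algebra (ZMod p)[X] F :=
    ((algebraMap (RatFunc (ZMod p)) F).comp (algebraMap (ZMod p)[X] (RatFunc (ZMod p)))).toAlgebra
  have : IsScalarTower (ZMod p)[X] (RatFunc (ZMod p)) F := .of_algebraMap_eq' rfl
  have : IsScalarTower (ZMod p) (ZMod p)[X] F := .of_algebraMap_eq' <| by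
    rw [IsScalarTower.algebraMap_eq (ZMod p)[X] (RatFunc (ZMod p)) F, RingHom.comp_assoc,
      ← IsScalarTower.algebraMap_eq]
    rfl
  have : FaithfulSMul (ZMod p)[X] F := (faithfulSMul_iff_algebraMap_injective _ _).mpr <|
    (algebraMap (RatFunc (ZMod p)) F).injective.comp (IsFractionRing.injective _ _)
  have hk : ∀ (A : ValuationSubring F) (c : ZMod p), algebraMap (ZMod p) F c ∈ A := by
    intro A c
    obtain ⟨m, rfl⟩ := ZMod.natCast_zmod_surjective c
    simp
  have : Algebra.EssFiniteType (ZMod p) F := by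
    have : Algebra.EssFiniteType (ZMod p)[X] (RatFunc (ZMod p)) :=
      .of_isLocalization _ (nonZeroDivisors (ZMod p)[X])
    have : Algebra.EssFiniteType (ZMod p) (RatFunc (ZMod p)) := .comp _ (ZMod p)[X] _
    exact .comp _ (RatFunc (ZMod p)) _
  have htr : Algebra.trdeg (ZMod p) F ≤ 1 := by
    have : Algebra.IsAlgebraic (ZMod p)[X] F :=
      (IsFractionRing.comap_isAlgebraic_iff (K := RatFunc (ZMod p))).mpr inferInstance
    have h := lift_trdeg_add_eq (ZMod p) (ZMod p)[X] F
    rw [Polynomial.trdeg_of_isDomain, trdeg_eq_zero] at h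
    have h2 : Algebra.trdeg (ZMod p) F = 1 := by simpa using h.symm
    exact h2.le
  have key : ∀ v : FinPlace F, Sum.inr v ∈ S → ∃ x ∈ sIntegers S, x ∉ v.ring := by
    intro v hv
    obtain ⟨x, h1, h2⟩ := exists_notMem_forall_mem hk htr v
    exact ⟨x, mem_sIntegers.mpr fun w => h2 _ fun h => w.2 (h ▸ hv), h1⟩
  refine ⟨?_, key⟩
  obtain ⟨v₀, hv₀⟩ : ∃ v₀ : FinPlace F, Sum.inr v₀ ∈ S := by
    obtain ⟨w | v, hw⟩ := hne
    · have h1 : (p : ℂ) = 0 := by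
        rw [← map_natCast w.embedding, ← map_natCast (algebraMap (ZMod p) F)]
        simp
      exact ((Fact.out : p.Prime).ne_zero (by exact_mod_cast h1)).elim
    · exact ⟨v, hw⟩
  obtain ⟨x, hx, hxv⟩ := key v₀ hv₀
  have := finiteDimensional_adjoin_simple htr (transcendental_of_notMem (hk v₀.ring) hxv)
  exact ⟨Algebra.adjoin (ZMod p) {x}, (ZMod p)⟮x⟯, inferInstance,
    isDedekindDomain_adjoin_singleton x, inferInstance, inferInstance, inferInstance,
    algebraMap _ F, RingHom.finite_algebraMap.mpr inferInstance, fun r =>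
      mem_sIntegers.mpr fun v => adjoin_singleton_mem (hk v.1.ring) (mem_sIntegers.mp hx v) r⟩

variable [h : IsGlobalField F]

/-- The `S`-integers contain a Dedekind domain over whose fraction field `F` is finite. -/
theorem exists_finite_of_nonempty (hne : S.Nonempty) :
    (∃ (R K : Type u) (_ : CommRing R) (_ : IsDedekindDomain R) (_ : Field K) (_ : Algebra R K)
      (_ : IsFractionRing R K) (φ : K →+* F), φ.Finite ∧
      (∀ r, φ (algebraMap R K r) ∈ sIntegers S)) ∧
    ∀ v : FinPlace F, Sum.inr v ∈ S → ∃ x ∈ sIntegers S, x ∉ v.ring := by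
  rcases h.out with h | ⟨p, hp, alg, hfin⟩
  · exact ⟨exists_finite_numberField, fun v => exists_pole_mem_sIntegers_of_numberField⟩
  · exact exists_finite_functionField p hne

open Polynomial in
theorem nonempty_outside (hfin : S.Finite) : Nonempty (Outside S) := by
  rcases h.out with h | ⟨p, hp, alg, hF⟩
  -- The element becomes `1 + 2 * r ^ 2 ≥ 3`, which is not a unit of `ℤ`. For polynomials, `1 + r *
  -- X` has positive degree.
  · refine nonempty_outside_of_finite hfin (φ := algebraMap ℚ F)
      (RingHom.finite_algebraMap.mpr h.to_finiteDimensional) (R := ℤ) fun r hr => ⟨2 * r, ?_, ?_⟩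
    · nlinarith [mul_self_nonneg r]
    · rw [Int.isUnit_iff]
      have : 0 < r * r := mul_self_pos.mpr hr
      rintro (h | h) <;> nlinarith
  · refine nonempty_outside_of_finite hfin (φ := algebraMap (RatFunc (ZMod p)) F)
      (RingHom.finite_algebraMap.mpr hF) (R := (ZMod p)[X]) fun r hr => ⟨X, ?_⟩
    have h1 : (1 + r * X).natDegree = r.natDegree + 1 := by
      rw [add_comm, ← C_1, natDegree_add_C, natDegree_mul_X hr]
    refine ⟨fun h2 => ?_, fun h2 => ?_⟩
    · rw [h2, natDegree_zero] at h1
      omega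
    · rw [natDegree_eq_zero_of_isUnit h2] at h1
      omega

end

section

variable {F : Type u} [Field F] [IsGlobalField F] {S : Set (Place F)}

theorem sIntegers_isDedekindDomain (hfin : S.Finite) (hne : S.Nonempty) :
    IsDedekindDomain (sIntegers S) := by
  obtain ⟨⟨R, K, _, _, _, _, _, φ, hφ, hR⟩, hS⟩ := exists_finite_of_nonempty hne
  exact isDedekindDomain_sIntegers hφ hR hS (nonempty_outside hfin).some

theorem sIntegers_isFractionRing (hfin : S.Finite) (hne : S.Nonempty) :
    IsFractionRing (sIntegers S) F := by
  obtain ⟨⟨R, K, _, _, _, _, _, φ, hφ, hR⟩, -⟩ := exists_finite_of_nonempty hne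
  exact isFractionRing_sIntegers hφ hR (nonempty_outside hfin).some

theorem placePt_ne_genPt (hne : S.Nonempty) (v : Outside S) :
    placePt S v ≠ genPt (sIntegers S) := by
  obtain ⟨⟨R, K, _, _, _, _, _, φ, hφ, hR⟩, -⟩ := exists_finite_of_nonempty hne
  obtain ⟨π, h0, h1, -⟩ := exists_mem_placePt_le hφ hR v
  intro h
  rw [h] at h1
  exact h0 h1

theorem placePt_injective (hne : S.Nonempty) : Function.Injective (placePt S) := fun v w h => by
  obtain ⟨⟨R, K, _, _, _, _, _, φ, hφ, hR⟩, -⟩ := exists_finite_of_nonempty hne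
  exact placePt_injective_of_finite hφ hR (h ▸ le_rfl)

theorem exists_placePt_eq (hne : S.Nonempty) {q : Spec (.of (sIntegers S))}
    (hq : q ≠ genPt (sIntegers S)) : ∃ v, placePt S v = q := by
  obtain ⟨⟨R, K, _, _, _, _, _, φ, hφ, hR⟩, hS⟩ := exists_finite_of_nonempty hne
  have := q.isPrime
  obtain ⟨v, hv⟩ := exists_placePt_eq_of_isPrime hφ hR hS (P := q.asIdeal)
    fun h => hq (PrimeSpectrum.ext h)
  exact ⟨v, PrimeSpectrum.ext hv⟩

end
end IntegralModels

/-! ### Integral models form a basis of the adelic topology -/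

namespace IntegralModels

open Limits Topology

section Basis

variable {F : Type u} [Field F] [IsGlobalField F] {S : Set (Place F)} {X : Over (Spec (.of F))}

/-- The `𝒪_v`-points of a flat model inside the local points. -/
def FlatModel.localPts (M : FlatModel (sIntegers S) X.hom) (v : Outside S) :
    Set (LocalPoints X v.1) :=
  {z | IsIntegralPt M (sIntegersMap S v) v.1.integers.subtype z.pt}

omit [IsGlobalField F] in
theorem FlatModel.isOpen_localPts (M : FlatModel (sIntegers S) X.hom) (v : Outside S) :
    IsOpen (M.localPts v) :=
  isOpen_setOf_isIntegralPt M (subtype_comp_sIntegersMap v)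

/-- Non-zero primes are places, and an integral point at `v` meets the fibre over the prime of `v`.
Surjectivity is thus automatic for models with integral points at all places. -/
theorem FlatModel.surjective_str (hfin : S.Finite) (hne : S.Nonempty)
   
    (M : FlatModel (sIntegers S) X.hom) (z : ∀ v : Outside S, LocalPoints X v.1)
    (hz : ∀ v, z v ∈ M.localPts v) : Surjective M.str := by
  have := sIntegers_isFractionRing hfin hne
  refine ⟨fun q => ?_⟩
  by_cases hq : q = genPt (sIntegers S)
  · obtain ⟨v⟩ := nonempty_outside hfin
    rw [hq]
    exact ⟨M.gen ((z v).pt (closedPt v.1.completion)), M.mem_range_gen.mp ⟨_, rfl⟩⟩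
  · obtain ⟨v, rfl⟩ := exists_placePt_eq hne hq
    obtain ⟨w, hw, -⟩ := hz v
    refine ⟨w (closedPt v.1.integers), ?_⟩
    rw [← Scheme.Hom.comp_apply, hw]
    rfl

/-- The modification procedure in terms of places, with `P` recording what is demanded of the local
model inserted at `v`. -/
theorem FlatModel.exists_modification_at_places (hfin : S.Finite) (hne : S.Nonempty)
    [IsSeparated X.hom] (Y : FlatModel (sIntegers S) X.hom) [IsSeparated Y.str] {I : Set (Outside S)} (hI : I.Finite)
    (P : Outside S → ∀ (W : Scheme.{u}) (j : W ⟶ X.left),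
      FlatModel (sIntegers S) (j ≫ X.hom) → Prop)
    (hP : ∀ v ∈ I, ∃ (W : Scheme.{u}) (j : W ⟶ X.left) (Z : FlatModel (sIntegers S) (j ≫ X.hom)),
      IsOpenImmersion j ∧ IsSeparated Z.str ∧ P v W j Z) :
    ∃ Y' : FlatModel (sIntegers S) X.hom, IsSeparated Y'.str ∧
      (∀ v ∈ I, ∃ (W : Scheme.{u}) (j : W ⟶ X.left) (Z : FlatModel (sIntegers S) (j ≫ X.hom)),
        P v W j Z ∧ AgreesAt (placePt S v) j Z Y') ∧
      ∀ v ∉ I, AgreesAt (placePt S v) (𝟙 _) Y Y' := by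
  have := sIntegers_isFractionRing hfin hne
  have := sIntegers_isDedekindDomain hfin hne
  have : X.left.IsSeparated := isSeparated_of_str X.hom
  have hall : ∀ q : Spec (.of (sIntegers S)), ∃ (W : Scheme.{u}) (j : W ⟶ X.left)
      (Z : FlatModel (sIntegers S) (j ≫ X.hom)), IsOpenImmersion j ∧ IsSeparated Z.str ∧
      ∀ v ∈ I, placePt S v = q → P v W j Z := by
    intro q
    by_cases h : ∃ v ∈ I, placePt S v = q
    · obtain ⟨v, hv, rfl⟩ := h
      obtain ⟨W, j, Z, h1, h2, h3⟩ := hP v hv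
      refine ⟨W, j, Z, h1, h2, fun v' _ h => ?_⟩
      obtain rfl := placePt_injective hne h
      exact h3
    -- At primes where nothing is to be inserted, `Y` itself serves as a filler value.
    · refine ⟨X.left, 𝟙 _, Y.congr (Category.id_comp _).symm, inferInstance,
        (inferInstance : IsSeparated Y.str), fun v hv hq => (h ⟨v, hv, hq⟩).elim⟩
  choose W j Z hj hZ hPZ using hall
  obtain ⟨Y', hY', h1, h2⟩ := Y.exists_modifications (hI.image (placePt S)) (by
    rintro ⟨v, -, hv⟩
    exact placePt_ne_genPt hne v hv) j Z hZ
  refine ⟨Y', hY', fun v hv => ⟨_, _, _, hPZ _ v hv rfl, h1 _ ⟨v, hv, rfl⟩⟩, fun v hv => h2 _ ?_⟩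
  rintro ⟨v', hv', h⟩
  exact hv (placePt_injective hne h ▸ hv')

omit [IsGlobalField F] in
theorem AgreesAt.localPts_eq {Y Y' : FlatModel (sIntegers S) X.hom} {v : Outside S}
    (h : AgreesAt (placePt S v) (𝟙 _) Y Y') : Y'.localPts v = Y.localPts v := by
  ext z
  refine (isIntegralPt_iff_of_agreesAt h (Category.id_comp _) rfl).trans ?_
  constructor
  · rintro ⟨z', hz', h⟩
    rw [Category.comp_id] at hz'
    subst hz'
    exact h
  · exact fun h => ⟨_, Category.comp_id _, h⟩

/-- Modifying a model at finitely many places so that its integral points at these places lie in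
prescribed neighbourhoods. -/
theorem FlatModel.exists_localPts_subset (hfin : S.Finite) (hne : S.Nonempty)
    [IsSeparated X.hom]
    [LocallyOfFiniteType X.hom]
    (Y : FlatModel (sIntegers S) X.hom) [IsSeparated Y.str] {I : Set (Outside S)} (hI : I.Finite)
    (z : ∀ v : Outside S, LocalPoints X v.1) (U : ∀ v : Outside S, Set (LocalPoints X v.1))
    (hU : ∀ v ∈ I, IsOpen (U v)) (hzU : ∀ v ∈ I, z v ∈ U v) :
    ∃ Y' : FlatModel (sIntegers S) X.hom, IsSeparated Y'.str ∧
      (∀ v ∈ I, z v ∈ Y'.localPts v ∧ Y'.localPts v ⊆ U v) ∧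
      ∀ v ∉ I, Y'.localPts v = Y.localPts v := by
  have := sIntegers_isFractionRing hfin hne
  have := sIntegers_isDedekindDomain hfin hne
  obtain ⟨Y', hY', h1, h2⟩ := Y.exists_modification_at_places hfin hne hI
    (fun v W j Z => (∃ z₀, z₀ ≫ j = (z v).pt ∧
        IsIntegralPt Z (sIntegersMap S v) v.1.integers.subtype z₀) ∧
      ∀ (z' : LocalPoints X v.1) (z₁ : Spec (.of v.1.completion) ⟶ W), z₁ ≫ j = z'.pt →
        IsIntegralPt Z (sIntegersMap S v) v.1.integers.subtype z₁ → z' ∈ U v)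
    (fun v hv => exists_chart (subtype_comp_sIntegersMap v) (z v) (hU v hv) (hzU v hv))
  refine ⟨Y', hY', fun v hv => ?_, fun v hv => (h2 v hv).localPts_eq⟩
  obtain ⟨W, j, Z, ⟨h3, h4⟩, h5⟩ := h1 v hv
  refine ⟨(isIntegralPt_iff_of_agreesAt h5 rfl rfl).mpr h3, fun z' hz' => ?_⟩
  obtain ⟨z₁, h6, h7⟩ := (isIntegralPt_iff_of_agreesAt h5 rfl rfl).mp hz'
  exact h4 z' z₁ h6 h7

omit [IsGlobalField F] in
theorem IntegralModel.localIntegralPoints_eq (Y : IntegralModel X S) (v : Outside S) :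
    Y.localIntegralPoints v = Y.flatModel.localPts v :=
  Set.ext fun z => Y.mem_localIntegralPoints_iff v z

omit [IsGlobalField F] in
instance (Y : IntegralModel X S) : IsSeparated Y.flatModel.str := Y.separated

omit [IsGlobalField F] in
theorem IntegralModel.isSeparated_scheme (Y : IntegralModel X S) :
    Y.flatModel.scheme.IsSeparated :=
  isSeparated_of_str Y.flatModel.str

/-- Any separated model can be modified at finitely many places to a model `Y₁` for which `z` is
integral everywhere. On the box of `Y₁` the set `U` is open for the product topology, so near `z` it
imposes conditions at finitely many places only. A second modification at these places gives
integral points inside `U`. -/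
theorem exists_integralModel_of_isOpen (hfin : S.Finite) (hne : S.Nonempty)
    [IsSeparated X.hom]
    [LocallyOfFiniteType X.hom] [QuasiCompact X.hom] {U : Set (AdelicPoints X S)} (hU : IsOpen U)
    {z : AdelicPoints X S} (hz : z ∈ U) :
    ∃ Y : IntegralModel X S, z ∈ Y.integralPoints ∧ Y.integralPoints ⊆ U := by
  have := sIntegers_isFractionRing hfin hne
  have := sIntegers_isDedekindDomain hfin hne
  obtain ⟨Y₀, hY₀⟩ := exists_separated_model (sIntegers S) X.hom
  have : Y₀.scheme.IsSeparated := isSeparated_of_str Y₀.str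
  obtain ⟨Y₁, hY₁, h1, h2⟩ := Y₀.exists_localPts_subset hfin hne
    (z.finite_not_isIntegralPt Y₀) z.component (fun _ => Set.univ) (fun _ _ => isOpen_univ)
    (fun _ _ => trivial)
  have hz₁ : ∀ v, z.component v ∈ Y₁.localPts v := by
    intro v
    by_cases hv : z.component v ∈ Y₀.localPts v
    · rw [h2 v (fun h => h hv)]
      exact hv
    · exact (h1 v hv).1
  let M₁ := Y₁.integralModel hY₁ (Y₁.surjective_str hfin hne z.component hz₁)
  have hM₁ : ∀ v, M₁.localIntegralPoints v = Y₁.localPts v := fun v =>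
    Set.ext fun z => Y₁.mem_localIntegralPoints_integralModel _ _ v z
  have hopen : ∀ (T : Set (Place F)) (_ : T.Finite) (h : S ⊆ T) (Y : IntegralModel X T),
      IsOpen[TopologicalSpace.coinduced (Subtype.val : adelicBox h Y → AdelicPoints X S)
      (TopologicalSpace.induced (fun z v => z.1.component v)
        (Pi.topologicalSpace (ι := Outside S) (Y := fun v => LocalPoints X v.1)))] U := by
    have h := hU
    unfold AdelicPoints.instTopologicalSpace at h
    simpa only [isOpen_iSup_iff] using h
  have h3 := hopen S hfin subset_rfl M₁
  rw [isOpen_coinduced, isOpen_induced_iff] at h3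
  obtain ⟨O, hO, hOU⟩ := h3
  have hbox : ∀ z' : AdelicPoints X S, (∀ v, z'.component v ∈ Y₁.localPts v) →
      z' ∈ adelicBox subset_rfl M₁ := by
    intro z' h v
    change z'.component v ∈ M₁.localIntegralPoints v
    rw [hM₁]
    exact h v
  have hzO : z.component ∈ O := by
    have : (⟨z, hbox z hz₁⟩ : adelicBox subset_rfl M₁) ∈
        (fun z : adelicBox subset_rfl M₁ => fun v => z.1.component v) ⁻¹' O := by
      rw [hOU]; exact hz
    exact this
  obtain ⟨I, u, hu, huO⟩ := isOpen_pi_iff.mp hO _ hzO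
  -- Intersecting with the integral points of `Y₁` keeps the new integral points in the box of `Y₁`,
  -- the only region where `O` describes `U`.
  obtain ⟨Y₂, hY₂, h4, h5⟩ := Y₁.exists_localPts_subset hfin hne I.finite_toSet z.component
    (fun v => u v ∩ Y₁.localPts v) (fun v hv => (hu v hv).1.inter (Y₁.isOpen_localPts v))
    (fun v hv => ⟨(hu v hv).2, hz₁ v⟩)
  have hz₂ : ∀ v, z.component v ∈ Y₂.localPts v := by
    intro v
    by_cases hv : v ∈ I
    · exact (h4 v hv).1
    · rw [h5 v hv]; exact hz₁ v
  refine ⟨Y₂.integralModel hY₂ (Y₂.surjective_str hfin hne z.component hz₂),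
    fun v => (Y₂.mem_localIntegralPoints_integralModel _ _ v _).mpr (hz₂ v), fun z' hz' => ?_⟩
  have hz'₂ : ∀ v, z'.component v ∈ Y₂.localPts v := fun v =>
    (Y₂.mem_localIntegralPoints_integralModel _ _ v _).mp (hz' v)
  have hz'₁ : ∀ v, z'.component v ∈ Y₁.localPts v := by
    intro v
    by_cases hv : v ∈ I
    · exact ((h4 v hv).2 (hz'₂ v)).2
    · rw [← h5 v hv]; exact hz'₂ v
  have : (⟨z', hbox z' hz'₁⟩ : adelicBox subset_rfl M₁) ∈
      (fun z : adelicBox subset_rfl M₁ => fun v => z.1.component v) ⁻¹' O :=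
    huO fun v hv => ((h4 v hv).2 (hz'₂ v)).1
  rw [hOU] at this
  exact this

/-- In the box of a model `Z` over `𝒪_T`, points are integral for `Z` outside `T`, hence integral
for `Y` there with finitely many exceptions. Integrality for `Y` at the exceptions and at the places
of `T` is a finite number of open conditions. -/
theorem IntegralModel.isOpen_integralPoints (hne : S.Nonempty) (Y : IntegralModel X S) :
    IsOpen Y.integralPoints := by
  have hopen : ∀ (T : Set (Place F)) (_ : T.Finite) (h : S ⊆ T) (Z : IntegralModel X T),
      IsOpen[TopologicalSpace.coinduced (Subtype.val : adelicBox h Z → AdelicPoints X S)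
      (TopologicalSpace.induced (fun z v => z.1.component v)
        (Pi.topologicalSpace (ι := Outside S) (Y := fun v => LocalPoints X v.1)))]
        Y.integralPoints := by
    intro T hT h Z
    have := sIntegers_isFractionRing hT (hne.mono h)
    have := sIntegers_isDedekindDomain hT (hne.mono h)
    have hle : sIntegers S ≤ sIntegers T := by
      intro x hx
      rw [sIntegers, Subring.mem_iInf]
      exact fun v => mem_ring_of_mem_sIntegers hx (v.incl h)
    let _ : Algebra (sIntegers S) (sIntegers T) := (Subring.inclusion hle).toAlgebra
    have : IsScalarTower (sIntegers S) (sIntegers T) F := .of_algebraMap_eq' rfl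
    have := Y.isSeparated_scheme
    obtain ⟨r, hr, hrY⟩ := exists_isIntegralPt_of_isIntegralPt Z.flatModel Y.flatModel
      (Category.id_comp _)
    rw [isOpen_coinduced, isOpen_induced_iff]
    let I : Set (Outside S) := {v | (r : F)⁻¹ ∉ v.1.ring} ∪ {v | Sum.inr v.1 ∈ T}
    have hI : I.Finite := by
      refine (Outside.finite_setOf_notMem _).union ?_
      refine hT.preimage (f := fun v : Outside S => (Sum.inr v.1 : Place F)) ?_
      intro v _ w _ e
      exact Subtype.ext (Sum.inr_injective e)
    refine ⟨I.pi fun v => Y.localIntegralPoints v, isOpen_set_pi hI fun v _ => ?_, ?_⟩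
    · rw [Y.localIntegralPoints_eq]
      exact Y.flatModel.isOpen_localPts v
    · ext ⟨z, hz⟩
      refine ⟨fun hI v => ?_, fun h v _ => h v⟩
      by_cases hv : v ∈ I
      · exact hI v hv
      · have hvT : Sum.inr v.1 ∉ T := fun h => hv (Or.inr h)
        have hvr : (r : F)⁻¹ ∈ v.1.ring := by
          by_contra h
          exact hv (Or.inl h)
        have h1 : IsIntegralPt Z.flatModel (sIntegersMap T ⟨v.1, hvT⟩) v.1.integers.subtype
            (z.component v).pt := (Z.mem_localIntegralPoints_iff ⟨v.1, hvT⟩ _).mp (hz ⟨v.1, hvT⟩)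
        rw [Y.mem_localIntegralPoints_iff]
        have hu : IsUnit (sIntegersMap T ⟨v.1, hvT⟩ r) := isUnit_sIntegersMap hr hvr
        have e : (sIntegersMap T ⟨v.1, hvT⟩).comp (algebraMap (sIntegers S) (sIntegers T)) =
            sIntegersMap S v := RingHom.ext fun _ => Subtype.ext rfl
        have h2 := hrY e hu h1
        rw [Category.comp_id] at h2
        exact h2
  unfold AdelicPoints.instTopologicalSpace
  simpa only [isOpen_iSup_iff] using hopen

theorem isTopologicalBasis_integralPoints (hfin : S.Finite) (hne : S.Nonempty)
    [IsSeparated X.hom]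
    [LocallyOfFiniteType X.hom] [QuasiCompact X.hom] :
    TopologicalSpace.IsTopologicalBasis
      (Set.range fun Y : IntegralModel X S => Y.integralPoints) := by
  refine TopologicalSpace.isTopologicalBasis_of_isOpen_of_nhds ?_ ?_
  · rintro _ ⟨Y, rfl⟩
    exact Y.isOpen_integralPoints hne
  · intro z U hz hU
    obtain ⟨Y, h1, h2⟩ := exists_integralModel_of_isOpen hfin hne hU hz
    exact ⟨_, ⟨Y, rfl⟩, h1, h2⟩

end Basis
end IntegralModels

/-! ### Group structures from division morphisms -/

namespace IntegralModels

section GroupObject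

open MonoidalCategory CartesianMonoidalCategory Functor
open scoped Obj MonObj

/-- A division morphism and a unit that induce a group structure after applying a functor which is
faithful on the relevant morphisms define a group structure. -/
theorem exists_grpObj_of_div {C D : Type*} [Category C] [Category D] [CartesianMonoidalCategory C]
    [CartesianMonoidalCategory D] (Φ : C ⥤ D) [Φ.Monoidal] {G : C} {X : D} [GrpObj X]
    (e : Φ.obj G ≅ X) (P : C → Prop) (hP1 : P (𝟙_ C)) (hPG : P G)
    (hPt : ∀ A B, P A → P B → P (A ⊗ B))
    (hinj : ∀ T, P T → ∀ f g : T ⟶ G, Φ.map f = Φ.map g → f = g) (d : G ⊗ G ⟶ G)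
    (hd : Φ.map d ≫ e.hom = (Φ.map (fst G G) ≫ e.hom) / (Φ.map (snd G G) ≫ e.hom))
    (o : 𝟙_ C ⟶ G) (ho : Φ.map o ≫ e.hom = 1) :
    ∃ _ : GrpObj G, IsMonHom e.hom := by
  have hext : ∀ T, P T → ∀ f g : T ⟶ G, Φ.map f ≫ e.hom = Φ.map g ≫ e.hom → f = g :=
    fun T hT f g h => hinj T hT f g ((cancel_mono e.hom).mp h)
  have hdiv : ∀ {T : C} (f g : T ⟶ G), Φ.map (lift f g ≫ d) ≫ e.hom =
      (Φ.map f ≫ e.hom) / (Φ.map g ≫ e.hom) := by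
    intro T f g
    rw [Φ.map_comp, Category.assoc, hd, GrpObj.comp_div, ← Category.assoc, ← Category.assoc,
      ← Φ.map_comp, ← Φ.map_comp, lift_fst, lift_snd]
  have hone : ∀ T : C, Φ.map (toUnit T ≫ o) ≫ e.hom = 1 := by
    intro T
    rw [Φ.map_comp, Category.assoc, ho, MonObj.comp_one]
  -- Multiplication is `x / (1 / y)` and inversion is `1 / y`. Each axiom equates two morphisms into
  -- `G` with source satisfying `P`, so it can be verified after applying `Φ`, in the groups of
  -- morphisms into `X`.
  let m : G ⊗ G ⟶ G := lift (fst G G) (lift (toUnit _ ≫ o) (snd G G) ≫ d) ≫ d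
  have hm : Φ.map m ≫ e.hom = (Φ.map (fst G G) ≫ e.hom) * (Φ.map (snd G G) ≫ e.hom) := by
    rw [hdiv, hdiv, hone, one_div, div_inv_eq_mul]
  have hmul : ∀ {T : C} (f : T ⟶ G ⊗ G), Φ.map (f ≫ m) ≫ e.hom =
      (Φ.map (f ≫ fst G G) ≫ e.hom) * (Φ.map (f ≫ snd G G) ≫ e.hom) := by
    intro T f
    rw [Φ.map_comp, Category.assoc, hm, MonObj.comp_mul, ← Category.assoc, ← Category.assoc,
      ← Φ.map_comp, ← Φ.map_comp]
  let i : G ⟶ G := lift (toUnit _ ≫ o) (𝟙 G) ≫ d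
  have hi : Φ.map i ≫ e.hom = (e.hom)⁻¹ := by
    rw [hdiv, hone, Φ.map_id, Category.id_comp, one_div]
  have hone' : ∀ {T : C} (f : T ⟶ 𝟙_ C), Φ.map (f ≫ o) ≫ e.hom = 1 := by
    intro T f
    rw [← hone T, toUnit_unique f (toUnit T)]
  let M : MonObj G :=
    { one := o
      mul := m
      one_mul := hext _ (hPt _ _ hP1 hPG) _ _ (by
        rw [hmul, whiskerRight_fst, whiskerRight_snd, hone', one_mul, leftUnitor_hom])
      mul_one := hext _ (hPt _ _ hPG hP1) _ _ (by
        rw [hmul, whiskerLeft_fst, whiskerLeft_snd, hone', mul_one, rightUnitor_hom])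
      mul_assoc := hext _ (hPt _ _ (hPt _ _ hPG hPG) hPG) _ _ (by
        rw [hmul, whiskerRight_fst, whiskerRight_snd, hmul, ← Category.assoc (α_ G G G).hom, hmul,
          Category.assoc, Category.assoc, whiskerLeft_fst, whiskerLeft_snd, associator_hom_fst,
          ← Category.assoc _ _ m, hmul, Category.assoc, Category.assoc, associator_hom_snd_fst,
          associator_hom_snd_snd, mul_assoc]) }
  refine ⟨{ M with
    inv := i
    left_inv := hext _ hPG _ _ ?_
    right_inv := hext _ hPG _ _ ?_ }, ?_, ?_⟩
  · exact (hmul _).trans (by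
      rw [lift_fst, lift_snd, hi, Φ.map_id, Category.id_comp, inv_mul_cancel]
      exact (hone G).symm)
  · exact (hmul _).trans (by
      rw [lift_fst, lift_snd, hi, Φ.map_id, Category.id_comp, mul_inv_cancel]
      exact (hone G).symm)
  · change (LaxMonoidal.ε Φ ≫ Φ.map o) ≫ e.hom = η[X]
    rw [Category.assoc, ho, MonObj.comp_one, MonObj.one_eq_one]
  · change (LaxMonoidal.μ Φ G G ≫ Φ.map m) ≫ e.hom = (e.hom ⊗ₘ e.hom) ≫ μ[X]
    rw [Category.assoc, hm, MonObj.comp_mul, MonObj.mul_eq_mul, MonObj.comp_mul, tensorHom_fst,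
      tensorHom_snd, ← Category.assoc, ← Category.assoc, Functor.Monoidal.μ_fst,
      Functor.Monoidal.μ_snd]

end GroupObject
end IntegralModels

/-! ### Products of models and extension of morphisms near a fibre -/

namespace IntegralModels

open Limits

section Product

variable {R F : Type u} [CommRing R] [Field F] [Algebra R F] {X W X' W' : Scheme.{u}}
  {sX : X ⟶ Spec (.of F)} {sW : W ⟶ Spec (.of F)} {sX' : X' ⟶ Spec (.of F)}
  {sW' : W' ⟶ Spec (.of F)}

theorem isPullback_prod {Y Z : Scheme.{u}} {sY : Y ⟶ Spec (.of R)} {sZ : Z ⟶ Spec (.of R)}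
    {a : X ⟶ Y} {b : W ⟶ Z} (ha : IsPullback a sX sY (genMap R F))
    (hb : IsPullback b sW sZ (genMap R F)) :
    IsPullback (pullback.map sX sW sY sZ a b (genMap R F) ha.w.symm hb.w.symm)
      (pullback.fst sX sW ≫ sX) (pullback.fst sY sZ ≫ sY) (genMap R F) := by
  have h1 : IsPullback (pullback.fst sX sW ≫ a) (pullback.snd sX sW) sY (sW ≫ genMap R F) :=
    ((IsPullback.of_hasPullback sX sW).flip.paste_vert ha.flip).flip
  have h2 : IsPullback (pullback.map sX sW sY sZ a b (genMap R F) ha.w.symm hb.w.symm)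
      (pullback.snd sX sW) (pullback.snd sY sZ) b := by
    refine IsPullback.of_right (h₁₂ := pullback.fst sY sZ) (h₂₂ := sZ) ?_ ?_
      (IsPullback.of_hasPullback sY sZ)
    · rw [pullback.lift_fst, hb.w]
      exact h1
    · rw [pullback.lift_snd]
  have h3 := h2.flip.paste_horiz hb.flip
  rw [← pullback.condition, ← pullback.condition] at h3
  exact h3.flip

/-- The product of two flat models. -/
noncomputable def FlatModel.prod (M : FlatModel R sX) (N : FlatModel R sW) :
    FlatModel R (pullback.fst sX sW ≫ sX) where
  scheme := pullback M.str N.str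
  str := pullback.fst _ _ ≫ M.str
  gen := pullback.map sX sW M.str N.str M.gen N.gen (genMap R F) M.isPullback.w.symm
    N.isPullback.w.symm
  isPullback := isPullback_prod M.isPullback N.isPullback
  flat := inferInstance
  locallyOfFiniteType := inferInstance
  quasiCompact := inferInstance

end Product

section Extension

variable {R F : Type u} [CommRing R] [Field F] [Algebra R F] {X W X' W' : Scheme.{u}}
  {sX : X ⟶ Spec (.of F)} {sW : W ⟶ Spec (.of F)} {sX' : X' ⟶ Spec (.of F)}
  {sW' : W' ⟶ Spec (.of F)}

theorem FlatModel.prod_gen (M : FlatModel R sX) (N : FlatModel R sW) : (M.prod N).gen =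
    pullback.map sX sW M.str N.str M.gen N.gen (genMap R F) M.isPullback.w.symm
      N.isPullback.w.symm := rfl

theorem pullbackMap_comp {A B S A' B' S' A'' B'' S'' : Scheme.{u}} {f : A ⟶ S} {g : B ⟶ S}
    {f' : A' ⟶ S'} {g' : B' ⟶ S'} {f'' : A'' ⟶ S''} {g'' : B'' ⟶ S''} {a : A ⟶ A'} {b : B ⟶ B'}
    {c : S ⟶ S'} {a' : A' ⟶ A''} {b' : B' ⟶ B''} {c' : S' ⟶ S''} {a'' : A ⟶ A''} {b'' : B ⟶ B''}
    {c'' : S ⟶ S''} (h₁ : f ≫ c = a ≫ f') (h₁' : g ≫ c = b ≫ g') (h₂ : f' ≫ c' = a' ≫ f'')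
    (h₂' : g' ≫ c' = b' ≫ g'') (h₃ : f ≫ c'' = a'' ≫ f'') (h₃' : g ≫ c'' = b'' ≫ g'')
    (ha : a ≫ a' = a'') (hb : b ≫ b' = b'') :
    pullback.map f g f' g' a b c h₁ h₁' ≫ pullback.map f' g' f'' g'' a' b' c' h₂ h₂' =
      pullback.map f g f'' g'' a'' b'' c'' h₃ h₃' := by
  subst ha hb
  refine pullback.hom_ext ?_ ?_
  · rw [Category.assoc, pullback.lift_fst, pullback.lift_fst_assoc, pullback.lift_fst,
      Category.assoc]
  · rw [Category.assoc, pullback.lift_snd, pullback.lift_snd_assoc, pullback.lift_snd,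
      Category.assoc]

theorem pullbackMap_comp_comp {A B S A' B' S' A₁ B₁ S₁ A'' B'' S'' : Scheme.{u}} {f : A ⟶ S}
    {g : B ⟶ S} {f' : A' ⟶ S'} {g' : B' ⟶ S'} {f₁ : A₁ ⟶ S₁} {g₁ : B₁ ⟶ S₁} {f'' : A'' ⟶ S''}
    {g'' : B'' ⟶ S''} {a : A ⟶ A'} {b : B ⟶ B'} {c : S ⟶ S'} {a' : A' ⟶ A''} {b' : B' ⟶ B''}
    {c' : S' ⟶ S''} {a₁ : A ⟶ A₁} {b₁ : B ⟶ B₁} {c₁ : S ⟶ S₁} {a₂ : A₁ ⟶ A''} {b₂ : B₁ ⟶ B''}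
    {c₂ : S₁ ⟶ S''} (h₁ : f ≫ c = a ≫ f') (h₁' : g ≫ c = b ≫ g') (h₂ : f' ≫ c' = a' ≫ f'')
    (h₂' : g' ≫ c' = b' ≫ g'') (h₃ : f ≫ c₁ = a₁ ≫ f₁) (h₃' : g ≫ c₁ = b₁ ≫ g₁)
    (h₄ : f₁ ≫ c₂ = a₂ ≫ f'') (h₄' : g₁ ≫ c₂ = b₂ ≫ g'')
    (ha : a ≫ a' = a₁ ≫ a₂) (hb : b ≫ b' = b₁ ≫ b₂) :
    pullback.map f g f' g' a b c h₁ h₁' ≫ pullback.map f' g' f'' g'' a' b' c' h₂ h₂' =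
      pullback.map f g f₁ g₁ a₁ b₁ c₁ h₃ h₃' ≫ pullback.map f₁ g₁ f'' g'' a₂ b₂ c₂ h₄ h₄' := by
  rw [pullbackMap_comp _ _ _ _ (c'' := c₁ ≫ c₂) (by rw [reassoc_of% h₃, h₄, Category.assoc])
    (by rw [reassoc_of% h₃', h₄', Category.assoc]) ha hb,
    pullbackMap_comp _ _ _ _ (c'' := c₁ ≫ c₂) _ _ rfl rfl]

theorem isOpenImmersion_pullbackMap {A B A' B' S : Scheme.{u}} {f : A ⟶ S} {g : B ⟶ S}
    {f' : A' ⟶ S} {g' : B' ⟶ S} {a : A ⟶ A'} {b : B ⟶ B'} [IsOpenImmersion a] [IsOpenImmersion b]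
    (h : f ≫ 𝟙 S = a ≫ f') (h' : g ≫ 𝟙 S = b ≫ g') :
    IsOpenImmersion (pullback.map f g f' g' a b (𝟙 S) h h') := by
  infer_instance

theorem mem_range_pullbackMap {A B A' B' S : Scheme.{u}} {f : A ⟶ S} {g : B ⟶ S}
    {f' : A' ⟶ S} {g' : B' ⟶ S} {a : A ⟶ A'} {b : B ⟶ B'}
    (h : f ≫ 𝟙 S = a ≫ f') (h' : g ≫ 𝟙 S = b ≫ g') {z : ↑(pullback f' g')}
    (h1 : pullback.fst f' g' z ∈ Set.range a) (h2 : pullback.snd f' g' z ∈ Set.range b) :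
    z ∈ Set.range (pullback.map f g f' g' a b (𝟙 S) h h') := by
  rw [Scheme.Pullback.range_map]
  exact ⟨h1, h2⟩

theorem AgreesAt.prod {q : Spec (.of R)} {j : W ⟶ X} {j' : W' ⟶ X'} {Z : FlatModel R sW}
    {Y : FlatModel R sX} {Z' : FlatModel R sW'} {Y' : FlatModel R sX'} (hj : j ≫ sX = sW)
    (hj' : j' ≫ sX' = sW') (h : AgreesAt q j Z Y) (h' : AgreesAt q j' Z' Y') :
    AgreesAt q (pullback.map sW sW' sX sX' j j' (𝟙 _) (by simp [hj]) (by simp [hj']))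
      (Z.prod Z') (Y.prod Y') := by
  obtain ⟨Ω, b, a, t, _, _, hs, htb, hta, hb, ha⟩ := h
  obtain ⟨Ω', b', a', t', _, _, hs', htb', hta', hb', ha'⟩ := h'
  refine ⟨pullback (b ≫ Z.str) (b' ≫ Z'.str),
    pullback.map _ _ Z.str Z'.str b b' (𝟙 _) (by simp) (by simp),
    pullback.map _ _ Y.str Y'.str a a' (𝟙 _) (by simp [hs]) (by simp [hs']),
    pullback.map _ _ _ _ t t' (genMap R F) ?_ ?_, isOpenImmersion_pullbackMap _ _,
    isOpenImmersion_pullbackMap _ _, ?_, ?_, ?_, ?_, ?_⟩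
  · rw [reassoc_of% htb, Z.isPullback.w]
  · rw [reassoc_of% htb', Z'.isPullback.w]
  · change pullback.map _ _ _ _ _ _ _ _ _ ≫ pullback.fst _ _ ≫ Z.str =
      pullback.map _ _ _ _ _ _ _ _ _ ≫ pullback.fst _ _ ≫ Y.str
    rw [pullback.lift_fst_assoc, pullback.lift_fst_assoc, Category.assoc, Category.assoc, hs]
  · exact pullbackMap_comp (c'' := genMap R F) _ _ _ _ Z.isPullback.w.symm Z'.isPullback.w.symm
      htb htb'
  · exact pullbackMap_comp_comp (c₂ := genMap R F) _ _ _ _ _ _ Y.isPullback.w.symm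
      Y'.isPullback.w.symm hta hta'
  · intro z hz
    have e : (pullback.fst Z.str Z'.str ≫ Z.str) z = (pullback.snd Z.str Z'.str ≫ Z'.str) z := by
      rw [pullback.condition]
    exact mem_range_pullbackMap _ _ (hb _ hz) (hb' _ (e.symm.trans hz))
  · intro z hz
    have e : (pullback.fst Y.str Y'.str ≫ Y.str) z = (pullback.snd Y.str Y'.str ≫ Y'.str) z := by
      rw [pullback.condition]
    exact mem_range_pullbackMap _ _ (ha _ hz) (ha' _ (e.symm.trans hz))

/-- Near the fibre over `q`, the morphism `r`, partially defined as a morphism to `W`, extends to a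
morphism of models. -/
def ExtendsAt (q : Spec (.of R)) (M : FlatModel R sX') (Z : FlatModel R sW) (r : X' ⟶ X)
    (j : W ⟶ X) : Prop :=
  ∃ (Ω : Scheme.{u}) (i : Ω ⟶ M.scheme) (ψ : Ω ⟶ Z.scheme), IsOpenImmersion i ∧
    (∀ m, M.str m = q → m ∈ Set.range i) ∧ ψ ≫ Z.str = i ≫ M.str ∧
    ∀ ⦃T : Scheme.{u}⦄ (t : T ⟶ Ω) (x : T ⟶ X'), t ≫ i = x ≫ M.gen →
      ∃ y : T ⟶ W, y ≫ j = x ≫ r ∧ t ≫ ψ = y ≫ Z.gen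

/-- This carries an extension found on inserted local models over to the modified global models,
which coincide with them near the fibre over `q`. -/
theorem ExtendsAt.congr_agreesAt {q : Spec (.of R)} {M : FlatModel R sW'} {Z : FlatModel R sW}
    {M' : FlatModel R sX'} {Y : FlatModel R sX} {φ : X' ⟶ X} {k : W' ⟶ X'} {j : W ⟶ X}
    (h : ExtendsAt q M Z (k ≫ φ) j) (hk : k ≫ sX' = sW') (hM : AgreesAt q k M M')
    (hZ : AgreesAt q j Z Y) : ExtendsAt q M' Y φ (𝟙 X) := by
  obtain ⟨Ω, i, ψ, _, hi, hs, hψ⟩ := h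
  obtain ⟨Ω₁, b₁, a₁, t₁, _, _, hs₁, htb₁, hta₁, hb₁, ha₁⟩ := hM
  obtain ⟨Ω₂, b₂, a₂, t₂, _, _, hs₂, htb₂, hta₂, hb₂, ha₂⟩ := hZ
  refine ⟨pullback (pullback.snd b₁ i ≫ ψ) b₂, pullback.fst _ _ ≫ pullback.fst b₁ i ≫ a₁,
    pullback.snd _ _ ≫ a₂, inferInstance, ?_, ?_, ?_⟩
  · intro m hm
    obtain ⟨w, rfl⟩ := ha₁ m hm
    have hw : M.str (b₁ w) = q := by
      rw [← hm, ← Scheme.Hom.comp_apply, hs₁, Scheme.Hom.comp_apply]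
    have h1 : w ∈ Set.range (pullback.fst b₁ i) := by
      rw [Scheme.Pullback.range_fst]
      exact hi _ hw
    obtain ⟨w', rfl⟩ := h1
    have h2 : w' ∈ Set.range (pullback.fst (pullback.snd b₁ i ≫ ψ) b₂) := by
      rw [Scheme.Pullback.range_fst]
      refine hb₂ _ ?_
      rw [← Scheme.Hom.comp_apply, Category.assoc, hs, ← pullback.condition_assoc, ← hw]
      rfl
    obtain ⟨w'', rfl⟩ := h2
    exact ⟨w'', rfl⟩
  · rw [Category.assoc, ← hs₂, ← pullback.condition_assoc]
    simp only [Category.assoc]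
    rw [hs, ← pullback.condition_assoc, hs₁]
  · intro T t x e
    let x' : T ⟶ W' := M.isPullback.lift
      (t ≫ pullback.fst _ _ ≫ pullback.fst b₁ i ≫ b₁) (x ≫ sX') (by
        have := congrArg (· ≫ M'.str) e
        simp only [Category.assoc] at this ⊢
        rw [hs₁, this, M'.isPullback.w])
    have h1 : x' ≫ M.gen = t ≫ pullback.fst _ _ ≫ pullback.fst b₁ i ≫ b₁ :=
      M.isPullback.lift_fst _ _ _
    have h2 : x' ≫ sW' = x ≫ sX' := M.isPullback.lift_snd _ _ _
    have h3 : x' ≫ t₁ = t ≫ pullback.fst _ _ ≫ pullback.fst b₁ i := by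
      rw [← cancel_mono b₁, Category.assoc, htb₁, h1]
      simp only [Category.assoc]
    have h4 : x' ≫ k = x := by
      refine M'.isPullback.hom_ext ?_ ?_
      · rw [Category.assoc, ← hta₁, reassoc_of% h3, ← e]
      · rw [Category.assoc, hk, h2]
    obtain ⟨y, hy, hyψ⟩ := hψ (t ≫ pullback.fst _ _ ≫ pullback.snd b₁ i) x' (by
      rw [h1]
      simp only [Category.assoc]
      rw [pullback.condition])
    refine ⟨y ≫ j, ?_, ?_⟩
    · rw [Category.comp_id, hy, reassoc_of% h4]
    · have h5 : y ≫ t₂ = t ≫ pullback.snd _ _ := by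
        rw [← cancel_mono b₂, Category.assoc, htb₂, ← hyψ]
        simp only [Category.assoc]
        rw [pullback.condition]
      rw [Category.assoc, ← hta₂, reassoc_of% h5]

variable [IsDedekindDomain R] [IsFractionRing R F]

/-- A morphism of generic fibres which extends to a neighbourhood of every closed fibre extends to
a morphism of models. -/
theorem exists_isExt_of_extendsAt {M : FlatModel R sX'} {Y : FlatModel R sX} [Y.scheme.IsSeparated]
    {φ : X' ⟶ X} (hφ : φ ≫ sX = sX')
    (h : ∀ q, q ≠ genPt R → ExtendsAt q M Y φ (𝟙 X)) :
    ∃ ψ : M.scheme ⟶ Y.scheme, ψ ≫ Y.str = M.str ∧ M.gen ≫ ψ = φ ≫ Y.gen := by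
  have := M.locallyOfFiniteType_generic
  have := isLocallyNoetherian_over_field sX'
  have hw : (φ ≫ Y.gen) ≫ Y.str = M.gen ≫ M.str := by
    rw [Category.assoc, Y.isPullback.w, reassoc_of% hφ, M.isPullback.w]
  obtain ⟨ψ, hψ⟩ : ∃ ψ : M.scheme ⟶ Y.scheme, IsExt M.gen (φ ≫ Y.gen) (𝟙 _) ψ := by
    refine IsExt.glue M.isPullback fun m => ?_
    by_cases hm : M.str m = genPt R
    · obtain ⟨U, hU, ψ, hψ⟩ := exists_isExt_generic M.isPullback hw
      obtain ⟨x, rfl⟩ := M.mem_range_gen.mpr hm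
      exact ⟨U, hU x, ψ, by rwa [Category.comp_id]⟩
    · obtain ⟨Ω, i, ψ, _, hi, -, hψ⟩ := h _ hm
      refine ⟨i.opensRange, hi m rfl, i.isoOpensRange.inv ≫ ψ, ?_⟩
      intro T t x e
      rw [Category.comp_id] at e
      obtain ⟨y, hy, hyψ⟩ := hψ (t ≫ i.isoOpensRange.inv) x (by
        rw [← e, Category.assoc, Scheme.Hom.isoOpensRange_inv_comp])
      rw [Category.comp_id] at hy
      rw [← Category.assoc, hyψ, hy, Category.assoc]
  have h1 : M.gen ≫ ψ = φ ≫ Y.gen := by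
    rw [hψ M.gen (𝟙 _) (by simp), Category.id_comp]
  refine ⟨ψ, hom_ext_of_generic M.isPullback ?_, h1⟩
  rw [reassoc_of% h1, Y.isPullback.w, reassoc_of% hφ, M.isPullback.w]

/-- A morphism of generic fibres extends to a neighbourhood of almost every fibre. -/
theorem exists_ne_zero_extendsAt {M : FlatModel R sX'} {Y : FlatModel R sX} [Y.scheme.IsSeparated]
    {φ : X' ⟶ X} (hφ : φ ≫ sX = sX') :
    ∃ r : R, r ≠ 0 ∧ ∀ q : Spec (.of R), r ∉ q.asIdeal → ExtendsAt q M Y φ (𝟙 X) := by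
  have := M.locallyOfFiniteType_generic
  have := isLocallyNoetherian_over_field sX'
  have hw : (φ ≫ Y.gen) ≫ Y.str = M.gen ≫ M.str := by
    rw [Category.assoc, Y.isPullback.w, reassoc_of% hφ, M.isPullback.w]
  obtain ⟨U, hU, ψ, hψ⟩ := exists_isExt_generic M.isPullback hw
  obtain ⟨r, hr, hrU⟩ := exists_ne_zero_of_range_subset M.isPullback U hU
  refine ⟨r, hr, fun q hq => ⟨U, U.ι, ψ, inferInstance, ?_, ?_, ?_⟩⟩
  · rintro m rfl
    rw [Scheme.Opens.range_ι]
    exact hrU m hq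
  · refine hom_ext_of_generic (isPullback_shrink M.isPullback U.ι) ?_
    rw [← Category.assoc, hψ _ _ pullback.condition, Category.assoc, hw, pullback.condition_assoc]
  · intro T t x e
    refine ⟨x ≫ φ, Category.comp_id _, ?_⟩
    rw [hψ t x e, Category.assoc]

end Extension
end IntegralModels

/-! ### Rescaling coordinates in an order -/

namespace IntegralModels

section Rescaling

/-- Localized at `p`, the ring has no non-zero prime besides `p`. After inverting `π ∈ p` as well,
no prime can contain `b`, which thus becomes a unit. -/
theorem exists_notMem_dvd_mul_pow {R : Type*} [CommRing R] [IsDomain R] [Ring.DimensionLEOne R]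
    (p : Ideal R) [p.IsPrime] {π : R} (hπ : π ∈ p) {b : R} (hb : b ≠ 0) :
    ∃ s ∉ p, ∃ M : ℕ, b ∣ s * π ^ M := by
  by_contra! hcon
  have hdis : Disjoint (Ideal.span {b} : Set R)
      ((p.primeCompl ⊔ Submonoid.powers π : Submonoid R) : Set R) := by
    rw [Set.disjoint_left]
    rintro _ h1 h2
    obtain ⟨s, hs, _, ⟨M, rfl⟩, rfl⟩ := Submonoid.mem_sup.mp h2
    exact hcon s hs M (Ideal.mem_span_singleton.mp h1)
  obtain ⟨P, hP, hbP, hPd⟩ := Ideal.exists_le_prime_disjoint _ _ hdis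
  have hPp : P ≤ p := fun a ha => by
    by_contra h
    exact Set.disjoint_left.mp hPd ha (Submonoid.mem_sup_left (show a ∈ p.primeCompl from h))
  have hP0 : P ≠ ⊥ := by
    rintro rfl
    exact hb (by simpa using hbP)
  have hmax := Ring.DimensionLEOne.maximalOfPrime hP0 hP
  have := hmax.eq_of_le ‹p.IsPrime›.ne_top hPp
  subst this
  exact Set.disjoint_left.mp hPd hπ (Submonoid.mem_sup_right ⟨1, pow_one π⟩)

variable {R F : Type*} [CommRing R] [IsDomain R] [Ring.DimensionLEOne R] [Field F] [Algebra R F]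
  [IsFractionRing R F] {D : Type*} [CommRing D] [Algebra F D] [Algebra R D] [IsScalarTower R F D]

/-- The elements of an `R`-algebra lying in a subalgebra after localization at `p`. -/
def localSaturation (p : Ideal R) [hp : p.IsPrime] (C : Subalgebra R D) : Subalgebra R D where
  carrier := {d | ∃ s ∉ p, s • d ∈ C}
  mul_mem' := by
    rintro a b ⟨s, hs, ha⟩ ⟨t, ht, hb⟩
    refine ⟨s * t, fun h => (hp.mem_or_mem h).elim hs ht, ?_⟩
    rw [← smul_mul_smul_comm]
    exact mul_mem ha hb
  add_mem' := by
    rintro a b ⟨s, hs, ha⟩ ⟨t, ht, hb⟩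
    refine ⟨s * t, fun h => (hp.mem_or_mem h).elim hs ht, ?_⟩
    rw [smul_add]
    refine add_mem ?_ ?_
    · rw [mul_comm, mul_smul]
      exact C.smul_mem ha t
    · rw [mul_smul]
      exact C.smul_mem hb s
  algebraMap_mem' r := ⟨1, (Ideal.ne_top_iff_one p).mp hp.ne_top, by
    rw [one_smul]; exact C.algebraMap_mem r⟩

omit [IsDomain R] [Ring.DimensionLEOne R] in
theorem le_localSaturation (p : Ideal R) [hp : p.IsPrime] (C : Subalgebra R D) :
    C ≤ localSaturation p C := fun d hd => ⟨1, (Ideal.ne_top_iff_one p).mp hp.ne_top, by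
    rwa [one_smul]⟩

variable (F) in
/-- The order generated by the generators divided by `π ^ N`. -/
def scaledOrder {ι : Type*} (w : ι → D) (π : R) (N : ℕ) : Subalgebra R D :=
  Algebra.adjoin R (Set.range fun l => algebraMap F D (algebraMap R F π ^ N)⁻¹ * w l)

variable {ι : Type*} {w : ι → D} {π : R} {p : Ideal R} [hp : p.IsPrime]

variable (F p w π) in
/-- The element `q` vanishes to order `n` at the origin, integrally at `p` after rescaling. -/
def VanishesToOrder (n : ℕ) (q : D) : Prop :=
  ∃ M : ℕ, ∀ N ≥ M, ∃ i ∈ localSaturation p (scaledOrder F w π N), π ^ M • q = π ^ (n * N) • i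

omit [IsDomain R] [Ring.DimensionLEOne R] [IsFractionRing R F] [IsScalarTower R F D] in
theorem VanishesToOrder.add {n : ℕ} {q q' : D} (h : VanishesToOrder F w π p n q)
    (h' : VanishesToOrder F w π p n q') : VanishesToOrder F w π p n (q + q') := by
  obtain ⟨M, hM⟩ := h
  obtain ⟨M', hM'⟩ := h'
  refine ⟨M + M', fun N hN => ?_⟩
  obtain ⟨i, hi, e⟩ := hM N (by omega)
  obtain ⟨i', hi', e'⟩ := hM' N (by omega)
  refine ⟨π ^ M' • i + π ^ M • i', add_mem (Subalgebra.smul_mem _ hi _)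
    (Subalgebra.smul_mem _ hi' _), ?_⟩
  rw [smul_add, smul_add, smul_comm _ (π ^ M') i, smul_comm _ (π ^ M) i', ← e, ← e', smul_smul,
    smul_smul, pow_add, mul_comm (π ^ M')]

omit [IsDomain R] [Ring.DimensionLEOne R] [IsFractionRing R F] [IsScalarTower R F D] in
theorem VanishesToOrder.mul {n n' : ℕ} {q q' : D} (h : VanishesToOrder F w π p n q)
    (h' : VanishesToOrder F w π p n' q') : VanishesToOrder F w π p (n + n') (q * q') := by
  obtain ⟨M, hM⟩ := h
  obtain ⟨M', hM'⟩ := h'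
  refine ⟨M + M', fun N hN => ?_⟩
  obtain ⟨i, hi, e⟩ := hM N (by omega)
  obtain ⟨i', hi', e'⟩ := hM' N (by omega)
  refine ⟨i * i', mul_mem hi hi', ?_⟩
  rw [pow_add, ← smul_mul_smul_comm, e, e', smul_mul_smul_comm, add_mul, pow_add]

omit [IsDomain R] [Ring.DimensionLEOne R] [IsFractionRing R F] [IsScalarTower R F D] in
theorem VanishesToOrder.zero (n : ℕ) : VanishesToOrder F w π p n (0 : D) :=
  ⟨0, fun _ _ => ⟨0, zero_mem _, by rw [smul_zero, smul_zero]⟩⟩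

omit [IsDomain R] [Ring.DimensionLEOne R] in
include hp in
theorem vanishesToOrder_generator (hπ0 : π ≠ 0) (l : ι) : VanishesToOrder F w π p 1 (w l) := by
  refine ⟨0, fun N _ => ⟨_, le_localSaturation p _ (Algebra.subset_adjoin ⟨l, rfl⟩), ?_⟩⟩
  have h0 : algebraMap R F π ≠ 0 := by
    rwa [Ne, FaithfulSMul.algebraMap_eq_zero_iff]
  rw [pow_zero, one_smul, one_mul, Algebra.smul_def, ← mul_assoc,
    IsScalarTower.algebraMap_apply R F D, ← map_mul, map_pow, mul_inv_cancel₀ (pow_ne_zero _ h0),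
    map_one, one_mul]

/-- Scalars have denominators bounded by a fixed power of `π`, up to elements outside `p`, and the
generators are integral. An element therefore needs only a power of `π` independent of `N`. -/
theorem vanishesToOrder_zero (hπ : π ∈ p) (hπ0 : π ≠ 0) (hw : Algebra.adjoin F (Set.range w) = ⊤)
    (q : D) : VanishesToOrder F w π p 0 q := by
  have hq : q ∈ Algebra.adjoin F (Set.range w) := hw ▸ Algebra.mem_top
  induction hq using Algebra.adjoin_induction with
  | mem x hx =>
    obtain ⟨l, rfl⟩ := hx
    obtain ⟨M, hM⟩ := vanishesToOrder_generator (F := F) (p := p) (w := w) hπ0 l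
    refine ⟨M, fun N hN => ?_⟩
    obtain ⟨i, hi, e⟩ := hM N hN
    exact ⟨_, Subalgebra.smul_mem _ hi (π ^ (1 * N)), by rw [e, zero_mul, pow_zero, one_smul]⟩
  | algebraMap c =>
    obtain ⟨a, b, hb, rfl⟩ := IsFractionRing.div_surjective (A := R) c
    have hb0 : b ≠ 0 := nonZeroDivisors.ne_zero hb
    obtain ⟨s, hs, M, t, ht⟩ := exists_notMem_dvd_mul_pow p hπ hb0
    refine ⟨M, fun N _ => ⟨_, ⟨s, hs, ?_⟩, by rw [zero_mul, pow_zero, one_smul]⟩⟩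
    have : s • π ^ M • algebraMap F D (algebraMap R F a / algebraMap R F b) =
        algebraMap R D (t * a) := by
      have hb0 : algebraMap R F b ≠ 0 := by
        rwa [Ne, FaithfulSMul.algebraMap_eq_zero_iff]
      rw [smul_smul, ht, Algebra.smul_def, IsScalarTower.algebraMap_apply R F D,
        IsScalarTower.algebraMap_apply R F D, ← map_mul]
      congr 1
      rw [map_mul, map_mul]
      field_simp
    rw [this]
    exact Subalgebra.algebraMap_mem _ _
  | add x y _ _ hx hy => exact hx.add hy
  | mul x y _ _ hx hy => exact hx.mul hy

theorem vanishesToOrder_one (hπ : π ∈ p) (hπ0 : π ≠ 0) (hw : Algebra.adjoin F (Set.range w) = ⊤)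
    {q : D} (hq : q ∈ Ideal.span (Set.range w)) : VanishesToOrder F w π p 1 q := by
  induction hq using Submodule.span_induction with
  | mem x hx =>
    obtain ⟨l, rfl⟩ := hx
    exact vanishesToOrder_generator hπ0 l
  | zero => exact .zero _
  | add x y _ _ hx hy => exact hx.add hy
  | smul a x _ hx => simpa using (vanishesToOrder_zero hπ hπ0 hw a).mul hx

theorem vanishesToOrder_two (hπ : π ∈ p) (hπ0 : π ≠ 0) (hw : Algebra.adjoin F (Set.range w) = ⊤)
    {q : D} (hq : q ∈ Ideal.span (Set.range w) ^ 2) : VanishesToOrder F w π p 2 q := by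
  rw [pow_two] at hq
  induction hq using Submodule.mul_induction_on' with
  | mem_mul_mem x hx y hy =>
    exact (vanishesToOrder_one hπ hπ0 hw hx).mul (vanishesToOrder_one hπ hπ0 hw hy)
  | add x _ y _ hx hy => exact hx.add hy

omit [Ring.DimensionLEOne R] in
-- The loss `π ^ M` does not depend on `N`, so it is absorbed by the factor `π ^ (n * N)` for large
-- `N`.
theorem VanishesToOrder.exists_eq_smul {n : ℕ} {q : D} (h : VanishesToOrder F w π p n q)
    (hπ0 : π ≠ 0) : ∃ M : ℕ, ∀ N ≥ M, ∀ k, k + M ≤ n * N →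
      ∃ i ∈ localSaturation p (scaledOrder F w π N), q = π ^ k • i := by
  obtain ⟨M, hM⟩ := h
  refine ⟨M, fun N hN k hk => ?_⟩
  obtain ⟨i, hi, e⟩ := hM N hN
  refine ⟨_, Subalgebra.smul_mem _ hi (π ^ (n * N - M - k)), ?_⟩
  have hu : IsUnit (algebraMap R D (π ^ M)) := by
    rw [IsScalarTower.algebraMap_apply R F D]
    refine (IsUnit.mk0 _ ?_).map _
    rw [Ne, FaithfulSMul.algebraMap_eq_zero_iff]
    exact pow_ne_zero _ hπ0
  refine hu.mul_left_cancel ?_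
  rw [← Algebra.smul_def, ← Algebra.smul_def, e, smul_smul, smul_smul, ← pow_add, ← pow_add]
  congr 2
  omega

/-- A ring homomorphism defined near the origin whose linear part is integral is integral near the
fibre over `p` after rescaling. -/
theorem exists_scaledOrder_extension (hπ : π ∈ p) (hπ0 : π ≠ 0)
    (hw : Algebra.adjoin F (Set.range w) = ⊤) {A L κ : Type*} [CommRing A] [Algebra F A]
    [Algebra R A] [IsScalarTower R F A] [CommRing L] [Algebra D L] [Algebra F L]
    [IsScalarTower F D L] [Finite κ] {h : D} (hh : h - 1 ∈ Ideal.span (Set.range w))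
    (θ : A →ₐ[F] L) (x : κ → A)
    (hx : ∀ k, ∃ (m : ℕ) (α : D), θ (x k) * algebraMap D L h ^ m = algebraMap D L α ∧
      ∃ l ∈ Submodule.span R (Set.range w), α - l ∈ Ideal.span (Set.range w) ^ 2) :
    ∃ N₀, ∀ N ≥ N₀, ∃ γ : scaledOrder F w π N, h ∣ (γ : D) ∧
      (∀ P : Ideal (scaledOrder F w π N), P.IsPrime → P.comap (algebraMap R _) = p → γ ∉ P) ∧
      ∀ b ∈ scaledOrder F x π N, ∃ n : ℕ, ∃ c ∈ scaledOrder F w π N,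
        θ b * algebraMap D L γ ^ n = algebraMap D L c := by
  cases nonempty_fintype κ
  have h0 : algebraMap R F π ≠ 0 := by
    rwa [Ne, FaithfulSMul.algebraMap_eq_zero_iff]
  choose m α hα l hl hlα using hx
  obtain ⟨M₀, hM₀⟩ := (vanishesToOrder_one hπ hπ0 hw hh).exists_eq_smul hπ0
  choose M hM using fun k => (vanishesToOrder_two hπ hπ0 hw (hlα k)).exists_eq_smul hπ0
  -- For such `N` the element `h - 1` is divisible by `π`, which needs `1 + M₀ ≤ N`. The quadratic
  -- remainders `α k - l k` are divisible by `π ^ N`, which needs `N + M k ≤ 2 * N`.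
  refine ⟨M₀ + 1 + ∑ k, M k, fun N hN => ?_⟩
  have hMN : ∀ k, M k ≤ N := fun k =>
    (Finset.single_le_sum (fun _ _ => Nat.zero_le _) (Finset.mem_univ k)).trans
      ((Nat.le_add_left _ _).trans hN)
  obtain ⟨β, ⟨s₀, hs₀, hβ⟩, hβh⟩ := hM₀ N (by omega) 1 (by omega)
  rw [pow_one, sub_eq_iff_eq_add] at hβh
  have hlin : ∀ {l : D}, l ∈ Submodule.span R (Set.range w) →
      ∃ i ∈ localSaturation p (scaledOrder F w π N), l = π ^ N • i := by
    intro l hl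
    induction hl using Submodule.span_induction with
    | mem x hx =>
      obtain ⟨l, rfl⟩ := hx
      refine ⟨_, le_localSaturation p _ (Algebra.subset_adjoin ⟨l, rfl⟩), ?_⟩
      rw [Algebra.smul_def, ← mul_assoc, IsScalarTower.algebraMap_apply R F D, ← map_mul, map_pow,
        mul_inv_cancel₀ (pow_ne_zero _ h0), map_one, one_mul]
    | zero => exact ⟨0, zero_mem _, by rw [smul_zero]⟩
    | add x y _ _ hx hy =>
      obtain ⟨i, hi, rfl⟩ := hx
      obtain ⟨j, hj, rfl⟩ := hy
      exact ⟨i + j, add_mem hi hj, by rw [smul_add]⟩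
    | smul a x _ hx =>
      obtain ⟨i, hi, rfl⟩ := hx
      exact ⟨a • i, Subalgebra.smul_mem _ hi a, by rw [smul_comm]⟩
  have hα' : ∀ k, ∃ i, (∃ s ∉ p, s • i ∈ scaledOrder F w π N) ∧ α k = π ^ N • i := by
    intro k
    obtain ⟨i, hi, e⟩ := hM k N (hMN k) N (by have := hMN k; omega)
    obtain ⟨j, hj, e'⟩ := hlin (hl k)
    refine ⟨i + j, add_mem hi hj, ?_⟩
    rw [smul_add, ← e, ← e', sub_add_cancel]
  choose i hi hiα using hα'
  choose s hs hsi using hi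
  -- A common denominator outside `p` for all the elements that are integral only after localization
  -- at `p`.
  let S : R := s₀ * ∏ k, s k
  have hS : S ∉ p := by
    intro hmem
    refine (hp.mem_or_mem hmem).elim hs₀ fun h => ?_
    obtain ⟨k, -, hk⟩ := (Ideal.IsPrime.prod_mem_iff).mp h
    exact hs k hk
  have hSβ : S • β ∈ scaledOrder F w π N := by
    rw [show S = (∏ k, s k) * s₀ from mul_comm _ _, mul_smul]
    exact Subalgebra.smul_mem _ hβ _
  have hSi : ∀ k, S • i k ∈ scaledOrder F w π N := by
    intro k
    have : s k ∣ S := (Finset.dvd_prod_of_mem s (Finset.mem_univ k)).mul_left _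
    obtain ⟨t, ht⟩ := this
    rw [ht, mul_comm, mul_smul]
    exact Subalgebra.smul_mem _ (hsi k) _
  have hSh : S • h = π • (S • β) + algebraMap R D S := by
    rw [hβh, smul_add, smul_comm, Algebra.algebraMap_eq_smul_one]
  let γ₀ : scaledOrder F w π N := π • ⟨S • β, hSβ⟩ + algebraMap R _ S
  have hγ₀ : (γ₀ : D) = S • h := hSh.symm
  -- `γ₀ = S * h` is congruent to `S` modulo `π`, so it lies in no prime over `p`. The additional
  -- factor `S` in `γ = S ^ 2 * h` absorbs the denominator of the elements `i k` when powers of `γ`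
  -- clear the denominators of `θ`.
  let γ : scaledOrder F w π N := algebraMap R _ S * γ₀
  have hγ : (γ : D) = algebraMap R D S * (algebraMap R D S * h) := by
    rw [← Algebra.smul_def S h, ← hγ₀]
    rfl
  refine ⟨γ, ⟨algebraMap R D S * algebraMap R D S, by rw [hγ]; ring⟩, ?_, ?_⟩
  · intro P hP hPp hγP
    apply hS
    rw [← hPp, Ideal.mem_comap]
    refine (hP.mem_or_mem hγP).elim id fun hγP => ?_
    have : (π • ⟨S • β, hSβ⟩ : scaledOrder F w π N) ∈ P := by
      rw [Algebra.smul_def]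
      refine P.mul_mem_right _ ?_
      rw [← Ideal.mem_comap, hPp]
      exact hπ
    exact (P.add_mem_iff_right this).mp hγP
  · intro b hb
    induction hb using Algebra.adjoin_induction with
    | mem x hx =>
      obtain ⟨k, rfl⟩ := hx
      refine ⟨m k + 1, (S • i k) * (algebraMap R D S ^ (2 * m k) * γ₀), mul_mem (hSi k)
        (mul_mem (pow_mem (Subalgebra.algebraMap_mem _ _) _) γ₀.2), ?_⟩
      have e1 : θ (algebraMap F A (algebraMap R F π ^ N)⁻¹ * x k) * algebraMap D L h ^ m k =
          algebraMap D L (i k) := by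
        rw [map_mul, AlgHom.commutes, mul_assoc, hα, hiα, IsScalarTower.algebraMap_apply F D L,
          ← map_mul, Algebra.smul_def, ← mul_assoc, IsScalarTower.algebraMap_apply R F D,
          ← map_mul, map_pow, inv_mul_cancel₀ (pow_ne_zero _ h0), map_one, one_mul]
      rw [hγ, hγ₀, Algebra.smul_def, Algebra.smul_def]
      simp only [map_mul, map_pow, ← e1]
      ring
    | algebraMap r =>
      refine ⟨0, algebraMap R D r, Subalgebra.algebraMap_mem _ _, ?_⟩
      rw [pow_zero, mul_one, IsScalarTower.algebraMap_apply R F A, AlgHom.commutes,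
        IsScalarTower.algebraMap_apply R F D, ← IsScalarTower.algebraMap_apply F D L]
    | add x y _ _ hx hy =>
      obtain ⟨n, c, hc, e⟩ := hx
      obtain ⟨n', c', hc', e'⟩ := hy
      refine ⟨n + n', c * γ ^ n' + c' * γ ^ n, add_mem (mul_mem hc (pow_mem γ.2 _))
        (mul_mem hc' (pow_mem γ.2 _)), ?_⟩
      rw [map_add, map_add, map_mul, map_mul, map_pow, map_pow, ← e, ← e']
      ring
    | mul x y _ _ hx hy =>
      obtain ⟨n, c, hc, e⟩ := hx
      obtain ⟨n', c', hc', e'⟩ := hy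
      refine ⟨n + n', c * c', mul_mem hc hc', ?_⟩
      rw [map_mul, map_mul, ← e, ← e']
      ring

end Rescaling
end IntegralModels

/-! ### Extending morphisms between affine models -/

namespace IntegralModels

open Limits

section AffineExtension

variable {R F : Type u} [CommRing R] [IsDedekindDomain R] [Field F] [Algebra R F]
  [IsFractionRing R F]

omit [IsDedekindDomain R] [Algebra R F] [IsFractionRing R F] in
-- `γ` is a multiple of `h`, so `θ` is defined after inverting `γ`. By `hBC` it then maps `B` into
-- the localization of the order `C`, not merely into that of `D`.
theorem exists_localization_lift {A D L L' : Type u} [CommRing A] [CommRing D]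
    [CommRing L] [Algebra F A] [Algebra R A] [Algebra F D] [Algebra R D]
    [Algebra D L] [Algebra F L] {B : Subalgebra R A} {C : Subalgebra R D} {h : D}
    [IsLocalization.Away h L] (θ : A →ₐ[F] L) (γ : C) (hγ : h ∣ (γ : D)) (C' : Type u)
    [CommRing C'] [CommRing L'] [Algebra C C'] [Algebra D L'] [IsLocalization.Away γ C']
    [IsLocalization.Away (γ : D) L']
    (hBC : ∀ b ∈ B, ∃ n : ℕ, ∃ c ∈ C, θ b * algebraMap D L γ ^ n = algebraMap D L c) :
    ∃ (σ : L →+* L') (ι : C' →+* L') (g : B →+* C'), σ.comp (algebraMap D L) = algebraMap D L' ∧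
      Function.Injective ι ∧ ι.comp (algebraMap C C') = (algebraMap D L').comp (algebraMap C D) ∧
      ι.comp g = (σ.comp θ.toRingHom).comp (algebraMap B A) := by
  have hhu : IsUnit (algebraMap D L' h) :=
    isUnit_of_dvd_unit (map_dvd _ hγ) (IsLocalization.Away.algebraMap_isUnit (γ : D))
  obtain ⟨σ, hσ⟩ : ∃ σ : L →+* L', ∀ d, σ (algebraMap D L d) = algebraMap D L' d :=
    ⟨IsLocalization.Away.lift h hhu, fun d => IsLocalization.Away.lift_eq h hhu d⟩
  have hmap : (Submonoid.powers γ).map (algebraMap C D) = Submonoid.powers (γ : D) := by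
    rw [Submonoid.map_powers]; rfl
  have : IsLocalization ((Submonoid.powers γ).map (algebraMap C D)) L' := by
    rw [hmap]; infer_instance
  obtain ⟨ι, hι, hιC⟩ : ∃ ι : C' →+* L', Function.Injective ι ∧
      ∀ c : C, ι (algebraMap C C' c) = algebraMap D L' c :=
    ⟨IsLocalization.map (M := Submonoid.powers γ) (T := (Submonoid.powers γ).map (algebraMap C D))
      L' (algebraMap C D) (Submonoid.le_comap_map _),
      IsLocalization.map_injective_of_injective (Submonoid.powers γ) C' L' Subtype.val_injective,
      fun c => IsLocalization.map_eq _ c⟩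
  obtain ⟨g, hg⟩ := exists_lift_of_forall_mem hι ((σ.comp θ.toRingHom).comp (algebraMap B A)) (by
    rintro ⟨b, hb⟩
    obtain ⟨n, c, hc, e⟩ := hBC b hb
    have e' := congrArg σ e
    rw [map_mul, map_pow, hσ, hσ] at e'
    refine ⟨IsLocalization.mk' C' ⟨c, hc⟩ (⟨γ ^ n, n, rfl⟩ : Submonoid.powers γ), ?_⟩
    have hu : IsUnit (algebraMap D L' γ ^ n) :=
      (IsLocalization.Away.algebraMap_isUnit (γ : D)).pow n
    refine hu.mul_right_cancel (Eq.trans ?_ e'.symm)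
    rw [← map_pow, show ((γ : D) ^ n) = ((γ ^ n : C) : D) from rfl, ← hιC, ← map_mul]
    exact (congrArg ι (IsLocalization.mk'_spec C' _ _)).trans (hιC ⟨c, hc⟩))
  exact ⟨σ, ι, g, RingHom.ext hσ, hι, RingHom.ext hιC, hg⟩

/-- The locus in the model of `C` where `γ` is invertible is an open neighbourhood of the fibre over
`q`, because `γ` lies in no prime over `q`; on it `θ` restricts to the orders. -/
theorem extendsAt_affineModel {X : Scheme.{u}} {A D L : Type u} [CommRing A] [CommRing D]
    [CommRing L] [Algebra F A] [Algebra R A] [IsScalarTower R F A] [Algebra F D] [Algebra R D]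
    [IsScalarTower R F D] [Algebra D L] [Algebra F L] [IsScalarTower F D L] {B : Subalgebra R A}
    (hB : IsOrder B) {C : Subalgebra R D} (hC : IsOrder C) {h : D} [IsLocalization.Away h L]
    (θ : A →ₐ[F] L) {j : Spec (.of A) ⟶ X} {r : Spec (.of D) ⟶ X}
    (hθ : Spec.map (CommRingCat.ofHom θ.toRingHom) ≫ j =
      Spec.map (CommRingCat.ofHom (algebraMap D L)) ≫ r)
    {q : Spec (.of R)} (γ : C) (hγ : h ∣ (γ : D))
    (hγq : ∀ P : Ideal C, P.IsPrime → P.comap (algebraMap R C) = q.asIdeal → γ ∉ P)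
    (hBC : ∀ b ∈ B, ∃ n : ℕ, ∃ c ∈ C, θ b * algebraMap D L γ ^ n = algebraMap D L c) :
    ExtendsAt q (affineModel R F C hC) (affineModel R F B hB) r j := by
  obtain ⟨L', _, _, _⟩ : ∃ (L' : Type u) (_ : CommRing L') (_ : Algebra D L'),
    IsLocalization.Away (γ : D) L' := ⟨Localization.Away (γ : D), _, _, inferInstance⟩
  obtain ⟨C', _, _, _⟩ : ∃ (C' : Type u) (_ : CommRing C') (_ : Algebra C C'),
    IsLocalization.Away γ C' := ⟨Localization.Away γ, _, _, inferInstance⟩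
  obtain ⟨σ, ι, g, hσ, hι, hιC, hg⟩ := exists_localization_lift (L' := L') θ γ hγ C' hBC
  have : IsOpenImmersion (Spec.map (CommRingCat.ofHom (algebraMap D L'))) :=
    IsOpenImmersion.of_isLocalization (γ : D)
  have : IsOpenImmersion (Spec.map (CommRingCat.ofHom (algebraMap C C'))) :=
    IsOpenImmersion.of_isLocalization γ
  refine ⟨Spec (.of C'), Spec.map (CommRingCat.ofHom (algebraMap C C')),
    Spec.map (CommRingCat.ofHom g), IsOpenImmersion.of_isLocalization γ, ?_, ?_, ?_⟩
  · intro m hm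
    have h1 : γ ∉ PrimeSpectrum.asIdeal m := hγq _ m.isPrime (congrArg PrimeSpectrum.asIdeal hm)
    have h2 : m ∈ Set.range (PrimeSpectrum.comap (algebraMap C C')) := by
      rw [PrimeSpectrum.localization_away_comap_range C' γ]
      exact h1
    exact h2
  · refine (specMap_comp_specMap (algebraMap R B) g).trans (Eq.trans ?_
      (specMap_comp_specMap (algebraMap R C) (algebraMap C C')).symm)
    congr 2
    refine RingHom.ext fun a => hι ?_
    have h1 := congrArg (fun f => f (algebraMap R B a)) hg
    have h2 := congrArg (fun f => f (algebraMap R C a)) hιC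
    refine h1.trans (Eq.trans ?_ h2.symm)
    change σ (θ (algebraMap R A a)) = algebraMap D L' (algebraMap R D a)
    rw [IsScalarTower.algebraMap_apply R F A, AlgHom.commutes,
      IsScalarTower.algebraMap_apply R F D, IsScalarTower.algebraMap_apply F D L]
    exact RingHom.congr_fun hσ _
  · intro T t x e
    have e : t ≫ Spec.map (CommRingCat.ofHom (algebraMap C C')) =
      x ≫ Spec.map (CommRingCat.ofHom (algebraMap C D)) := e
    obtain ⟨x', rfl⟩ : ∃ x', x' ≫ Spec.map (CommRingCat.ofHom (algebraMap D L')) = x := by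
      refine ⟨IsOpenImmersion.lift _ x ?_, IsOpenImmersion.lift_fac _ _ _⟩
      rintro _ ⟨y, rfl⟩
      have h1 : x y ∈ Set.range (PrimeSpectrum.comap (algebraMap D L')) := by
        rw [PrimeSpectrum.localization_away_comap_range L' (γ : D)]
        have h2 : Spec.map (CommRingCat.ofHom (algebraMap C D)) (x y) ∈
            Set.range (PrimeSpectrum.comap (algebraMap C C')) := by
          rw [← Scheme.Hom.comp_apply, ← e]
          exact ⟨t y, rfl⟩
        rw [PrimeSpectrum.localization_away_comap_range C' γ] at h2
        exact h2
      exact h1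
    have ht : x' ≫ Spec.map (CommRingCat.ofHom ι) = t := by
      rw [← cancel_mono (Spec.map (CommRingCat.ofHom (algebraMap C C'))), e, Category.assoc,
        Category.assoc, specMap_comp_specMap, specMap_comp_specMap, hιC]
    refine ⟨x' ≫ Spec.map (CommRingCat.ofHom σ) ≫ Spec.map (CommRingCat.ofHom θ.toRingHom), ?_, ?_⟩
    · rw [Category.assoc, Category.assoc, hθ, ← Category.assoc (Spec.map _) (Spec.map _) r,
        specMap_comp_specMap, hσ, Category.assoc]
    · change t ≫ Spec.map (CommRingCat.ofHom g) =
        (x' ≫ _ ≫ _) ≫ Spec.map (CommRingCat.ofHom (algebraMap B A))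
      rw [← ht, Category.assoc, Category.assoc, Category.assoc, specMap_comp_specMap,
        specMap_comp_specMap, specMap_comp_specMap, hg, RingHom.comp_assoc]

omit [IsDedekindDomain R] [IsFractionRing R F] in
theorem ExtendsAt.of_hom {X W P P' : Scheme.{u}} {sW : W ⟶ Spec (.of F)} {sP : P ⟶ Spec (.of F)}
    {sP' : P' ⟶ Spec (.of F)} {q : Spec (.of R)} {M : FlatModel R sP} {M' : FlatModel R sP'}
    {Z : FlatModel R sW} {r : P' ⟶ X} {j : W ⟶ X} (h : ExtendsAt q M' Z r j)
    (f : M.scheme ⟶ M'.scheme) (hf : f ≫ M'.str = M.str) (k : P ⟶ P')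
    (hk : M.gen ≫ f = k ≫ M'.gen) : ExtendsAt q M Z (k ≫ r) j := by
  obtain ⟨Ω, i, ψ, _, hi, hs, hψ⟩ := h
  refine ⟨pullback f i, pullback.fst f i, pullback.snd f i ≫ ψ, inferInstance, ?_, ?_, ?_⟩
  · intro m hm
    rw [Scheme.Pullback.range_fst]
    refine hi _ ?_
    rw [← Scheme.Hom.comp_apply, hf, hm]
  · rw [Category.assoc, hs, ← pullback.condition_assoc, hf]
  · intro T t x e
    obtain ⟨y, hy, hyψ⟩ := hψ (t ≫ pullback.snd f i) (x ≫ k) (by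
      rw [Category.assoc, ← pullback.condition, reassoc_of% e, hk, Category.assoc])
    exact ⟨y, by rw [hy, Category.assoc], by rw [← hyψ, Category.assoc]⟩

open scoped TensorProduct in
/-- The generators of a tensor product given by generators of the factors. -/
def tensorGenerators (F : Type*) {A κ : Type*} [Field F] [CommRing A] [Algebra F A] (x : κ → A) :
    κ ⊕ κ → A ⊗[F] A :=
  Sum.elim (fun k => x k ⊗ₜ 1) (fun k => 1 ⊗ₜ x k)

theorem adjoin_tensorGenerators {F A κ : Type*} [Field F] [CommRing A] [Algebra F A] {x : κ → A}
    (hx : Algebra.adjoin F (Set.range x) = ⊤) :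
    Algebra.adjoin F (Set.range (tensorGenerators F x)) = ⊤ := by
  have hl : ∀ a : A, (a ⊗ₜ 1 : TensorProduct F A A) ∈
      Algebra.adjoin F (Set.range (tensorGenerators F x)) := by
    intro a
    have ha : a ∈ Algebra.adjoin F (Set.range x) := hx ▸ Algebra.mem_top
    have h1 : (Algebra.TensorProduct.includeLeft : A →ₐ[F] TensorProduct F A A) a ∈
      (Algebra.adjoin F (Set.range x)).map Algebra.TensorProduct.includeLeft := ⟨a, ha, rfl⟩
    rw [AlgHom.map_adjoin, ← Set.range_comp] at h1
    refine Algebra.adjoin_mono ?_ h1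
    rintro _ ⟨k, rfl⟩
    exact ⟨Sum.inl k, rfl⟩
  have hr : ∀ a : A, (1 ⊗ₜ a : TensorProduct F A A) ∈
      Algebra.adjoin F (Set.range (tensorGenerators F x)) := by
    intro a
    have ha : a ∈ Algebra.adjoin F (Set.range x) := hx ▸ Algebra.mem_top
    have h1 : (Algebra.TensorProduct.includeRight : A →ₐ[F] TensorProduct F A A) a ∈
      (Algebra.adjoin F (Set.range x)).map Algebra.TensorProduct.includeRight := ⟨a, ha, rfl⟩
    rw [AlgHom.map_adjoin, ← Set.range_comp] at h1
    refine Algebra.adjoin_mono ?_ h1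
    rintro _ ⟨k, rfl⟩
    exact ⟨Sum.inr k, rfl⟩
  rw [eq_top_iff]
  rintro z -
  induction z using TensorProduct.induction_on with
  | zero => exact zero_mem _
  | add y z hy hz => exact add_mem hy hz
  | tmul a b =>
    have : (a ⊗ₜ b : TensorProduct F A A) = (a ⊗ₜ 1) * (1 ⊗ₜ b) := by simp
    rw [this]
    exact mul_mem (hl a) (hr b)

open scoped TensorProduct in
-- `B` is torsion-free, hence flat, so its tensor square over `R` embeds into that of `A`. For `A`
-- it makes no difference whether the tensor product is taken over `R` or over its fraction field.
theorem injective_tensorProduct_order {A : Type u} [CommRing A] [Algebra F A] [Algebra R A]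
    [IsScalarTower R F A] (B : Subalgebra R A) (τ : B ⊗[R] B →ₐ[R] A ⊗[F] A)
    (hτ : ∀ a b, τ (a ⊗ₜ b) = (a : A) ⊗ₜ (b : A)) : Function.Injective τ := by
  have h2 : Module.IsTorsionFree R A := by
    refine Module.isTorsionFree_iff_smul_eq_zero.mpr fun r a h => ?_
    by_cases hr : r = 0
    · exact Or.inl hr
    · rw [Algebra.smul_def] at h
      exact Or.inr ((isUnit_algebraMap_of_ne_zero F hr).mul_right_eq_zero.mp h)
  have : Module.IsTorsionFree R B := inferInstance
  have h3 := TensorProduct.map_injective_of_flat_flat B.val.toLinearMap B.val.toLinearMap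
    Subtype.val_injective Subtype.val_injective
  have := IsLocalization.tensorProduct_compatibleSMul (nonZeroDivisors R) F A A
  let e := TensorProduct.equivOfCompatibleSMul R F R A A
  have h4 : ∀ z, e (τ z) = TensorProduct.map B.val.toLinearMap B.val.toLinearMap z := by
    intro z
    induction z using TensorProduct.induction_on with
    | zero => simp
    | add y z hy hz => rw [map_add, map_add, hy, hz, map_add]
    | tmul a b => rw [hτ]; rfl
  intro y z h
  apply h3
  rw [← h4, ← h4, h]

/-- The order in `A ⊗ A` generated by the rescaled coordinates of both factors is contained in the
image of `B ⊗ B`. So the product of the affine models maps to the model of that order, and the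
extension is pulled back along this map. -/
theorem extendsAt_prod_affineModel {X W : Scheme.{u}} {sW : W ⟶ Spec (.of F)} {A κ : Type u}
    [CommRing A] [Algebra F A] [Algebra R A] [IsScalarTower R F A] {x : κ → A} {π : R} {N : ℕ}
    (hB : IsOrder (scaledOrder F x π N)) (hC : IsOrder (scaledOrder F (tensorGenerators F x) π N))
    {q : Spec (.of R)} {Z : FlatModel R sW} {r : Spec (.of (TensorProduct F A A)) ⟶ X} {j : W ⟶ X}
    (h : ExtendsAt q (affineModel R F _ hC) Z r j) :
    ExtendsAt q ((affineModel R F _ hB).prod (affineModel R F _ hB)) Z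
      ((pullbackSpecIso F A A).hom ≫ r) j := by
  let B := scaledOrder F x π N
  let C := scaledOrder F (tensorGenerators F x) π N
  let l : A →ₐ[R] TensorProduct F A A := Algebra.TensorProduct.includeLeft
  let r : A →ₐ[R] TensorProduct F A A := Algebra.TensorProduct.includeRight.restrictScalars R
  let τ : TensorProduct R B B →ₐ[R] TensorProduct F A A :=
    Algebra.TensorProduct.lift (l.comp B.val) (r.comp B.val) fun _ _ => Commute.all _ _
  have hτ : ∀ a b : B, τ (a ⊗ₜ b) = (a : A) ⊗ₜ (b : A) := by
    intro a b
    simp [τ, l, r]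
  have hinj := injective_tensorProduct_order (F := F) B τ hτ
  have hrange : C ≤ τ.range := by
    refine Algebra.adjoin_le ?_
    rintro _ ⟨k | k, rfl⟩
    · refine ⟨⟨_, Algebra.subset_adjoin ⟨k, rfl⟩⟩ ⊗ₜ 1, ?_⟩
      refine (hτ _ _).trans ?_
      simp [tensorGenerators, ← Algebra.smul_def]
    · refine ⟨1 ⊗ₜ ⟨_, Algebra.subset_adjoin ⟨k, rfl⟩⟩, ?_⟩
      refine (hτ _ _).trans ?_
      simp only [tensorGenerators, Sum.elim_inr, ← Algebra.smul_def]
      exact TensorProduct.tmul_smul _ _ _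
  obtain ⟨g, hg⟩ := exists_lift_of_forall_mem (ι := τ.toRingHom) hinj (algebraMap C _)
    fun c => hrange c.2
  have hfst : (pullbackSpecIso F A A).hom ≫ Spec.map (CommRingCat.ofHom l.toRingHom) =
      pullback.fst _ _ := pullbackSpecIso_hom_fst F A A
  have hsnd : (pullbackSpecIso F A A).hom ≫ Spec.map (CommRingCat.ofHom r.toRingHom) =
      pullback.snd _ _ := pullbackSpecIso_hom_snd F A A
  have hgen : ((affineModel R F B hB).prod (affineModel R F B hB)).gen =
      (pullbackSpecIso F A A).hom ≫ Spec.map (CommRingCat.ofHom τ.toRingHom) ≫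
        (pullbackSpecIso R B B).inv := by
    rw [FlatModel.prod_gen]
    refine pullback.hom_ext ?_ ?_
    · refine (pullback.lift_fst _ _ _).trans ?_
      change pullback.fst _ _ ≫ Spec.map (CommRingCat.ofHom (algebraMap B A)) = _
      refine Eq.trans ?_ (Category.assoc _ _ _).symm
      refine Eq.trans ?_ (congrArg (_ ≫ ·) (Category.assoc _ _ _).symm)
      refine Eq.trans ?_ (congrArg (fun t => _ ≫ _ ≫ t) (pullbackSpecIso_inv_fst R B B).symm)
      rw [← hfst, Category.assoc, specMap_comp_specMap, specMap_comp_specMap]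
      congr 3
      ext b
      simp [τ, l, r]
    · refine (pullback.lift_snd _ _ _).trans ?_
      change pullback.snd _ _ ≫ Spec.map (CommRingCat.ofHom (algebraMap B A)) = _
      refine Eq.trans ?_ (Category.assoc _ _ _).symm
      refine Eq.trans ?_ (congrArg (_ ≫ ·) (Category.assoc _ _ _).symm)
      refine Eq.trans ?_ (congrArg (fun t => _ ≫ _ ≫ t) (pullbackSpecIso_inv_snd R B B).symm)
      rw [← hsnd, Category.assoc, specMap_comp_specMap, specMap_comp_specMap]
      congr 3
      ext b
      simp [τ, l, r]
  refine h.of_hom ((pullbackSpecIso R B B).hom ≫ Spec.map (CommRingCat.ofHom g)) ?_ _ ?_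
  · change (_ ≫ _) ≫ Spec.map (CommRingCat.ofHom (algebraMap R C)) =
      pullback.fst _ _ ≫ Spec.map (CommRingCat.ofHom (algebraMap R B))
    rw [Category.assoc, specMap_comp_specMap]
    have e1 := congrArg (· ≫ Spec.map (CommRingCat.ofHom (algebraMap R B)))
      (pullbackSpecIso_hom_fst R B B)
    refine Eq.trans ?_ e1
    refine Eq.trans ?_ (Category.assoc _ _ _).symm
    rw [specMap_comp_specMap]
    congr 3
    ext a
    apply hinj
    have h1 := RingHom.congr_fun hg (algebraMap R C a)
    refine h1.trans ?_
    exact (τ.commutes a).symm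
  · rw [hgen]
    have e1 : Spec.map (CommRingCat.ofHom (algebraMap C (TensorProduct F A A))) =
        Spec.map (CommRingCat.ofHom τ.toRingHom) ≫ Spec.map (CommRingCat.ofHom g) := by
      rw [specMap_comp_specMap, ← hg]
    refine Eq.trans ?_ (congrArg ((pullbackSpecIso F A A).hom ≫ ·) e1.symm)
    refine (Category.assoc _ _ _).trans (congrArg ((pullbackSpecIso F A A).hom ≫ ·) ?_)
    refine (Category.assoc _ _ _).trans
      (congrArg (Spec.map (CommRingCat.ofHom τ.toRingHom) ≫ ·) ?_)
    exact Iso.inv_hom_id_assoc _ _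

end AffineExtension
end IntegralModels

/-! ### Linear parts of functions on a product -/

namespace IntegralModels

open Limits

section LinearPart

open scoped TensorProduct

variable {F : Type*} [Field F]

theorem mem_span_range_of_map_eq_zero {D ι : Type*} [CommRing D] [Algebra F D] {w : ι → D}
    (hw : Algebra.adjoin F (Set.range w) = ⊤) (ε : D →ₐ[F] F) (hε : ∀ l, ε (w l) = 0) {q : D}
    (hq : ε q = 0) : q ∈ Ideal.span (Set.range w) := by
  suffices h : ∀ q, q - algebraMap F D (ε q) ∈ Ideal.span (Set.range w) by
    simpa [hq] using h q
  intro q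
  have hq : q ∈ Algebra.adjoin F (Set.range w) := hw ▸ Algebra.mem_top
  induction hq using Algebra.adjoin_induction with
  | mem x hx =>
    obtain ⟨l, rfl⟩ := hx
    rw [hε, map_zero, sub_zero]
    exact Ideal.subset_span ⟨l, rfl⟩
  | algebraMap c => simp
  | add x y _ _ hx hy =>
    rw [map_add, map_add, add_sub_add_comm]
    exact add_mem hx hy
  | mul x y _ _ hx hy =>
    have : x * y - algebraMap F D (ε (x * y)) = (x - algebraMap F D (ε x)) * y +
        algebraMap F D (ε x) * (y - algebraMap F D (ε y)) := by
      rw [map_mul, map_mul]; ring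
    rw [this]
    exact add_mem (Ideal.mul_mem_right _ _ hx) (Ideal.mul_mem_left _ _ hy)

variable {A : Type*} [CommRing A] [Algebra F A]

/-- Restriction of functions along the morphism with the given components. -/
def pairHom (a b : A →ₐ[F] A) : A ⊗[F] A →ₐ[F] A :=
  Algebra.TensorProduct.lift a b fun _ _ => Commute.all _ _

@[simp]
theorem pairHom_tmul (a b : A →ₐ[F] A) (y z : A) : pairHom a b (y ⊗ₜ z) = a y * b z := rfl

variable {κ : Type*} {x : κ → A}

theorem tmul_one_mem {n : ℕ} {z : A} (hz : z ∈ Ideal.span (Set.range x) ^ n) :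
    (z ⊗ₜ[F] (1 : A)) ∈ Ideal.span (Set.range (tensorGenerators F x)) ^ n := by
  have h := Ideal.mem_map_of_mem
    (Algebra.TensorProduct.includeLeft : A →ₐ[F] A ⊗[F] A) hz
  rw [Ideal.map_pow, Ideal.map_span, ← Set.range_comp] at h
  refine Ideal.pow_right_mono (Ideal.span_mono ?_) n h
  rintro _ ⟨k, rfl⟩
  exact ⟨Sum.inl k, rfl⟩

theorem one_tmul_mem {n : ℕ} {z : A} (hz : z ∈ Ideal.span (Set.range x) ^ n) :
    ((1 : A) ⊗ₜ[F] z) ∈ Ideal.span (Set.range (tensorGenerators F x)) ^ n := by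
  have h := Ideal.mem_map_of_mem
    (Algebra.TensorProduct.includeRight : A →ₐ[F] A ⊗[F] A) hz
  rw [Ideal.map_pow, Ideal.map_span, ← Set.range_comp] at h
  refine Ideal.pow_right_mono (Ideal.span_mono ?_) n h
  rintro _ ⟨k, rfl⟩
  exact ⟨Sum.inr k, rfl⟩

theorem pairHom_id_id_mem_sq {α : A ⊗[F] A}
    (h : α ∈ Ideal.span (Set.range (tensorGenerators F x)) ^ 2) :
    pairHom (AlgHom.id F A) (AlgHom.id F A) α ∈ Ideal.span (Set.range x) ^ 2 := by
  have h := Ideal.mem_map_of_mem (pairHom (AlgHom.id F A) (AlgHom.id F A)) h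
  rw [Ideal.map_pow, Ideal.map_span, ← Set.range_comp] at h
  refine Ideal.pow_right_mono (Ideal.span_mono ?_) 2 h
  rintro _ ⟨k | k, rfl⟩
  · exact ⟨k, by simp [tensorGenerators]⟩
  · exact ⟨k, by simp [tensorGenerators]⟩

/-- The constant functions with a given value at the origin. -/
def constHom (ε : A →ₐ[F] F) : A →ₐ[F] A := (Algebra.ofId F A).comp ε

/-- Up to second order, a function on the product is the sum of its restrictions to the two axes
minus its value at the origin. For a pure tensor `a ⊗ b` the error is `(a - ε a) ⊗ (b - ε b)`. -/
theorem sub_sub_add_mem_sq (hx : Algebra.adjoin F (Set.range x) = ⊤) (ε : A →ₐ[F] F)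
    (hε : ∀ k, ε (x k) = 0) (α : A ⊗[F] A) :
    α - pairHom (AlgHom.id F A) (constHom ε) α ⊗ₜ 1 - 1 ⊗ₜ pairHom (constHom ε) (AlgHom.id F A) α +
      algebraMap F _ (ε (pairHom (AlgHom.id F A) (constHom ε) α)) ∈
      Ideal.span (Set.range (tensorGenerators F x)) ^ 2 := by
  have hI : ∀ a, a - algebraMap F A (ε a) ∈ Ideal.span (Set.range x) := fun a =>
    mem_span_range_of_map_eq_zero hx ε hε (by simp)
  induction α using TensorProduct.induction_on with
  | zero => simp
  | add y z hy hz =>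
    have := add_mem hy hz
    convert this using 1
    simp only [map_add, TensorProduct.add_tmul, TensorProduct.tmul_add]
    ring
  | tmul a b =>
    have h1 := tmul_one_mem (F := F) (x := x) (n := 1) (z := a - algebraMap F A (ε a))
      (by rw [pow_one]; exact hI a)
    have h2 := one_tmul_mem (F := F) (x := x) (n := 1) (z := b - algebraMap F A (ε b))
      (by rw [pow_one]; exact hI b)
    rw [pow_one] at h1 h2
    have h3 := Ideal.mul_mem_mul h1 h2
    rw [← pow_two] at h3
    convert h3 using 1
    have e1 : ∀ c : F, ∀ y z : A, y ⊗ₜ[F] (algebraMap F A c * z) = (algebraMap F A c * y) ⊗ₜ z := by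
      intro c y z
      rw [← Algebra.smul_def, ← Algebra.smul_def, TensorProduct.tmul_smul, TensorProduct.smul_tmul']
    have e2 : ∀ c : F, (algebraMap F A c) ⊗ₜ[F] (1 : A) = algebraMap F (A ⊗[F] A) c := fun c => rfl
    have e3 : ∀ c : F, (1 : A) ⊗ₜ[F] (algebraMap F A c) = algebraMap F (A ⊗[F] A) c := fun c => by
      rw [← e2, ← mul_one (algebraMap F A c), e1, mul_one]
    have e4 : ∀ y z : A, y ⊗ₜ[F] z = (y ⊗ₜ 1) * (1 ⊗ₜ z) := fun y z => by simp
    have e5 : ∀ y z : A, (y * z) ⊗ₜ[F] (1 : A) = (y ⊗ₜ 1) * (z ⊗ₜ 1) := fun y z => by simp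
    have e6 : ∀ y z : A, (1 : A) ⊗ₜ[F] (y * z) = (1 ⊗ₜ y) * (1 ⊗ₜ z) := fun y z => by simp
    simp only [pairHom_tmul, constHom, AlgHom.comp_apply, Algebra.ofId_apply, AlgHom.id_apply,
      map_mul, AlgHom.commutes, TensorProduct.sub_tmul, TensorProduct.tmul_sub, e5, e6, e2, e3,
      e4 a b, Algebra.algebraMap_self, RingHom.id_apply,
      map_one, ← Algebra.TensorProduct.one_def]
    ring

/-- The linear part of a function on the product which restricts to `x₀` on the first factor and
vanishes to second order on the diagonal. -/
theorem sub_mem_sq_of_restrict (hx : Algebra.adjoin F (Set.range x) = ⊤) (ε : A →ₐ[F] F)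
    (hε : ∀ k, ε (x k) = 0) {α : A ⊗[F] A} {x₀ : A} (hx₀ : ε x₀ = 0)
    (h₁ : pairHom (AlgHom.id F A) (constHom ε) α - x₀ ∈ Ideal.span (Set.range x) ^ 2)
    (h₂ : pairHom (AlgHom.id F A) (AlgHom.id F A) α ∈ Ideal.span (Set.range x) ^ 2) :
    α - (x₀ ⊗ₜ 1 - 1 ⊗ₜ x₀) ∈ Ideal.span (Set.range (tensorGenerators F x)) ^ 2 := by
  have hε2 : ∀ z ∈ Ideal.span (Set.range x), ε z = 0 := by
    intro z hz
    have : Ideal.span (Set.range x) ≤ RingHom.ker ε.toRingHom := by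
      rw [Ideal.span_le]
      rintro _ ⟨k, rfl⟩
      exact hε k
    exact this hz
  have h3 := sub_sub_add_mem_sq hx ε hε α
  have h4 : ε (pairHom (AlgHom.id F A) (constHom ε) α) = 0 := by
    have := hε2 _ (Ideal.pow_le_self two_ne_zero h₁)
    rwa [map_sub, hx₀, sub_zero] at this
  rw [h4, map_zero, add_zero] at h3
  -- Restricting to the diagonal, where `α` vanishes to second order, shows that the restriction of
  -- `α` to the second axis is minus that to the first.
  have h5 := pairHom_id_id_mem_sq h3
  rw [map_sub, map_sub, pairHom_tmul, pairHom_tmul, map_one, mul_one, one_mul,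
    AlgHom.id_apply, AlgHom.id_apply] at h5
  have h6 : pairHom (constHom ε) (AlgHom.id F A) α + x₀ ∈ Ideal.span (Set.range x) ^ 2 := by
    have := sub_mem (sub_mem h₂ h5) h₁
    convert this using 1
    ring
  have h7 := add_mem (add_mem h3 (tmul_one_mem (F := F) h₁)) (one_tmul_mem (F := F) h6)
  convert h7 using 1
  rw [TensorProduct.sub_tmul, TensorProduct.tmul_add]
  ring

end LinearPart
-- Division near the unit of a group scheme
section GroupChart

variable {R F : Type u} [CommRing R] [IsDedekindDomain R] [Field F] [Algebra R F]
  [IsFractionRing R F]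

omit [IsDedekindDomain R] [IsFractionRing R F] [Algebra R F] [CommRing R] in
theorem specMap_pairHom {A : Type u} [CommRing A] [Algebra F A] (a b : A →ₐ[F] A) :
    Spec.map (CommRingCat.ofHom (pairHom a b).toRingHom) ≫ (pullbackSpecIso F A A).inv =
      pullback.lift (Spec.map (CommRingCat.ofHom a.toRingHom))
        (Spec.map (CommRingCat.ofHom b.toRingHom)) (by
          rw [specMap_comp_specMap, specMap_comp_specMap]
          congr 2
          exact a.comp_algebraMap.trans b.comp_algebraMap.symm) := by
  refine pullback.hom_ext ?_ ?_
  · rw [Category.assoc, pullbackSpecIso_inv_fst, pullback.lift_fst, specMap_comp_specMap]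
    congr 2
    ext y
    simp
  · rw [Category.assoc, pullbackSpecIso_inv_snd, pullback.lift_snd]
    refine (specMap_comp_specMap _ _).trans ?_
    congr 2
    ext y
    simp

omit [IsDedekindDomain R] [IsFractionRing R F] [Algebra R F] [CommRing R] in
/-- Pulling back along a morphism an identity between a partially defined homomorphism and a
globally defined one. -/
theorem exists_pow_mul_eq_zero {X : Scheme.{u}} {A A' D L : Type u} [CommRing A] [CommRing A']
    [CommRing D] [CommRing L] [Algebra D L] {h : D} [IsLocalization.Away h L] (θ : A →+* L)
    {j : Spec (.of A) ⟶ X} [Mono j] {r : Spec (.of D) ⟶ X}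
    (hθ : Spec.map (CommRingCat.ofHom θ) ≫ j =
      Spec.map (CommRingCat.ofHom (algebraMap D L)) ≫ r) (P : D →+* A') (η : A →+* A')
    (hP : Spec.map (CommRingCat.ofHom P) ≫ r = Spec.map (CommRingCat.ofHom η) ≫ j) {a : A} {m : ℕ}
    {α : D} (hα : θ a * algebraMap D L h ^ m = algebraMap D L α) :
    ∃ n : ℕ, P h ^ n * (η a * P h ^ m - P α) = 0 := by
  obtain ⟨L', _, _, _⟩ : ∃ (L' : Type u) (_ : CommRing L') (_ : Algebra A' L'),
    IsLocalization.Away (P h) L' := ⟨Localization.Away (P h), _, _, inferInstance⟩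
  have hu : IsUnit (((algebraMap A' L').comp P) h) :=
    IsLocalization.Away.algebraMap_isUnit (P h)
  obtain ⟨l, hl⟩ : ∃ l : L →+* L', l.comp (algebraMap D L) = (algebraMap A' L').comp P :=
    ⟨IsLocalization.Away.lift h hu, RingHom.ext fun d => IsLocalization.Away.lift_eq h hu d⟩
  have hlθ : l.comp θ = (algebraMap A' L').comp η := by
    have e : Spec.map (CommRingCat.ofHom (l.comp θ)) =
        Spec.map (CommRingCat.ofHom ((algebraMap A' L').comp η)) := by
      rw [← cancel_mono j, ← specMap_comp_specMap, ← specMap_comp_specMap, Category.assoc,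
        Category.assoc, hθ, ← hP, ← Category.assoc, ← Category.assoc, specMap_comp_specMap,
        specMap_comp_specMap, hl]
    exact congrArg CommRingCat.Hom.hom (Spec.map_injective e)
  have h1 := congrArg l hα
  have h2 : ∀ d, l (algebraMap D L d) = algebraMap A' L' (P d) := RingHom.congr_fun hl
  have h3 : l (θ a) = algebraMap A' L' (η a) := RingHom.congr_fun hlθ a
  rw [map_mul, map_pow, h2, h2, h3, ← map_pow, ← map_mul] at h1
  obtain ⟨⟨_, n, rfl⟩, hn⟩ := (IsLocalization.eq_iff_exists (Submonoid.powers (P h)) L').mp h1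
  exact ⟨n, by rw [mul_sub, sub_eq_zero]; exact hn⟩

theorem isOrder_scaledOrder {D : Type u} {ι : Type*} [CommRing D] [Algebra R D] [Algebra F D]
    [IsScalarTower R F D] [Finite ι] {w : ι → D} (hw : Algebra.adjoin F (Set.range w) = ⊤) {π : R}
    (hπ0 : π ≠ 0) (N : ℕ) : IsOrder (scaledOrder F w π N) := by
  refine isOrder_adjoin F (Set.finite_range _) ?_
  rw [eq_top_iff, ← hw, Algebra.adjoin_le_iff]
  rintro _ ⟨l, rfl⟩
  have hc : algebraMap R F π ^ N ≠ 0 :=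
    pow_ne_zero _ ((map_ne_zero_iff _ (IsFractionRing.injective R F)).mpr hπ0)
  have : w l = algebraMap F D (algebraMap R F π ^ N) *
      (algebraMap F D (algebraMap R F π ^ N)⁻¹ * w l) := by
    rw [← mul_assoc, ← map_mul, mul_inv_cancel₀ hc, map_one, one_mul]
  rw [this]
  exact mul_mem (Subalgebra.algebraMap_mem _ _) (Algebra.subset_adjoin ⟨l, rfl⟩)

/-- The division morphism of a group scheme extends to the models given by small polydiscs around
the unit. -/
theorem exists_extendsAt_div {X : Scheme.{u}} {sX : X ⟶ Spec (.of F)} {d : pullback sX sX ⟶ X}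
    (hds : d ≫ sX = pullback.fst sX sX ≫ sX) {e : Spec (.of F) ⟶ X} (hes : e ≫ sX = 𝟙 _)
    (hd₁ : pullback.lift (𝟙 X) (sX ≫ e) (by simp [hes]) ≫ d = 𝟙 X)
    (hd₂ : pullback.lift (𝟙 X) (𝟙 X) rfl ≫ d = sX ≫ e)
    {A κ : Type u} [CommRing A] [Algebra F A] [Algebra R A] [IsScalarTower R F A] [Finite κ]
    {j : Spec (.of A) ⟶ X} [IsOpenImmersion j]
    (hj : j ≫ sX = Spec.map (CommRingCat.ofHom (algebraMap F A))) {ε : A →ₐ[F] F}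
    (hε : Spec.map (CommRingCat.ofHom ε.toRingHom) ≫ j = e) {x : κ → A}
    (hx : Algebra.adjoin F (Set.range x) = ⊤) (hεx : ∀ k, ε (x k) = 0) {q : Spec (.of R)} {π : R}
    (hπ : π ∈ q.asIdeal) (hπ0 : π ≠ 0) :
    ∃ N₀, ∀ N ≥ N₀, ∀ hB : IsOrder (scaledOrder F x π N),
      ExtendsAt q ((affineModel R F _ hB).prod (affineModel R F _ hB)) (affineModel R F _ hB)
        (pullback.map (Spec.map (CommRingCat.ofHom (algebraMap F A)))
          (Spec.map (CommRingCat.ofHom (algebraMap F A))) sX sX j j (𝟙 _) (by simp [hj])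
          (by simp [hj]) ≫ d) j := by
  let J := pullback.map (Spec.map (CommRingCat.ofHom (algebraMap F A)))
          (Spec.map (CommRingCat.ofHom (algebraMap F A))) sX sX j j (𝟙 _) (by simp [hj])
          (by simp [hj])
  let r := (pullbackSpecIso F A A).inv ≫ J ≫ d
  have hP : ∀ a b : A →ₐ[F] A, Spec.map (CommRingCat.ofHom (pairHom a b).toRingHom) ≫ r =
      pullback.lift (Spec.map (CommRingCat.ofHom a.toRingHom) ≫ j)
        (Spec.map (CommRingCat.ofHom b.toRingHom) ≫ j) (by
          rw [Category.assoc, Category.assoc, hj, specMap_comp_specMap, specMap_comp_specMap]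
          congr 2
          exact a.comp_algebraMap.trans b.comp_algebraMap.symm) ≫ d := by
    intro a b
    rw [← Category.assoc, specMap_pairHom, ← Category.assoc]
    congr 1
    refine pullback.hom_ext ?_ ?_
    · rw [Category.assoc, pullback.lift_fst, pullback.lift_fst_assoc, pullback.lift_fst]
    · rw [Category.assoc, pullback.lift_snd, pullback.lift_snd_assoc, pullback.lift_snd]
  have hid : Spec.map (CommRingCat.ofHom (AlgHom.id F A).toRingHom) = 𝟙 _ := Spec.map_id _
  have hconst : Spec.map (CommRingCat.ofHom (constHom ε).toRingHom) ≫ j = j ≫ sX ≫ e := by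
    rw [← hε, reassoc_of% hj, ← Category.assoc, specMap_comp_specMap]
    rfl
  have hP₁ : Spec.map (CommRingCat.ofHom (pairHom (AlgHom.id F A) (constHom ε)).toRingHom) ≫ r =
      j := by
    rw [hP]
    have : j ≫ pullback.lift (𝟙 X) (sX ≫ e) (by simp [hes]) ≫ d = j := by
      rw [hd₁, Category.comp_id]
    refine Eq.trans ?_ this
    refine Eq.trans (congrArg (· ≫ d) ?_) (Category.assoc _ _ _)
    refine pullback.hom_ext ?_ ?_
    · refine (pullback.lift_fst _ _ _).trans (Eq.trans ?_
        ((Category.assoc _ _ _).trans (congrArg (j ≫ ·) (pullback.lift_fst _ _ _))).symm)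
      rw [hid, Category.comp_id]
      exact Category.id_comp j
    · refine (pullback.lift_snd _ _ _).trans (Eq.trans ?_
        ((Category.assoc _ _ _).trans (congrArg (j ≫ ·) (pullback.lift_snd _ _ _))).symm)
      exact hconst
  have hP₂ : Spec.map (CommRingCat.ofHom (pairHom (AlgHom.id F A) (AlgHom.id F A)).toRingHom) ≫ r =
      Spec.map (CommRingCat.ofHom (constHom ε).toRingHom) ≫ j := by
    rw [hP, hconst, ← hd₂]
    refine Eq.trans (congrArg (· ≫ d) ?_) (Category.assoc _ _ _)
    refine pullback.hom_ext ?_ ?_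
    · refine (pullback.lift_fst _ _ _).trans (Eq.trans ?_
        ((Category.assoc _ _ _).trans (congrArg (j ≫ ·) (pullback.lift_fst _ _ _))).symm)
      rw [hid, Category.comp_id]
      exact Category.id_comp j
    · refine (pullback.lift_snd _ _ _).trans (Eq.trans ?_
        ((Category.assoc _ _ _).trans (congrArg (j ≫ ·) (pullback.lift_snd _ _ _))).symm)
      rw [hid, Category.comp_id]
      exact Category.id_comp j
  let ε' : TensorProduct F A A →ₐ[F] F := ε.comp (pairHom (AlgHom.id F A) (constHom ε))
  have hε' : Spec.map (CommRingCat.ofHom ε'.toRingHom) ≫ r = e := by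
    have e1 : Spec.map (CommRingCat.ofHom ε'.toRingHom) = Spec.map (CommRingCat.ofHom ε.toRingHom) ≫
        Spec.map (CommRingCat.ofHom (pairHom (AlgHom.id F A) (constHom ε)).toRingHom) :=
      (specMap_comp_specMap _ _).symm
    rw [e1, Category.assoc, hP₁, hε]
  have hw := adjoin_tensorGenerators hx
  have hε'w : ∀ l, ε' (tensorGenerators F x l) = 0 := by
    rintro (k | k)
    · simp [ε', tensorGenerators, hεx]
    · simp [ε', tensorGenerators, constHom, hεx]
  let o : Spec (.of F) := closedPt F
  have ho : Spec.map (CommRingCat.ofHom ε'.toRingHom) o ∈ r ⁻¹ᵁ j.opensRange := by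
    change r (Spec.map (CommRingCat.ofHom ε'.toRingHom) o) ∈ Set.range j
    rw [← Scheme.Hom.comp_apply, hε', ← hε, Scheme.Hom.comp_apply]
    exact ⟨_, rfl⟩
  obtain ⟨_, ⟨h₀, rfl⟩, hoh, hhj⟩ :=
    PrimeSpectrum.isTopologicalBasis_basic_opens.exists_subset_of_mem_open ho
      (r ⁻¹ᵁ j.opensRange).2
  have hc : ε' h₀ ≠ 0 := by
    intro h
    apply hoh
    change ε' h₀ ∈ o.asIdeal
    rw [h]
    exact zero_mem _
  -- The denominator is normalized to take the value `1` at the origin, so that `h - 1` lies in the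
  -- ideal generated by the coordinates.
  obtain ⟨h, hε'h, hhj⟩ : ∃ h, ε' h = 1 ∧
      ∀ y ∈ PrimeSpectrum.basicOpen h, r y ∈ j.opensRange := by
    refine ⟨algebraMap F _ (ε' h₀)⁻¹ * h₀, ?_, fun y hy => hhj fun h2 => hy ?_⟩
    · rw [map_mul, AlgHom.commutes]
      exact inv_mul_cancel₀ hc
    · exact Ideal.mul_mem_left _ _ h2
  have hh : h - 1 ∈ Ideal.span (Set.range (tensorGenerators F x)) :=
    mem_span_range_of_map_eq_zero hw ε' hε'w (by rw [map_sub, hε'h, map_one, sub_self])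
  obtain ⟨L, _, _, _, _, _⟩ : ∃ (L : Type u) (_ : CommRing L) (_ : Algebra (TensorProduct F A A) L)
    (_ : Algebra F L) (_ : IsScalarTower F (TensorProduct F A A) L), IsLocalization.Away h L :=
    ⟨Localization.Away h, inferInstance, inferInstance, inferInstance, inferInstance, inferInstance⟩
  obtain ⟨θ₀, hθ₀⟩ : ∃ θ₀, θ₀ ≫ j =
      Spec.map (CommRingCat.ofHom (algebraMap (TensorProduct F A A) L)) ≫ r := by
    refine ⟨IsOpenImmersion.lift j _ ?_, IsOpenImmersion.lift_fac _ _ _⟩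
    rintro _ ⟨y, rfl⟩
    have h1 : Spec.map (CommRingCat.ofHom (algebraMap (TensorProduct F A A) L)) y ∈
        Set.range (PrimeSpectrum.comap (algebraMap (TensorProduct F A A) L)) := ⟨y, rfl⟩
    rw [PrimeSpectrum.localization_away_comap_range L h] at h1
    exact hhj _ h1
  obtain ⟨θ, rfl⟩ : ∃ θ : A →+* L, Spec.map (CommRingCat.ofHom θ) = θ₀ :=
    ⟨(Spec.preimage θ₀).hom, Spec.map_preimage θ₀⟩
  have hrs : r ≫ sX = Spec.map (CommRingCat.ofHom (algebraMap F (TensorProduct F A A))) := by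
    simp only [r, Category.assoc]
    rw [hds, pullback.lift_fst_assoc, Category.assoc, hj, pullbackSpecIso_inv_fst_assoc]
    exact specMap_comp_specMap _ _
  have hθF : θ.comp (algebraMap F A) = algebraMap F L := by
    have e1 := congrArg (· ≫ sX) hθ₀
    simp only [Category.assoc] at e1
    rw [hrs, hj, specMap_comp_specMap, specMap_comp_specMap, ← IsScalarTower.algebraMap_eq] at e1
    exact congrArg CommRingCat.Hom.hom (Spec.map_injective e1)
  let θ' : A →ₐ[F] L := ⟨θ, RingHom.congr_fun hθF⟩
  have hθ' : Spec.map (CommRingCat.ofHom θ'.toRingHom) ≫ j =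
      Spec.map (CommRingCat.ofHom (algebraMap (TensorProduct F A A) L)) ≫ r := hθ₀
  have := q.isPrime
  obtain ⟨N₀, hN₀⟩ := exists_scaledOrder_extension (p := q.asIdeal) hπ hπ0 hw hh θ' x (by
    intro k
    obtain ⟨⟨α, _, m, rfl⟩, hα⟩ := IsLocalization.surj (Submonoid.powers h) (θ' (x k))
    simp only [map_pow] at hα
    obtain ⟨n₁, hn₁⟩ := exists_pow_mul_eq_zero θ'.toRingHom hθ' _ (RingHom.id A)
      (hP₁.trans ((congrArg (· ≫ j) hid).trans (Category.id_comp j)).symm) hα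
    obtain ⟨n₂, hn₂⟩ := exists_pow_mul_eq_zero θ'.toRingHom hθ' _ (constHom ε).toRingHom hP₂ hα
    have hn₁ : pairHom (AlgHom.id F A) (constHom ε) h ^ n₁ *
      (x k * pairHom (AlgHom.id F A) (constHom ε) h ^ m -
        pairHom (AlgHom.id F A) (constHom ε) α) = 0 := hn₁
    have hn₂ : pairHom (AlgHom.id F A) (AlgHom.id F A) h ^ n₂ *
      (constHom ε (x k) * pairHom (AlgHom.id F A) (AlgHom.id F A) h ^ m -
        pairHom (AlgHom.id F A) (AlgHom.id F A) α) = 0 := hn₂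
    have hxk : x k ∈ Ideal.span (Set.range x) := Ideal.subset_span ⟨k, rfl⟩
    have hP₁h : pairHom (AlgHom.id F A) (constHom ε) h - 1 ∈ Ideal.span (Set.range x) :=
      mem_span_range_of_map_eq_zero hx ε hεx (by
        rw [map_sub, map_one]
        exact sub_eq_zero.mpr hε'h)
    -- The identities `x / 1 = x` and `x / x = 1` hold for the numerator `α` only up to the powers
    -- `n₁` and `n₂` of `h`, as they come from localizations. The factor `h ^ (n₁ + n₂)` makes both
    -- available, and the linear part of the new numerator is `x k ⊗ 1 - 1 ⊗ x k`.
    refine ⟨m + (n₁ + n₂), α * h ^ (n₁ + n₂), ?_, _, ?_,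
      sub_mem_sq_of_restrict hx ε hεx (hεx k) ?_ ?_⟩
    · rw [pow_add, ← mul_assoc, hα, map_mul, map_pow]
    · exact sub_mem (Submodule.subset_span ⟨Sum.inl k, rfl⟩)
        (Submodule.subset_span ⟨Sum.inr k, rfl⟩)
    · have e1 : pairHom (AlgHom.id F A) (constHom ε) (α * h ^ (n₁ + n₂)) - x k =
          x k * (pairHom (AlgHom.id F A) (constHom ε) h ^ (m + n₁ + n₂) - 1) := by
        rw [map_mul, map_pow]
        linear_combination (-(pairHom (AlgHom.id F A) (constHom ε) h ^ n₂)) * hn₁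
      rw [e1, pow_two]
      refine Ideal.mul_mem_mul hxk ?_
      obtain ⟨t, ht⟩ := sub_one_dvd_pow_sub_one (pairHom (AlgHom.id F A) (constHom ε) h) (m + n₁ + n₂)
      rw [ht]
      exact Ideal.mul_mem_right _ _ hP₁h
    · have e1 : pairHom (AlgHom.id F A) (AlgHom.id F A) (α * h ^ (n₁ + n₂)) = 0 := by
        have e2 : constHom ε (x k) = 0 := by
          simp [constHom, hεx]
        rw [e2] at hn₂
        rw [map_mul, map_pow]
        linear_combination (-(pairHom (AlgHom.id F A) (AlgHom.id F A) h ^ n₁)) * hn₂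
      rw [e1]
      exact zero_mem _)
  refine ⟨N₀, fun N hN hB => ?_⟩
  have hC : IsOrder (scaledOrder F (tensorGenerators F x) π N) :=
     isOrder_scaledOrder hw hπ0 N
  obtain ⟨γ, hγ, hγq, hBC⟩ := hN₀ N hN
  have h1 := extendsAt_prod_affineModel hB hC
    (extendsAt_affineModel hB hC θ' hθ' γ hγ hγq hBC)
  simp only [r, Iso.hom_inv_id_assoc] at h1
  exact h1

end GroupChart
end IntegralModels

/-! ### The unit section and polydiscs around it -/

namespace IntegralModels

open Limits Topology

section UnitChart

variable (R F : Type u) [CommRing R] [Field F] [Algebra R F]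

/-- The model of the point given by the base. -/
noncomputable def unitModel : FlatModel R (𝟙 (Spec (.of F))) where
  scheme := Spec (.of R)
  str := 𝟙 _
  gen := genMap R F
  isPullback := .of_vert_isIso ⟨by simp⟩
  flat := inferInstance
  locallyOfFiniteType := inferInstance
  quasiCompact := inferInstance

variable {R F} [IsDedekindDomain R] [IsFractionRing R F]

/-- The coordinates vanish at the unit, so evaluation there maps the order into `R`, whatever the
scaling. -/
theorem extendsAt_unit_affineModel {X : Scheme.{u}} {e : Spec (.of F) ⟶ X} {A κ : Type u}
    [CommRing A] [Algebra F A] [Algebra R A] [IsScalarTower R F A] {j : Spec (.of A) ⟶ X}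
    {ε : A →ₐ[F] F} (hε : Spec.map (CommRingCat.ofHom ε.toRingHom) ≫ j = e) {x : κ → A}
    (hεx : ∀ k, ε (x k) = 0) {q : Spec (.of R)} {π : R} {N : ℕ}
    (hB : IsOrder (scaledOrder F x π N)) :
    ExtendsAt q (unitModel R F) (affineModel R F _ hB) e j := by
  obtain ⟨g, hg⟩ := exists_lift_of_forall_mem (IsFractionRing.injective R F)
    (ε.toRingHom.comp (algebraMap (scaledOrder F x π N) A)) (by
      rintro ⟨b, hb⟩
      change ε b ∈ _
      induction hb using Algebra.adjoin_induction with
      | mem b hb =>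
        obtain ⟨k, rfl⟩ := hb
        rw [map_mul, hεx, mul_zero]
        exact zero_mem _
      | algebraMap r =>
        rw [IsScalarTower.algebraMap_apply R F A, AlgHom.commutes]
        exact ⟨r, rfl⟩
      | add a b _ _ ha hb => rw [map_add]; exact add_mem ha hb
      | mul a b _ _ ha hb => rw [map_mul]; exact mul_mem ha hb)
  refine ⟨Spec (.of R), 𝟙 (Spec (.of R)), Spec.map (CommRingCat.ofHom g),
    inferInstanceAs (IsOpenImmersion (𝟙 (Spec (.of R)))),
    fun m _ => ⟨m, rfl⟩, ?_, fun T t y hy => ⟨y ≫ Spec.map (CommRingCat.ofHom ε.toRingHom), ?_, ?_⟩⟩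
  · change _ ≫ Spec.map (CommRingCat.ofHom (algebraMap R _)) = 𝟙 _ ≫ 𝟙 _
    rw [specMap_comp_specMap, Category.comp_id]
    have : g.comp (algebraMap R (scaledOrder F x π N)) = RingHom.id R := by
      refine RingHom.ext fun r => IsFractionRing.injective R F ?_
      refine (RingHom.congr_fun hg (algebraMap R _ r)).trans ?_
      change ε (algebraMap R A r) = _
      rw [IsScalarTower.algebraMap_apply R F A, AlgHom.commutes]
      rfl
    rw [this]
    exact Spec.map_id _
  · rw [Category.assoc, hε]
  · obtain rfl : t = y ≫ genMap R F := (Category.comp_id t).symm.trans hy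
    change (y ≫ Spec.map (CommRingCat.ofHom (algebraMap R F))) ≫ _ =
      (y ≫ _) ≫ Spec.map (CommRingCat.ofHom (algebraMap (scaledOrder F x π N) A))
    rw [Category.assoc, Category.assoc, specMap_comp_specMap, specMap_comp_specMap, hg]

/-- The integral points of the models given by small polydiscs around the unit lie in a given
neighbourhood of the unit. -/
theorem exists_mem_of_isIntegralPt_scaledOrder {v : FinPlace F} {X : Over (Spec (.of F))}
    {ρ : R →+* v.integers}
    (hρ : v.integers.subtype.comp ρ = (algebraMap F v.completion).comp (algebraMap R F))
    {U : Set (LocalPoints X v)} {A κ : Type u} [CommRing A] [Algebra F A] [Algebra R A]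
    [IsScalarTower R F A] [Finite κ] {j : Spec (.of A) ⟶ X.left}
    (hj : j ≫ X.hom = Spec.map (CommRingCat.ofHom (algebraMap F A))) {ε : A →ₐ[F] F} {x : κ → A}
    (hεx : ∀ k, ε (x k) = 0)
    (h : ∃ Ω ∈ 𝓝 fun k => ((algebraMap F v.completion).comp ε.toRingHom) (x k),
      ∀ (z' : LocalPoints X v) (φ' : A →+* v.completion),
        Spec.map (CommRingCat.ofHom φ') ≫ j = z'.pt → (fun k => φ' (x k)) ∈ Ω → z' ∈ U)
    {π : R} (hπ : algebraMap R F π ∈ v.ring) (hπ' : (algebraMap R F π)⁻¹ ∉ v.ring) :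
    ∃ N₀, ∀ N ≥ N₀, ∀ hB : IsOrder (scaledOrder F x π N), ∀ (z' : LocalPoints X v)
      (z₁ : Spec (.of v.completion) ⟶ Spec (.of A)), z₁ ≫ j = z'.pt →
      IsIntegralPt (affineModel R F _ hB) ρ v.integers.subtype z₁ → z' ∈ U := by
  obtain ⟨N₀, hN₀⟩ := exists_polydisc (U := U) j x ((algebraMap F v.completion).comp ε.toRingHom)
    h hπ hπ'
  refine ⟨N₀, fun N hN hB z' z₁ hz₁ hint => ?_⟩
  obtain ⟨φ', rfl⟩ : ∃ φ' : A →+* v.completion, Spec.map (CommRingCat.ofHom φ') = z₁ :=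
    ⟨(Spec.preimage z₁).hom, Spec.map_preimage z₁⟩
  have halg : φ'.comp (algebraMap F A) = algebraMap F v.completion := by
    have h2 := z'.pt_comp_hom
    rw [← hz₁, Category.assoc, hj, specMap_comp_specMap] at h2
    exact congrArg CommRingCat.Hom.hom (Spec.map_injective h2)
  have hint' := (isIntegralPt_affineModel hB Subtype.val_injective (by
    rw [hρ, ← halg, RingHom.comp_assoc, ← IsScalarTower.algebraMap_eq])).mp hint
  refine hN₀ N hN z' φ' hz₁ fun k => ?_
  obtain ⟨w, hw⟩ := hint' _ ⟨k, rfl⟩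
  have h1 : ((algebraMap F v.completion).comp ε.toRingHom) (x k) = 0 := by
    change algebraMap F v.completion (ε (x k)) = 0
    rw [hεx, map_zero]
  rw [h1, sub_zero, div_eq_inv_mul, ← map_inv₀, ← halg, RingHom.comp_apply, ← map_mul]
  have h2 : v.integers.subtype w ∈ v.integers := w.2
  rwa [hw] at h2

end UnitChart
end IntegralModels

/-! ### Rescaling polynomials and Taylor expansion -/

namespace IntegralModels

open MvPolynomial

section Rescaling

variable {R F : Type*} [CommRing R] [IsDomain R] [Field F] [Algebra R F] [IsFractionRing R F]
  {ι : Type*}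

variable (ι) in
/-- The substitution rescaling all the variables. -/
noncomputable def rescale {K : Type*} [CommRing K] (c : K) : MvPolynomial ι K →ₐ[K] MvPolynomial ι K :=
  aeval fun k => C c * X k

omit [IsDomain R] [IsFractionRing R F] in
theorem rescale_map (c : R) (p : MvPolynomial ι R) :
    rescale ι (algebraMap R F c) (map (algebraMap R F) p) =
      map (algebraMap R F) (rescale ι c p) := by
  induction p using MvPolynomial.induction_on with
  | C a => simp [rescale]
  | add p q hp hq => simp only [map_add, hp, hq]
  | mul_X p k hp =>
    rw [map_mul, map_mul, map_mul, map_mul, hp]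
    simp [rescale]

variable (R) in
/-- After rescaling the variables by `c`, the polynomial is divisible by `c ^ n`, up to a
denominator which does not depend on `c`. -/
def IsOfOrder (n : ℕ) (p : MvPolynomial ι F) : Prop :=
  ∃ s : R, s ≠ 0 ∧ ∀ c : R, ∃ g : MvPolynomial ι R,
    C (algebraMap R F s) * rescale ι (algebraMap R F c) p = map (algebraMap R F) (C (c ^ n) * g)

theorem exists_C_mul_eq_map (p : MvPolynomial ι F) : ∃ s : R, s ≠ 0 ∧ ∃ g : MvPolynomial ι R,
    C (algebraMap R F s) * p = map (algebraMap R F) g := by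
  induction p using MvPolynomial.induction_on with
  | C a =>
    obtain ⟨a, b, hb, rfl⟩ := IsFractionRing.div_surjective (A := R) a
    refine ⟨b, nonZeroDivisors.ne_zero hb, C a, ?_⟩
    have : algebraMap R F b ≠ 0 :=
      (map_ne_zero_iff _ (IsFractionRing.injective R F)).mpr (nonZeroDivisors.ne_zero hb)
    rw [← map_mul, map_C, mul_div_cancel₀ _ this]
  | add p q hp hq =>
    obtain ⟨s, hs, g, hg⟩ := hp
    obtain ⟨t, ht, h, hh⟩ := hq
    refine ⟨s * t, mul_ne_zero hs ht, C t * g + C s * h, ?_⟩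
    simp only [map_add, map_mul, map_C, ← hg, ← hh]
    ring
  | mul_X p k hp =>
    obtain ⟨s, hs, g, hg⟩ := hp
    refine ⟨s, hs, g * X k, ?_⟩
    rw [map_mul, map_X, ← hg, mul_assoc]

theorem isOfOrder_zero (p : MvPolynomial ι F) : IsOfOrder R 0 p := by
  obtain ⟨s, hs, g, hg⟩ := exists_C_mul_eq_map (R := R) p
  refine ⟨s, hs, fun c => ⟨rescale ι c g, ?_⟩⟩
  have h := congrArg (rescale ι (algebraMap R F c)) hg
  rw [rescale_map, map_mul] at h
  rw [pow_zero, map_one, one_mul, ← h]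
  simp [rescale]

omit [IsDomain R] [IsFractionRing R F] in
theorem IsOfOrder.exists_eq {n : ℕ} {p : MvPolynomial ι F} (h : IsOfOrder R n p) :
    ∃ s : R, s ≠ 0 ∧ ∀ c : R, ∃ g : MvPolynomial ι R, C (algebraMap R F s) *
      rescale ι (algebraMap R F c) p = map (algebraMap R F) (C (c ^ n) * g) := h

omit [IsFractionRing R F] in
theorem IsOfOrder.add {n : ℕ} {p q : MvPolynomial ι F} (hp : IsOfOrder R n p)
    (hq : IsOfOrder R n q) : IsOfOrder R n (p + q) := by
  obtain ⟨s, hs, h⟩ := hp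
  obtain ⟨t, ht, h'⟩ := hq
  refine ⟨s * t, mul_ne_zero hs ht, fun c => ?_⟩
  obtain ⟨g, hg⟩ := h c
  obtain ⟨g', hg'⟩ := h' c
  refine ⟨C t * g + C s * g', ?_⟩
  have e : map (algebraMap R F) (C (c ^ n) * (C t * g + C s * g')) =
    C (algebraMap R F t) * map (algebraMap R F) (C (c ^ n) * g) +
      C (algebraMap R F s) * map (algebraMap R F) (C (c ^ n) * g') := by
    simp only [map_add, map_mul, map_C]
    ring
  rw [e, ← hg, ← hg']
  simp only [map_add, map_mul]
  ring

omit [IsFractionRing R F] in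
theorem IsOfOrder.mul {m n k : ℕ} (hk : m + n = k) {p q : MvPolynomial ι F} (hp : IsOfOrder R m p)
    (hq : IsOfOrder R n q) : IsOfOrder R k (p * q) := by
  subst hk
  obtain ⟨s, hs, h⟩ := hp
  obtain ⟨t, ht, h'⟩ := hq
  refine ⟨s * t, mul_ne_zero hs ht, fun c => ?_⟩
  obtain ⟨g, hg⟩ := h c
  obtain ⟨g', hg'⟩ := h' c
  refine ⟨g * g', ?_⟩
  have e : map (algebraMap R F) (C (c ^ (m + n)) * (g * g')) =
    map (algebraMap R F) (C (c ^ m) * g) * map (algebraMap R F) (C (c ^ n) * g') := by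
    simp only [map_mul, map_C, pow_add]
    ring
  rw [e, ← hg, ← hg']
  simp only [map_mul]
  ring

omit [IsFractionRing R F] in
variable (R) in
theorem isOfOrder_zero_right (n : ℕ) : IsOfOrder R n (0 : MvPolynomial ι F) := by
  refine ⟨1, one_ne_zero, fun c => ⟨0, ?_⟩⟩
  rw [map_zero (rescale ι _), mul_zero, mul_zero, map_zero]

omit [IsFractionRing R F] in
theorem isOfOrder_X (k : ι) : IsOfOrder R 1 (X k : MvPolynomial ι F) := by
  refine ⟨1, one_ne_zero, fun c => ⟨X k, ?_⟩⟩
  rw [map_one, map_one, one_mul, pow_one, rescale, aeval_X, map_mul, map_C, map_X]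

theorem isOfOrder_one {p : MvPolynomial ι F}
    (hp : p ∈ Ideal.span (Set.range (X : ι → MvPolynomial ι F))) : IsOfOrder R 1 p := by
  refine Submodule.span_induction (p := fun p _ => IsOfOrder R 1 p) ?_ (isOfOrder_zero_right R 1)
    (fun p q _ _ hp hq => hp.add hq) (fun a p _ hp => ?_) hp
  · rintro _ ⟨k, rfl⟩
    exact isOfOrder_X k
  · exact (isOfOrder_zero (R := R) a).mul (zero_add 1) hp

theorem isOfOrder_two {p : MvPolynomial ι F}
    (hp : p ∈ Ideal.span (Set.range (X : ι → MvPolynomial ι F)) ^ 2) : IsOfOrder R 2 p := by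
  rw [pow_two] at hp
  refine Submodule.mul_induction_on (C := fun p => IsOfOrder R 2 p) hp
    (fun p hp q hq => ?_) (fun p q hp hq => hp.add hq)
  exact (isOfOrder_one hp).mul one_add_one_eq_two (isOfOrder_one hq)

/-- Rescaling a polynomial with integral linear part. -/
theorem exists_rescale_eq [Fintype ι] {f : MvPolynomial ι F} {c : ι → R}
    (hf : f - ∑ l, C (algebraMap R F (c l)) * X l ∈
      Ideal.span (Set.range (X : ι → MvPolynomial ι F)) ^ 2) :
    ∃ s : R, s ≠ 0 ∧ ∀ π : R, s ∣ π → ∀ N ≥ 2, ∃ g : MvPolynomial ι R,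
      rescale ι (algebraMap R F (π ^ N)) f = C (algebraMap R F (π ^ N)) *
        map (algebraMap R F) (∑ l, C (c l) * X l + C π * g) := by
  obtain ⟨s, hs, h⟩ := (isOfOrder_two (R := R) hf).exists_eq
  refine ⟨s, hs, ?_⟩
  rintro _ ⟨t, rfl⟩ N hN
  obtain ⟨g, hg⟩ := h ((s * t) ^ N)
  obtain ⟨n, rfl⟩ := Nat.exists_eq_add_of_le' hN
  -- With `π = s * t` and `N = n + 2` one has `π ^ (2 * N) = s * π ^ N * π * (π ^ n * t)`. So the
  -- quadratic remainder, whose denominator is `s`, is divisible by `π ^ N * π`.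
  refine ⟨C ((s * t) ^ n * t) * g, ?_⟩
  have hs' : (C (algebraMap R F s) : MvPolynomial ι F) ≠ 0 := by
    rw [Ne, MvPolynomial.C_eq_zero, map_eq_zero_iff _ (IsFractionRing.injective R F)]
    exact hs
  have e : C (((s * t) ^ (n + 2)) ^ 2) * g =
      C s * (C ((s * t) ^ (n + 2)) * (C (s * t) * (C ((s * t) ^ n * t) * g))) := by
    simp only [C_mul, C_pow]
    ring
  have hlin : rescale ι (algebraMap R F ((s * t) ^ (n + 2)))
      (∑ l, C (algebraMap R F (c l)) * X l) = C (algebraMap R F ((s * t) ^ (n + 2))) *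
        map (algebraMap R F) (∑ l, C (c l) * X l) := by
    rw [map_sum, map_sum, Finset.mul_sum]
    refine Finset.sum_congr rfl fun l _ => ?_
    rw [map_mul, map_mul, map_C, map_X, rescale, aeval_X, algHom_C, algebraMap_eq]
    ring
  rw [e, map_mul, map_C, map_mul, map_C] at hg
  have hg' := mul_left_cancel₀ hs' hg
  rw [map_sub, hlin, sub_eq_iff_eq_add] at hg'
  rw [hg', add_comm, ← mul_add, ← map_add]

end Rescaling

section Taylor

variable {F : Type*} [Field F] {ι : Type*} [Fintype ι]

/-- The first order Taylor expansion of a polynomial. -/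
theorem taylor_sub_mem_sq (b t : ι → F) (p : MvPolynomial ι F) :
    aeval (fun k => C (b k) + C (t k) * X k) p - C (aeval b p) -
      ∑ k, C (t k * aeval b (pderiv k p)) * X k ∈
        Ideal.span (Set.range (X : ι → MvPolynomial ι F)) ^ 2 := by
  classical
  have hX : ∀ k, (X k : MvPolynomial ι F) ∈ Ideal.span (Set.range (X : ι → MvPolynomial ι F)) :=
    fun k => Ideal.subset_span ⟨k, rfl⟩
  induction p using MvPolynomial.induction_on with
  | C a => simp
  | add p q hp hq =>
    have := add_mem hp hq
    convert this using 1
    simp only [map_add, mul_add, add_mul, Finset.sum_add_distrib]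
    ring
  | mul_X p i hp =>
    set I := Ideal.span (Set.range (X : ι → MvPolynomial ι F)) with hI
    have h1 : ∑ k, C (t k * aeval b (pderiv k p)) * X k ∈ I :=
      sum_mem fun k _ => Ideal.mul_mem_left _ _ (hX k)
    have h2 : (∑ k, C (t k * aeval b (pderiv k p)) * X k) * (C (t i) * X i) ∈ I ^ 2 := by
      rw [pow_two]
      exact Ideal.mul_mem_mul h1 (Ideal.mul_mem_left _ _ (hX i))
    have h3 := add_mem (Ideal.mul_mem_right (C (b i) + C (t i) * X i) _ hp) h2
    convert h3 using 1
    have e1 : ∀ k, C (t k * aeval b (pderiv k (p * X i))) * X k =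
        C (t k * aeval b (pderiv k p)) * X k * C (b i) +
          (if k = i then C (t i * aeval b p) * X i else 0) := by
      intro k
      rw [Derivation.leibniz, pderiv_X]
      by_cases hk : k = i
      · subst hk
        simp only [Pi.single_eq_same, smul_eq_mul, mul_one, map_add, map_mul, aeval_X, if_true]
        ring
      · rw [Pi.single_eq_of_ne (Ne.symm hk)]
        simp only [smul_eq_mul, mul_zero, zero_add, map_mul, aeval_X, if_neg hk, add_zero]
        ring
    rw [Finset.sum_congr rfl fun k _ => e1 k, Finset.sum_add_distrib, Finset.sum_ite_eq',
      if_pos (Finset.mem_univ i), ← Finset.sum_mul]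
    simp only [map_mul, aeval_X]
    ring

end Taylor

end IntegralModels

/-! ### Smoothness of small polydiscs -/

namespace IntegralModels

open MvPolynomial

section SmoothQuotient

/-- A quotient of a polynomial ring with invertible Jacobian determinant is smooth. -/
theorem smooth_away_jacobian {R ι σ E' : Type*} [CommRing R] [Finite ι] [Fintype σ] [DecidableEq σ]
    (h : σ → MvPolynomial ι R) {a : σ → ι} (ha : Function.Injective a) [CommRing E'] [Algebra R E']
    [Algebra (MvPolynomial ι R ⧸ Ideal.span (Set.range h)) E']
    [IsScalarTower R (MvPolynomial ι R ⧸ Ideal.span (Set.range h)) E']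
    [IsLocalization.Away (Ideal.Quotient.mk (Ideal.span (Set.range h))
      (Matrix.of fun i j => pderiv (a i) (h j)).det) E'] : Algebra.Smooth R E' := by
  let P := Algebra.PreSubmersivePresentation.naive (v := h) a ha
  let Δ := Ideal.Quotient.mk (Ideal.span (Set.range h))
      (Matrix.of fun i j => pderiv (a i) (h j)).det
  have hP : P.jacobian = Δ := by
    rw [P.jacobian_eq_jacobiMatrix_det]
    have : P.jacobiMatrix = Matrix.of fun i j => pderiv (a i) (h j) := by
      ext i j : 2
      rw [P.jacobiMatrix_apply]
      rfl
    rw [this]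
    rfl
  let Q := Algebra.PreSubmersivePresentation.localizationAway E' Δ
  have hu : IsUnit (Q.comp P).jacobian := by
    rw [Algebra.PreSubmersivePresentation.comp_jacobian_eq_jacobian_smul_jacobian,
      Algebra.PreSubmersivePresentation.localizationAway_jacobian, hP, Algebra.smul_def]
    exact (IsLocalization.Away.algebraMap_isUnit Δ).mul (IsLocalization.Away.algebraMap_isUnit Δ)
  have : Algebra.IsStandardSmooth R E' :=
    Algebra.SubmersivePresentation.isStandardSmooth ⟨Q.comp P, hu⟩
  infer_instance

/-- If an algebra becomes smooth after inverting an element, then so does any quotient by a torsion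
ideal which is torsion free. -/
theorem smooth_away_of_surjective {R E B E' B' : Type*} [CommRing R] [IsDomain R] [CommRing E] [CommRing B]
    [Algebra R E] [Algebra R B] (φ : E →ₐ[R] B) (hφ : Function.Surjective φ)
    (hker : ∀ e, φ e = 0 → ∃ r : R, r ≠ 0 ∧ r • e = 0) (Δ : E) [CommRing E'] [Algebra E E']
    [Algebra R E'] [IsScalarTower R E E'] [IsLocalization.Away Δ E'] [CommRing B'] [Algebra B B']
    [Algebra R B'] [IsScalarTower R B B'] [IsLocalization.Away (φ Δ) B'] [Algebra.Smooth R E'] :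
    Algebra.Smooth R B' := by
  -- Being smooth, `E'` is flat and hence torsion-free over the domain `R`. The torsion kernel of
  -- `φ` therefore dies in `E'`, which makes `ψ` injective.
  have : Module.Flat R E' := inferInstance
  have hu : IsUnit (((algebraMap B B').comp φ.toRingHom) Δ) :=
    IsLocalization.Away.algebraMap_isUnit (φ Δ)
  obtain ⟨ψ, hψ⟩ : ∃ ψ : E' →ₐ[R] B', ∀ e, ψ (algebraMap E E' e) = algebraMap B B' (φ e) := by
    refine ⟨{ IsLocalization.Away.lift Δ hu with
      commutes' r := ?_ }, IsLocalization.Away.lift_eq Δ hu⟩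
    change IsLocalization.Away.lift Δ hu (algebraMap R E' r) = _
    rw [IsScalarTower.algebraMap_apply R E E', IsLocalization.Away.lift_eq,
      IsScalarTower.algebraMap_apply R B B']
    exact congrArg (algebraMap B B') (φ.commutes r)
  have hs : Function.Surjective ψ := by
    intro b
    obtain ⟨b, ⟨_, n, rfl⟩, rfl⟩ := IsLocalization.exists_mk'_eq (Submonoid.powers (φ Δ)) b
    obtain ⟨e, rfl⟩ := hφ b
    refine ⟨IsLocalization.mk' E' e (⟨Δ ^ n, n, rfl⟩ : Submonoid.powers Δ), ?_⟩
    rw [IsLocalization.eq_mk'_iff_mul_eq]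
    have := congrArg ψ (IsLocalization.mk'_spec E' e (⟨Δ ^ n, n, rfl⟩ : Submonoid.powers Δ))
    rw [map_mul, hψ, hψ] at this
    exact Eq.trans (congrArg (fun t => ψ _ * algebraMap B B' t) (map_pow φ Δ n).symm) this
  have hi : Function.Injective ψ := by
    rw [injective_iff_map_eq_zero]
    intro z hz
    obtain ⟨e, ⟨_, n, rfl⟩, rfl⟩ := IsLocalization.exists_mk'_eq (Submonoid.powers Δ) z
    have h1 := congrArg ψ (IsLocalization.mk'_spec E' e (⟨Δ ^ n, n, rfl⟩ : Submonoid.powers Δ))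
    rw [map_mul, hz, zero_mul, hψ] at h1
    obtain ⟨⟨_, m, rfl⟩, hm⟩ := (IsLocalization.map_eq_zero_iff (Submonoid.powers (φ Δ)) B' (φ e)).mp
      h1.symm
    have hm : φ Δ ^ m * φ e = 0 := hm
    rw [← map_pow, ← map_mul] at hm
    obtain ⟨r, hr, hre⟩ := hker _ hm
    have h2 := congrArg (algebraMap E E') hre
    rw [map_zero, algebraMap.smul, map_mul, map_pow, ← mul_smul_comm] at h2
    have hu : IsUnit (algebraMap E E' Δ) := IsLocalization.Away.algebraMap_isUnit Δ
    have h3 := (hu.pow m).mul_right_eq_zero.mp h2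
    have h4 : algebraMap E E' e = 0 := (smul_eq_zero.mp h3).resolve_left hr
    rw [IsLocalization.mk'_eq_zero_iff]
    obtain ⟨c, hc⟩ := (IsLocalization.map_eq_zero_iff (Submonoid.powers Δ) E' e).mp h4
    exact ⟨c, hc⟩
  exact Algebra.Smooth.of_equiv (AlgEquiv.ofBijective ψ ⟨hi, hs⟩)

end SmoothQuotient

section SmoothOrder

variable {R F : Type u} [CommRing R] [IsDedekindDomain R] [Field F] [Algebra R F]
  [IsFractionRing R F] {A : Type u} [CommRing A] [Algebra F A] [Algebra R A] [IsScalarTower R F A]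
  {ι σ : Type*}

omit [IsDedekindDomain R] [Algebra R F] [IsFractionRing R F] [Algebra R A] [IsScalarTower R F A] in
/-- The relations between rescaled generators. -/
theorem mem_span_rescale {x : ι → A} {f : σ → MvPolynomial ι F}
    (hf : RingHom.ker (aeval x : MvPolynomial ι F →ₐ[F] A) ≤ Ideal.span (Set.range f)) {c : F}
    (hc : c ≠ 0) {p : MvPolynomial ι F} (hp : aeval (fun k => algebraMap F A c⁻¹ * x k) p = 0) :
    p ∈ Ideal.span (Set.range fun i => rescale ι c (f i)) := by
  have h1 : rescale ι c⁻¹ p ∈ RingHom.ker (aeval x : MvPolynomial ι F →ₐ[F] A) := by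
    rw [RingHom.mem_ker, ← hp, rescale, ← AlgHom.comp_apply]
    congr 1
    ext k
    simp
  have h2 : rescale ι c (rescale ι c⁻¹ p) = p := by
    rw [← AlgHom.comp_apply]
    refine AlgHom.congr_fun (φ₂ := AlgHom.id F _) ?_ p
    ext1 k
    simp only [rescale, AlgHom.comp_apply, aeval_X, map_mul, algHom_C, AlgHom.id_apply,
      algebraMap_eq]
    rw [← mul_assoc, ← C_mul, inv_mul_cancel₀ hc, C_1, one_mul]
  have h3 := Ideal.mem_map_of_mem (rescale ι c).toRingHom (hf h1)
  rw [Ideal.map_span, ← Set.range_comp] at h3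
  change rescale ι c (rescale ι c⁻¹ p) ∈ _ at h3
  rwa [h2] at h3

omit [IsDedekindDomain R] in
/-- Clearing denominators in a relation. -/
theorem exists_C_mul_mem_span [IsDomain R] {h : σ → MvPolynomial ι R} {p : MvPolynomial ι R}
    (hp : map (algebraMap R F) p ∈ Ideal.span (Set.range fun i => map (algebraMap R F) (h i))) :
    ∃ r : R, r ≠ 0 ∧ C r * p ∈ Ideal.span (Set.range h) := by
  have hinj := map_injective (σ := ι) (algebraMap R F) (IsFractionRing.injective R F)
  suffices H : ∀ p' ∈ Ideal.span (Set.range fun i => map (algebraMap R F) (h i)),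
      ∃ r : R, r ≠ 0 ∧ ∃ p'' ∈ Ideal.span (Set.range h),
        C (algebraMap R F r) * p' = map (algebraMap R F) p'' by
    obtain ⟨r, hr, p'', hp'', e⟩ := H _ hp
    refine ⟨r, hr, ?_⟩
    rw [← map_C, ← map_mul] at e
    rwa [hinj e]
  intro p' hp'
  induction hp' using Submodule.span_induction with
  | mem p' hp' =>
    obtain ⟨i, rfl⟩ := hp'
    exact ⟨1, one_ne_zero, h i, Ideal.subset_span ⟨i, rfl⟩, by rw [map_one, C_1, one_mul]⟩
  | zero => exact ⟨1, one_ne_zero, 0, zero_mem _, by rw [mul_zero, map_zero]⟩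
  | add p q _ _ hp hq =>
    obtain ⟨r, hr, p', hp', e⟩ := hp
    obtain ⟨t, ht, q', hq', e'⟩ := hq
    refine ⟨r * t, mul_ne_zero hr ht, C t * p' + C r * q',
      add_mem (Ideal.mul_mem_left _ _ hp') (Ideal.mul_mem_left _ _ hq'), ?_⟩
    have e2 : map (algebraMap R F) (C t * p' + C r * q') = C (algebraMap R F t) *
        map (algebraMap R F) p' + C (algebraMap R F r) * map (algebraMap R F) q' := by
      rw [map_add, map_mul, map_mul, map_C, map_C]
    rw [e2, ← e, ← e', map_mul, C_mul]
    ring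
  | smul a p _ hp =>
    obtain ⟨r, hr, p', hp', e⟩ := hp
    obtain ⟨t, ht, g, hg⟩ := exists_C_mul_eq_map (R := R) a
    refine ⟨t * r, mul_ne_zero ht hr, g * p', Ideal.mul_mem_left _ _ hp', ?_⟩
    have e2 : map (algebraMap R F) (g * p') = map (algebraMap R F) g * map (algebraMap R F) p' :=
      map_mul _ _ _
    rw [e2, ← e, ← hg, map_mul, C_mul, smul_eq_mul]
    ring

/-- If the generators satisfy enough relations with integral linear part, the order given by a small
polydisc is smooth away from a function congruent to `1` modulo `π`. -/
theorem exists_smooth_away_scaledOrder [Fintype ι] [Fintype σ] [DecidableEq σ] {x : ι → A}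
    {f : σ → MvPolynomial ι F} (hx : ∀ i, aeval x (f i) = 0)
    (hf : RingHom.ker (aeval x : MvPolynomial ι F →ₐ[F] A) ≤ Ideal.span (Set.range f))
    {a : σ → ι} (ha : Function.Injective a) {c : σ → ι → R}
    (hc : ∀ i j, c i (a j) = if i = j then 1 else 0) {π : R} (hπ0 : π ≠ 0) {N : ℕ}
    {g : σ → MvPolynomial ι R} (hg : ∀ i, rescale ι (algebraMap R F (π ^ N)) (f i) =
      C (algebraMap R F (π ^ N)) * map (algebraMap R F) (∑ l, C (c i l) * X l + C π * g i)) :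
    ∃ δ : scaledOrder F x π N, (∃ b, δ = 1 + algebraMap R _ π * b) ∧
      ∀ (B' : Type u) [CommRing B'] [Algebra (scaledOrder F x π N) B'] [Algebra R B']
        [IsScalarTower R (scaledOrder F x π N) B'] [IsLocalization.Away δ B'],
        Algebra.Smooth R B' := by
  have hπN : algebraMap R F (π ^ N) ≠ 0 :=
    (map_ne_zero_iff _ (IsFractionRing.injective R F)).mpr (pow_ne_zero _ hπ0)
  let h : σ → MvPolynomial ι R := fun i => ∑ l, C (c i l) * X l + C π * g i
  let Δ := (Matrix.of fun i j => pderiv (a i) (h j)).det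
  let y : ι → A := fun l => algebraMap F A (algebraMap R F π ^ N)⁻¹ * x l
  have hB : (aeval y : MvPolynomial ι R →ₐ[R] A).range = scaledOrder F x π N :=
    (Algebra.adjoin_range_eq_range_aeval R y).symm
  have hyF : ∀ p : MvPolynomial ι R, aeval y p = aeval y (map (algebraMap R F) p) := fun p =>
    (aeval_map_algebraMap F y p).symm
  have hyS : ∀ p : MvPolynomial ι F, aeval y (rescale ι (algebraMap R F (π ^ N)) p) =
      aeval x p := by
    intro p
    rw [← AlgHom.comp_apply]
    refine AlgHom.congr_fun ?_ p
    ext1 k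
    simp only [rescale, AlgHom.comp_apply, aeval_X, map_mul, algHom_C, y]
    rw [← mul_assoc, ← map_mul, map_pow, mul_inv_cancel₀ (by rwa [← map_pow]), map_one, one_mul]
  have hh0 : ∀ i, aeval y (h i) = 0 := by
    intro i
    have h1 := hyS (f i)
    rw [hx, hg, map_mul, ← hyF, algHom_C] at h1
    exact ((IsUnit.mk0 _ hπN).map (algebraMap F A)).mul_right_eq_zero.mp h1
  obtain ⟨φ₀, hφ₀⟩ : ∃ φ₀ : MvPolynomial ι R →ₐ[R] scaledOrder F x π N,
      ∀ p, (φ₀ p : A) = aeval y p :=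
    ⟨(aeval y : MvPolynomial ι R →ₐ[R] A).codRestrict _ fun p => hB ▸ ⟨p, rfl⟩, fun p => rfl⟩
  have hφh : ∀ p ∈ Ideal.span (Set.range h), φ₀ p = 0 := by
    intro p hp
    have : Ideal.span (Set.range h) ≤ RingHom.ker φ₀ := by
      rw [Ideal.span_le]
      rintro _ ⟨i, rfl⟩
      exact Subtype.ext ((hφ₀ _).trans (hh0 i))
    exact this hp
  let φ : MvPolynomial ι R ⧸ Ideal.span (Set.range h) →ₐ[R] scaledOrder F x π N :=
    Ideal.Quotient.liftₐ _ φ₀ hφh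
  have hφ : Function.Surjective φ := by
    rintro ⟨b, hb⟩
    rw [← hB] at hb
    obtain ⟨p, hp⟩ := hb
    exact ⟨Ideal.Quotient.mk _ p, Subtype.ext ((hφ₀ p).trans hp)⟩
  -- The `h i` generate all relations between the rescaled coordinates over `F` only. Clearing
  -- denominators shows that the relations they miss over `R` are torsion.
  have hker : ∀ e, φ e = 0 → ∃ r : R, r ≠ 0 ∧ r • e = 0 := by
    intro e he
    obtain ⟨p, rfl⟩ := Ideal.Quotient.mk_surjective e
    have h1 : aeval y p = 0 := (hφ₀ p).symm.trans (congrArg Subtype.val he)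
    rw [hyF] at h1
    have h2 := mem_span_rescale hf hπN (p := map (algebraMap R F) p) (by
      rw [← h1]
      simp only [y, map_pow])
    have h3 : map (algebraMap R F) p ∈ Ideal.span (Set.range fun i => map (algebraMap R F) (h i)) := by
      refine Ideal.span_le.mpr ?_ h2
      rintro _ ⟨i, rfl⟩
      change rescale ι (algebraMap R F (π ^ N)) (f i) ∈ _
      rw [hg]
      exact Ideal.mul_mem_left _ _ (Ideal.subset_span ⟨i, rfl⟩)
    obtain ⟨r, hr, h4⟩ := exists_C_mul_mem_span h3
    refine ⟨r, hr, ?_⟩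
    have h5 : Ideal.Quotient.mk (Ideal.span (Set.range h)) (C r * p) = 0 :=
      Ideal.Quotient.eq_zero_iff_mem.mpr h4
    rw [← h5, ← smul_eq_C_mul]
    rfl
  refine ⟨φ₀ Δ, ?_, ?_⟩
  -- Modulo `π` the relations are linear and the selected minor of their coefficient matrix is the
  -- identity.
  · have h1 : Δ - 1 ∈ Ideal.span {(C π : MvPolynomial ι R)} := by
      rw [← Ideal.Quotient.eq_zero_iff_mem, map_sub, map_one, sub_eq_zero, RingHom.map_det]
      have : (Ideal.Quotient.mk (Ideal.span {(C π : MvPolynomial ι R)})).mapMatrix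
          (Matrix.of fun i j => pderiv (a i) (h j)) = 1 := by
        ext i j : 2
        have e1 : pderiv (a i) (h j) = C (c j (a i)) + C π * pderiv (a i) (g j) := by
          simp only [h, map_add, map_sum, pderiv_C_mul]
          congr 1
          rw [Finset.sum_eq_single (a i)]
          · rw [pderiv_X_self, mul_one]
          · intro l _ hl
            rw [pderiv_X_of_ne hl, mul_zero]
          · simp
        rw [RingHom.mapMatrix_apply, Matrix.map_apply, Matrix.of_apply, e1, map_add, map_mul,
          Ideal.Quotient.eq_zero_iff_mem.mpr (Ideal.mem_span_singleton_self (C π)), zero_mul,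
          add_zero, hc, Matrix.one_apply]
        by_cases hij : i = j
        · simp [hij]
        · simp [hij, Ne.symm hij]
      rw [this, Matrix.det_one]
    obtain ⟨b, hb⟩ := Ideal.mem_span_singleton'.mp h1
    refine ⟨φ₀ b, ?_⟩
    rw [← φ₀.commutes, ← map_mul, algebraMap_eq, mul_comm, hb, map_sub, map_one]
    ring
  · intro B' _ _ _ _ _
    let Δ' := Ideal.Quotient.mk (Ideal.span (Set.range h)) Δ
    have := smooth_away_jacobian (E' := Localization.Away Δ') h ha
    have : IsLocalization.Away (φ Δ') B' := ‹_›
    exact smooth_away_of_surjective φ hφ hker Δ' (E' := Localization.Away Δ') (B' := B')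

end SmoothOrder
end IntegralModels

/-! ### Coordinates on smooth schemes at a rational point -/

namespace IntegralModels

open MvPolynomial

section SmoothGenerators

variable (R : Type*) {F : Type*} [CommRing R] [IsDomain R] [Field F] [Algebra R F]
  [IsFractionRing R F]

theorem exists_ne_zero_forall_mul_eq {ι : Type*} [Finite ι] (c : ι → F) :
    ∃ s : R, s ≠ 0 ∧ ∀ i, ∃ r : R, algebraMap R F r = algebraMap R F s * c i := by
  obtain ⟨s, hs⟩ := IsLocalization.exist_integer_multiples_of_finite (nonZeroDivisors R) c
  refine ⟨s, nonZeroDivisors.ne_zero s.2, fun i => ?_⟩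
  obtain ⟨r, hr⟩ := hs i
  exact ⟨r, by rw [hr, Algebra.smul_def]⟩

/-- Generators of a standard smooth algebra which vanish at a rational point, and relations between
them in a normal form. -/
theorem exists_smooth_generators {A : Type*} [CommRing A] [Algebra F A]
    [h : Algebra.IsStandardSmooth F A] (ε : A →ₐ[F] F) :
    ∃ (ι σ : Type) (_ : Fintype ι) (_ : Fintype σ) (_ : DecidableEq σ) (x : ι → A)
      (f : σ → MvPolynomial ι F) (a : σ → ι) (c : σ → ι → R),
      Algebra.adjoin F (Set.range x) = ⊤ ∧ (∀ k, ε (x k) = 0) ∧ (∀ i, aeval x (f i) = 0) ∧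
      RingHom.ker (aeval x : MvPolynomial ι F →ₐ[F] A) ≤ Ideal.span (Set.range f) ∧
      Function.Injective a ∧ (∀ i j, c i (a j) = if i = j then 1 else 0) ∧
      ∀ i, f i - ∑ l, C (algebraMap R F (c i l)) * X l ∈
        Ideal.span (Set.range (X : ι → MvPolynomial ι F)) ^ 2 := by
  classical
  obtain ⟨ι, σ, _, _, ⟨P⟩⟩ := h.out
  have := Fintype.ofFinite ι
  have := Fintype.ofFinite σ
  let b : ι → F := fun k => ε (P.val k)
  have hb : ∀ p, ε (aeval P.val p) = aeval b p := fun p => MvPolynomial.comp_aeval_apply P.val ε p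
  have hb0 : ∀ j, aeval b (P.relation j) = 0 := fun j => by
    rw [← hb, P.aeval_val_relation, map_zero]
  let M : Matrix σ σ F := Matrix.of fun i j => aeval b (pderiv (P.map i) (P.relation j))
  have hM : IsUnit M.det := by
    have h1 := P.jacobian_isUnit.map ε
    rw [P.jacobian_eq_jacobiMatrix_det, P.algebraMap_apply, hb, AlgHom.map_det] at h1
    convert h1 using 2
    ext i j : 2
    rw [AlgHom.mapMatrix_apply, Matrix.map_apply, P.jacobiMatrix_apply]
    rfl
  have hMM : ∀ k i, ∑ j, M⁻¹ j i * M k j = if i = k then 1 else 0 := by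
    intro k i
    have h1 := congrFun (congrFun (Matrix.mul_nonsing_inv M hM) k) i
    rw [Matrix.mul_apply, Matrix.one_apply] at h1
    simp only [eq_comm (a := i)]
    rw [← h1]
    exact Finset.sum_congr rfl fun j _ => mul_comm _ _
  let c' : σ × ι → F := fun q => ∑ j, M⁻¹ j q.1 * aeval b (pderiv q.2 (P.relation j))
  obtain ⟨s, hs, hr⟩ := exists_ne_zero_forall_mul_eq R c'
  choose r hr using hr
  -- Combining the relations by the inverse Jacobian `M⁻¹` turns the pivot columns into an identity
  -- matrix, but the other coefficients `c'` lie only in `F`. Scaling the non-pivot variables by the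
  -- common denominator `s` makes them integral and leaves the pivots alone.
  let t : ι → F := fun l => if l ∈ Set.range P.map then 1 else algebraMap R F s
  have ht : ∀ l, t l ≠ 0 := by
    intro l
    simp only [t]
    split_ifs
    · exact one_ne_zero
    · exact (map_ne_zero_iff _ (IsFractionRing.injective R F)).mpr hs
  let c : σ → ι → R := fun i l =>
    if l ∈ Set.range P.map then (if P.map i = l then 1 else 0) else r (i, l)
  have hca : ∀ i j, c i (P.map j) = if i = j then 1 else 0 := by
    intro i j
    simp only [c, if_pos (Set.mem_range_self j), P.map_inj.eq_iff]
  have hct : ∀ i l, algebraMap R F (c i l) = ∑ j, M⁻¹ j i * (t l * aeval b (pderiv l (P.relation j))) := by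
    intro i l
    have e : ∑ j, M⁻¹ j i * (t l * aeval b (pderiv l (P.relation j))) = t l * c' (i, l) := by
      simp only [c', Finset.mul_sum]
      exact Finset.sum_congr rfl fun j _ => by ring
    rw [e]
    by_cases hl : l ∈ Set.range P.map
    · obtain ⟨k, rfl⟩ := hl
      have h1 : c' (i, P.map k) = if i = k then 1 else 0 := hMM k i
      rw [hca, h1]
      simp only [t, if_pos (Set.mem_range_self k), one_mul]
      split_ifs <;> simp
    · simp only [c, t, if_neg hl]
      exact hr _
  let x : ι → A := fun k => algebraMap F A (t k)⁻¹ * (P.val k - algebraMap F A (b k))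
  let T : MvPolynomial ι F →ₐ[F] MvPolynomial ι F := aeval fun k => C (b k) + C (t k) * X k
  let T' : MvPolynomial ι F →ₐ[F] MvPolynomial ι F := aeval fun k => C (t k)⁻¹ * (X k - C (b k))
  have hT : ∀ p, aeval x (T p) = aeval P.val p := by
    intro p
    rw [← AlgHom.comp_apply]
    refine AlgHom.congr_fun ?_ p
    ext1 k
    simp only [T, x, AlgHom.comp_apply, aeval_X, map_add, map_mul, algHom_C]
    rw [← mul_assoc, ← map_mul, mul_inv_cancel₀ (ht k), map_one, one_mul, add_sub_cancel]
  have hT' : ∀ p, aeval P.val (T' p) = aeval x p := by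
    intro p
    rw [← AlgHom.comp_apply]
    refine AlgHom.congr_fun ?_ p
    ext1 k
    simp only [T', x, AlgHom.comp_apply, aeval_X, map_sub, map_mul, algHom_C]
  have hTT' : ∀ p, T (T' p) = p := by
    intro p
    rw [← AlgHom.comp_apply]
    refine AlgHom.congr_fun (φ₂ := AlgHom.id F _) ?_ p
    ext1 k
    simp only [T, T', AlgHom.comp_apply, aeval_X, map_sub, map_mul, algHom_C, AlgHom.id_apply,
      algebraMap_eq]
    rw [add_sub_cancel_left, ← mul_assoc, ← C_mul, inv_mul_cancel₀ (ht k), C_1, one_mul]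
  let f : σ → MvPolynomial ι F := fun i => ∑ j, C (M⁻¹ j i) * T (P.relation j)
  have hTf : ∀ k, T (P.relation k) = ∑ i, C (M i k) * f i := by
    intro k
    have h1 : ∀ j, ∑ i, M⁻¹ j i * M i k = if j = k then 1 else 0 := by
      intro j
      have h1 := congrFun (congrFun (Matrix.nonsing_inv_mul M hM) j) k
      rwa [Matrix.mul_apply, Matrix.one_apply] at h1
    simp only [f, Finset.mul_sum]
    rw [Finset.sum_comm]
    have h2 : ∀ j, ∑ i, C (M i k) * (C (M⁻¹ j i) * T (P.relation j)) =
        if j = k then T (P.relation j) else 0 := by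
      intro j
      have h3 : ∑ i, C (M i k) * (C (M⁻¹ j i) * T (P.relation j)) =
          C (∑ i, M⁻¹ j i * M i k) * T (P.relation j) := by
        rw [map_sum, Finset.sum_mul]
        refine Finset.sum_congr rfl fun i _ => ?_
        rw [C_mul]
        ring
      rw [h3, h1]
      split_ifs
      · rw [C_1, one_mul]
      · rw [C_0, zero_mul]
    rw [Finset.sum_congr rfl fun j _ => h2 j, Finset.sum_ite_eq', if_pos (Finset.mem_univ k)]
  refine ⟨ι, σ, inferInstance, inferInstance, inferInstance, x, f, P.map, c, ?_, ?_, ?_, ?_,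
    P.map_inj, hca, ?_⟩
  · rw [Algebra.adjoin_range_eq_range_aeval, AlgHom.range_eq_top]
    intro z
    obtain ⟨p, rfl⟩ := P.aeval_val_surjective z
    exact ⟨T p, hT p⟩
  · intro k
    simp only [x, map_mul, map_sub, AlgHom.commutes, b]
    simp
  · intro i
    simp only [f, map_sum, map_mul, hT, P.aeval_val_relation, mul_zero, Finset.sum_const_zero]
  · intro p hp
    rw [RingHom.mem_ker] at hp
    have h1 : T' p ∈ P.ker := by
      rw [P.ker_eq_ker_aeval_val, RingHom.mem_ker]
      exact (hT' p).trans hp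
    rw [← P.span_range_relation_eq_ker] at h1
    have h2 := Ideal.mem_map_of_mem T.toRingHom h1
    rw [Ideal.map_span, ← Set.range_comp] at h2
    change T (T' p) ∈ _ at h2
    rw [hTT'] at h2
    refine Ideal.span_le.mpr ?_ h2
    rintro _ ⟨k, rfl⟩
    change T (P.relation k) ∈ _
    rw [hTf]
    exact sum_mem fun i _ => Ideal.mul_mem_left _ _ (Ideal.subset_span ⟨i, rfl⟩)
  · intro i
    have h1 : ∑ j, C (M⁻¹ j i) * (T (P.relation j) - C (aeval b (P.relation j)) -
        ∑ k, C (t k * aeval b (pderiv k (P.relation j))) * X k) ∈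
          Ideal.span (Set.range (X : ι → MvPolynomial ι F)) ^ 2 :=
      sum_mem fun j _ => Ideal.mul_mem_left _ _ (taylor_sub_mem_sq b t (P.relation j))
    convert h1 using 1
    simp only [hb0, C_0, sub_zero, mul_sub, Finset.sum_sub_distrib, Finset.mul_sum]
    rw [Finset.sum_comm]
    congr 1
    refine Finset.sum_congr rfl fun l _ => ?_
    rw [hct, map_sum, Finset.sum_mul]
    refine Finset.sum_congr rfl fun j _ => ?_
    rw [C_mul, mul_assoc]

end SmoothGenerators

section SmoothOver

open Limits

variable {R F : Type u} [CommRing R] [Field F] [Algebra R F] {X W : Scheme.{u}}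
  {sX : X ⟶ Spec (.of F)} {sW : W ⟶ Spec (.of F)}

/-- The model is smooth in a neighbourhood of the fibre over `q`. -/
def SmoothOver (q : Spec (.of R)) (M : FlatModel R sX) : Prop :=
  ∃ (Ω : Scheme.{u}) (i : Ω ⟶ M.scheme), IsOpenImmersion i ∧
    (∀ m, M.str m = q → m ∈ Set.range i) ∧ Smooth (i ≫ M.str)

theorem SmoothOver.congr_agreesAt {q : Spec (.of R)} {j : W ⟶ X} {Z : FlatModel R sW}
    {Y : FlatModel R sX} (h : SmoothOver q Z) (hZ : AgreesAt q j Z Y) : SmoothOver q Y := by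
  obtain ⟨Ω, i, _, hi, hs⟩ := h
  obtain ⟨Ω', b, a, t, _, _, hs', -, -, -, ha⟩ := hZ
  refine ⟨pullback i b, pullback.snd i b ≫ a, inferInstance, ?_, ?_⟩
  · intro y hy
    obtain ⟨w, rfl⟩ := ha y hy
    have h1 : w ∈ Set.range (pullback.snd i b) := by
      rw [Scheme.Pullback.range_snd]
      refine hi _ ?_
      rw [← hy, ← Scheme.Hom.comp_apply, hs', Scheme.Hom.comp_apply]
    obtain ⟨o, rfl⟩ := h1
    exact ⟨o, rfl⟩
  · rw [Category.assoc, ← hs', ← pullback.condition_assoc]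
    infer_instance

/-- The order is smooth where `δ` is invertible, and since `δ` is congruent to `1` modulo `π`, this
locus contains every fibre over a prime containing `π`. The element `s` collects the denominators of
the quadratic parts of the relations. -/
theorem exists_smoothOver_affineModel (R : Type u) [CommRing R] [IsDedekindDomain R] [Algebra R F]
    [IsFractionRing R F] {A : Type u} [CommRing A] [Algebra F A]
    [Algebra R A] [IsScalarTower R F A] [Algebra.IsStandardSmooth F A] (ε : A →ₐ[F] F) :
    ∃ (κ : Type u) (_ : Finite κ) (x : κ → A) (s : R), Algebra.adjoin F (Set.range x) = ⊤ ∧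
      (∀ k, ε (x k) = 0) ∧ s ≠ 0 ∧ ∀ π : R, π ≠ 0 → s ∣ π → ∀ N ≥ 2,
      ∀ hB : IsOrder (scaledOrder F x π N), ∀ q : Spec (.of R), π ∈ q.asIdeal →
        SmoothOver q (affineModel R F _ hB) := by
  obtain ⟨ι, σ, _, _, _, x, f, a, c, hx, hεx, hxf, hf, ha, hc, hl⟩ := exists_smooth_generators R ε
  choose s hs hg using fun i => exists_rescale_eq (hl i)
  have hr : Set.range (fun k : ULift.{u} ι => x k.down) = Set.range x :=
    Equiv.ulift.surjective.range_comp x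
  refine ⟨ULift.{u} ι, inferInstance, fun k => x k.down, ∏ i, s i, by rwa [hr], fun k => hεx _,
    Finset.prod_ne_zero_iff.mpr fun i _ => hs i, ?_⟩
  intro π hπ0 hπ N hN
  have hB : scaledOrder F (fun k : ULift.{u} ι => x k.down) π N = scaledOrder F x π N := by
    unfold scaledOrder
    congr 1
    exact Equiv.ulift.surjective.range_comp
      (fun k => algebraMap F A (algebraMap R F π ^ N)⁻¹ * x k)
  rw [hB]
  intro hB q hq
  choose g hg using fun i => hg i π ((Finset.dvd_prod_of_mem s (Finset.mem_univ i)).trans hπ) N hN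
  obtain ⟨δ, ⟨b, hb⟩, hδ⟩ := exists_smooth_away_scaledOrder hxf hf ha hc hπ0 hg
  obtain ⟨B', _, _, _, _, _⟩ : ∃ (B' : Type u) (_ : CommRing B') (_ : Algebra (scaledOrder F x π N) B')
    (_ : Algebra R B') (_ : IsScalarTower R (scaledOrder F x π N) B'),
    IsLocalization.Away δ B' :=
    ⟨Localization.Away δ, inferInstance, inferInstance, inferInstance, inferInstance, inferInstance⟩
  refine ⟨Spec (.of B'), Spec.map (CommRingCat.ofHom (algebraMap (scaledOrder F x π N) B')),
    IsOpenImmersion.of_isLocalization δ, ?_, ?_⟩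
  · intro m hm
    have h1 : δ ∉ PrimeSpectrum.asIdeal m := by
      intro h
      have h2 : algebraMap R (scaledOrder F x π N) π ∈ PrimeSpectrum.asIdeal m := by
        have h3 : π ∈ (PrimeSpectrum.asIdeal m).comap (algebraMap R (scaledOrder F x π N)) := by
          have h4 : (PrimeSpectrum.asIdeal m).comap (algebraMap R (scaledOrder F x π N)) =
            q.asIdeal := congrArg PrimeSpectrum.asIdeal hm
          rwa [h4]
        exact h3
      refine m.isPrime.ne_top ((Ideal.eq_top_iff_one _).mpr ?_)
      have h5 := sub_mem h (Ideal.mul_mem_right b _ h2)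
      rwa [hb, add_sub_cancel_right] at h5
    have h2 : m ∈ Set.range (PrimeSpectrum.comap (algebraMap (scaledOrder F x π N) B')) := by
      rw [PrimeSpectrum.localization_away_comap_range B' δ]
      exact h1
    exact h2
  · change Smooth (_ ≫ Spec.map (CommRingCat.ofHom (algebraMap R (scaledOrder F x π N))))
    rw [specMap_comp_specMap, ← IsScalarTower.algebraMap_eq,
      HasRingHomProperty.Spec_iff (P := @Smooth)]
    exact RingHom.smooth_algebraMap.mpr (hδ B')

end SmoothOver

end IntegralModels

/-! ### Smoothness near the generic fibre -/

namespace IntegralModels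

open Limits

section SmoothLocus

theorem isIso_stalkMap {X Y : Scheme.{u}} (f : X ⟶ Y) [Flat f] [IsPreimmersion f] (x : X) :
    IsIso (f.stalkMap x) := by
  rw [ConcreteCategory.isIso_iff_bijective]
  refine ⟨?_, f.stalkMap_surjective x⟩
  algebraize [(f.stalkMap x).hom]
  have : Module.FaithfullyFlat (Y.presheaf.stalk (f x)) (X.presheaf.stalk x) :=
    @Module.FaithfullyFlat.of_flat_of_isLocalHom _ _ _ _ _ _ _
      (Flat.stalkMap f x) (f.toLRSHom.prop x)
  exact ‹RingHom.FaithfullyFlat _›.injective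

theorem formallySmooth_stalkMap_congr {X Y : Scheme.{u}} {f g : X ⟶ Y} (h : f = g) (x : X) :
    (f.stalkMap x).hom.FormallySmooth ↔ (g.stalkMap x).hom.FormallySmooth := by
  subst h
  rfl

theorem formallySmooth_stalkMap_comp {X Y Z : Scheme.{u}} (f : X ⟶ Y) (g : Y ⟶ Z) (x : X) :
    ((f ≫ g).stalkMap x).hom.FormallySmooth ↔
      (g.stalkMap (f x) ≫ f.stalkMap x).hom.FormallySmooth := by
  rw [Scheme.Hom.stalkMap_comp]
  rfl

variable {R F : Type u} [CommRing R] [Field F] [Algebra R F] [IsFractionRing R F]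
  {X : Scheme.{u}} {sX : X ⟶ Spec (.of F)}

theorem FlatModel.flat_gen (M : FlatModel R sX) : Flat M.gen :=
  MorphismProperty.of_isPullback M.isPullback.flip (flat_genMap R F)

/-- The local rings of the model at points of the generic fibre are those of `X`, and the base has
local ring `F` at its generic point, so the two stalk maps agree. -/
theorem FlatModel.formallySmooth_stalkMap_gen (M : FlatModel R sX) [Smooth sX] (x : X) :
    (M.str.stalkMap (M.gen x)).hom.FormallySmooth := by
  have := M.isPreimmersion_gen
  have := M.flat_gen
  have := isIso_stalkMap M.gen x
  have := isIso_stalkMap (genMap R F) (sX x)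
  have h1 : (sX.stalkMap x).hom.FormallySmooth := by
    rw [← Scheme.Hom.mem_smoothLocus, sX.smoothLocus_eq_top]
    trivial
  have h2 : ((sX ≫ genMap R F).stalkMap x).hom.FormallySmooth :=
    (formallySmooth_stalkMap_comp _ _ _).mpr
      ((RingHom.FormallySmooth.respectsIso.cancel_left_isIso _ _).mpr h1)
  exact (RingHom.FormallySmooth.respectsIso.cancel_right_isIso _ _).mp
    ((formallySmooth_stalkMap_comp _ _ _).mp
      ((formallySmooth_stalkMap_congr M.isPullback.w x).mpr h2))

variable [IsDedekindDomain R]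

omit [IsFractionRing R F] in
theorem FlatModel.locallyOfFinitePresentation_str (M : FlatModel R sX) :
    LocallyOfFinitePresentation M.str :=
  LocallyOfFinitePresentation.iff_locallyOfFiniteType.mpr inferInstance

/-- The smooth locus is open and contains the generic fibre, hence almost all closed fibres. -/
theorem FlatModel.exists_ne_zero_smoothOver (M : FlatModel R sX) [Smooth sX] :
    ∃ r : R, r ≠ 0 ∧ ∀ q : Spec (.of R), r ∉ q.asIdeal → SmoothOver q M := by
  have := M.locallyOfFinitePresentation_str
  obtain ⟨r, hr, h⟩ := exists_ne_zero_of_range_subset M.isPullback M.str.smoothLocus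
    M.formallySmooth_stalkMap_gen
  refine ⟨r, hr, fun q hq => ⟨_, M.str.smoothLocus.ι, inferInstance, ?_, ?_⟩⟩
  · rintro m rfl
    rw [Scheme.Opens.range_ι]
    exact h m hq
  · rw [← Scheme.Hom.smoothLocus_eq_top_iff, ← Scheme.Hom.preimage_smoothLocus_eq]
    exact Scheme.Opens.ι_preimage_self _

omit [IsFractionRing R F] in
theorem FlatModel.smooth_str (M : FlatModel R sX) (h : ∀ q, SmoothOver q M) : Smooth M.str := by
  have := M.locallyOfFinitePresentation_str
  rw [← Scheme.Hom.smoothLocus_eq_top_iff, eq_top_iff]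
  intro m _
  obtain ⟨Ω, i, _, hi, _⟩ := h (M.str m)
  obtain ⟨w, rfl⟩ := hi m rfl
  have h1 : w ∈ i ⁻¹ᵁ M.str.smoothLocus := by
    rw [Scheme.Hom.preimage_smoothLocus_eq, Scheme.Hom.smoothLocus_eq_top]
    trivial
  exact h1

end SmoothLocus
end IntegralModels

/-! ### Charts around the unit with all required properties -/

namespace IntegralModels

open Limits Topology

section Chart

variable {F : Type u} [Field F]

theorem exists_isStandardSmooth_chart {X : Scheme.{u}} (sX : X ⟶ Spec (.of F)) [Smooth sX] (x : X) :
    ∃ (A : Type u) (_ : CommRing A) (_ : Algebra F A) (j : Spec (.of A) ⟶ X), IsOpenImmersion j ∧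
      j ≫ sX = Spec.map (CommRingCat.ofHom (algebraMap F A)) ∧ x ∈ Set.range j ∧
      Algebra.IsStandardSmooth F A := by
  obtain ⟨U, hU, V, hV, hx, e, h⟩ := Smooth.exists_isStandardSmooth sX x
  obtain rfl : U = ⊤ := by
    rw [eq_top_iff]
    intro y _
    have : y = sX x := Subsingleton.elim (α := PrimeSpectrum F) _ _
    rw [this]
    exact e hx
  obtain ⟨τ, hτ⟩ := Spec.map_surjective (hV.fromSpec ≫ sX)
  have hτ' : τ = (Scheme.ΓSpecIso (.of F)).inv ≫ sX.appLE ⊤ V e := by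
    apply Spec.map_injective
    rw [hτ, Spec.map_comp, ← IsAffineOpen.SpecMap_appLE_fromSpec sX (isAffineOpen_top _) hV e,
      IsAffineOpen.fromSpec_top]
    congr 1
    rw [Scheme.isoSpec_Spec_inv]
  let _ : Algebra F Γ(X, V) := τ.hom.toAlgebra
  refine ⟨Γ(X, V), inferInstance, inferInstance, hV.fromSpec, inferInstance, hτ.symm, ?_, ?_⟩
  · rw [hV.range_fromSpec]
    exact hx
  · have : τ.hom.IsStandardSmooth := by
      rw [hτ', CommRingCat.hom_comp]
      exact RingHom.isStandardSmooth_respectsIso.2 _ (Scheme.ΓSpecIso (.of F)).symm.commRingCatIsoToRingEquiv h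
    exact this

theorem exists_finiteType_chart {X : Scheme.{u}} (sX : X ⟶ Spec (.of F)) [LocallyOfFiniteType sX]
    (x : X) :
    ∃ (A : Type u) (_ : CommRing A) (_ : Algebra F A) (j : Spec (.of A) ⟶ X), IsOpenImmersion j ∧
      j ≫ sX = Spec.map (CommRingCat.ofHom (algebraMap F A)) ∧ x ∈ Set.range j ∧
      Algebra.FiniteType F A := by
  obtain ⟨_, ⟨W, hW, rfl⟩, hxW, -⟩ := X.isBasis_affineOpens.exists_subset_of_mem_open
    (Set.mem_univ x) isOpen_univ
  have hW : IsAffineOpen W := hW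
  obtain ⟨τ, hτ⟩ := Spec.map_surjective (hW.fromSpec ≫ sX)
  let _ : Algebra F Γ(X, W) := τ.hom.toAlgebra
  refine ⟨Γ(X, W), inferInstance, inferInstance, hW.fromSpec, inferInstance, hτ.symm, ?_, ?_⟩
  · rwa [hW.range_fromSpec]
  · have : LocallyOfFiniteType (Spec.map τ) := hτ ▸ inferInstance
    exact RingHom.finiteType_algebraMap.mp (HasRingHomProperty.Spec_iff.mp this)

/-- Affine charts in an open set, standard smooth ones if the scheme is smooth. -/
theorem exists_chart_in_open {X : Scheme.{u}} (sX : X ⟶ Spec (.of F)) [LocallyOfFiniteType sX]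
    {x : X} (G : X.Opens) (hx : x ∈ G) :
    ∃ (A : Type u) (_ : CommRing A) (_ : Algebra F A) (j : Spec (.of A) ⟶ X), IsOpenImmersion j ∧
      j ≫ sX = Spec.map (CommRingCat.ofHom (algebraMap F A)) ∧ x ∈ Set.range j ∧
      (∀ y, j y ∈ G) ∧ Algebra.FiniteType F A ∧ (Smooth sX → Algebra.IsStandardSmooth F A) := by
  obtain ⟨A, _, _, j, _, hj, ⟨x₀, hx₀⟩, hA, hA'⟩ : ∃ (A : Type u) (_ : CommRing A) (_ : Algebra F A)
      (j : Spec (.of A) ⟶ X), IsOpenImmersion j ∧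
      j ≫ sX = Spec.map (CommRingCat.ofHom (algebraMap F A)) ∧ x ∈ Set.range j ∧
      Algebra.FiniteType F A ∧ (Smooth sX → Algebra.IsStandardSmooth F A) := by
    by_cases h : Smooth sX
    · obtain ⟨A, _, _, j, h1, h2, h3, h4⟩ := exists_isStandardSmooth_chart sX x
      exact ⟨A, _, _, j, h1, h2, h3, inferInstance, fun _ => h4⟩
    · obtain ⟨A, _, _, j, h1, h2, h3, h4⟩ := exists_finiteType_chart sX x
      exact ⟨A, _, _, j, h1, h2, h3, h4, fun h' => (h h').elim⟩
  obtain ⟨_, ⟨_, ⟨s, rfl⟩, rfl⟩, hs, hsG⟩ :=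
    (PrimeSpectrum.isBasis_basic_opens (R := A)).exists_subset_of_mem_open
      (show x₀ ∈ (j ⁻¹ᵁ G : (Spec (.of A)).Opens) from (congrArg (· ∈ G) hx₀).mpr hx) (j ⁻¹ᵁ G).2
  obtain ⟨B, _, _, _, _, _⟩ : ∃ (B : Type u) (_ : CommRing B) (_ : Algebra A B) (_ : Algebra F B)
    (_ : IsScalarTower F A B), IsLocalization.Away s B :=
    ⟨Localization.Away s, inferInstance, inferInstance, inferInstance, inferInstance, inferInstance⟩
  have hr : Set.range (Spec.map (CommRingCat.ofHom (algebraMap A B))) =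
      (PrimeSpectrum.basicOpen s : Set (PrimeSpectrum A)) := PrimeSpectrum.localization_away_comap_range B s
  have := IsOpenImmersion.of_isLocalization (S := B) s
  refine ⟨B, inferInstance, inferInstance, Spec.map (CommRingCat.ofHom (algebraMap A B)) ≫ j,
    inferInstance, ?_, ?_, ?_, ?_, ?_⟩
  · rw [Category.assoc, hj, specMap_comp_specMap, ← IsScalarTower.algebraMap_eq]
  · have : x₀ ∈ Set.range (Spec.map (CommRingCat.ofHom (algebraMap A B))) := hr ▸ hs
    obtain ⟨y, rfl⟩ := this
    exact ⟨y, hx₀⟩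
  · intro y
    exact hsG (hr ▸ ⟨y, rfl⟩)
  · have : Algebra.FinitePresentation A B := IsLocalization.Away.finitePresentation s
    exact Algebra.FiniteType.trans (S := A) hA inferInstance
  · intro h
    have := hA' h
    have : Algebra.IsStandardSmooth A B := Algebra.IsStandardSmooth.localization_away s
    exact .trans F A B

theorem exists_generators_vanishing {A : Type u} [CommRing A] [Algebra F A] [Algebra.FiniteType F A]
    (ε : A →ₐ[F] F) : ∃ (κ : Type u) (_ : Finite κ) (x : κ → A),
      Algebra.adjoin F (Set.range x) = ⊤ ∧ ∀ k, ε (x k) = 0 := by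
  obtain ⟨s, hs⟩ := (inferInstance : Algebra.FiniteType F A).out
  refine ⟨s, inferInstance, fun k => k.1 - algebraMap F A (ε k), ?_, fun k => by simp⟩
  rw [eq_top_iff, ← hs, Algebra.adjoin_le_iff]
  intro a ha
  rw [← sub_add_cancel a (algebraMap F A (ε a))]
  exact add_mem (Algebra.subset_adjoin ⟨⟨a, ha⟩, rfl⟩) (Subalgebra.algebraMap_mem _ _)

variable {v : FinPlace F} {X : Over (Spec (.of F))}
  {R : Type u} [CommRing R] [IsDedekindDomain R] [Algebra R F] [IsFractionRing R F]

/-- A chart around the unit section whose integral points lie in a given neighbourhood of the unit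
and form a group, and which is smooth if the group is. -/
theorem exists_unit_chart [LocallyOfFiniteType X.hom] {ρ : R →+* v.integers}
    (hρ : v.integers.subtype.comp ρ = (algebraMap F v.completion).comp (algebraMap R F))
    (hR : ∀ r : R, algebraMap R F r ∈ v.ring)
    {d : pullback X.hom X.hom ⟶ X.left} (hds : d ≫ X.hom = pullback.fst X.hom X.hom ≫ X.hom)
    {e : Spec (.of F) ⟶ X.left} (hes : e ≫ X.hom = 𝟙 _)
    (hd₁ : pullback.lift (𝟙 X.left) (X.hom ≫ e) (by simp [hes]) ≫ d = 𝟙 X.left)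
    (hd₂ : pullback.lift (𝟙 X.left) (𝟙 X.left) rfl ≫ d = X.hom ≫ e)
    (z : LocalPoints X v)
    (hz : z.pt = Spec.map (CommRingCat.ofHom (algebraMap F v.completion)) ≫ e)
    {U : Set (LocalPoints X v)} (hU : IsOpen U) (hzU : z ∈ U) {q : Spec (.of R)} {π : R}
    (hπ : π ∈ q.asIdeal) (hπ' : (algebraMap R F π)⁻¹ ∉ v.ring) :
    ∃ (W : Scheme.{u}) (j : W ⟶ X.left) (Z : FlatModel R (j ≫ X.hom)), IsOpenImmersion j ∧
      IsSeparated Z.str ∧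
      (∀ (z' : LocalPoints X v) (z₁ : Spec (.of v.completion) ⟶ W), z₁ ≫ j = z'.pt →
        IsIntegralPt Z ρ v.integers.subtype z₁ → z' ∈ U) ∧
      ExtendsAt q (Z.prod Z) Z (pullback.map (j ≫ X.hom) (j ≫ X.hom) X.hom X.hom j j (𝟙 _) (by simp)
        (by simp) ≫ d) j ∧
      ExtendsAt q (unitModel R F) Z e j ∧ (Smooth X.hom → SmoothOver q Z) := by
  suffices ∃ (W : Scheme.{u}) (sW : W ⟶ Spec (.of F)) (j : W ⟶ X.left) (hj : j ≫ X.hom = sW)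
      (Z : FlatModel R sW), IsOpenImmersion j ∧ IsSeparated Z.str ∧
      (∀ (z' : LocalPoints X v) (z₁ : Spec (.of v.completion) ⟶ W), z₁ ≫ j = z'.pt →
        IsIntegralPt Z ρ v.integers.subtype z₁ → z' ∈ U) ∧
      ExtendsAt q (Z.prod Z) Z (pullback.map sW sW X.hom X.hom j j (𝟙 _) (by simp [hj])
        (by simp [hj]) ≫ d) j ∧
      ExtendsAt q (unitModel R F) Z e j ∧ (Smooth X.hom → SmoothOver q Z) by
    obtain ⟨W, _, j, rfl, Z, h⟩ := this
    exact ⟨W, j, Z, h⟩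
  obtain ⟨G, hG, H⟩ := exists_nhds_chart z hU hzU
  let o : Spec (.of F) := closedPt F
  have ho : ∀ x : Spec (.of F), x = o := fun x => Subsingleton.elim (α := PrimeSpectrum F) _ _
  have hoG : e o ∈ G := by
    have := hG (closedPt v.completion)
    rw [hz, Scheme.Hom.comp_apply] at this
    rwa [ho (Spec.map _ _)] at this
  obtain ⟨A, _, _, j, _, hj, hoj, hjG, _, hsm⟩ := exists_chart_in_open X.hom G hoG
  let _ : Algebra R A := ((algebraMap F A).comp (algebraMap R F)).toAlgebra
  have : IsScalarTower R F A := .of_algebraMap_eq' rfl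
  obtain ⟨ε, hε⟩ : ∃ ε : A →ₐ[F] F, Spec.map (CommRingCat.ofHom ε.toRingHom) ≫ j = e := by
    let ε₀ : Spec (.of F) ⟶ Spec (.of A) := IsOpenImmersion.lift j e (by
      rintro _ ⟨x, rfl⟩
      rwa [ho x])
    obtain ⟨ε, hε⟩ : ∃ ε : A →+* F, Spec.map (CommRingCat.ofHom ε) = ε₀ :=
      ⟨(Spec.preimage ε₀).hom, Spec.map_preimage ε₀⟩
    have h1 : Spec.map (CommRingCat.ofHom ε) ≫ j = e := by
      rw [hε]
      exact IsOpenImmersion.lift_fac _ _ _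
    refine ⟨⟨ε, fun r => ?_⟩, h1⟩
    have h2 : Spec.map (CommRingCat.ofHom (ε.comp (algebraMap F A))) =
        Spec.map (CommRingCat.ofHom (RingHom.id F)) := by
      rw [← specMap_comp_specMap, ← hj, ← Category.assoc, h1, hes]
      exact (Spec.map_id _).symm
    exact RingHom.congr_fun (congrArg CommRingCat.Hom.hom (Spec.map_injective h2)) r
  obtain ⟨κ, _, x, s, hx, hεx, hs0, hs⟩ : ∃ (κ : Type u) (_ : Finite κ) (x : κ → A) (s : R),
      Algebra.adjoin F (Set.range x) = ⊤ ∧ (∀ k, ε (x k) = 0) ∧ s ≠ 0 ∧ (Smooth X.hom →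
      ∀ π : R, π ≠ 0 → s ∣ π → ∀ N ≥ 2,
      ∀ hB : IsOrder (scaledOrder F x π N), ∀ q : Spec (.of R), π ∈ q.asIdeal →
        SmoothOver q (affineModel R F _ hB)) := by
    by_cases h : Smooth X.hom
    · have := hsm h
      obtain ⟨κ, h0, x, s, h1, h2, h3, h4⟩ := exists_smoothOver_affineModel R ε
      exact ⟨κ, h0, x, s, h1, h2, h3, fun _ => h4⟩
    · obtain ⟨κ, h0, x, h1, h2⟩ := exists_generators_vanishing ε
      exact ⟨κ, h0, x, 1, h1, h2, one_ne_zero, fun h' => (h h').elim⟩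
  -- The scaling parameter is `π * s` in place of `π`, because the smoothness criterion wants it to
  -- be divisible by `s`. It still lies in `q` and its inverse is still not integral at `v`.
  have hπs : π * s ∈ q.asIdeal := q.asIdeal.mul_mem_right _ hπ
  have hs0' : algebraMap R F s ≠ 0 := (map_ne_zero_iff _ (IsFractionRing.injective R F)).mpr hs0
  have hπs' : (algebraMap R F (π * s))⁻¹ ∉ v.ring := by
    intro h
    refine hπ' ?_
    have := v.ring.mul_mem _ _ h (hR s)
    rwa [map_mul, mul_inv, mul_assoc, inv_mul_cancel₀ hs0', mul_one] at this
  have hπs0 : π * s ≠ 0 := by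
    intro h
    rw [h, map_zero, inv_zero] at hπs'
    exact hπs' v.ring.zero_mem
  obtain ⟨N₁, h₁⟩ := exists_extendsAt_div hds hes hd₁ hd₂ hj hε hx hεx hπs hπs0
  obtain ⟨N₂, h₂⟩ := exists_mem_of_isIntegralPt_scaledOrder hρ hj hεx
    (H j hj hjG x hx ((algebraMap F v.completion).comp ε.toRingHom) (by
      rw [hz, ← specMap_comp_specMap, Category.assoc, hε])) (hR (π * s)) hπs'
  -- `N₁` serves the extension of division, `N₂` the containment in `U`, and `2` the smoothness.
  let N := max (max N₁ N₂) 2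
  have hB := isOrder_scaledOrder (R := R) hx hπs0 N
  have h₁ := h₁ N (le_max_of_le_left (le_max_left _ _)) hB
  have h₂ := h₂ N (le_max_of_le_left (le_max_right _ _)) hB
  have h₃ := extendsAt_unit_affineModel (q := q) hε hεx hB
  have h₄ := fun h => hs h (π * s) hπs0 (dvd_mul_left _ _) N (le_max_right _ _) hB q hπs
  have h₅ : IsSeparated (affineModel R F _ hB).str := by
    change IsSeparated (Spec.map _)
    infer_instance
  exact ⟨_, _, j, hj, affineModel R F _ hB, inferInstance, h₅, h₂, h₁, h₃, h₄⟩

end Chart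
end IntegralModels

/-! ### Group scheme models -/

namespace IntegralModels

open Limits Topology

section GroupModels

variable {F : Type u} [Field F] [IsGlobalField F] {S : Set (Place F)} {X : Over (Spec (.of F))}

omit [IsGlobalField F] in
theorem exists_mem_placePt_of_ne {v : Outside S} (hv : placePt S v ≠ genPt (sIntegers S)) :
    ∃ π : sIntegers S, π ∈ (placePt S v).asIdeal ∧ (π : F)⁻¹ ∉ v.1.ring := by
  obtain ⟨π, hπ, hπ0⟩ := Submodule.exists_mem_ne_zero_of_ne_bot
    (show (placePt S v).asIdeal ≠ ⊥ from fun h => hv (PrimeSpectrum.ext h))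
  refine ⟨π, hπ, fun h => ?_⟩
  have hu := isUnit_sIntegersMap hπ0 h
  exact (IsLocalRing.mem_maximalIdeal _).mp
    (show sIntegersMap S v π ∈ IsLocalRing.maximalIdeal v.1.integers from hπ) hu

/-- A flat model can be modified such that the division and the unit of the group extend, making it
smaller at finitely many places. -/
theorem FlatModel.exists_modification_div (hfin : S.Finite) (hne : S.Nonempty)
    [IsSeparated X.hom]
    [LocallyOfFiniteType X.hom] (Y : FlatModel (sIntegers S) X.hom) [IsSeparated Y.str]
    {d : pullback X.hom X.hom ⟶ X.left} (hds : d ≫ X.hom = pullback.fst X.hom X.hom ≫ X.hom)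
    {e : Spec (.of F) ⟶ X.left} (hes : e ≫ X.hom = 𝟙 _)
    (hd₁ : pullback.lift (𝟙 X.left) (X.hom ≫ e) (by simp [hes]) ≫ d = 𝟙 X.left)
    (hd₂ : pullback.lift (𝟙 X.left) (𝟙 X.left) rfl ≫ d = X.hom ≫ e)
    (z : ∀ v : Outside S, LocalPoints X v.1)
    (hz : ∀ v, (z v).pt = Spec.map (CommRingCat.ofHom (algebraMap F v.1.completion)) ≫ e)
    (hzY : ∀ v, z v ∈ Y.localPts v) :
    ∃ Y' : FlatModel (sIntegers S) X.hom, IsSeparated Y'.str ∧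
      (∀ v, Y'.localPts v ⊆ Y.localPts v) ∧
      (∃ δ : pullback Y'.str Y'.str ⟶ Y'.scheme, δ ≫ Y'.str = pullback.fst _ _ ≫ Y'.str ∧
        (Y'.prod Y').gen ≫ δ = d ≫ Y'.gen) ∧
      (∃ η : Spec (.of (sIntegers S)) ⟶ Y'.scheme, η ≫ Y'.str = 𝟙 _ ∧
        genMap (sIntegers S) F ≫ η = e ≫ Y'.gen) ∧
      (Smooth X.hom → Smooth Y'.str) := by
  have := sIntegers_isFractionRing hfin hne
  have := sIntegers_isDedekindDomain hfin hne
  have : Y.scheme.IsSeparated := isSeparated_of_str Y.str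
  obtain ⟨r₁, hr₁, h₁⟩ := exists_ne_zero_extendsAt (M := Y.prod Y) (Y := Y) hds
  obtain ⟨r₂, hr₂, h₂⟩ := exists_ne_zero_extendsAt (M := unitModel (sIntegers S) F) (Y := Y) hes
  obtain ⟨r₃, hr₃, h₃⟩ : ∃ r : sIntegers S, r ≠ 0 ∧ (Smooth X.hom →
      ∀ q : Spec (.of (sIntegers S)), r ∉ q.asIdeal → SmoothOver q Y) := by
    by_cases h : Smooth X.hom
    · obtain ⟨r, h1, h2⟩ := Y.exists_ne_zero_smoothOver
      exact ⟨r, h1, fun _ => h2⟩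
    · exact ⟨1, one_ne_zero, fun h' => (h h').elim⟩
  have hr : r₁ * r₂ * r₃ ≠ 0 := mul_ne_zero (mul_ne_zero hr₁ hr₂) hr₃
  -- Outside `I` division and unit already extend to `Y`, and `Y` is smooth there if `X` is. At the
  -- finitely many places of `I` a polydisc around the unit is inserted.
  let I : Set (Outside S) := {v | r₁ * r₂ * r₃ ∈ (placePt S v).asIdeal}
  have hI : I.Finite := (finite_setOf_mem_asIdeal hr).preimage
    (placePt_injective hne).injOn
  have hIr : ∀ v ∉ I, r₁ ∉ (placePt S v).asIdeal ∧ r₂ ∉ (placePt S v).asIdeal ∧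
      r₃ ∉ (placePt S v).asIdeal := fun v hv =>
    ⟨fun h => hv (Ideal.mul_mem_right _ _ (Ideal.mul_mem_right _ _ h)),
      fun h => hv (Ideal.mul_mem_right _ _ (Ideal.mul_mem_left _ _ h)),
      fun h => hv (Ideal.mul_mem_left _ _ h)⟩
  obtain ⟨Y', hY', hbad, hgood⟩ := Y.exists_modification_at_places hfin hne hI
    (fun v W j Z => (∀ (z' : LocalPoints X v.1) (z₁ : Spec (.of v.1.completion) ⟶ W),
        z₁ ≫ j = z'.pt → IsIntegralPt Z (sIntegersMap S v) v.1.integers.subtype z₁ →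
          z' ∈ Y.localPts v) ∧
      ExtendsAt (placePt S v) (Z.prod Z) Z (pullback.map (j ≫ X.hom) (j ≫ X.hom) X.hom X.hom j j
        (𝟙 _) (by simp) (by simp) ≫ d) j ∧
      ExtendsAt (placePt S v) (unitModel (sIntegers S) F) Z e j ∧
      (Smooth X.hom → SmoothOver (placePt S v) Z)) (by
    intro v _
    obtain ⟨π, h1, h2⟩ := exists_mem_placePt_of_ne (placePt_ne_genPt hne v)
    exact exists_unit_chart (subtype_comp_sIntegersMap v)
      (fun r => mem_ring_of_mem_sIntegers r.2 v) hds hes hd₁ hd₂ (z v) (hz v)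
      (Y.isOpen_localPts v) (hzY v) h1 h2)
  have : Y'.scheme.IsSeparated := isSeparated_of_str Y'.str
  have hunit : ∀ v, AgreesAt (placePt S v) (𝟙 _) (unitModel (sIntegers S) F)
    (unitModel (sIntegers S) F) := fun v => .refl _ _
  have hdiv : ∀ q, q ≠ genPt (sIntegers S) → ExtendsAt q (Y'.prod Y') Y' d (𝟙 X.left) := by
    intro q hq
    obtain ⟨v, rfl⟩ := exists_placePt_eq hne hq
    by_cases hv : v ∈ I
    · obtain ⟨W, j, Z, ⟨-, h, -, -⟩, hZ⟩ := hbad v hv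
      exact h.congr_agreesAt (by
        rw [pullback.lift_fst_assoc, Category.assoc]) (hZ.prod rfl rfl hZ) hZ
    · have h := h₁ _ (hIr v hv).1
      have hk : 𝟙 _ ≫ pullback.fst X.hom X.hom ≫ X.hom = pullback.fst X.hom X.hom ≫ X.hom :=
        Category.id_comp _
      refine ExtendsAt.congr_agreesAt (k := 𝟙 _) (by rwa [Category.id_comp]) hk ?_ (hgood v hv)
      have h2 := (hgood v hv).prod (Category.id_comp _) (Category.id_comp _) (hgood v hv)
      rwa [pullback.map_id] at h2
  have hone : ∀ q, q ≠ genPt (sIntegers S) →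
      ExtendsAt q (unitModel (sIntegers S) F) Y' e (𝟙 X.left) := by
    intro q hq
    obtain ⟨v, rfl⟩ := exists_placePt_eq hne hq
    by_cases hv : v ∈ I
    · obtain ⟨W, j, Z, ⟨-, -, h, -⟩, hZ⟩ := hbad v hv
      exact ExtendsAt.congr_agreesAt (k := 𝟙 _) (by rwa [Category.id_comp]) (Category.id_comp _)
        (hunit v) hZ
    · exact ExtendsAt.congr_agreesAt (k := 𝟙 _) (by
        rw [Category.id_comp]
        exact h₂ _ (hIr v hv).2.1) (Category.id_comp _) (hunit v) (hgood v hv)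
  refine ⟨Y', hY', fun v z' hz' => ?_, exists_isExt_of_extendsAt hds hdiv,
    exists_isExt_of_extendsAt hes hone, fun h => ?_⟩
  · by_cases hv : v ∈ I
    · obtain ⟨W, j, Z, ⟨h, -⟩, hZ⟩ := hbad v hv
      obtain ⟨z₁, h6, h7⟩ := (isIntegralPt_iff_of_agreesAt hZ rfl rfl).mp hz'
      exact h z' z₁ h6 h7
    · exact (hgood v hv).localPts_eq.le hz'
  · refine Y'.smooth_str fun q => ?_
    by_cases hq : q = genPt (sIntegers S)
    · obtain ⟨r, h1, h2⟩ := Y'.exists_ne_zero_smoothOver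
      exact h2 q (by rw [hq]; exact h1)
    · obtain ⟨v, rfl⟩ := exists_placePt_eq hne hq
      by_cases hv : v ∈ I
      · obtain ⟨W, j, Z, ⟨-, -, -, h'⟩, hZ⟩ := hbad v hv
        exact (h' h).congr_agreesAt hZ
      · exact (h₃ h _ (hIr v hv).2.2).congr_agreesAt (hgood v hv)

open MonoidalCategory CartesianMonoidalCategory
open scoped Obj MonObj

omit [IsGlobalField F] in
-- Base change to `F` is faithful on morphisms from flat schemes into the separated scheme `Y`, and
-- products of flat schemes are flat. So the group structure of `X` determines one on `Y` as soon as
-- division and unit extend.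
theorem FlatModel.exists_groupModel [GrpObj X] [IsDedekindDomain (sIntegers S)]
    [IsFractionRing (sIntegers S) F] (Y : FlatModel (sIntegers S) X.hom) (hsep : IsSeparated Y.str)
    (hsurj : Surjective Y.str)
    (hδ : ∃ δ : pullback Y.str Y.str ⟶ Y.scheme, δ ≫ Y.str = pullback.fst _ _ ≫ Y.str ∧
        (Y.prod Y).gen ≫ δ = (fst X X / snd X X).left ≫ Y.gen)
    (hη' : ∃ η' : Spec (.of (sIntegers S)) ⟶ Y.scheme, η' ≫ Y.str = 𝟙 _ ∧
        genMap (sIntegers S) F ≫ η' = (η[X] : 𝟙_ _ ⟶ X).left ≫ Y.gen) :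
    ∃ G : GroupModel X S, G.toIntegralModel = Y.integralModel hsep hsurj := by
  obtain ⟨δ, hδs, hδ⟩ := hδ
  obtain ⟨η', hηs, hη⟩ := hη'
  have : Y.scheme.IsSeparated := isSeparated_of_str Y.str
  let Φ := Over.pullback (genMap (sIntegers S) F)
  let G : Over (Spec (.of (sIntegers S))) := Over.mk Y.str
  let i : Φ.obj G ≅ X := (Y.integralModel hsep hsurj).iso
  have hi : i.hom.left ≫ Y.gen = pullback.fst Y.str (genMap (sIntegers S) F) :=
    Y.isPullback.isoPullback_inv_fst
  have hΦ : ∀ {T T' : Over (Spec (.of (sIntegers S)))} (f : T ⟶ T'),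
      (Φ.map f).left ≫ pullback.fst T'.hom (genMap (sIntegers S) F) =
        pullback.fst T.hom (genMap (sIntegers S) F) ≫ f.left := fun f => pullback.lift_fst _ _ _
  have hext : ∀ {T : Over (Spec (.of F))} (f g : T ⟶ X), f.left ≫ Y.gen = g.left ≫ Y.gen →
      f = g := fun f g h => by
    ext1
    exact Y.isPullback.hom_ext h ((Over.w f).trans (Over.w g).symm)
  have hmap : ∀ {T : Over (Spec (.of (sIntegers S)))} (f : T ⟶ G),
      (Φ.map f ≫ i.hom).left ≫ Y.gen = pullback.fst T.hom (genMap (sIntegers S) F) ≫ f.left :=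
    fun f => (Category.assoc _ _ _).trans ((congrArg ((Φ.map f).left ≫ ·) hi).trans (hΦ f))
  obtain ⟨g, hg⟩ := exists_grpObj_of_div Φ i (fun T => Flat T.hom)
    (inferInstanceAs (Flat (𝟙 (Spec (.of (sIntegers S)))))) Y.flat
    (fun A B _ _ => show Flat (pullback.fst A.hom B.hom ≫ A.hom) by
      infer_instance) (by
      intro T hT f g h
      ext1
      refine hom_ext_of_generic (Z := Y.scheme)
        (IsPullback.of_hasPullback T.hom (genMap (sIntegers S) F)) ?_
      rw [← hΦ f, ← hΦ g, h])
    (Over.homMk δ hδs) (by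
      refine hext _ _ ((hmap _).trans ?_)
      have h1 : (Φ.map (fst G G) ≫ i.hom) / (Φ.map (snd G G) ≫ i.hom) =
          lift (Φ.map (fst G G) ≫ i.hom) (Φ.map (snd G G) ≫ i.hom) ≫ (fst X X / snd X X) := by
        rw [GrpObj.comp_div, lift_fst, lift_snd]
      rw [h1, Over.comp_left, Category.assoc, ← hδ]
      refine Eq.trans ?_ (Category.assoc _ (Y.prod Y).gen δ)
      refine congrArg (· ≫ δ) ?_
      rw [Over.lift_left]
      refine pullback.hom_ext ?_ ?_
      · refine Eq.trans ?_ (Category.assoc _ _ _).symm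
        refine Eq.trans ?_ (congrArg (_ ≫ ·) (pullback.lift_fst _ _ _).symm)
        refine Eq.trans ?_ (Category.assoc _ _ _)
        refine Eq.trans ?_ (congrArg (· ≫ _) (pullback.lift_fst _ _ _).symm)
        exact (hmap (fst G G)).symm
      · refine Eq.trans ?_ (Category.assoc _ _ _).symm
        refine Eq.trans ?_ (congrArg (_ ≫ ·) (pullback.lift_snd _ _ _).symm)
        refine Eq.trans ?_ (Category.assoc _ _ _)
        refine Eq.trans ?_ (congrArg (· ≫ _) (pullback.lift_snd _ _ _).symm)
        exact (hmap (snd G G)).symm)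
    (Over.homMk η' hηs) (by
      refine hext _ _ ((hmap _).trans ?_)
      change pullback.fst (𝟙 _) (genMap (sIntegers S) F) ≫ η' =
        (pullback.snd (𝟙 _) (genMap (sIntegers S) F) ≫ (η : 𝟙_ _ ⟶ X).left) ≫ Y.gen
      rw [Category.assoc, ← hη, ← pullback.condition_assoc, Category.id_comp])
  exact ⟨{ toIntegralModel := Y.integralModel hsep hsurj, grpObj := g, isMonHom_iso := hg }, rfl⟩

omit [IsGlobalField F] in
theorem GroupModel.unit_comp_genericMap [GrpObj X] (G : GroupModel X S) :
    ∃ η' : Spec (.of (sIntegers S)) ⟶ G.scheme.left, η' ≫ G.scheme.hom = 𝟙 _ ∧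
      (η[X] : 𝟙_ _ ⟶ X).left ≫ G.genericMap =
        Spec.map (CommRingCat.ofHom (sIntegers S).subtype) ≫ η' := by
  let _ := G.grpObj
  have := G.isMonHom_iso
  let Φ := Over.pullback (Spec.map (CommRingCat.ofHom (sIntegers S).subtype))
  let o : 𝟙_ (Over (Spec (.of (sIntegers S)))) ⟶ G.scheme := η
  have h1 : (η[X] : 𝟙_ _ ⟶ X) ≫ G.iso.inv = Functor.LaxMonoidal.ε Φ ≫ Φ.map o := by
    rw [Iso.comp_inv_eq]
    exact (IsMonHom.one_hom (f := G.iso.hom)).symm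
  have h2 : (Φ.map o).left ≫ pullback.fst G.scheme.hom
      (Spec.map (CommRingCat.ofHom (sIntegers S).subtype)) = pullback.fst (𝟙 _)
      (Spec.map (CommRingCat.ofHom (sIntegers S).subtype)) ≫ o.left := pullback.lift_fst _ _ _
  have h3 : (Functor.LaxMonoidal.ε Φ).left ≫ pullback.snd (𝟙 _)
      (Spec.map (CommRingCat.ofHom (sIntegers S).subtype)) = 𝟙 _ :=
    Over.w (Functor.LaxMonoidal.ε Φ)
  refine ⟨o.left, Over.w o, ?_⟩
  have h4 := congrArg (fun f => Over.Hom.left f ≫ pullback.fst G.scheme.hom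
      (Spec.map (CommRingCat.ofHom (sIntegers S).subtype))) h1
  refine (Category.assoc _ _ _).symm.trans (h4.trans ?_)
  refine (Category.assoc _ _ _).trans ?_
  refine (congrArg (_ ≫ ·) h2).trans ?_
  refine (Category.assoc _ _ _).symm.trans ?_
  refine congrArg (· ≫ o.left) ?_
  have h5 : pullback.fst (𝟙 _) (Spec.map (CommRingCat.ofHom (sIntegers S).subtype)) =
      pullback.snd (𝟙 _) (Spec.map (CommRingCat.ofHom (sIntegers S).subtype)) ≫
        Spec.map (CommRingCat.ofHom (sIntegers S).subtype) := by
    rw [← pullback.condition, Category.comp_id]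
  rw [h5]
  refine (Category.assoc _ _ _).symm.trans ?_
  refine (congrArg (· ≫ _) h3).trans ?_
  exact Category.id_comp _

theorem AdelicPoints.component_unit_pt [GrpObj X] (v : Outside S) :
    ((unit X S).component v).pt =
      Spec.map (CommRingCat.ofHom (algebraMap F v.1.completion)) ≫ (η[X] : 𝟙_ _ ⟶ X).left := by
  refine (Category.assoc _ _ _).symm.trans ?_
  refine congrArg (· ≫ (η[X] : 𝟙_ _ ⟶ X).left) ?_
  exact specMap_comp_specMap (diagonal S) (adeleProj S v)

theorem GroupModel.unit_mem_integralPoints [GrpObj X] (G : GroupModel X S) :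
    AdelicPoints.unit X S ∈ G.toIntegralModel.integralPoints := by
  intro v
  obtain ⟨η', h1, h2⟩ := G.unit_comp_genericMap
  rw [IntegralModel.mem_localIntegralPoints_iff]
  refine ⟨Spec.map (CommRingCat.ofHom (sIntegersMap S v)) ≫ η', ?_, ?_⟩
  · exact (Category.assoc _ _ _).trans ((congrArg (_ ≫ ·) h1).trans (Category.comp_id _))
  · rw [AdelicPoints.component_unit_pt]
    refine Eq.trans ?_ (Category.assoc _ _ _).symm
    refine Eq.trans ?_ (congrArg (_ ≫ ·) h2.symm)
    refine (Category.assoc _ _ _).symm.trans (Eq.trans ?_ (Category.assoc _ _ _))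
    refine congrArg (· ≫ η') ?_
    exact (specMap_comp_specMap _ _).trans (specMap_comp_specMap (sIntegers S).subtype
      (algebraMap F v.1.completion)).symm

/-- An integral model inside the neighbourhood is modified further, which only shrinks its integral
points, until division and unit extend. The extended unit is a section of the structure morphism, so
the new model is surjective over the base. -/
theorem exists_groupModel_of_mem_nhds (hfin : S.Finite) (hne : S.Nonempty)
    [IsSeparated X.hom]
    [LocallyOfFiniteType X.hom] [QuasiCompact X.hom] [GrpObj X] {U : Set (AdelicPoints X S)}
    (hU : U ∈ nhds (AdelicPoints.unit X S)) :
    ∃ G : GroupModel X S, G.toIntegralModel.integralPoints ⊆ U ∧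
      (Smooth X.hom → Smooth G.scheme.hom) := by
  have := sIntegers_isFractionRing hfin hne
  have := sIntegers_isDedekindDomain hfin hne
  obtain ⟨U', hU', hopen, hmem⟩ := mem_nhds_iff.mp hU
  obtain ⟨Y, hY, hYU⟩ := exists_integralModel_of_isOpen hfin hne hopen hmem
  let e : 𝟙_ (Over (Spec (.of F))) ⟶ X := η
  let d : X ⊗ X ⟶ X := fst X X / snd X X
  have h1 : lift (𝟙 X) (toUnit X ≫ e) ≫ d = 𝟙 X := by
    rw [GrpObj.comp_div, lift_fst, lift_snd, ← Hom.one_def, div_one]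
  have h2 : lift (𝟙 X) (𝟙 X) ≫ d = toUnit X ≫ e := by
    rw [GrpObj.comp_div, lift_fst, lift_snd, div_self', Hom.one_def]
  obtain ⟨Y', hsep, hsub, hδ, hη, hsm⟩ := Y.flatModel.exists_modification_div hfin hne
    (d := d.left) (Over.w d) (e := e.left) (Over.w e)
    (by
      have := congrArg Over.Hom.left h1
      rwa [Over.comp_left, Over.lift_left] at this)
    (by
      have := congrArg Over.Hom.left h2
      rwa [Over.comp_left, Over.lift_left] at this)
    (AdelicPoints.unit X S).component AdelicPoints.component_unit_pt
    fun v => (Y.localIntegralPoints_eq v).le (hY v)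
  have hsurj : Surjective Y'.str := by
    obtain ⟨η', hη', -⟩ := hη
    refine ⟨fun q => ⟨η' q, ?_⟩⟩
    rw [← Scheme.Hom.comp_apply, hη']
    rfl
  obtain ⟨G, hG⟩ := Y'.exists_groupModel hsep hsurj hδ hη
  refine ⟨G, fun z hz => hU' (hYU fun v => ?_), fun h => ?_⟩
  · rw [Y.localIntegralPoints_eq]
    rw [hG] at hz
    exact hsub v ((Y'.mem_localIntegralPoints_integralModel _ _ v _).mp (hz v))
  · rw [hG]
    exact hsm h

end GroupModels
end IntegralModels

theorem corollary2p8 {F : Type u} [Field F] [IntegralModels.IsGlobalField F]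
    (S : Set (IntegralModels.Place F)) (hfin : S.Finite) (hne : S.Nonempty)
    (hinf : ∀ w : NumberField.InfinitePlace F, Sum.inl w ∈ S)
    (X : Over (Spec (.of F)))
    [IsSeparated X.hom] [LocallyOfFiniteType X.hom] [QuasiCompact X.hom] :
    -- integral models realise every neighbourhood of every point
    (∀ U : Set (IntegralModels.AdelicPoints X S), IsOpen U → ∀ z ∈ U,
      ∃ Y : IntegralModels.IntegralModel X S, z ∈ Y.integralPoints ∧ Y.integralPoints ⊆ U) ∧
    -- the sets of integral points form a basis of the adelic topology
    TopologicalSpace.IsTopologicalBasis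
      (Set.range fun Y : IntegralModels.IntegralModel X S => Y.integralPoints) ∧
    -- algebraic groups, and smooth algebraic groups
    ∀ [GrpObj X],
      ((nhds (IntegralModels.AdelicPoints.unit X S)).HasBasis (fun _ => True)
        fun G : IntegralModels.GroupModel X S => G.toIntegralModel.integralPoints) ∧
      (Smooth X.hom →
        (nhds (IntegralModels.AdelicPoints.unit X S)).HasBasis
          (fun G : IntegralModels.GroupModel X S => Smooth G.scheme.hom)
          fun G => G.toIntegralModel.integralPoints) := by
  refine ⟨fun U hU z hz => IntegralModels.exists_integralModel_of_isOpen hfin hne hU hz,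
    IntegralModels.isTopologicalBasis_integralPoints hfin hne, fun {_} => ⟨⟨fun U => ?_⟩,
    fun hX => ⟨fun U => ?_⟩⟩⟩
  · refine ⟨fun hU => ?_, fun ⟨G, _, hG⟩ => ?_⟩
    · obtain ⟨G, hG, -⟩ := IntegralModels.exists_groupModel_of_mem_nhds hfin hne hU
      exact ⟨G, trivial, hG⟩
    · exact Filter.mem_of_superset ((G.isOpen_integralPoints hne).mem_nhds
        G.unit_mem_integralPoints) hG
  · refine ⟨fun hU => ?_, fun ⟨G, _, hG⟩ => ?_⟩
    · obtain ⟨G, hG, hs⟩ := IntegralModels.exists_groupModel_of_mem_nhds hfin hne hU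
      exact ⟨G, hs hX, hG⟩
    · exact Filter.mem_of_superset ((G.isOpen_integralPoints hne).mem_nhds
        G.unit_mem_integralPoints) hG
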